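/- Let $N=\mathbb Z^n$ with standard basis $e_1,\dots,e_n$ and dual basis $e^1,\dots,e^n$, and let $\Sigma$ be a complete smooth fan in $N_{\mathbb R}$ with primitive ray generators $\rho_1,\dots,\rho_d$ whose toric manifold is projective (i.e. $\Sigma$ carries a strictly convex piecewise linear function with integral slopes). **The space and its log polyvector fields.** Let $X=\bigcup_\sigma X_\sigma\subset\mathbb C^d$, where $\sigma$ runs over the $n$-dimensional cones and $X_\sigma=\{z: z_i=0 \text{ if } \rho_i\notin\sigma\}\cong\mathbb C^n$ (the zero locus of the Stanley–Reisner ideal of $\Sigma$), and let $f=z_1+\dots+z_d$. Put $\tilde\theta_k=\sum_{i}\langle\rho_i,e^k\rangle z_i\frac{\partial}{\partial z_i}$ and $g_k=\sum_i\langle\rho_i,e^k\rangle z_i$ for $1\le k\le n$. Let $\mathrm{PV}_{\log}(X)$ be the space of smooth $(0,*)$-forms on $X$ (tuples of smooth $(0,*)$-forms on the $X_\sigma$ that agree on all intersections $X_\sigma\cap X_{\sigma'}$) with values in the exterior algebra on the odd global frame $\tilde\theta_1,\dots,\tilde\theta_n$, and let $$\bar\partial=\sum_i d\bar z_i\wedge\tfrac{\partial}{\partial\bar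 z_i},\qquad \{f,-\}=\sum_k g_k\tfrac{\partial}{\partial\tilde\theta_k},\qquad \partial=\sum_k \tilde\theta_k(\cdot)\,\tfrac{\partial}{\partial\tilde\theta_k},\qquad Q=\bar\partial+u\partial,\quad Q_f=Q+\{f,-\},$$ where in $\partial$ the vector field $\tilde\theta_k$ acts on coefficients, and let $\mathcal H_f=H(\mathrm{PV}_{\log}(X)[[u]],Q_f)$, a $\mathbb C[[u]]$-module. **The higher residue pairing.** Let $V_f=(\sum_k g_k\bar g_k)^{-1}\sum_k\bar g_k\tilde\theta_k$ on $X\setminus 0$. For a smooth compactly supported real function $\rho=\rho(|z_1|^2,\dots,|z_d|^2)$ on $\mathbb C^d$ which is $1$ near $0$, let $T^u_\rho=\rho+[Q,\rho]\,V_f\,(1+[Q,V_f])^{-1}$ (graded commutators of operators), which maps $\mathrm{PV}_{\log}(X)[[u]]$ to compactly supported elements. Let $\Omega$ be the log form with $\Omega|_{X_\sigma}=\det(\rho_{i_1},\dots,\rho_{i_n})\,\frac{dz_{i_1}}{z_{i_1}}\wedge\dots\wedge\frac{dz_{i_n}}{z_{i_n}}$ for $\sigma$ generated by $\rho_{i_1},\dots,\rho_{i_n}$,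 let $\mathrm{Tr}\,\alpha=\sum_\sigma\int_{X_\sigma}(\alpha\vdash\Omega)\wedge\Omega$ for compactly supported $\alpha$, and let $$K_f(\alpha(u),\beta(u))=\mathrm{Tr}\big(T^u_\rho\alpha(u)\wedge\overline{T^u_\rho\beta(u)}\big)\in\mathbb C[[u]],\qquad \overline{\gamma(u)}=\gamma(-u).$$ **The monomials.** Let $\sigma_1,\dots,\sigma_\mu$ be an order of the $n$-dimensional cones of $\Sigma$ such that, with $\tau_i$ the intersection of $\sigma_i$ with all $\sigma_j$ for which $j>i$ and $\dim(\sigma_i\cap\sigma_j)=n-1$, one has: if $\tau_i\subset\sigma_j$, then $i\le j$. Let $\varphi_i=P(\tau_i)$ be the product of the $z_k$ over the rays $\rho_k$ of $\tau_i$. **Theorem.** The classes of $\varphi_1,\dots,\varphi_\mu$ form a basis of the $\mathbb C[[u]]$-module $\mathcal H_f$, and this basis is good: for all $i,j$, $K_f(\varphi_i,\varphi_j)\in\mathbb C$; more precisely, there is a complex number $c_{ij}$ such that $K_f(\alpha,\beta)=c_{ij}$ for every cut-off function $\rho$ as above and all cocycles $\alpha,\beta$ representing the classes of $\varphi_i,\varphi_j$.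 -/

import Mathlib

open scoped ContDiff PowerSeries

noncomputable section

namespace LogLG

/-! ### Fans -/

/-- The real cone generated by the lattice vectors `ray i`, `i ∈ s`. -/
def rayCone {n d : ℕ} (ray : Fin d → Fin n → ℤ) (s : Finset (Fin d)) :
    PointedCone ℝ (Fin n → ℝ) :=
  PointedCone.hull ℝ ((fun i : Fin d => fun k : Fin n => (ray i k : ℝ)) '' (s : Set (Fin d)))

/-- A complete smooth fan in `N ⊗ ℝ`, `N = ℤⁿ`, with `d` rays.  A cone of a smooth fan is
recorded by the set of (indices of) its rays; the standard basis of `ℤⁿ` is the basis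
`e₁, …, eₙ` of `N`, so that `ray i k` is `⟨ρ_i, e^k⟩`. -/
structure SmoothCompleteFan (n d : ℕ) where
  /-- the ray generators `ρ_1, …, ρ_d` -/
  ray : Fin d → Fin n → ℤ
  /-- the cones, as sets of rays -/
  cones : Finset (Finset (Fin d))
  zero_mem : ∅ ∈ cones
  ray_mem : ∀ i, {i} ∈ cones
  face_mem : ∀ s ∈ cones, ∀ t ⊆ s, t ∈ cones
  /-- the generators of each cone are pairwise distinct members of a `ℤ`-basis of `N` -/
  smooth : ∀ s ∈ cones, Set.InjOn ray s ∧
    ∃ b : Module.Basis (Fin n) ℤ (Fin n → ℤ), ∀ i ∈ s, ray i ∈ Set.range b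
  /-- two cones meet in their common face -/
  inter_eq : ∀ s ∈ cones, ∀ t ∈ cones, rayCone ray s ⊓ rayCone ray t = rayCone ray (s ∩ t)
  complete : ∀ x : Fin n → ℝ, ∃ s ∈ cones, x ∈ rayCone ray s

variable {n d : ℕ}

/-- The `n`-dimensional cones. -/
abbrev SmoothCompleteFan.MaxCone (F : SmoothCompleteFan n d) : Type :=
  ↥(F.cones.filter fun s => s.card = n)

/-- There is a strictly convex function on the support of the fan that is linear with integral
slope `m s` on each `n`-dimensional cone `s`: the toric manifold of the fan is projective. -/
def SmoothCompleteFan.IsProjective (F : SmoothCompleteFan n d) : Prop :=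
  ∃ (ψ : (Fin n → ℝ) → ℝ) (m : F.MaxCone → Fin n → ℤ), ∀ (s : F.MaxCone) (x : Fin n → ℝ),
    (x ∈ rayCone F.ray s.1 → ψ x = ∑ k, (m s k : ℝ) * x k) ∧
    (x ∉ rayCone F.ray s.1 → ∑ k, (m s k : ℝ) * x k < ψ x)

/-- For an order `σ_1, …, σ_μ` of the `n`-dimensional cones, the cone `τ_i`: the intersection of
`σ_i` with all `σ_j` such that `j > i` and `dim (σ_i ∩ σ_j) = n - 1`. -/
def SmoothCompleteFan.tau (F : SmoothCompleteFan n d) {μ : ℕ} (σ : Fin μ ≃ F.MaxCone)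
    (i : Fin μ) : Finset (Fin d) :=
  (σ i).1.filter fun v =>
    ∀ j, i < j → ((σ i).1 ∩ (σ j).1).card + 1 = n → v ∈ (σ j).1

/-- The condition on the order of the `n`-dimensional cones: if `τ_i ⊆ σ_j`, then `i ≤ j`. -/
def SmoothCompleteFan.IsGoodOrder (F : SmoothCompleteFan n d) {μ : ℕ} (σ : Fin μ ≃ F.MaxCone) :
    Prop :=
  ∀ i j, F.tau σ i ⊆ (σ j).1 → i ≤ j

/-! ### Exterior algebra over a commutative `ℂ`-algebra `R`

An element of the exterior algebra on anticommuting generators `e_i`, `i ∈ ι`, is recorded by its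
coefficients with respect to the monomials `e_A = e_{i_1} ∧ ⋯ ∧ e_{i_p}`,
`A = {i_1 < ⋯ < i_p}`. -/

section Exterior

variable {ι : Type} [LinearOrder ι] [DecidableEq ι] {R : Type} [CommRing R] [Algebra ℂ R]

/-- `e_i ∧ e_A = leftSign i A • e_{A ∪ {i}}` for `i ∉ A`. -/
def leftSign (i : ι) (A : Finset ι) : ℂ := (-1) ^ (A.filter fun a => a < i).card

/-- `e_A ∧ e_B = wedgeSign A B • e_{A ∪ B}` for disjoint `A`, `B`. -/
def wedgeSign (A B : Finset ι) : ℂ := (-1) ^ ((A ×ˢ B).filter fun p => p.2 < p.1).card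

/-- The product. -/
def wedge (α β : Finset ι → R) : Finset ι → R := fun A =>
  ∑ B ∈ A.powerset, wedgeSign B (A \ B) • (α B * β (A \ B))

/-- Left multiplication by the generator `e_i`. -/
def genMul (i : ι) (α : Finset ι → R) : Finset ι → R := fun A =>
  if i ∈ A then leftSign i A • α (A.erase i) else 0

/-- The odd derivation `∂/∂e_i`, with `[∂/∂e_i, e_j ∧] = δ_{ij}`. -/
def genDer (i : ι) (α : Finset ι → R) : Finset ι → R := fun A =>
  if i ∈ A then 0 else leftSign i A • α (insert i A)

end Exterior

/-! ### The components of `X`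

`X ⊆ ℂᵈ` is the union of the coordinate subspaces `X_s = {z : z_i = 0 for i ∉ s}`, `s` an
`n`-dimensional cone.  `X_s` is parametrized by `s → ℂ`. -/

/-- The inclusion `X_s ⊆ ℂᵈ`. -/
def incl (s : Finset (Fin d)) (z : s → ℂ) : Fin d → ℂ :=
  fun i => if h : i ∈ s then z ⟨i, h⟩ else 0

/-- The projection `ℂᵈ → X_s`. -/
def proj (s : Finset (Fin d)) (w : Fin d → ℂ) : s → ℂ := fun i => w i

/-- `∂a/∂z_i` on `X_s` (zero if `i ∉ s`). -/
def dz (s : Finset (Fin d)) (i : Fin d) (a : (s → ℂ) → ℂ) : (s → ℂ) → ℂ := fun z =>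
  (1 / 2) * (fderiv ℝ a z (proj s (Pi.single i 1))
    - Complex.I * fderiv ℝ a z (proj s (Pi.single i Complex.I)))

/-- `∂a/∂\bar z_i` on `X_s` (zero if `i ∉ s`). -/
def dzbar (s : Finset (Fin d)) (i : Fin d) (a : (s → ℂ) → ℂ) : (s → ℂ) → ℂ := fun z =>
  (1 / 2) * (fderiv ℝ a z (proj s (Pi.single i 1))
    + Complex.I * fderiv ℝ a z (proj s (Pi.single i Complex.I)))

/-- The odd generators: `Sum.inlₗ i` stands for `d\bar z_i`, and `Sum.inrₗ k` for the global
relative log vector field `θ̃_k = ∑_i ⟨ρ_i, e^k⟩ z_i ∂/∂z_i`. -/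
abbrev Gen (n d : ℕ) : Type := Fin d ⊕ₗ Fin n

/-- The coefficients on `X_s` of an element of `A^{0,*} ⊗ Λ^* Θ`, with respect to the monomials
`d\bar z_J ⊗ θ̃_K`. -/
abbrev Fld (n : ℕ) {d : ℕ} (s : Finset (Fin d)) : Type := Finset (Gen n d) → (s → ℂ) → ℂ

/-- All the `d\bar z_i` which occur in the monomial are differentials of coordinates of `X_s`. -/
def LeftIn (A : Finset (Gen n d)) (s : Finset (Fin d)) : Prop := ∀ i, Sum.inlₗ i ∈ A → i ∈ s

namespace SmoothCompleteFan

variable (F : SmoothCompleteFan n d)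

/-! ### The operators on one component -/

section Component

variable (s : Finset (Fin d))

/-- `g_k = ∑_i ⟨ρ_i, e^k⟩ z_i` on `X_s`; `df = ∑_k g_k · (the log form dual to θ̃_k)` for
`f = z_1 + ⋯ + z_d`. -/
def g (k : Fin n) : (s → ℂ) → ℂ := fun z => ∑ i, (F.ray i k : ℂ) * incl s z i

/-- The action of `θ̃_k = ∑_i ⟨ρ_i, e^k⟩ z_i ∂/∂z_i` on functions on `X_s`. -/
def theta (k : Fin n) (a : (s → ℂ) → ℂ) : (s → ℂ) → ℂ := fun z =>
  ∑ i, (F.ray i k : ℂ) * incl s z i * dz s i a z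

/-- `\bar∂ = ∑_i d\bar z_i ∧ ∂/∂\bar z_i`. -/
def dbar (α : Fld n s) : Fld n s := ∑ i : Fin d, genMul (Sum.inlₗ i) fun A => dzbar s i (α A)

/-- `{f, -} = ∑_k g_k ∂/∂θ̃_k`. -/
def bracketF (α : Fld n s) : Fld n s := ∑ k : Fin n, fun A => F.g s k * genDer (Sum.inrₗ k) α A

/-- The operator `∂ = ∑_k θ̃_k ∂/∂θ̃_k` (`θ̃_k` acting on the coefficients) on polyvector fields,
the conjugate of the holomorphic de Rham differential under contraction with `Ω`. -/
def del (α : Fld n s) : Fld n s := ∑ k : Fin n, fun A => F.theta s k (genDer (Sum.inrₗ k) α A)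

/-- Multiplication by `V_f = (∑_k g_k \bar g_k)⁻¹ ∑_k \bar g_k θ̃_k`, which is smooth away from the
origin. -/
def mulV (α : Fld n s) : Fld n s := ∑ k : Fin n, fun A z =>
  (starRingEnd ℂ (F.g s k z) / ∑ l, F.g s l z * starRingEnd ℂ (F.g s l z)) *
    genMul (Sum.inrₗ k) α A z

/-! Formal power series in `u` are recorded by their coefficients. -/

/-- `u` times the operator `D`. -/
def uTimes {M : Type} [Zero M] (D : M → M) (α : ℕ → M) : ℕ → M
  | 0 => 0
  | k + 1 => D (α k)

/-- `Q = \bar∂ + u ∂`. -/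
def opQ (α : ℕ → Fld n s) : ℕ → Fld n s := fun k => dbar s (α k) + uTimes (F.del s) α k

/-- `V_f`, coefficientwise. -/
def opV (α : ℕ → Fld n s) : ℕ → Fld n s := fun k => F.mulV s (α k)

/-- The graded commutator `[Q, V_f] = Q V_f + V_f Q`. -/
def commQV (α : ℕ → Fld n s) : ℕ → Fld n s := F.opQ s (F.opV s α) + F.opV s (F.opQ s α)

/-- `(1 + [Q, V_f])⁻¹ = ∑_m (-1)^m [Q, V_f]^m`.  A summand of `[Q, V_f]` either raises the degree
in the `d\bar z_i` (which is at most `n` on `X_s`) or carries a factor `u`, so only the terms with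
`m ≤ n + k` contribute to the coefficient of `u^k`. -/
def invQV (α : ℕ → Fld n s) : ℕ → Fld n s := fun k =>
  ∑ m ∈ Finset.range (n + k + 1), (-1 : ℂ) ^ m • ((F.commQV s)^[m] α) k

/-- Multiplication by (the restriction to `X_s` of) a real function on `ℂᵈ`. -/
def mulFun (ρ : (Fin d → ℂ) → ℝ) (α : ℕ → Fld n s) : ℕ → Fld n s :=
  fun k A z => (ρ (incl s z) : ℂ) * α k A z

/-- The commutator `[Q, ρ] = Q ρ - ρ Q`. -/
def commQFun (ρ : (Fin d → ℂ) → ℝ) (α : ℕ → Fld n s) : ℕ → Fld n s :=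
  F.opQ s (mulFun s ρ α) - mulFun s ρ (F.opQ s α)

/-- `T_ρ^u = ρ + [Q, ρ] V_f (1 + [Q, V_f])⁻¹`.  The singularity of `V_f` at the origin does not
matter, since `ρ` is constant near the origin. -/
def opT (ρ : (Fin d → ℂ) → ℝ) (α : ℕ → Fld n s) : ℕ → Fld n s :=
  mulFun s ρ α + F.commQFun s ρ (F.opV s (F.invQV s α))

/-- The monomial `d\bar z_s ⊗ θ̃_1 ∧ ⋯ ∧ θ̃_n` of top degree on `X_s`. -/
def topIdx : Finset (Gen n d) :=
  (s.disjSum Finset.univ).map toLex.toEmbedding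

end Component

/-- The determinant (`±1`) of the ray generators of an `n`-dimensional cone `s`, in increasing
order of their indices: `Ω` restricts to `det s · ⋀_{i ∈ s} dz_i / z_i` on `X_s`. -/
def coneDet (s : F.MaxCone) : ℤ :=
  Matrix.det (Matrix.of fun a k : Fin n =>
    F.ray (s.1.orderEmbOfFin (Finset.mem_filter.mp s.2).2 a) k)

/-- The trace `Tr α = ∫_X (α ⊢ Ω) ∧ Ω`.  If `a d\bar z_s ⊗ θ̃_1 ∧ ⋯ ∧ θ̃_n` is the top part of `α`
on `X_s`, then, with `(θ̃_1 ∧ ⋯ ∧ θ̃_n) ⊢ Ω = (-1)^{n(n-1)/2}` and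
`d\bar z_s ∧ dz_s = (-1)^{n(n-1)/2} ∏ d\bar z_i ∧ dz_i`, `d\bar z ∧ dz = 2 √-1 dx ∧ dy`, the
contribution of `X_s` is `(2 √-1)^n det s ∫ a / ∏_{i ∈ s} z_i` with respect to Lebesgue measure. -/
def trace (α : (s : F.MaxCone) → Fld n s.1) : ℂ :=
  (2 * Complex.I) ^ n * ∑ s : F.MaxCone, (F.coneDet s : ℂ) *
    ∫ z : s.1 → ℂ, α s (topIdx s.1) z / ∏ i, z i

/-! ### Log polyvector fields on `X` -/

/-- `PV_log(X)`: tuples of smooth fields on the components `X_s` whose coefficients restrict to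
the same forms on `X_s ∩ X_t`, for all `s` and `t`. -/
def PV : Submodule ℂ ((s : F.MaxCone) → Fld n s.1) where
  carrier := {α |
    (∀ s A, ContDiff ℝ ∞ (α s A)) ∧
    (∀ s A, ¬ LeftIn A s.1 → α s A = 0) ∧
    ∀ s t A, LeftIn A s.1 → LeftIn A t.1 → ∀ w : Fin d → ℂ, (∀ i, i ∉ s.1 ∩ t.1 → w i = 0) →
      α s A (proj s.1 w) = α t A (proj t.1 w)}
  zero_mem' := ⟨fun _ _ => contDiff_const, fun _ _ _ => rfl, fun _ _ _ _ _ _ _ => rfl⟩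
  add_mem' := by
    rintro α β ⟨h1, h2, h3⟩ ⟨k1, k2, k3⟩
    refine ⟨fun s A => (h1 s A).add (k1 s A), fun s A hA => ?_, fun s t A hs ht w hw => ?_⟩
    · simp [h2 s A hA, k2 s A hA]
    · simp [h3 s t A hs ht w hw, k3 s t A hs ht w hw]
  smul_mem' := by
    rintro c α ⟨h1, h2, h3⟩
    refine ⟨fun s A => contDiff_const.mul (h1 s A), fun s A hA => ?_, fun s t A hs ht w hw => ?_⟩
    · simp [h2 s A hA]
    · simp [h3 s t A hs ht w hw]

end SmoothCompleteFan

/-! ### Facts needed for the operators to act on `PV_log(X)` -/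

section Facts

variable {s t : Finset (Fin d)}

theorem incl_proj {w : Fin d → ℂ} (hw : ∀ i, i ∉ s → w i = 0) : incl s (proj s w) = w := by
  funext i
  by_cases h : i ∈ s
  · simp [incl, proj, h]
  · simp [incl, h, hw i h]

theorem contDiff_incl (i : Fin d) : ContDiff ℝ ∞ fun z : s → ℂ => incl s z i := by
  by_cases h : i ∈ s
  · simpa [incl, h] using contDiff_apply ℝ ℂ (⟨i, h⟩ : s)
  · simpa [incl, h] using contDiff_const

theorem contDiff_sum_fun {m : ℕ} {a : Fin m → (s → ℂ) → ℂ} (ha : ∀ i, ContDiff ℝ ∞ (a i)) :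
    ContDiff ℝ ∞ (∑ i, a i) := by
  have : ContDiff ℝ ∞ fun z => ∑ i, a i z := ContDiff.sum fun i _ => ha i
  convert this using 1
  funext z
  simp

theorem contDiff_fderiv_apply {a : (s → ℂ) → ℂ} (ha : ContDiff ℝ ∞ a) (v : s → ℂ) :
    ContDiff ℝ ∞ fun z => fderiv ℝ a z v :=
  (ha.fderiv_right (m := ∞) (by simp)).clm_apply contDiff_const

theorem contDiff_dz {a : (s → ℂ) → ℂ} (ha : ContDiff ℝ ∞ a) (i : Fin d) :
    ContDiff ℝ ∞ (dz s i a) :=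
  contDiff_const.mul
    ((contDiff_fderiv_apply ha _).sub (contDiff_const.mul (contDiff_fderiv_apply ha _)))

theorem contDiff_dzbar {a : (s → ℂ) → ℂ} (ha : ContDiff ℝ ∞ a) (i : Fin d) :
    ContDiff ℝ ∞ (dzbar s i a) :=
  contDiff_const.mul
    ((contDiff_fderiv_apply ha _).add (contDiff_const.mul (contDiff_fderiv_apply ha _)))

theorem dz_add {a b : (s → ℂ) → ℂ} (ha : ContDiff ℝ ∞ a) (hb : ContDiff ℝ ∞ b) (i : Fin d) :
    dz s i (a + b) = dz s i a + dz s i b := by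
  funext z
  have h1 := (ha.differentiable (by simp)) z
  have h2 := (hb.differentiable (by simp)) z
  simp only [dz, Pi.add_apply, fderiv_add h1 h2, _root_.add_apply]
  ring

theorem dzbar_add {a b : (s → ℂ) → ℂ} (ha : ContDiff ℝ ∞ a) (hb : ContDiff ℝ ∞ b) (i : Fin d) :
    dzbar s i (a + b) = dzbar s i a + dzbar s i b := by
  funext z
  have h1 := (ha.differentiable (by simp)) z
  have h2 := (hb.differentiable (by simp)) z
  simp only [dzbar, Pi.add_apply, fderiv_add h1 h2, _root_.add_apply]
  ring

theorem dz_smul {a : (s → ℂ) → ℂ} (ha : ContDiff ℝ ∞ a) (c : ℂ) (i : Fin d) :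
    dz s i (c • a) = c • dz s i a := by
  funext z
  have h1 := (ha.differentiable (by simp)) z
  simp only [dz, Pi.smul_apply, fderiv_const_smul h1 c, _root_.smul_apply,
    smul_eq_mul]
  ring

theorem dzbar_smul {a : (s → ℂ) → ℂ} (ha : ContDiff ℝ ∞ a) (c : ℂ) (i : Fin d) :
    dzbar s i (c • a) = c • dzbar s i a := by
  funext z
  have h1 := (ha.differentiable (by simp)) z
  simp only [dzbar, Pi.smul_apply, fderiv_const_smul h1 c, _root_.smul_apply,
    smul_eq_mul]
  ring

theorem dz_zero (i : Fin d) : dz s i 0 = 0 := by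
  funext z; simp [dz]

theorem dzbar_zero (i : Fin d) : dzbar s i 0 = 0 := by
  funext z; simp [dzbar]

theorem fderiv_compat {a : (s → ℂ) → ℂ} {b : (t → ℂ) → ℂ} (ha : ContDiff ℝ ∞ a)
    (hb : ContDiff ℝ ∞ b)
    (hab : ∀ w : Fin d → ℂ, (∀ i, i ∉ s ∩ t → w i = 0) → a (proj s w) = b (proj t w))
    {w v : Fin d → ℂ} (hw : ∀ i, i ∉ s ∩ t → w i = 0) (hv : ∀ i, i ∉ s ∩ t → v i = 0) :
    fderiv ℝ a (proj s w) (proj s v) = fderiv ℝ b (proj t w) (proj t v) := by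
  rw [← (ha.differentiable (by simp) _).lineDeriv_eq_fderiv,
    ← (hb.differentiable (by simp) _).lineDeriv_eq_fderiv]
  unfold lineDeriv
  congr 1
  funext r
  exact hab (w + r • v) fun i hi => by simp [hw i hi, hv i hi]

theorem dz_compat {a : (s → ℂ) → ℂ} {b : (t → ℂ) → ℂ} (ha : ContDiff ℝ ∞ a)
    (hb : ContDiff ℝ ∞ b)
    (hab : ∀ w : Fin d → ℂ, (∀ i, i ∉ s ∩ t → w i = 0) → a (proj s w) = b (proj t w))
    {w : Fin d → ℂ} (hw : ∀ i, i ∉ s ∩ t → w i = 0) {i : Fin d} (hi : i ∈ s ∩ t) :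
    dz s i a (proj s w) = dz t i b (proj t w) := by
  have key : ∀ c : ℂ, ∀ j, j ∉ s ∩ t → (Pi.single i c : Fin d → ℂ) j = 0 := fun c j hj =>
    Pi.single_eq_of_ne (fun h : j = i => hj (h ▸ hi)) _
  simp only [dz, fderiv_compat ha hb hab hw (key _)]

theorem dzbar_compat {a : (s → ℂ) → ℂ} {b : (t → ℂ) → ℂ} (ha : ContDiff ℝ ∞ a)
    (hb : ContDiff ℝ ∞ b)
    (hab : ∀ w : Fin d → ℂ, (∀ i, i ∉ s ∩ t → w i = 0) → a (proj s w) = b (proj t w))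
    {w : Fin d → ℂ} (hw : ∀ i, i ∉ s ∩ t → w i = 0) {i : Fin d} (hi : i ∈ s ∩ t) :
    dzbar s i a (proj s w) = dzbar t i b (proj t w) := by
  have key : ∀ c : ℂ, ∀ j, j ∉ s ∩ t → (Pi.single i c : Fin d → ℂ) j = 0 := fun c j hj =>
    Pi.single_eq_of_ne (fun h : j = i => hj (h ▸ hi)) _
  simp only [dzbar, fderiv_compat ha hb hab hw (key _)]

theorem leftIn_insert_inr [DecidableEq (Gen n d)] {A : Finset (Gen n d)} {k : Fin n} :
    LeftIn (insert (Sum.inrₗ k) A) s ↔ LeftIn A s := by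
  simp [LeftIn]

end Facts

namespace SmoothCompleteFan

variable (F : SmoothCompleteFan n d)

theorem proj_g {s : Finset (Fin d)} {w : Fin d → ℂ} (hw : ∀ i, i ∉ s → w i = 0) (k : Fin n) :
    F.g s k (proj s w) = ∑ i, (F.ray i k : ℂ) * w i := by
  simp [g, incl_proj hw]

theorem contDiff_g (s : Finset (Fin d)) (k : Fin n) : ContDiff ℝ ∞ (F.g s k) :=
  ContDiff.sum fun i _ => contDiff_const.mul (contDiff_incl i)

theorem contDiff_theta {s : Finset (Fin d)} {a : (s → ℂ) → ℂ} (ha : ContDiff ℝ ∞ a)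
    (k : Fin n) : ContDiff ℝ ∞ (F.theta s k a) :=
  ContDiff.sum fun i _ => (contDiff_const.mul (contDiff_incl i)).mul (contDiff_dz ha i)

theorem theta_zero {s : Finset (Fin d)} (k : Fin n) : F.theta s k 0 = 0 := by
  funext z; simp [theta, dz_zero]

theorem theta_add {s : Finset (Fin d)} {a b : (s → ℂ) → ℂ} (ha : ContDiff ℝ ∞ a)
    (hb : ContDiff ℝ ∞ b) (k : Fin n) :
    F.theta s k (a + b) = F.theta s k a + F.theta s k b := by
  funext z
  simp only [theta, dz_add ha hb, Pi.add_apply, mul_add, Finset.sum_add_distrib]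

theorem theta_smul {s : Finset (Fin d)} {a : (s → ℂ) → ℂ} (ha : ContDiff ℝ ∞ a) (c : ℂ)
    (k : Fin n) : F.theta s k (c • a) = c • F.theta s k a := by
  funext z
  simp only [theta, dz_smul ha, Pi.smul_apply, smul_eq_mul, Finset.mul_sum]
  exact Finset.sum_congr rfl fun i _ => by ring

theorem contDiff_genDer {s : Finset (Fin d)} {α : Fld n s} (h : ∀ A, ContDiff ℝ ∞ (α A))
    (x : Gen n d) (A : Finset (Gen n d)) : ContDiff ℝ ∞ (genDer x α A) := by
  unfold genDer
  split_ifs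
  · exact contDiff_const
  · exact contDiff_const.mul (h _)

theorem contDiff_genMul {s : Finset (Fin d)} {α : Fld n s} (h : ∀ A, ContDiff ℝ ∞ (α A))
    (x : Gen n d) (A : Finset (Gen n d)) : ContDiff ℝ ∞ (genMul x α A) := by
  unfold genMul
  split_ifs
  · exact contDiff_const.mul (h _)
  · exact contDiff_const

theorem genDer_inr_eq_zero {s : Finset (Fin d)} {α : Fld n s}
    (h : ∀ A, ¬ LeftIn A s → α A = 0) (k : Fin n) {A : Finset (Gen n d)} (hA : ¬ LeftIn A s) :
    genDer (Sum.inrₗ k) α A = 0 := by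
  unfold genDer
  split_ifs
  · rfl
  · rw [h _ (fun h' => hA (leftIn_insert_inr.mp h')), smul_zero]

theorem genDer_add {ι R : Type} [LinearOrder ι] [DecidableEq ι] [CommRing R] [Algebra ℂ R] (x : ι)
    (α β : Finset ι → R) : genDer x (α + β) = genDer x α + genDer x β := by
  funext A
  simp only [genDer, Pi.add_apply]
  split_ifs <;> simp

theorem genDer_smul {ι R : Type} [LinearOrder ι] [DecidableEq ι] [CommRing R] [Algebra ℂ R] (x : ι) (c : ℂ)
    (α : Finset ι → R) : genDer x (c • α) = c • genDer x α := by
  funext A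
  simp only [genDer, Pi.smul_apply]
  split_ifs
  · simp
  · rw [smul_comm]

theorem genMul_add {ι R : Type} [LinearOrder ι] [DecidableEq ι] [CommRing R] [Algebra ℂ R] (x : ι)
    (α β : Finset ι → R) : genMul x (α + β) = genMul x α + genMul x β := by
  funext A
  simp only [genMul, Pi.add_apply]
  split_ifs <;> simp

theorem genMul_smul {ι R : Type} [LinearOrder ι] [DecidableEq ι] [CommRing R] [Algebra ℂ R] (x : ι) (c : ℂ)
    (α : Finset ι → R) : genMul x (c • α) = c • genMul x α := by
  funext A
  simp only [genMul, Pi.smul_apply]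
  split_ifs
  · rw [smul_comm]
  · simp

theorem genDer_inr_compat {α : (s : F.MaxCone) → Fld n s.1} (hα : α ∈ F.PV) (k : Fin n)
    (s t : F.MaxCone) (A : Finset (Gen n d)) (hs : LeftIn A s.1) (ht : LeftIn A t.1)
    (w : Fin d → ℂ) (hw : ∀ i, i ∉ s.1 ∩ t.1 → w i = 0) :
    genDer (Sum.inrₗ k) (α s) A (proj s.1 w) = genDer (Sum.inrₗ k) (α t) A (proj t.1 w) := by
  unfold genDer
  split_ifs
  · rfl
  · simp only [Pi.smul_apply]
    rw [hα.2.2 s t _ (leftIn_insert_inr.mpr hs) (leftIn_insert_inr.mpr ht) w hw]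

theorem dbar_mem {α : (s : F.MaxCone) → Fld n s.1} (hα : α ∈ F.PV) :
    (fun s : F.MaxCone => dbar s.1 (α s)) ∈ F.PV := by
  obtain ⟨h1, h2, h3⟩ := hα
  refine ⟨fun s A => ?_, fun s A hA => ?_, fun s t A hs ht w hw => ?_⟩
  · simp only [dbar, Finset.sum_apply]
    exact contDiff_sum_fun fun i => contDiff_genMul (fun B => contDiff_dzbar (h1 s B) i) _ _
  · simp only [dbar, Finset.sum_apply]
    refine Finset.sum_eq_zero fun i _ => ?_
    unfold genMul
    beta_reduce
    split_ifs with hi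
    · by_cases his : i ∈ s.1
      · rw [h2 s _ (fun h' => hA fun j hj => ?_), dzbar_zero, smul_zero]
        by_cases hji : j = i
        · exact hji ▸ his
        · exact h' j (Finset.mem_erase.mpr
            ⟨fun h => hji (Sum.inl_injective (toLex.injective h)), hj⟩)
      · have hp : ∀ c : ℂ, proj s.1 (Pi.single i c : Fin d → ℂ) = 0 := fun c => by
          funext j
          exact Pi.single_eq_of_ne (fun h : (j : Fin d) = i => his (h ▸ j.2)) _
        have : dzbar s.1 i (α s (A.erase (Sum.inlₗ i))) = 0 := by
          funext z; simp [dzbar, hp]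
        rw [this, smul_zero]
    · rfl
  · simp only [dbar, Finset.sum_apply]
    refine Finset.sum_congr rfl fun i _ => ?_
    unfold genMul
    split_ifs with hi
    · simp only [Pi.smul_apply]
      rw [dzbar_compat (h1 s _) (h1 t _) (h3 s t _ (fun j hj => hs j (Finset.mem_of_mem_erase hj))
        (fun j hj => ht j (Finset.mem_of_mem_erase hj))) hw
        (Finset.mem_inter.mpr ⟨hs i hi, ht i hi⟩)]
    · rfl

theorem bracketF_mem {α : (s : F.MaxCone) → Fld n s.1} (hα : α ∈ F.PV) :
    (fun s : F.MaxCone => F.bracketF s.1 (α s)) ∈ F.PV := by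
  refine ⟨fun s A => ?_, fun s A hA => ?_, fun s t A hs ht w hw => ?_⟩
  · simp only [bracketF, Finset.sum_apply]
    exact contDiff_sum_fun fun k => (F.contDiff_g s.1 k).mul (contDiff_genDer (hα.1 s) _ _)
  · simp only [bracketF, Finset.sum_apply]
    exact Finset.sum_eq_zero fun k _ => by rw [genDer_inr_eq_zero (hα.2.1 s) k hA, mul_zero]
  · simp only [bracketF, Finset.sum_apply, Pi.mul_apply]
    refine Finset.sum_congr rfl fun k _ => ?_
    rw [F.genDer_inr_compat hα k s t A hs ht w hw,
      F.proj_g (fun i hi => hw i fun h => hi (Finset.mem_inter.mp h).1),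
      F.proj_g (fun i hi => hw i fun h => hi (Finset.mem_inter.mp h).2)]

theorem del_mem {α : (s : F.MaxCone) → Fld n s.1} (hα : α ∈ F.PV) :
    (fun s : F.MaxCone => F.del s.1 (α s)) ∈ F.PV := by
  refine ⟨fun s A => ?_, fun s A hA => ?_, fun s t A hs ht w hw => ?_⟩
  · simp only [del, Finset.sum_apply]
    exact contDiff_sum_fun fun k => F.contDiff_theta (contDiff_genDer (hα.1 s) _ _) k
  · simp only [del, Finset.sum_apply]
    exact Finset.sum_eq_zero fun k _ => by
      rw [genDer_inr_eq_zero (hα.2.1 s) k hA, theta_zero]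
  · simp only [del, Finset.sum_apply, theta]
    refine Finset.sum_congr rfl fun k _ => Finset.sum_congr rfl fun i _ => ?_
    rw [incl_proj (fun i hi => hw i fun h => hi (Finset.mem_inter.mp h).1),
      incl_proj (fun i hi => hw i fun h => hi (Finset.mem_inter.mp h).2)]
    by_cases hi : i ∈ s.1 ∩ t.1
    · rw [dz_compat (contDiff_genDer (hα.1 s) _ _) (contDiff_genDer (hα.1 t) _ _)
        (F.genDer_inr_compat hα k s t A hs ht) hw hi]
    · simp [hw i hi]

/-- `\bar∂` on `PV_log(X)`. -/
def dbarPV : F.PV →ₗ[ℂ] F.PV where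
  toFun α := ⟨fun s => dbar s.1 (α.1 s), F.dbar_mem α.2⟩
  map_add' α β := by
    refine Subtype.ext (funext fun s => ?_)
    show dbar s.1 (α.1 s + β.1 s) = dbar s.1 (α.1 s) + dbar s.1 (β.1 s)
    simp only [dbar, ← Finset.sum_add_distrib, ← genMul_add]
    refine Finset.sum_congr rfl fun i _ => congrArg _ (funext fun A => ?_)
    exact dzbar_add (α.2.1 s A) (β.2.1 s A) i
  map_smul' c α := by
    refine Subtype.ext (funext fun s => ?_)
    show dbar s.1 (c • α.1 s) = c • dbar s.1 (α.1 s)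
    simp only [dbar, Finset.smul_sum, ← genMul_smul]
    refine Finset.sum_congr rfl fun i _ => congrArg _ (funext fun A => ?_)
    exact dzbar_smul (α.2.1 s A) c i

/-- `{f, -}` on `PV_log(X)`. -/
def bracketPV : F.PV →ₗ[ℂ] F.PV where
  toFun α := ⟨fun s => F.bracketF s.1 (α.1 s), F.bracketF_mem α.2⟩
  map_add' α β := by
    refine Subtype.ext (funext fun s => ?_)
    show F.bracketF s.1 (α.1 s + β.1 s) = F.bracketF s.1 (α.1 s) + F.bracketF s.1 (β.1 s)
    simp only [bracketF, ← Finset.sum_add_distrib, genDer_add]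
    refine Finset.sum_congr rfl fun i _ => funext fun A => ?_
    simp [mul_add]
  map_smul' c α := by
    refine Subtype.ext (funext fun s => ?_)
    show F.bracketF s.1 (c • α.1 s) = c • F.bracketF s.1 (α.1 s)
    simp only [bracketF, Finset.smul_sum, genDer_smul]
    refine Finset.sum_congr rfl fun i _ => funext fun A => ?_
    simp

/-- `∂` on `PV_log(X)`. -/
def delPV : F.PV →ₗ[ℂ] F.PV where
  toFun α := ⟨fun s => F.del s.1 (α.1 s), F.del_mem α.2⟩
  map_add' α β := by
    refine Subtype.ext (funext fun s => ?_)
    show F.del s.1 (α.1 s + β.1 s) = F.del s.1 (α.1 s) + F.del s.1 (β.1 s)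
    simp only [del, ← Finset.sum_add_distrib, genDer_add]
    refine Finset.sum_congr rfl fun k _ => funext fun A => ?_
    exact F.theta_add (contDiff_genDer (α.2.1 s) _ A) (contDiff_genDer (β.2.1 s) _ A) k
  map_smul' c α := by
    refine Subtype.ext (funext fun s => ?_)
    show F.del s.1 (c • α.1 s) = c • F.del s.1 (α.1 s)
    simp only [del, Finset.smul_sum, genDer_smul]
    refine Finset.sum_congr rfl fun k _ => funext fun A => ?_
    exact F.theta_smul (contDiff_genDer (α.2.1 s) _ A) c k

end SmoothCompleteFan

/-! ### Formal power series in `u` with coefficients in a vector space -/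

/-- `M[[u]]`, as the space of sequences of coefficients. -/
def USeries (M : Type) : Type := ℕ → M

namespace USeries

section Coeff

variable {M : Type}

/-- The coefficient of `u^k`. -/
def coeff (α : USeries M) (k : ℕ) : M := α k

/-- The power series with given coefficients. -/
def mk (a : ℕ → M) : USeries M := a

theorem coeff_mk (a : ℕ → M) (k : ℕ) : (mk a).coeff k = a k := rfl

theorem ext {α β : USeries M} (h : ∀ k, α.coeff k = β.coeff k) : α = β := funext h

end Coeff

section Module

variable {M : Type} [AddCommGroup M]

instance : AddCommGroup (USeries M) := inferInstanceAs (AddCommGroup (ℕ → M))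

/-- The constant power series. -/
def const (m : M) : USeries M := mk fun k => if k = 0 then m else 0

theorem coeff_add (α β : USeries M) (k : ℕ) : (α + β).coeff k = α.coeff k + β.coeff k := rfl

theorem coeff_zero (k : ℕ) : (0 : USeries M).coeff k = 0 := rfl

variable [Module ℂ M]

instance : SMul ℂ⟦X⟧ (USeries M) where
  smul c α := mk fun k =>
    ∑ p ∈ Finset.HasAntidiagonal.antidiagonal k, PowerSeries.coeff p.1 c • α.coeff p.2

theorem coeff_smul (c : ℂ⟦X⟧) (α : USeries M) (k : ℕ) :
    (c • α).coeff k =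
      ∑ p ∈ Finset.HasAntidiagonal.antidiagonal k, PowerSeries.coeff p.1 c • α.coeff p.2 :=
  rfl

instance : Module ℂ⟦X⟧ (USeries M) where
  one_smul α := by
    refine ext fun k => ?_
    rw [coeff_smul, Finset.sum_eq_single (0, k)]
    · simp
    · rintro ⟨a, b⟩ hp hne
      rw [PowerSeries.coeff_one, if_neg, zero_smul]
      rintro rfl
      exact hne (by simpa using hp)
    · simp
  mul_smul c e α := by
    refine ext fun k => ?_
    simp only [coeff_smul, PowerSeries.coeff_mul, Finset.sum_smul, Finset.smul_sum,
      Finset.sum_sigma']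
    apply Finset.sum_nbij' (fun ⟨⟨_i, j⟩, ⟨k, l⟩⟩ ↦ ⟨(k, l + j), (l, j)⟩)
      (fun ⟨⟨i, _j⟩, ⟨k, l⟩⟩ ↦ ⟨(i + k, l), (i, k)⟩) <;>
      simp +contextual [mul_smul] <;> grind
  smul_zero c := ext fun k => by simp [coeff_smul, coeff_zero]
  smul_add c α β := ext fun k => by simp [coeff_smul, coeff_add, Finset.sum_add_distrib]
  add_smul c e α := ext fun k => by
    simp [coeff_smul, coeff_add, add_smul, Finset.sum_add_distrib]
  zero_smul α := ext fun k => by simp [coeff_smul, coeff_zero]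

/-- `D_0 + u D_1` on `M[[u]]`, for linear operators `D_0`, `D_1` on `M`. -/
def linearOp (D₀ D₁ : M →ₗ[ℂ] M) : USeries M →ₗ[ℂ⟦X⟧] USeries M where
  toFun α := mk fun k => D₀ (α.coeff k) + SmoothCompleteFan.uTimes D₁ α.coeff k
  map_add' α β := by
    refine ext fun k => ?_
    cases k with
    | zero => simp [coeff_mk, coeff_add, SmoothCompleteFan.uTimes]
    | succ k => simp only [coeff_mk, coeff_add, SmoothCompleteFan.uTimes, map_add]; abel
  map_smul' c α := by
    refine ext fun k => ?_
    cases k with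
    | zero => simp [coeff_smul, coeff_mk, SmoothCompleteFan.uTimes]
    | succ k =>
      simp only [RingHom.id_apply, coeff_smul, coeff_mk, SmoothCompleteFan.uTimes, map_sum,
        map_smul, smul_add, Finset.sum_add_distrib]
      congr 1
      rw [Finset.Nat.sum_antidiagonal_succ']
      simp

end Module

end USeries

namespace SmoothCompleteFan

variable (F : SmoothCompleteFan n d)

/-! ### The state space -/

/-- `Q_f = \bar∂ + {f, -} + u ∂` on `PV_log(X)[[u]]`. -/
def Qf : USeries F.PV →ₗ[ℂ⟦X⟧] USeries F.PV :=
  USeries.linearOp (F.dbarPV + F.bracketPV) F.delPV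

/-- The `Q_f`-closed elements. -/
abbrev Cocycle : Submodule ℂ⟦X⟧ (USeries F.PV) := LinearMap.ker F.Qf

/-- The cohomology `H_f = H(PV_log(X)[[u]], Q_f)`, a `ℂ[[u]]`-module. -/
abbrev Hf : Type := F.Cocycle ⧸ (LinearMap.range F.Qf).comap F.Cocycle.subtype

/-- The cohomology class of a cocycle. -/
def cls (α : F.Cocycle) : F.Hf := Submodule.Quotient.mk α

/-- The function `P(τ) = ∏_{i ∈ τ} z_i` on `X`, as a polyvector field. -/
def monomialField (τ : Finset (Fin d)) (s : F.MaxCone) : Fld n s.1 :=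
  fun A z => if A = ∅ then ∏ i ∈ τ, incl s.1 z i else 0

theorem monomialField_mem (τ : Finset (Fin d)) : F.monomialField τ ∈ F.PV := by
  refine ⟨fun s A => ?_, fun s A hA => ?_, fun s t A hs ht w hw => ?_⟩
  · unfold monomialField
    split_ifs
    · exact contDiff_prod (𝕜 := ℝ) (𝔸' := ℂ) (t := τ) fun i _ => contDiff_incl i
    · exact contDiff_const
  · have : A ≠ ∅ := by
      rintro rfl
      exact hA fun i hi => absurd hi (Finset.notMem_empty _)
    funext z
    simp [monomialField, this]
  · unfold monomialField
    rw [incl_proj (fun i hi => hw i fun h => hi (Finset.mem_inter.mp h).1),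
      incl_proj (fun i hi => hw i fun h => hi (Finset.mem_inter.mp h).2)]

theorem dzbar_monomialField (τ : Finset (Fin d)) (s : F.MaxCone) (i : Fin d)
    (A : Finset (Gen n d)) : dzbar s.1 i (F.monomialField τ s A) = 0 := by
  have hd : Differentiable ℂ (F.monomialField τ s A) := by
    unfold monomialField
    split_ifs
    · refine ContDiff.differentiable (n := 1)
        (contDiff_prod (𝕜 := ℂ) (𝔸' := ℂ) (t := τ) fun j _ => ?_) (by simp)
      by_cases h : j ∈ s.1
      · simpa [incl, h] using contDiff_apply ℂ ℂ (⟨j, h⟩ : s.1)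
      · simpa [incl, h] using contDiff_const
    · exact differentiable_const _
  funext z
  have hv : proj s.1 (Pi.single i Complex.I : Fin d → ℂ)
      = Complex.I • proj s.1 (Pi.single i 1 : Fin d → ℂ) := by
    funext j
    simp only [proj, Pi.smul_apply, Pi.single_apply]
    split_ifs <;> simp
  have hr := (hd z).hasFDerivAt.restrictScalars ℝ
  simp only [dzbar, hr.fderiv, hv, ContinuousLinearMap.coe_restrictScalars', map_smul,
    smul_eq_mul, ← mul_assoc, Complex.I_mul_I, Pi.zero_apply]
  ring

/-- `P(τ)` as an element of `PV_log(X)[[u]]`. -/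
def monomial (τ : Finset (Fin d)) : USeries F.PV :=
  USeries.const ⟨F.monomialField τ, F.monomialField_mem τ⟩

theorem monomial_mem (τ : Finset (Fin d)) : F.monomial τ ∈ F.Cocycle := by
  have hder : ∀ (s : F.MaxCone) (k : Fin n) (A : Finset (Gen n d)),
      genDer (Sum.inrₗ k) (F.monomialField τ s) A = 0 := by
    intro s k A
    unfold genDer
    split_ifs
    · rfl
    · have : F.monomialField τ s (insert (Sum.inrₗ k) A) = 0 := by
        funext z; simp [monomialField]
      rw [this, smul_zero]
  have h1 : F.dbarPV ⟨F.monomialField τ, F.monomialField_mem τ⟩ = 0 := by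
    refine Subtype.ext (funext fun s => ?_)
    show dbar s.1 (F.monomialField τ s) = 0
    refine Finset.sum_eq_zero fun i _ => funext fun A => ?_
    simp only [genMul, dzbar_monomialField, smul_zero, ite_self, Pi.zero_apply]
  have h2 : F.bracketPV ⟨F.monomialField τ, F.monomialField_mem τ⟩ = 0 := by
    refine Subtype.ext (funext fun s => ?_)
    show F.bracketF s.1 (F.monomialField τ s) = 0
    refine Finset.sum_eq_zero fun k _ => funext fun A => ?_
    rw [hder, mul_zero]; rfl
  have h3 : F.delPV ⟨F.monomialField τ, F.monomialField_mem τ⟩ = 0 := by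
    refine Subtype.ext (funext fun s => ?_)
    show F.del s.1 (F.monomialField τ s) = 0
    refine Finset.sum_eq_zero fun k _ => funext fun A => ?_
    rw [hder, theta_zero]; rfl
  rw [LinearMap.mem_ker]
  refine USeries.ext fun k => ?_
  show (F.dbarPV + F.bracketPV) ((F.monomial τ).coeff k)
    + uTimes F.delPV (F.monomial τ).coeff k = 0
  rcases k with _ | _ | k <;>
    simp [monomial, USeries.const, USeries.coeff_mk, uTimes, h1, h2, h3]

/-- The class of `P(τ)` in `H_f`. -/
def monomialClass (τ : Finset (Fin d)) : F.Hf := F.cls ⟨F.monomial τ, F.monomial_mem τ⟩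

end SmoothCompleteFan

/-! ### The higher residue pairing -/

/-- Cut-off functions: `ρ = ρ(|z_1|², …, |z_d|²)` is smooth and real-valued with compact support,
and `ρ = 1` near the origin. -/
def IsCutoff (ρ : (Fin d → ℂ) → ℝ) : Prop :=
  (∃ r : (Fin d → ℝ) → ℝ, ContDiff ℝ ∞ r ∧ ∀ z, ρ z = r fun i => ‖z i‖ ^ 2) ∧
    HasCompactSupport ρ ∧ ∀ᶠ z in nhds 0, ρ z = 1

/-- The higher residue pairing `K_f(α(u), β(u)) = Tr(T_ρ^u α(u) ∧ (T_ρ^u β)(-u))` of two elements of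
`PV_log(X)[[u]]`, formed with the cut-off function `ρ`. -/
def SmoothCompleteFan.Kf (F : SmoothCompleteFan n d) (ρ : (Fin d → ℂ) → ℝ)
    (α β : USeries F.PV) : ℂ⟦X⟧ :=
  PowerSeries.mk fun k => ∑ p ∈ Finset.HasAntidiagonal.antidiagonal k, (-1) ^ p.2 *
    F.trace fun s => wedge (F.opT s.1 ρ (fun l => (α.coeff l).1 s) p.1)
      (F.opT s.1 ρ (fun l => (β.coeff l).1 s) p.2)

end LogLG

end

open scoped ContDiff PowerSeries

noncomputable section

namespace LogLG

set_option linter.unusedSectionVars false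
set_option linter.unusedSimpArgs false

variable {n d : ℕ}

/-! ### Creation and annihilation operators -/

section Exterior

variable {ι : Type} [LinearOrder ι] [DecidableEq ι] {R : Type} [CommRing R] [Algebra ℂ R]

theorem leftSign_insert {i j : ι} {A : Finset ι} (h : j ∉ A) :
    leftSign i (insert j A) = if j < i then -leftSign i A else leftSign i A := by
  unfold leftSign
  rw [Finset.filter_insert]
  split_ifs
  · rw [Finset.card_insert_of_notMem (by simp [h]), pow_succ, mul_neg_one]
  · rfl

theorem leftSign_erase {i j : ι} {A : Finset ι} (h : j ∈ A) :
    leftSign i (A.erase j) = if j < i then -leftSign i A else leftSign i A := by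
  have := leftSign_insert (i := i) (Finset.notMem_erase j A)
  rw [Finset.insert_erase h] at this
  rw [this]
  split_ifs <;> simp

theorem leftSign_mul_self (i : ι) (A : Finset ι) : leftSign i A * leftSign i A = 1 := by
  unfold leftSign
  rw [← pow_add, ← two_mul, pow_mul]
  simp

theorem leftSign_ne_zero (i : ι) (A : Finset ι) : leftSign i A ≠ 0 := by
  unfold leftSign
  exact pow_ne_zero _ (by simp)

/-- Left multiplication by a generator, as a linear operator. -/
def creation (R : Type) [CommRing R] [Algebra ℂ R] (i : ι) : Module.End ℂ (Finset ι → R) where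
  toFun := genMul i
  map_add' := SmoothCompleteFan.genMul_add i
  map_smul' := SmoothCompleteFan.genMul_smul i

/-- The odd derivative along a generator, as a linear operator. -/
def annihilation (R : Type) [CommRing R] [Algebra ℂ R] (i : ι) :
    Module.End ℂ (Finset ι → R) where
  toFun := genDer i
  map_add' := SmoothCompleteFan.genDer_add i
  map_smul' := SmoothCompleteFan.genDer_smul i

theorem creation_apply (i : ι) (α : Finset ι → R) : creation R i α = genMul i α := rfl

theorem annihilation_apply (i : ι) (α : Finset ι → R) : annihilation R i α = genDer i α := rfl

theorem creation_mul_self (i : ι) : creation R i * creation R i = 0 := by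
  ext α A
  simp [creation_apply, genMul]

theorem annihilation_mul_self (i : ι) : annihilation R i * annihilation R i = 0 := by
  ext α A
  simp [annihilation_apply, genDer]

theorem creation_anticomm (i j : ι) :
    creation R i * creation R j = -(creation R j * creation R i) := by
  rcases eq_or_ne i j with rfl | hij
  · simp [creation_mul_self]
  refine LinearMap.ext fun α => funext fun A => ?_
  simp only [Module.End.mul_apply, LinearMap.neg_apply, Pi.neg_apply, creation_apply, genMul]
  by_cases hi : i ∈ A <;> by_cases hj : j ∈ A <;> simp [hi, hj, hij, hij.symm]
  rw [leftSign_erase hi, leftSign_erase hj, Finset.erase_right_comm, smul_smul, smul_smul,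
    ← neg_smul]
  congr 1
  rcases lt_or_gt_of_ne hij with h | h <;> simp [h, h.not_gt] <;> ring

theorem annihilation_anticomm (i j : ι) :
    annihilation R i * annihilation R j = -(annihilation R j * annihilation R i) := by
  rcases eq_or_ne i j with rfl | hij
  · simp [annihilation_mul_self]
  refine LinearMap.ext fun α => funext fun A => ?_
  simp only [Module.End.mul_apply, LinearMap.neg_apply, Pi.neg_apply, annihilation_apply, genDer]
  by_cases hi : i ∈ A <;> by_cases hj : j ∈ A <;> simp [hi, hj, hij, hij.symm]
  rw [leftSign_insert hi, leftSign_insert hj, Finset.insert_comm, smul_smul, smul_smul,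
    ← neg_smul]
  congr 1
  rcases lt_or_gt_of_ne hij with h | h <;> simp [h, h.not_gt] <;> ring

theorem annihilation_mul_creation (i : ι) :
    annihilation R i * creation R i = 1 - creation R i * annihilation R i := by
  refine LinearMap.ext fun α => funext fun A => ?_
  simp only [Module.End.mul_apply, LinearMap.sub_apply, Pi.sub_apply, creation_apply,
    annihilation_apply, genDer, genMul, Module.End.one_apply]
  by_cases hi : i ∈ A <;> simp [hi]
  · rw [leftSign_erase hi]
    simp [smul_smul, leftSign_mul_self]
  · rw [leftSign_insert hi]
    simp [smul_smul, leftSign_mul_self]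

theorem annihilation_mul_creation_of_ne {i j : ι} (hij : i ≠ j) :
    annihilation R i * creation R j = -(creation R j * annihilation R i) := by
  refine LinearMap.ext fun α => funext fun A => ?_
  simp only [Module.End.mul_apply, LinearMap.neg_apply, Pi.neg_apply, creation_apply,
    annihilation_apply, genDer, genMul]
  by_cases hi : i ∈ A <;> by_cases hj : j ∈ A <;> simp [hi, hj, hij, hij.symm]
  rw [leftSign_insert hi, leftSign_erase hj, Finset.erase_insert_of_ne hij, smul_smul, smul_smul,
    ← neg_smul]
  congr 1
  rcases lt_or_gt_of_ne hij with h | h <;> simp [h, h.not_gt] <;> ring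

/-- The coefficientwise action of a linear operator on `R`. -/
def coeffwise (ι : Type) {R : Type} [CommRing R] [Algebra ℂ R] :
    Module.End ℂ R →+* Module.End ℂ (Finset ι → R) where
  toFun L := L.compLeft (Finset ι)
  map_one' := rfl
  map_mul' _ _ := rfl
  map_zero' := rfl
  map_add' _ _ := rfl

theorem coeffwise_apply (L : Module.End ℂ R) (α : Finset ι → R) (A : Finset ι) :
    coeffwise ι L α A = L (α A) := rfl

theorem coeffwise_creation (L : Module.End ℂ R) (i : ι) :
    Commute (coeffwise ι L) (creation R i) := by
  refine LinearMap.ext fun α => funext fun A => ?_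
  simp only [Module.End.mul_apply, coeffwise_apply, creation_apply, genMul]
  split_ifs <;> simp

theorem coeffwise_annihilation (L : Module.End ℂ R) (i : ι) :
    Commute (coeffwise ι L) (annihilation R i) := by
  refine LinearMap.ext fun α => funext fun A => ?_
  simp only [Module.End.mul_apply, coeffwise_apply, annihilation_apply, genDer]
  split_ifs <;> simp

/-! ### The wedge product -/

/-- The parity operator. -/
def parity (α : Finset ι → R) : Finset ι → R := fun A => (-1 : ℂ) ^ A.card • α A

theorem wedgeSign_insert_left {i : ι} {B C : Finset ι} (hB : i ∉ B) :
    wedgeSign (insert i B) C = leftSign i C * wedgeSign B C := by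
  unfold wedgeSign leftSign
  rw [← pow_add]
  congr 1
  rw [Finset.insert_eq, Finset.union_product, Finset.filter_union, Finset.card_union_of_disjoint,
    Finset.singleton_product]
  · congr 1
    rw [Finset.filter_map, Finset.card_map]
    rfl
  · rw [Finset.disjoint_left]
    rintro ⟨a, b⟩ h1 h2
    simp only [Finset.mem_filter, Finset.mem_product, Finset.mem_singleton] at h1 h2
    exact hB (h1.1.1 ▸ h2.1.1)

theorem wedgeSign_insert_right {i : ι} {B C : Finset ι} (hB : i ∉ B) (hC : i ∉ C) :
    wedgeSign B (insert i C) = (-1) ^ B.card * leftSign i B * wedgeSign B C := by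
  have h1 : ((B ×ˢ insert i C).filter fun p => p.2 < p.1).card
      = (B.filter fun a => i < a).card + ((B ×ˢ C).filter fun p => p.2 < p.1).card := by
    rw [Finset.insert_eq, Finset.product_union, Finset.filter_union,
      Finset.card_union_of_disjoint, Finset.product_singleton]
    · congr 1
      rw [Finset.filter_map, Finset.card_map]
      rfl
    · rw [Finset.disjoint_left]
      rintro ⟨a, b⟩ h1 h2
      simp only [Finset.mem_filter, Finset.mem_product, Finset.mem_singleton] at h1 h2
      exact hC (h1.1.2 ▸ h2.1.2)
  have h2 : B.card = (B.filter fun a => a < i).card + (B.filter fun a => i < a).card := by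
    rw [← Finset.card_filter_add_card_filter_not (s := B) (fun a => a < i)]
    congr 2
    refine Finset.filter_congr fun a ha => ?_
    have : a ≠ i := fun h => hB (h ▸ ha)
    rw [not_lt]
    exact ⟨fun h => lt_of_le_of_ne h this.symm, le_of_lt⟩
  unfold wedgeSign leftSign
  rw [h1, h2, pow_add, pow_add]
  have : ((-1 : ℂ) ^ (B.filter fun a => a < i).card) * (-1) ^ (B.filter fun a => a < i).card = 1 := by
    rw [← pow_add, ← two_mul, pow_mul]; simp
  linear_combination (-(-1 : ℂ) ^ (B.filter fun a => i < a).card *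
    (-1 : ℂ) ^ ((B ×ˢ C).filter fun p => p.2 < p.1).card) * this

theorem genMul_wedge_left (i : ι) (α β : Finset ι → R) :
    wedge (genMul i α) β = genMul i (wedge α β) := by
  funext A
  simp only [wedge, genMul]
  split_ifs with hi
  · rw [Finset.smul_sum]
    have h0 : ∀ B ∈ A.powerset, B ∉ (A.powerset.filter fun B => i ∈ B) →
        wedgeSign B (A \ B) • ((if i ∈ B then leftSign i B • α (B.erase i) else 0) * β (A \ B))
          = 0 := by
      intro B hB hB'
      rw [if_neg (fun h => hB' (Finset.mem_filter.mpr ⟨hB, h⟩)), zero_mul, smul_zero]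
    rw [← Finset.sum_subset (Finset.filter_subset _ _) h0]
    refine Finset.sum_bij' (fun B _ => B.erase i) (fun B _ => insert i B) ?_ ?_ ?_ ?_ ?_
    · intro B hB
      simp only [Finset.mem_filter, Finset.mem_powerset] at hB ⊢
      exact Finset.erase_subset_erase _ hB.1
    · intro B hB
      simp only [Finset.mem_filter, Finset.mem_powerset] at hB ⊢
      exact ⟨Finset.insert_subset hi (hB.trans (Finset.erase_subset _ _)),
        Finset.mem_insert_self _ _⟩
    · intro B hB
      exact Finset.insert_erase (Finset.mem_filter.mp hB).2
    · intro B hB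
      exact Finset.erase_insert fun h => by
        simpa using Finset.mem_powerset.mp hB h
    · intro B hB
      obtain ⟨hBA, hiB⟩ := Finset.mem_filter.mp hB
      rw [Finset.mem_powerset] at hBA
      have hC : A.erase i \ B.erase i = A \ B := by
        ext x; by_cases hx : x = i <;> simp [hx, hiB]
      rw [if_pos hiB, hC, smul_mul_assoc, smul_smul, smul_smul]
      congr 1
      have h1 := wedgeSign_insert_left (C := A \ B) (Finset.notMem_erase i B)
      rw [Finset.insert_erase hiB] at h1
      have h2 : leftSign i A = leftSign i B * leftSign i (A \ B) := by
        unfold leftSign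
        rw [← pow_add, ← Finset.card_union_of_disjoint, ← Finset.filter_union,
          Finset.union_sdiff_of_subset hBA]
        exact Finset.disjoint_filter_filter Finset.disjoint_sdiff
      rw [h1, h2]; ring
  · refine Finset.sum_eq_zero fun B hB => ?_
    rw [if_neg (fun h => hi (Finset.mem_powerset.mp hB h)), zero_mul, smul_zero]

theorem genMul_wedge_right (i : ι) (α β : Finset ι → R) :
    wedge (parity α) (genMul i β) = genMul i (wedge α β) := by
  funext A
  simp only [wedge, genMul, parity]
  split_ifs with hi
  · rw [Finset.smul_sum]
    have h0 : ∀ B ∈ A.powerset, B ∉ (A.erase i).powerset →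
        wedgeSign B (A \ B) • ((-1 : ℂ) ^ B.card • α B *
          (if i ∈ A \ B then leftSign i (A \ B) • β ((A \ B).erase i) else 0)) = 0 := by
      intro B hB hB'
      rw [if_neg, mul_zero, smul_zero]
      intro h
      refine hB' (Finset.mem_powerset.mpr fun x hx => Finset.mem_erase.mpr ⟨?_, ?_⟩)
      · rintro rfl
        exact (Finset.mem_sdiff.mp h).2 hx
      · exact Finset.mem_powerset.mp hB hx
    rw [← Finset.sum_subset (Finset.powerset_mono.mpr (Finset.erase_subset _ _)) h0]
    refine Finset.sum_congr rfl fun B hB => ?_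
    rw [Finset.mem_powerset] at hB
    have hiB : i ∉ B := fun h => by simpa using hB h
    have hC : A.erase i \ B = (A \ B).erase i := by
      ext x; simp; tauto
    have hi' : i ∈ A \ B := Finset.mem_sdiff.mpr ⟨hi, hiB⟩
    rw [if_pos hi', hC, smul_mul_smul_comm, smul_smul, smul_smul]
    congr 1
    have h1 := wedgeSign_insert_right hiB (Finset.notMem_erase i (A \ B))
    rw [Finset.insert_erase hi'] at h1
    have h2 : leftSign i A = leftSign i B * leftSign i (A \ B) := by
      unfold leftSign
      rw [← pow_add, ← Finset.card_union_of_disjoint, ← Finset.filter_union,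
        Finset.union_sdiff_of_subset (hB.trans (Finset.erase_subset _ _))]
      exact Finset.disjoint_filter_filter Finset.disjoint_sdiff
    rw [h1, h2]
    have : ((-1 : ℂ) ^ B.card) * (-1) ^ B.card = 1 := by
      rw [← pow_add, ← two_mul, pow_mul]; simp
    linear_combination (leftSign i B * wedgeSign B ((A \ B).erase i) * leftSign i (A \ B)) * this
  · refine Finset.sum_eq_zero fun B hB => ?_
    rw [if_neg (fun h => hi (Finset.mem_sdiff.mp h).1), mul_zero, smul_zero]

theorem wedge_add_left (α α' β : Finset ι → R) :
    wedge (α + α') β = wedge α β + wedge α' β := by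
  funext A
  simp [wedge, add_mul, Finset.sum_add_distrib]

theorem wedge_add_right (α β β' : Finset ι → R) :
    wedge α (β + β') = wedge α β + wedge α β' := by
  funext A
  simp [wedge, mul_add, Finset.sum_add_distrib]

theorem wedge_smul_left (c : ℂ) (α β : Finset ι → R) : wedge (c • α) β = c • wedge α β := by
  funext A
  simp [wedge, Finset.smul_sum, smul_comm c]

theorem wedge_smul_right (c : ℂ) (α β : Finset ι → R) : wedge α (c • β) = c • wedge α β := by
  funext A
  simp [wedge, Finset.smul_sum, smul_comm c]

theorem wedge_neg_left (α β : Finset ι → R) : wedge (-α) β = -wedge α β := by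
  simpa using wedge_smul_left (-1) α β

theorem parity_add (α β : Finset ι → R) : parity (α + β) = parity α + parity β := by
  funext A; simp [parity]

theorem parity_parity (α : Finset ι → R) : parity (parity α) = α := by
  funext A
  simp only [parity, smul_smul, ← pow_add, ← two_mul, pow_mul]
  simp

theorem parity_genMul (i : ι) (α : Finset ι → R) : parity (genMul i α) = -genMul i (parity α) := by
  funext A
  simp only [parity, genMul, Pi.neg_apply]
  split_ifs with h
  · rw [← Finset.insert_erase h, Finset.card_insert_of_notMem (Finset.notMem_erase i A),
      Finset.insert_erase h, pow_succ, smul_smul, smul_smul, ← neg_smul]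
    congr 1; ring
  · simp

theorem parity_genDer (i : ι) (α : Finset ι → R) : parity (genDer i α) = -genDer i (parity α) := by
  funext A
  simp only [parity, genDer, Pi.neg_apply]
  split_ifs with h
  · simp
  · rw [Finset.card_insert_of_notMem h, pow_succ, smul_smul, smul_smul, ← neg_smul]
    congr 1; ring

theorem genDer_wedge_eq_zero {i : ι} {α β : Finset ι → R} (hα : genDer i α = 0)
    (hβ : genDer i β = 0) : genDer i (wedge α β) = 0 := by
  have key : ∀ γ : Finset ι → R, genDer i γ = 0 → ∀ B, i ∈ B → γ B = 0 := by
    intro γ h B hB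
    have := congrFun h (B.erase i)
    simp only [genDer, Finset.notMem_erase, if_false, Finset.insert_erase hB, Pi.zero_apply] at this
    exact (smul_eq_zero_iff_right (leftSign_ne_zero _ _)).mp this
  funext A
  simp only [genDer, wedge]
  split_ifs with hi
  · rfl
  · rw [Finset.sum_eq_zero, smul_zero]; · rfl
    intro B _
    by_cases hB : i ∈ B
    · rw [key α hα B hB, zero_mul, smul_zero]
    · rw [key β hβ _ (Finset.mem_sdiff.mpr ⟨Finset.mem_insert_self _ _, hB⟩), mul_zero, smul_zero]

theorem genDer_genDer_self (i : ι) (α : Finset ι → R) : genDer i (genDer i α) = 0 :=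
  congrArg (fun L => L α) (annihilation_mul_self (R := R) i)

theorem genMul_genMul_self (i : ι) (α : Finset ι → R) : genMul i (genMul i α) = 0 :=
  congrArg (fun L => L α) (creation_mul_self (R := R) i)

theorem genDer_genMul_self (i : ι) (α : Finset ι → R) :
    genDer i (genMul i α) = α - genMul i (genDer i α) :=
  congrArg (fun L => L α) (annihilation_mul_creation (R := R) i)

theorem genDer_wedge (i : ι) (α β : Finset ι → R) :
    genDer i (wedge α β) = wedge (genDer i α) β + wedge (parity α) (genDer i β) := by
  have split : ∀ γ : Finset ι → R, ∃ γ₀ γ₁ : Finset ι → R, γ = γ₀ + genMul i γ₁ ∧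
      genDer i γ₀ = 0 ∧ genDer i γ₁ = 0 := fun γ =>
    ⟨genDer i (genMul i γ), genDer i γ, by rw [genDer_genMul_self]; abel,
      genDer_genDer_self i _, genDer_genDer_self i _⟩
  obtain ⟨α₀, α₁, rfl, h₀, h₁⟩ := split α
  obtain ⟨β₀, β₁, rfl, k₀, k₁⟩ := split β
  have zero_mul' : genMul i (0 : Finset ι → R) = 0 := map_zero (creation R i)
  have hp : genDer i (parity α₀) = 0 := by
    rw [← neg_eq_zero, ← parity_genDer, h₀]; funext A; simp [parity]
  have neg_mul' : ∀ γ : Finset ι → R, genMul i (-γ) = -genMul i γ := map_neg (creation R i)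
  have e1 : ∀ γ : Finset ι → R, genDer i γ = 0 → genDer i (genMul i γ) = γ := fun γ h => by
    rw [genDer_genMul_self, h, zero_mul', sub_zero]
  have r : ∀ γ η : Finset ι → R, wedge γ (genMul i η) = genMul i (wedge (parity γ) η) := by
    intro γ η
    rw [← genMul_wedge_right, parity_parity]
  simp only [SmoothCompleteFan.genDer_add, h₀, k₀, e1 _ h₁, e1 _ k₁, zero_add, wedge_add_left,
    wedge_add_right, SmoothCompleteFan.genMul_add, neg_mul', neg_zero, add_zero, genMul_wedge_left, r, parity_add, parity_genMul, genMul_genMul_self,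
    genDer_wedge_eq_zero h₀ k₀, e1 _ (genDer_wedge_eq_zero h₁ k₀),
    e1 _ (genDer_wedge_eq_zero hp k₁), wedge_neg_left]
  abel

end Exterior

/-! ### Integrals depending smoothly on a parameter -/

section Parametric

theorem hasFDerivAt_intervalIntegral {H E : Type} [NormedAddCommGroup H] [NormedSpace ℝ H]
    [ProperSpace H] [NormedAddCommGroup E] [NormedSpace ℝ E] {G : H × ℝ → E}
    (hG : ContDiff ℝ 1 G) (x : H) :
    HasFDerivAt (fun y => ∫ t in (0 : ℝ)..1, G (y, t))
      (∫ t in (0 : ℝ)..1, (fderiv ℝ G (x, t)).comp (ContinuousLinearMap.inl ℝ H ℝ)) x := by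
  have hc : Continuous fun p : H × ℝ => (fderiv ℝ G p).comp (ContinuousLinearMap.inl ℝ H ℝ) :=
    (hG.continuous_fderiv one_ne_zero).clm_comp continuous_const
  obtain ⟨C, hC⟩ := ((isCompact_closedBall x 1).prod
    (isCompact_Icc (a := (0 : ℝ)) (b := 1))).exists_bound_of_continuousOn hc.continuousOn
  refine intervalIntegral.hasFDerivAt_integral_of_dominated_of_fderiv_le
    (F := fun y t => G (y, t)) (bound := fun _ => C)
    (F' := fun y t => (fderiv ℝ G (y, t)).comp (ContinuousLinearMap.inl ℝ H ℝ))
    (Metric.closedBall_mem_nhds x one_pos) ?_ ?_ ?_ ?_ ?_ ?_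
  · exact Filter.Eventually.of_forall fun y =>
      (hG.continuous.comp (by fun_prop : Continuous fun t : ℝ => (y, t))).aestronglyMeasurable
  · exact (hG.continuous.comp (by fun_prop : Continuous fun t : ℝ => (x, t))).intervalIntegrable _ _
  · exact (hc.comp (by fun_prop : Continuous fun t : ℝ => (x, t))).aestronglyMeasurable
  · refine Filter.Eventually.of_forall fun t ht y hy => hC (y, t) ⟨hy, ?_⟩
    rw [Set.uIoc_of_le zero_le_one] at ht
    exact Set.Ioc_subset_Icc_self ht
  · exact intervalIntegrable_const
  · refine Filter.Eventually.of_forall fun t _ y _ => ?_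
    have h1 : HasFDerivAt G (fderiv ℝ G (y, t)) (y, t) :=
      (hG.differentiable one_ne_zero _).hasFDerivAt
    have h2 : HasFDerivAt (fun z : H => (z, t)) (ContinuousLinearMap.inl ℝ H ℝ) y := by
      exact (hasFDerivAt_id y).prodMk (hasFDerivAt_const t y)
    exact h1.comp y h2

theorem contDiff_intervalIntegral {H : Type} [NormedAddCommGroup H] [NormedSpace ℝ H]
    [ProperSpace H] {E : Type} [NormedAddCommGroup E] [NormedSpace ℝ E] {G : H × ℝ → E}
    (hG : ContDiff ℝ ∞ G) : ContDiff ℝ ∞ fun y => ∫ t in (0 : ℝ)..1, G (y, t) := by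
  rw [contDiff_infty]
  intro m
  induction m generalizing E with
  | zero =>
    refine contDiff_zero.mpr (continuous_iff_continuousAt.mpr fun x => ?_)
    exact (hasFDerivAt_intervalIntegral (hG.of_le (by simp)) x).continuousAt
  | succ m ih =>
    exact contDiff_succ_iff_hasFDerivAt.mpr
      ⟨_, ih ((hG.fderiv_right (m := ∞) (by simp)).clm_comp contDiff_const),
        fun x => hasFDerivAt_intervalIntegral (hG.of_le (by simp)) x⟩

end Parametric

theorem commute_smul_add_smul {A : Type} [Ring A] [Algebra ℂ A] {x y p : A} (hx : Commute x p)
    (hy : Commute y p) (k c : ℂ) : Commute (k • (x + c • y)) p :=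
  (hx.add_left (hy.smul_left c)).smul_left k

theorem commute_smul_sub_smul {A : Type} [Ring A] [Algebra ℂ A] {x y p : A} (hx : Commute x p)
    (hy : Commute y p) (k c : ℂ) : Commute (k • (x - c • y)) p :=
  (hx.sub_left (hy.smul_left c)).smul_left k

/-! ### Smooth functions on a component -/

/-- The smooth functions on `X_s`, as a subalgebra of all functions. -/
def smoothSubalgebra (s : Finset (Fin d)) : Subalgebra ℂ ((s → ℂ) → ℂ) where
  carrier := {a | ContDiff ℝ ∞ a}
  mul_mem' {a b} (ha : ContDiff ℝ ∞ a) (hb : ContDiff ℝ ∞ b) := ha.mul hb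
  add_mem' {a b} (ha : ContDiff ℝ ∞ a) (hb : ContDiff ℝ ∞ b) := ha.add hb
  algebraMap_mem' c := (contDiff_const : ContDiff ℝ ∞ fun _ : s → ℂ => c)

/-- The algebra of smooth functions on `X_s`. -/
def Sm (s : Finset (Fin d)) : Type := smoothSubalgebra s

instance (s : Finset (Fin d)) : CommRing (Sm s) := inferInstanceAs (CommRing (smoothSubalgebra s))

instance (s : Finset (Fin d)) : Algebra ℂ (Sm s) :=
  inferInstanceAs (Algebra ℂ (smoothSubalgebra s))

namespace Sm

variable {s : Finset (Fin d)}

instance : Ring (Module.End ℂ (Sm s)) := Module.End.instRing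

/-- The underlying function. -/
def val (a : Sm s) : (s → ℂ) → ℂ := Subtype.val (p := (· ∈ smoothSubalgebra s)) a

/-- A smooth function as an element of `Sm s`. -/
def mk (a : (s → ℂ) → ℂ) (ha : ContDiff ℝ ∞ a) : Sm s := (⟨a, ha⟩ : smoothSubalgebra s)

@[simp] theorem val_mk (a : (s → ℂ) → ℂ) (ha : ContDiff ℝ ∞ a) : (mk a ha).val = a := rfl

theorem contDiff (a : Sm s) : ContDiff ℝ ∞ a.val :=
  Subtype.property (p := (· ∈ smoothSubalgebra s)) a

theorem differentiable (a : Sm s) : Differentiable ℝ a.val := a.contDiff.differentiable (by simp)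

@[simp] theorem coe_add (a b : Sm s) (z : s → ℂ) : (a + b).val z = a.val z + b.val z := rfl
@[simp] theorem coe_sub (a b : Sm s) (z : s → ℂ) : (a - b).val z = a.val z - b.val z := rfl
@[simp] theorem coe_neg (a : Sm s) (z : s → ℂ) : (-a).val z = -a.val z := rfl
@[simp] theorem coe_mul (a b : Sm s) (z : s → ℂ) : (a * b).val z = a.val z * b.val z := rfl
@[simp] theorem coe_smul (c : ℂ) (a : Sm s) (z : s → ℂ) : (c • a).val z = c * a.val z := rfl
@[simp] theorem coe_zero (z : s → ℂ) : (0 : Sm s).val z = 0 := rfl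
@[simp] theorem coe_one (z : s → ℂ) : (1 : Sm s).val z = 1 := rfl
@[simp] theorem coe_algebraMap (c : ℂ) (z : s → ℂ) : (algebraMap ℂ (Sm s) c).val z = c := rfl

theorem ext {a b : Sm s} (h : ∀ z, a.val z = b.val z) : a = b := Subtype.ext (p := (· ∈ smoothSubalgebra s)) (funext h)

/-- The derivative in a constant direction. -/
def dir (w : s → ℂ) : Module.End ℂ (Sm s) where
  toFun a := mk (fun z => fderiv ℝ a.val z w) (contDiff_fderiv_apply a.contDiff w)
  map_add' a b := ext fun z => by
    show fderiv ℝ (a.val + b.val) z w = _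
    rw [fderiv_add (a.differentiable z) (b.differentiable z)]; rfl
  map_smul' c a := ext fun z => by
    show fderiv ℝ (c • a.val) z w = _
    rw [fderiv_const_smul (a.differentiable z)]; rfl

theorem dir_apply (w : s → ℂ) (a : Sm s) (z : s → ℂ) : (dir w a).val z = fderiv ℝ a.val z w := rfl

theorem dir_comm (v w : s → ℂ) : Commute (dir v) (dir w) := by
  refine LinearMap.ext fun a => ext fun z => ?_
  have h2 : ∀ v w : s → ℂ, (dir v (dir w a)).val z = fderiv ℝ (fderiv ℝ a.val) z v w := by
    intro v w
    have : DifferentiableAt ℝ (fderiv ℝ a.val) z :=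
      (a.contDiff.fderiv_right (m := ∞) (by simp)).differentiable (by simp) z
    show fderiv ℝ (fun y => fderiv ℝ a.val y w) z v = _
    rw [fderiv_clm_apply this (differentiableAt_const w)]
    simp
  show (dir v (dir w a)).val z = (dir w (dir v a)).val z
  rw [h2, h2]
  exact (a.contDiff.contDiffAt.isSymmSndFDerivAt (by simp; exact WithTop.coe_le_coe.mpr le_top)) v w

theorem dir_mul (w : s → ℂ) (a b : Sm s) : dir w (a * b) = a * dir w b + dir w a * b := by
  refine ext fun z => ?_
  show fderiv ℝ (a.val * b.val) z w = _
  rw [fderiv_mul (a.differentiable z) (b.differentiable z)]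
  simp [dir_apply, mul_comm]

/-- The coordinate `z_i` on `X_s`. -/
def coord (s : Finset (Fin d)) (i : Fin d) : Sm s := mk (fun z => incl s z i) (contDiff_incl i)

/-- The conjugate coordinate on `X_s`. -/
def conjCoord (s : Finset (Fin d)) (i : Fin d) : Sm s :=
  mk (fun z => starRingEnd ℂ (incl s z i)) (Complex.conjCLE.contDiff.comp (contDiff_incl i))

theorem incl_add (z w : s → ℂ) (i : Fin d) : incl s (z + w) i = incl s z i + incl s w i := by
  by_cases h : i ∈ s <;> simp [incl, h]

theorem incl_smul (c : ℝ) (z : s → ℂ) (i : Fin d) : incl s (c • z) i = c • incl s z i := by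
  by_cases h : i ∈ s <;> simp [incl, h]

theorem coord_eq_zero {i : Fin d} (hi : i ∉ s) : coord s i = 0 :=
  ext fun z => by simp [coord, incl, hi]

/-- The coordinate as a continuous linear map. -/
def coordCLM (s : Finset (Fin d)) (i : Fin d) : (s → ℂ) →L[ℝ] ℂ :=
  LinearMap.toContinuousLinearMap
    { toFun := fun z => incl s z i, map_add' := fun z w => incl_add z w i,
      map_smul' := fun c z => incl_smul c z i }

theorem dir_coord (w : s → ℂ) (i : Fin d) : dir w (coord s i) = algebraMap ℂ _ (incl s w i) := by
  refine ext fun z => ?_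
  show fderiv ℝ (coordCLM s i) z w = _
  rw [ContinuousLinearMap.fderiv]
  rfl

theorem dir_conjCoord (w : s → ℂ) (i : Fin d) :
    dir w (conjCoord s i) = algebraMap ℂ _ (starRingEnd ℂ (incl s w i)) := by
  refine ext fun z => ?_
  show fderiv ℝ (Complex.conjCLE.toContinuousLinearMap.comp (coordCLM s i)) z w = _
  rw [ContinuousLinearMap.fderiv]
  rfl

/-- `∂/∂z_i`. -/
def dzOp (s : Finset (Fin d)) (i : Fin d) : Module.End ℂ (Sm s) :=
  (1 / 2 : ℂ) • (dir (proj s (Pi.single i 1)) - Complex.I • dir (proj s (Pi.single i Complex.I)))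

/-- `∂/∂\bar z_i`. -/
def dzbarOp (s : Finset (Fin d)) (i : Fin d) : Module.End ℂ (Sm s) :=
  (1 / 2 : ℂ) • (dir (proj s (Pi.single i 1)) + Complex.I • dir (proj s (Pi.single i Complex.I)))

theorem coe_dzOp (i : Fin d) (a : Sm s) : (dzOp s i a).val = dz s i a.val := rfl

theorem coe_dzbarOp (i : Fin d) (a : Sm s) : (dzbarOp s i a).val = dzbar s i a.val := rfl

theorem proj_single_eq_zero {i : Fin d} (hi : i ∉ s) (c : ℂ) :
    proj s (Pi.single i c : Fin d → ℂ) = 0 := by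
  funext j
  exact Pi.single_eq_of_ne (fun h : (j : Fin d) = i => hi (h ▸ j.2)) _

theorem dir_zero : dir (0 : s → ℂ) = 0 :=
  LinearMap.ext fun a => ext fun z => by simp [dir_apply]

theorem dzbarOp_eq_zero {i : Fin d} (hi : i ∉ s) : dzbarOp s i = 0 := by
  simp [dzbarOp, proj_single_eq_zero hi, dir_zero]

theorem incl_proj_single (i j : Fin d) (c : ℂ) :
    incl s (proj s (Pi.single i c)) j = if i ∈ s ∧ j = i then c else 0 := by
  by_cases hij : j = i
  · subst hij
    by_cases hj : j ∈ s <;> simp [incl, proj, hj]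
  · by_cases hj : j ∈ s <;> simp [incl, proj, hj, hij]

theorem dzOp_commute {L : Module.End ℂ (Sm s)} {i : Fin d}
    (h : ∀ c, Commute (dir (proj s (Pi.single i c))) L) : Commute (dzOp s i) L :=
  commute_smul_sub_smul (h _) (h _) _ _

theorem dzbarOp_commute {L : Module.End ℂ (Sm s)} {i : Fin d}
    (h : ∀ c, Commute (dir (proj s (Pi.single i c))) L) : Commute (dzbarOp s i) L :=
  commute_smul_add_smul (h _) (h _) _ _

theorem dzOp_comm (i j : Fin d) : Commute (dzOp s i) (dzOp s j) :=
  dzOp_commute fun _ => (dzOp_commute fun _ => dir_comm _ _).symm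

theorem dzbarOp_comm (i j : Fin d) : Commute (dzbarOp s i) (dzbarOp s j) :=
  dzbarOp_commute fun _ => (dzbarOp_commute fun _ => dir_comm _ _).symm

theorem dzbarOp_dzOp_comm (i j : Fin d) : Commute (dzbarOp s i) (dzOp s j) :=
  dzbarOp_commute fun _ => (dzOp_commute fun _ => dir_comm _ _).symm

theorem dzOp_mul (i : Fin d) (a b : Sm s) : dzOp s i (a * b) = a * dzOp s i b + dzOp s i a * b := by
  simp only [dzOp, LinearMap.smul_apply, LinearMap.sub_apply, dir_mul, smul_sub, smul_add,
    mul_sub, sub_mul, mul_smul_comm, smul_mul_assoc]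
  abel

theorem dzbarOp_mul (i : Fin d) (a b : Sm s) :
    dzbarOp s i (a * b) = a * dzbarOp s i b + dzbarOp s i a * b := by
  simp only [dzbarOp, LinearMap.smul_apply, LinearMap.add_apply, dir_mul, smul_add,
    mul_add, add_mul, mul_smul_comm, smul_mul_assoc]
  abel

theorem dzOp_coord (i j : Fin d) :
    dzOp s i (coord s j) = if i ∈ s ∧ j = i then 1 else 0 := by
  simp only [dzOp, LinearMap.smul_apply, LinearMap.sub_apply, dir_coord, incl_proj_single]
  split_ifs
  · refine ext fun z => ?_
    have : (1 / 2 : ℂ) * (1 - Complex.I * Complex.I) = 1 := by norm_num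
    exact this
  · simp

theorem dzbarOp_coord (i j : Fin d) : dzbarOp s i (coord s j) = 0 := by
  simp only [dzbarOp, LinearMap.smul_apply, LinearMap.add_apply, dir_coord, incl_proj_single]
  split_ifs
  · refine ext fun z => ?_
    have : (1 / 2 : ℂ) * (1 + Complex.I * Complex.I) = 0 := by norm_num
    exact this
  · simp

theorem dzbarOp_conjCoord (i j : Fin d) :
    dzbarOp s i (conjCoord s j) = if i ∈ s ∧ j = i then 1 else 0 := by
  simp only [dzbarOp, LinearMap.smul_apply, LinearMap.add_apply, dir_conjCoord, incl_proj_single]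
  split_ifs
  · refine ext fun z => ?_
    have : (1 / 2 : ℂ) * (1 + Complex.I * -Complex.I) = 1 := by norm_num
    rw [map_one, Complex.conj_I]
    exact this
  · simp

/-- Multiplication by a function. -/
abbrev mulOp (a : Sm s) : Module.End ℂ (Sm s) := LinearMap.mulLeft ℂ a

theorem mulOp_comm (a b : Sm s) : Commute (mulOp a) (mulOp b) :=
  LinearMap.ext fun c => by simp [mul_left_comm]

theorem dzOp_mul_mulOp (i : Fin d) (a : Sm s) :
    dzOp s i * mulOp a = mulOp a * dzOp s i + mulOp (dzOp s i a) :=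
  LinearMap.ext fun b => by simp [dzOp_mul]

theorem dzbarOp_mul_mulOp (i : Fin d) (a : Sm s) :
    dzbarOp s i * mulOp a = mulOp a * dzbarOp s i + mulOp (dzbarOp s i a) :=
  LinearMap.ext fun b => by simp [dzbarOp_mul]

theorem mulOp_one : mulOp (1 : Sm s) = 1 := LinearMap.ext fun b => by simp

theorem mulOp_zero : mulOp (0 : Sm s) = 0 := LinearMap.ext fun b => by simp

/-! ### Scaling one variable -/

/-- Multiplication of the coordinate `z_v` by `t`. -/
def scale (v : Fin d) (t : ℝ) (z : s → ℂ) : s → ℂ := fun j => if (j : Fin d) = v then t * z j else z j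

theorem scale_eq (v : Fin d) (t : ℝ) (z : s → ℂ) :
    scale v t z = z + (t - 1) • proj s (Pi.single v (incl s z v)) := by
  funext j
  by_cases h : (j : Fin d) = v
  · subst h
    simp [scale, proj, incl]; ring
  · simp [scale, proj, h]

theorem scale_one (v : Fin d) (z : s → ℂ) : scale v 1 z = z := by
  funext j; simp [scale]

theorem contDiff_scale (v : Fin d) :
    ContDiff ℝ ∞ fun p : (s → ℂ) × ℝ => scale v p.2 p.1 := by
  refine contDiff_pi.mpr fun j => ?_
  unfold scale
  split_ifs
  · exact (Complex.ofRealCLM.contDiff.comp contDiff_snd).mul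
      ((contDiff_apply ℝ ℂ j).comp contDiff_fst)
  · exact (contDiff_apply ℝ ℂ j).comp contDiff_fst

/-- Scaling as a continuous linear map. -/
def scaleCLM (v : Fin d) (t : ℝ) : (s → ℂ) →L[ℝ] (s → ℂ) :=
  LinearMap.toContinuousLinearMap
    { toFun := scale v t
      map_add' := fun z w => by funext j; by_cases h : (j : Fin d) = v <;> simp [scale, h, mul_add]
      map_smul' := fun c z => by
        funext j
        by_cases h : (j : Fin d) = v <;> simp [scale, h, mul_left_comm] }

theorem contDiff_scale_integrand (v : Fin d) (m : ℕ) (a : Sm s) :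
    ContDiff ℝ ∞ fun p : (s → ℂ) × ℝ => ((p.2 : ℂ) ^ m) * a.val (scale v p.2 p.1) :=
  ((Complex.ofRealCLM.contDiff.comp contDiff_snd).pow m).mul (a.contDiff.comp (contDiff_scale v))

theorem continuous_scale_integrand (v : Fin d) (m : ℕ) (a : Sm s) (z : s → ℂ) :
    Continuous fun t : ℝ => ((t : ℂ) ^ m) * a.val (scale v t z) :=
  (contDiff_scale_integrand v m a).continuous.comp (by fun_prop : Continuous fun t : ℝ => (z, t))

/-- The weighted average `∫₀¹ t^m a(…, t z_v, …) dt`. -/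
def avg (v : Fin d) (m : ℕ) : Module.End ℂ (Sm s) where
  toFun a := mk (fun z => ∫ t in (0 : ℝ)..1, ((t : ℂ) ^ m) * a.val (scale v t z))
    (contDiff_intervalIntegral (contDiff_scale_integrand v m a))
  map_add' a b := ext fun z => by
    show ∫ t in (0 : ℝ)..1, (t : ℂ) ^ m * (a.val (scale v t z) + b.val (scale v t z))
      = (∫ t in (0 : ℝ)..1, (t : ℂ) ^ m * a.val (scale v t z))
        + ∫ t in (0 : ℝ)..1, (t : ℂ) ^ m * b.val (scale v t z)
    rw [← intervalIntegral.integral_add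
      ((continuous_scale_integrand v m a z).intervalIntegrable _ _)
      ((continuous_scale_integrand v m b z).intervalIntegrable _ _)]
    exact intervalIntegral.integral_congr fun t _ => mul_add _ _ _
  map_smul' c a := ext fun z => by
    show ∫ t in (0 : ℝ)..1, (t : ℂ) ^ m * (c * a.val (scale v t z))
      = c * ∫ t in (0 : ℝ)..1, (t : ℂ) ^ m * a.val (scale v t z)
    rw [← intervalIntegral.integral_const_mul]
    exact intervalIntegral.integral_congr fun t _ => mul_left_comm _ _ _

theorem avg_apply (v : Fin d) (m : ℕ) (a : Sm s) (z : s → ℂ) :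
    (avg v m a).val z = ∫ t in (0 : ℝ)..1, ((t : ℂ) ^ m) * a.val (scale v t z) := rfl

/-- Restriction to `z_v = 0`, pulled back along the projection. -/
def restr (v : Fin d) : Module.End ℂ (Sm s) where
  toFun a := mk (fun z => a.val (scale v 0 z)) (a.contDiff.comp (scaleCLM v 0).contDiff)
  map_add' _ _ := rfl
  map_smul' _ _ := rfl

theorem restr_apply (v : Fin d) (a : Sm s) (z : s → ℂ) : (restr v a).val z = a.val (scale v 0 z) := rfl

theorem hasFDerivAt_comp_scale (v : Fin d) (t : ℝ) (a : Sm s) (z : s → ℂ) :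
    HasFDerivAt (fun y => a.val (scale v t y)) ((fderiv ℝ a.val (scale v t z)).comp (scaleCLM v t)) z :=
  (a.differentiable _).hasFDerivAt.comp z (scaleCLM v t).hasFDerivAt

theorem dir_avg (v : Fin d) (m : ℕ) (w : s → ℂ) (a : Sm s) (z : s → ℂ) :
    (dir w (avg v m a)).val z
      = ∫ t in (0 : ℝ)..1, ((t : ℂ) ^ m) * fderiv ℝ a.val (scale v t z) (scale v t w) := by
  have hG := (contDiff_scale_integrand v m a).of_le (m := 1) (by simp)
  have h := (hasFDerivAt_intervalIntegral hG z).fderiv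
  have hc : Continuous fun t : ℝ => (fderiv ℝ
      (fun p : (s → ℂ) × ℝ => ((p.2 : ℂ) ^ m) * a.val (scale v p.2 p.1)) (z, t)).comp
        (ContinuousLinearMap.inl ℝ (s → ℂ) ℝ) :=
    ((hG.continuous_fderiv one_ne_zero).clm_comp continuous_const).comp
      (by fun_prop : Continuous fun t : ℝ => (z, t))
  show fderiv ℝ (fun y => ∫ t in (0 : ℝ)..1, ((t : ℂ) ^ m) * a.val (scale v t y)) z w = _
  rw [h, ContinuousLinearMap.intervalIntegral_apply (hc.intervalIntegrable _ _)]
  refine intervalIntegral.integral_congr fun t _ => ?_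
  have h1 : HasFDerivAt (fun p : (s → ℂ) × ℝ => ((p.2 : ℂ) ^ m) * a.val (scale v p.2 p.1))
      _ (z, t) := (hG.differentiable one_ne_zero _).hasFDerivAt
  have h2 : HasFDerivAt (fun y : s → ℂ => (y, t)) (ContinuousLinearMap.inl ℝ (s → ℂ) ℝ) z := by
    exact (hasFDerivAt_id z).prodMk (hasFDerivAt_const t z)
  have h3 := h1.comp z h2
  have h4 := (hasFDerivAt_comp_scale v t a z).const_mul ((t : ℂ) ^ m)
  have := congrArg (fun L => L w) (h3.unique h4)
  exact this

theorem scale_proj_single (v i : Fin d) (t : ℝ) (c : ℂ) :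
    scale v t (proj s (Pi.single i c)) = (if i = v then t else 1) • proj s (Pi.single i c) := by
  funext j
  by_cases hj : (j : Fin d) = v
  · by_cases hi : i = v
    · simp [scale, hj, hi]
    · have : (j : Fin d) ≠ i := fun h => hi (h ▸ hj)
      simp [scale, proj, this, hi]
  · by_cases hi : i = v
    · have : (j : Fin d) ≠ i := fun h => hj (h ▸ hi)
      simp [scale, proj, this]
    · simp [scale, hj, hi]

theorem dir_single_avg_of_ne {v i : Fin d} (h : i ≠ v) (m : ℕ) (c : ℂ) :
    Commute (dir (proj s (Pi.single i c))) (avg v m) := by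
  refine LinearMap.ext fun a => ext fun z => ?_
  show (dir _ (avg v m a)).val z = _
  rw [dir_avg]
  simp only [scale_proj_single, h, if_false, one_smul]
  rfl

theorem dir_single_avg (v : Fin d) (m : ℕ) (c : ℂ) :
    dir (proj s (Pi.single v c)) * avg v m = avg v (m + 1) * dir (proj s (Pi.single v c)) := by
  refine LinearMap.ext fun a => ext fun z => ?_
  show (dir _ (avg v m a)).val z = _
  rw [dir_avg]
  show _ = ∫ t in (0 : ℝ)..1, _
  refine intervalIntegral.integral_congr fun t _ => ?_
  simp only [scale_proj_single, if_true, map_smul, Complex.real_smul, dir_apply, pow_succ]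
  ring

theorem dzbarOp_avg_of_ne {v i : Fin d} (h : i ≠ v) (m : ℕ) : Commute (dzbarOp s i) (avg v m) :=
  dzbarOp_commute fun c => dir_single_avg_of_ne h m c

theorem dzbarOp_avg (v : Fin d) (m : ℕ) : dzbarOp s v * avg v m = avg v (m + 1) * dzbarOp s v := by
  simp [dzbarOp, add_mul, mul_add, dir_single_avg]

theorem incl_scale (v i : Fin d) (t : ℝ) (z : s → ℂ) :
    incl s (scale v t z) i = if i = v then t * incl s z i else incl s z i := by
  by_cases hi : i ∈ s <;> by_cases h : i = v <;> simp [incl, scale, hi, h]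

theorem avg_coord (v : Fin d) (m : ℕ) :
    avg v m * mulOp (coord s v) = mulOp (coord s v) * avg v (m + 1) := by
  refine LinearMap.ext fun a => ext fun z => ?_
  show ∫ t in (0 : ℝ)..1, (t : ℂ) ^ m * (incl s (scale v t z) v * a.val (scale v t z))
    = incl s z v * ∫ t in (0 : ℝ)..1, (t : ℂ) ^ (m + 1) * a.val (scale v t z)
  rw [← intervalIntegral.integral_const_mul]
  refine intervalIntegral.integral_congr fun t _ => ?_
  simp only [incl_scale, if_true]; ring

theorem avg_coord_of_ne {v i : Fin d} (h : i ≠ v) (m : ℕ) :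
    Commute (avg v m) (mulOp (coord s i)) := by
  refine LinearMap.ext fun a => ext fun z => ?_
  show ∫ t in (0 : ℝ)..1, (t : ℂ) ^ m * (incl s (scale v t z) i * a.val (scale v t z))
    = incl s z i * ∫ t in (0 : ℝ)..1, (t : ℂ) ^ m * a.val (scale v t z)
  rw [← intervalIntegral.integral_const_mul]
  refine intervalIntegral.integral_congr fun t _ => ?_
  simp only [incl_scale, h, if_false]; ring

theorem dir_restr (v : Fin d) (w : s → ℂ) (a : Sm s) (z : s → ℂ) :
    (dir w (restr v a)).val z = fderiv ℝ a.val (scale v 0 z) (scale v 0 w) :=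
  congrArg (fun L => L w) (hasFDerivAt_comp_scale v 0 a z).fderiv

theorem dir_single_restr_of_ne {v i : Fin d} (h : i ≠ v) (c : ℂ) :
    Commute (dir (proj s (Pi.single i c))) (restr v) := by
  refine LinearMap.ext fun a => ext fun z => ?_
  show (dir _ (restr v a)).val z = _
  rw [dir_restr]
  simp only [scale_proj_single, h, if_false, one_smul]
  rfl

theorem dir_single_restr (v : Fin d) (c : ℂ) : dir (proj s (Pi.single v c)) * restr v = 0 := by
  refine LinearMap.ext fun a => ext fun z => ?_
  show (dir _ (restr v a)).val z = _
  rw [dir_restr]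
  simp [scale_proj_single]

theorem dzOp_restr_of_ne {v i : Fin d} (h : i ≠ v) : Commute (dzOp s i) (restr v) :=
  dzOp_commute fun c => dir_single_restr_of_ne h c

theorem dzbarOp_restr_of_ne {v i : Fin d} (h : i ≠ v) : Commute (dzbarOp s i) (restr v) :=
  dzbarOp_commute fun c => dir_single_restr_of_ne h c

theorem dzOp_restr (v : Fin d) : dzOp s v * restr v = 0 := by
  simp [dzOp, sub_mul, dir_single_restr]

theorem dzbarOp_restr (v : Fin d) : dzbarOp s v * restr v = 0 := by
  simp [dzbarOp, add_mul, dir_single_restr]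

theorem restr_coord (v : Fin d) : restr v * mulOp (coord s v) = 0 := by
  refine LinearMap.ext fun a => ext fun z => ?_
  show incl s (scale v 0 z) v * _ = 0
  simp [incl_scale]

theorem restr_conjCoord (v : Fin d) : restr v * mulOp (conjCoord s v) = 0 := by
  refine LinearMap.ext fun a => ext fun z => ?_
  show starRingEnd ℂ (incl s (scale v 0 z) v) * _ = 0
  simp [incl_scale]

theorem restr_coord_of_ne {v i : Fin d} (h : i ≠ v) : Commute (restr v) (mulOp (coord s i)) := by
  refine LinearMap.ext fun a => ext fun z => ?_
  show incl s (scale v 0 z) i * a.val (scale v 0 z) = incl s z i * a.val (scale v 0 z)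
  simp [incl_scale, h]

theorem restr_conjCoord_of_ne {v i : Fin d} (h : i ≠ v) :
    Commute (restr v) (mulOp (conjCoord s i)) := by
  refine LinearMap.ext fun a => ext fun z => ?_
  show starRingEnd ℂ (incl s (scale v 0 z) i) * a.val (scale v 0 z)
    = starRingEnd ℂ (incl s z i) * a.val (scale v 0 z)
  simp [incl_scale, h]

theorem scale_comm (v w : Fin d) (t r : ℝ) (z : s → ℂ) :
    scale v t (scale w r z) = scale w r (scale v t z) := by
  funext j
  simp only [scale]
  split_ifs <;> ring

theorem restr_comm (v w : Fin d) : Commute (restr (s := s) v) (restr w) :=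
  LinearMap.ext fun a => ext fun z =>
    congrArg a.val (scale_comm w v 0 0 z)

theorem scale_scale (v : Fin d) (t r : ℝ) (z : s → ℂ) :
    scale v t (scale v r z) = scale v (t * r) z := by
  funext j
  simp only [scale]
  split_ifs <;> push_cast <;> ring

theorem restr_restr (v : Fin d) : restr (s := s) v * restr v = restr v :=
  LinearMap.ext fun a => ext fun z => by
    show a.val (scale v 0 (scale v 0 z)) = a.val (scale v 0 z)
    rw [scale_scale, mul_zero]

theorem restr_avg (v : Fin d) : restr (s := s) v * avg v 0 = restr v :=
  LinearMap.ext fun a => ext fun z => by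
    show ∫ t in (0 : ℝ)..1, (t : ℂ) ^ 0 * a.val (scale v t (scale v 0 z)) = a.val (scale v 0 z)
    simp [scale_scale]

theorem restr_avg_of_ne (v w : Fin d) (m : ℕ) :
    Commute (restr (s := s) v) (avg w m) :=
  LinearMap.ext fun a => ext fun z => by
    show ∫ t in (0 : ℝ)..1, (t : ℂ) ^ m * a.val (scale w t (scale v 0 z))
      = ∫ t in (0 : ℝ)..1, (t : ℂ) ^ m * a.val (scale v 0 (scale w t z))
    simp only [scale_comm v w]

theorem fderiv_single (a : Sm s) (z : s → ℂ) (v : Fin d) (c : ℂ) :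
    fderiv ℝ a.val z (proj s (Pi.single v c))
      = c * (dzOp s v a).val z + starRingEnd ℂ c * (dzbarOp s v a).val z := by
  have h : proj s (Pi.single v c : Fin d → ℂ)
      = c.re • proj s (Pi.single v 1) + c.im • proj s (Pi.single v Complex.I) := by
    funext j
    by_cases hj : (j : Fin d) = v
    · subst hj
      simp [proj]
    · simp [proj, hj]
  rw [h, map_add, map_smul, map_smul, coe_dzOp, coe_dzbarOp]
  simp only [dz, dzbar, Complex.real_smul]
  have hc := Complex.re_add_im c
  set x := fderiv ℝ a.val z (proj s (Pi.single v 1))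
  set y := fderiv ℝ a.val z (proj s (Pi.single v Complex.I))
  have hcc : starRingEnd ℂ c = c.re - c.im * Complex.I := by
    apply Complex.ext <;> simp
  rw [hcc]
  generalize (c.re : ℂ) = p at *
  generalize (c.im : ℂ) = q at *
  rw [← hc]
  linear_combination (q * y) * Complex.I_mul_I

theorem euler_avg (v : Fin d) (m : ℕ) (a : Sm s) (z : s → ℂ) :
    ∫ t in (0 : ℝ)..1, ((t : ℂ) ^ m * fderiv ℝ a.val (scale v t z)
        (proj s (Pi.single v (incl s z v))) + (m : ℂ) * (t : ℂ) ^ (m - 1) * a.val (scale v t z))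
      = a.val z - (0 : ℂ) ^ m * a.val (scale v 0 z) := by
  have hd : ∀ t : ℝ, HasDerivAt (fun t : ℝ => (t : ℂ) ^ m * a.val (scale v t z))
      ((t : ℂ) ^ m * fderiv ℝ a.val (scale v t z) (proj s (Pi.single v (incl s z v)))
        + (m : ℂ) * (t : ℂ) ^ (m - 1) * a.val (scale v t z)) t := by
    intro t
    have h1 : HasDerivAt (fun t : ℝ => scale v t z) (proj s (Pi.single v (incl s z v))) t := by
      simp only [scale_eq]
      simpa using (((hasDerivAt_id t).sub_const 1).smul_const
        (proj s (Pi.single v (incl s z v)))).const_add z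
    have h2 := (a.differentiable (scale v t z)).hasFDerivAt.comp_hasDerivAt t h1
    have h3 : HasDerivAt (fun t : ℝ => (t : ℂ) ^ m) ((m : ℂ) * (t : ℂ) ^ (m - 1)) t := by
      simpa using ((hasDerivAt_pow m (t : ℂ)).comp_ofReal)
    have := h3.mul h2
    rw [add_comm]
    exact this
  have hc : Continuous fun t : ℝ => (t : ℂ) ^ m * fderiv ℝ a.val (scale v t z)
      (proj s (Pi.single v (incl s z v))) + (m : ℂ) * (t : ℂ) ^ (m - 1) * a.val (scale v t z) := by
    have h1 := continuous_scale_integrand v m (dir (proj s (Pi.single v (incl s z v))) a) z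
    have h2 := (continuous_scale_integrand v (m - 1) a z).const_mul (m : ℂ)
    refine (h1.add h2).congr fun t => ?_
    simp [dir_apply, mul_assoc]
  rw [intervalIntegral.integral_eq_sub_of_hasDerivAt (fun t _ => hd t)
    (hc.intervalIntegrable _ _)]
  simp [scale_one]

theorem euler_avg_succ (v : Fin d) (m : ℕ) :
    mulOp (coord s v) * avg v (m + 1) * dzOp s v + mulOp (conjCoord s v) * avg v (m + 1) * dzbarOp s v
      = 1 - ((m : ℂ) + 1) • avg v m := by
  refine LinearMap.ext fun a => ext fun z => ?_
  have h := euler_avg v (m + 1) a z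
  have i1 := (continuous_scale_integrand v (m + 1) (dzOp s v a) z).intervalIntegrable
    (μ := MeasureTheory.volume) 0 1
  have i2 := (continuous_scale_integrand v (m + 1) (dzbarOp s v a) z).intervalIntegrable
    (μ := MeasureTheory.volume) 0 1
  have i3 := (continuous_scale_integrand v m a z).intervalIntegrable
    (μ := MeasureTheory.volume) 0 1
  have e : ∀ t : ℝ, ((t : ℂ) ^ (m + 1) * fderiv ℝ a.val (scale v t z)
        (proj s (Pi.single v (incl s z v)))
          + ((m + 1 : ℕ) : ℂ) * (t : ℂ) ^ (m + 1 - 1) * a.val (scale v t z))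
      = incl s z v * ((t : ℂ) ^ (m + 1) * (dzOp s v a).val (scale v t z))
        + starRingEnd ℂ (incl s z v) * ((t : ℂ) ^ (m + 1) * (dzbarOp s v a).val (scale v t z))
        + ((m : ℂ) + 1) * ((t : ℂ) ^ m * a.val (scale v t z)) := by
    intro t
    rw [fderiv_single]
    push_cast
    ring
  simp only [e] at h
  rw [intervalIntegral.integral_add ((i1.const_mul _).add (i2.const_mul _)) (i3.const_mul _),
    intervalIntegral.integral_add (i1.const_mul _) (i2.const_mul _),
    intervalIntegral.integral_const_mul, intervalIntegral.integral_const_mul,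
    intervalIntegral.integral_const_mul] at h
  show incl s z v * (avg v (m + 1) (dzOp s v a)).val z
    + starRingEnd ℂ (incl s z v) * (avg v (m + 1) (dzbarOp s v a)).val z
      = a.val z - ((m : ℂ) + 1) * (avg v m a).val z
  simp only [avg_apply]
  simp only [zero_pow (Nat.succ_ne_zero m), zero_mul, sub_zero] at h
  rw [← h]; ring

theorem euler_avg_zero (v : Fin d) :
    mulOp (coord s v) * avg v 0 * dzOp s v + mulOp (conjCoord s v) * avg v 0 * dzbarOp s v
      = 1 - restr v := by
  refine LinearMap.ext fun a => ext fun z => ?_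
  have h := euler_avg v 0 a z
  have i1 := (continuous_scale_integrand v 0 (dzOp s v a) z).intervalIntegrable
    (μ := MeasureTheory.volume) 0 1
  have i2 := (continuous_scale_integrand v 0 (dzbarOp s v a) z).intervalIntegrable
    (μ := MeasureTheory.volume) 0 1
  have e : ∀ t : ℝ, ((t : ℂ) ^ 0 * fderiv ℝ a.val (scale v t z)
        (proj s (Pi.single v (incl s z v))) + ((0 : ℕ) : ℂ) * (t : ℂ) ^ (0 - 1) * a.val (scale v t z))
      = incl s z v * ((t : ℂ) ^ 0 * (dzOp s v a).val (scale v t z))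
        + starRingEnd ℂ (incl s z v) * ((t : ℂ) ^ 0 * (dzbarOp s v a).val (scale v t z)) := by
    intro t
    rw [fderiv_single]
    push_cast
    ring
  simp only [e] at h
  rw [intervalIntegral.integral_add (i1.const_mul _) (i2.const_mul _),
    intervalIntegral.integral_const_mul, intervalIntegral.integral_const_mul] at h
  show incl s z v * (avg v 0 (dzOp s v a)).val z
    + starRingEnd ℂ (incl s z v) * (avg v 0 (dzbarOp s v a)).val z = a.val z - a.val (scale v 0 z)
  simp only [avg_apply]
  rw [h]; simp

end Sm

/-! ### The homotopy in one variable -/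

section OneVariable

variable {C A : Type} [Ring C] [Ring A]

/-- Two pairs of creation and annihilation operators. -/
structure FermionPair (e i t δ : A) : Prop where
  ee : e * e = 0
  ii : i * i = 0
  tt : t * t = 0
  dd : δ * δ = 0
  ie : i * e = 1 - e * i
  dt : δ * t = 1 - t * δ
  te : t * e = -(e * t)
  ti : t * i = -(i * t)
  de : δ * e = -(e * δ)
  di : δ * i = -(i * δ)

namespace FermionPair

variable {e i t δ : A}

theorem rules (h : FermionPair e i t δ) (w : A) : e * (e * w) = 0 ∧ i * (i * w) = 0 ∧ t * (t * w) = 0 ∧ δ * (δ * w) = 0 ∧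
    i * (e * w) = w - e * (i * w) ∧ δ * (t * w) = w - t * (δ * w) ∧ t * (e * w) = -(e * (t * w)) ∧
    t * (i * w) = -(i * (t * w)) ∧ δ * (e * w) = -(e * (δ * w)) ∧ δ * (i * w) = -(i * (δ * w)) := by
  simp only [← mul_assoc, h.ee, h.ii, h.tt, h.dd, h.ie, h.dt, h.te, h.ti, h.de, h.di, zero_mul,
    neg_mul, sub_mul, one_mul, and_self]

theorem e_word (h : FermionPair e i t δ) : e * (t * (1 - e * i)) = e * t ∧ e * (t * (e * i)) = 0 ∧
    (i * (1 - t * δ)) * e = (1 - e * i) * (1 - t * δ) ∧ (i * (t * δ)) * e = (1 - e * i) * (t * δ) ∧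
    (t * (1 - e * i)) * e = 0 ∧ (t * (e * i)) * e = -(e * t) := by
  refine ⟨?_, ?_, ?_, ?_, ?_, ?_⟩ <;>
  · simp only [mul_sub, sub_mul, mul_assoc, h.ee, h.ii, h.tt, h.dd, h.ie, h.dt, h.te, h.ti, h.de,
      h.di, h.rules, mul_zero, zero_mul, mul_one, one_mul, mul_neg, neg_neg, neg_zero, sub_zero,
      sub_self, sub_neg_eq_add]
    try abel

theorem d_word (h : FermionPair e i t δ) : δ * (i * (1 - t * δ)) = 0 ∧ δ * (i * (t * δ)) = -(i * δ) ∧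
    δ * (t * (1 - e * i)) = (1 - e * i) * (1 - t * δ) ∧ δ * (t * (e * i)) = e * i * (1 - t * δ) ∧
    (i * (1 - t * δ)) * δ = i * δ ∧ (i * (t * δ)) * δ = 0 ∧
    (t * (1 - e * i)) * δ = (1 - e * i) * (t * δ) ∧ (t * (e * i)) * δ = e * i * (t * δ) := by
  refine ⟨?_, ?_, ?_, ?_, ?_, ?_, ?_, ?_⟩ <;>
  · simp only [mul_sub, sub_mul, mul_assoc, h.ee, h.ii, h.tt, h.dd, h.ie, h.dt, h.te, h.ti, h.de,
      h.di, h.rules, mul_zero, zero_mul, mul_one, one_mul, mul_neg, neg_neg, neg_zero, sub_zero,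
      sub_self, sub_neg_eq_add]
    try abel

theorem p_word (h : FermionPair e i t δ) : (1 - e * i) * (t * (1 - e * i)) = t * (1 - e * i) ∧
    (1 - e * i) * (t * (e * i)) = 0 ∧ (1 - e * i) * e = 0 ∧
    (1 - e * i) * (1 - e * i) = 1 - e * i ∧ δ * (1 - t * δ) = 0 ∧ i * (1 - e * i) = 0 ∧
    i * ((1 - e * i) * (1 - t * δ)) = 0 ∧ δ * ((1 - e * i) * (1 - t * δ)) = 0 ∧
    (1 - t * δ) * (1 - e * i) = (1 - e * i) * (1 - t * δ) := by
  refine ⟨?_, ?_, ?_, ?_, ?_, ?_, ?_, ?_, ?_⟩ <;>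
  · simp only [mul_sub, sub_mul, mul_assoc, h.ee, h.ii, h.tt, h.dd, h.ie, h.dt, h.te, h.ti, h.de,
      h.di, h.rules, mul_zero, zero_mul, mul_one, one_mul, mul_neg, neg_neg, neg_zero, sub_zero,
      sub_self, sub_neg_eq_add]
    try abel

end FermionPair

theorem mul_mul_mul_of_commute {x y x' y' : A} (h : Commute y x') :
    (x * y) * (x' * y') = (x * x') * (y * y') := by
  rw [mul_assoc, ← mul_assoc y, h.eq, mul_assoc, mul_assoc]

/-- The calculus of one complex variable: multiplication by `z` and `\bar z`, the derivatives
`∂` and `\bar∂`, the weighted averages along rays through the origin and the restriction to it. -/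
structure RadialCalculus (z zb D Db J₀ J₁ J₂ ev : C) : Prop where
  D_z : D * z = z * D + 1
  Db_zb : Db * zb = zb * Db + 1
  D_Db : D * Db = Db * D
  Db_J₀ : Db * J₀ = J₁ * Db
  Db_J₁ : Db * J₁ = J₂ * Db
  J₀_z : J₀ * z = z * J₁
  J₁_z : J₁ * z = z * J₂
  z_zb : z * zb = zb * z
  euler₀ : z * J₀ * D + zb * J₀ * Db = 1 - ev
  euler₁ : z * J₁ * D + zb * J₁ * Db = 1 - J₀
  euler₂ : z * J₂ * D + zb * J₂ * Db = 1 - (J₁ + J₁)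
  ev_zb : ev * zb = 0
  ev_z : ev * z = 0
  ev_J₀ : ev * J₀ = ev
  Db_ev : Db * ev = 0

variable (cw : C →+* A)

/-- The part of the differential which belongs to one variable. -/
def oneVarDiff (z Db : C) (e δ : A) : A := cw Db * e + cw z * δ

/-- The homotopy operator in one variable. -/
def oneVarHomotopy (zb D J₀ J₁ : C) (e i t δ : A) : A :=
  cw (zb * J₀) * (i * (1 - t * δ)) + cw (zb * J₁) * (i * (t * δ))
    + cw (J₀ * D) * (t * (1 - e * i)) + cw (J₁ * D) * (t * (e * i))

variable {cw} {z zb D Db J₀ J₁ J₂ ev : C} {e i t δ : A}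

theorem oneVarHomotopy_anticomm (hF : FermionPair e i t δ)
    (hR : RadialCalculus z zb D Db J₀ J₁ J₂ ev)
    (hc : ∀ c, Commute (cw c) e ∧ Commute (cw c) i ∧ Commute (cw c) t ∧ Commute (cw c) δ) :
    oneVarDiff cw z Db e δ * oneVarHomotopy cw zb D J₀ J₁ e i t δ
      + oneVarHomotopy cw zb D J₀ J₁ e i t δ * oneVarDiff cw z Db e δ
      = 1 - cw ev * ((1 - e * i) * (1 - t * δ)) := by
  have ce : ∀ c, Commute (cw c) e := fun c => (hc c).1
  have ci : ∀ c, Commute (cw c) i := fun c => (hc c).2.1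
  have ct : ∀ c, Commute (cw c) t := fun c => (hc c).2.2.1
  have cd : ∀ c, Commute (cw c) δ := fun c => (hc c).2.2.2
  have cP : ∀ c, Commute (cw c) (1 - e * i) := fun c =>
    (Commute.one_right _).sub_right ((ce c).mul_right (ci c))
  have cP' : ∀ c, Commute (cw c) (1 - t * δ) := fun c =>
    (Commute.one_right _).sub_right ((ct c).mul_right (cd c))
  have l1 : ∀ c c' w, (cw c * e) * (cw c' * w) = cw (c * c') * (e * w) := fun c c' w => by
    rw [mul_mul_mul_of_commute (ce c').symm, map_mul]
  have l2 : ∀ c c' w, (cw c * δ) * (cw c' * w) = cw (c * c') * (δ * w) := fun c c' w => by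
    rw [mul_mul_mul_of_commute (cd c').symm, map_mul]
  have l3 : ∀ c c' w, (cw c * (i * (1 - t * δ))) * (cw c' * w)
      = cw (c * c') * (i * (1 - t * δ) * w) := fun c c' w => by
    rw [mul_mul_mul_of_commute ((ci c').mul_right (cP' c')).symm, map_mul]
  have l4 : ∀ c c' w, (cw c * (i * (t * δ))) * (cw c' * w)
      = cw (c * c') * (i * (t * δ) * w) := fun c c' w => by
    rw [mul_mul_mul_of_commute ((ci c').mul_right ((ct c').mul_right (cd c'))).symm, map_mul]
  have l5 : ∀ c c' w, (cw c * (t * (1 - e * i))) * (cw c' * w)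
      = cw (c * c') * (t * (1 - e * i) * w) := fun c c' w => by
    rw [mul_mul_mul_of_commute ((ct c').mul_right (cP c')).symm, map_mul]
  have l6 : ∀ c c' w, (cw c * (t * (e * i))) * (cw c' * w)
      = cw (c * c') * (t * (e * i) * w) := fun c c' w => by
    rw [mul_mul_mul_of_commute ((ct c').mul_right ((ce c').mul_right (ci c'))).symm, map_mul]
  obtain ⟨w1, w2, w3, w4, w5, w6⟩ := hF.e_word
  obtain ⟨x1, x2, x3, x4, x5, x6, x7, x8⟩ := hF.d_word
  have r1 : Db * (zb * J₀) = J₀ + zb * J₁ * Db := by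
    rw [← mul_assoc, hR.Db_zb, add_mul, one_mul, mul_assoc, hR.Db_J₀, mul_assoc]; abel
  have r2 : Db * (zb * J₁) = J₁ + zb * J₂ * Db := by
    rw [← mul_assoc, hR.Db_zb, add_mul, one_mul, mul_assoc, hR.Db_J₁, mul_assoc]; abel
  have r3 : J₀ * D * z = J₀ + z * J₁ * D := by
    rw [mul_assoc, hR.D_z, mul_add, mul_one, ← mul_assoc, hR.J₀_z]; abel
  have r4 : J₁ * D * z = J₁ + z * J₂ * D := by
    rw [mul_assoc, hR.D_z, mul_add, mul_one, ← mul_assoc, hR.J₁_z]; abel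
  have r5 : Db * (J₀ * D) = J₁ * D * Db := by
    rw [← mul_assoc, hR.Db_J₀, mul_assoc, mul_assoc, hR.D_Db]
  have r6 : zb * J₀ * z = z * (zb * J₁) := by
    rw [mul_assoc, hR.J₀_z, ← mul_assoc, ← mul_assoc, hR.z_zb]
  have s00 : cw (z * (J₀ * D)) + cw (zb * J₀ * Db) = 1 - cw ev := by
    rw [← map_add, ← mul_assoc, hR.euler₀]; simp
  have s10 : cw (J₀ + zb * J₁ * Db) + cw (z * (J₁ * D)) = 1 := by
    rw [← map_add, ← mul_assoc, add_assoc, add_comm (zb * J₁ * Db), hR.euler₁]; simp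
  have s01 : cw (zb * J₁ * Db) + cw (J₀ + z * J₁ * D) = 1 := by
    rw [← map_add, add_left_comm, add_comm (zb * J₁ * Db), hR.euler₁]; simp
  have s11 : cw (J₁ + zb * J₂ * Db) + cw (J₁ + z * J₂ * D) = 1 := by
    rw [← map_add, add_add_add_comm, add_comm (zb * J₂ * Db), hR.euler₂]; simp
  unfold oneVarDiff oneVarHomotopy
  simp only [mul_add, add_mul, l1, l2, l3, l4, l5, l6, w1, w2, w3, w4, w5, w6, x1, x2, x3, x4, x5,
    x6, x7, x8, r1, r2, r3, r4, r5, r6, mul_zero, add_zero, zero_add, mul_neg]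
  have key : ∀ P P' : A, P * P' + (P * (1 - P')) + ((1 - P) * (1 - P')) + (1 - P) * P' = 1 := by
    intro P P'; noncomm_ring
  have y1 : e * (i * (1 - t * δ)) = e * i * (1 - t * δ) := by rw [mul_assoc]
  have y2 : e * (i * (t * δ)) = e * i * (t * δ) := by rw [mul_assoc]
  rw [y1, y2]
  have k := key (e * i) (t * δ)
  generalize e * i * (t * δ) = p11 at *
  generalize e * i * (1 - t * δ) = p10 at *
  generalize (1 - e * i) * (1 - t * δ) = p00 at *
  generalize (1 - e * i) * (t * δ) = p01 at *
  have f00 := congrArg (· * p00) s00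
  have f10 := congrArg (· * p10) s10
  have f01 := congrArg (· * p01) s01
  have f11 := congrArg (· * p11) s11
  simp only [add_mul, sub_mul, one_mul] at f00 f10 f01 f11
  have total := congrArg₂ (· + ·) (congrArg₂ (· + ·) f11 f10) (congrArg₂ (· + ·) f00 f01)
  rw [← k]
  refine Eq.trans ?_ (total.trans ?_) <;> abel

/-- An operator which does not involve the variable anticommutes with the homotopy. -/
theorem anticomm_oneVarHomotopy {c : C} {y : A}
    (hc : ∀ c, Commute (cw c) e ∧ Commute (cw c) i ∧ Commute (cw c) t ∧ Commute (cw c) δ)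
    (hy : ∀ c, Commute (cw c) y)
    (h1 : Commute c zb) (h2 : Commute c D) (h3 : Commute c J₀) (h4 : Commute c J₁)
    (k1 : y * e = -(e * y)) (k2 : y * i = -(i * y)) (k3 : y * t = -(t * y))
    (k4 : y * δ = -(δ * y)) :
    (cw c * y) * oneVarHomotopy cw zb D J₀ J₁ e i t δ
      = -(oneVarHomotopy cw zb D J₀ J₁ e i t δ * (cw c * y)) := by
  have q1 : Commute y (e * i) := by
    show y * (e * i) = e * i * y
    rw [← mul_assoc, k1, neg_mul, mul_assoc, k2, mul_neg, neg_neg, mul_assoc]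
  have q2 : Commute y (t * δ) := by
    show y * (t * δ) = t * δ * y
    rw [← mul_assoc, k3, neg_mul, mul_assoc, k4, mul_neg, neg_neg, mul_assoc]
  have q3 : Commute y (1 - e * i) := (Commute.one_right _).sub_right q1
  have q4 : Commute y (1 - t * δ) := (Commute.one_right _).sub_right q2
  have cp1 : ∀ c, Commute (cw c) (e * i) := fun c => (hc c).1.mul_right (hc c).2.1
  have cp2 : ∀ c, Commute (cw c) (t * δ) := fun c => (hc c).2.2.1.mul_right (hc c).2.2.2
  have key : ∀ (x : C) (o p : A), Commute c x → (y * o = -(o * y)) → Commute y p →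
      (∀ c, Commute (cw c) o) → (∀ c, Commute (cw c) p) →
      (cw c * y) * (cw x * (o * p)) = -((cw x * (o * p)) * (cw c * y)) := by
    intro x o p hx ho hp co cp
    rw [mul_mul_mul_of_commute (hy x).symm,
      mul_mul_mul_of_commute ((co c).mul_right (cp c)).symm, ← map_mul, ← map_mul, hx.eq,
      ← mul_neg]
    congr 1
    rw [← mul_assoc, ho, neg_mul, mul_assoc, hp.eq, mul_assoc]
  unfold oneVarHomotopy
  have c1 : ∀ {p}, (∀ c, Commute (cw c) p) → ∀ c, Commute (cw c) (1 - p) := fun h c =>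
    (Commute.one_right _).sub_right (h c)
  rw [mul_add, mul_add, mul_add, add_mul, add_mul, add_mul,
    key _ _ _ (h1.mul_right h3) k2 q4 (fun c => (hc c).2.1) (c1 cp2),
    key _ _ _ (h1.mul_right h4) k2 q2 (fun c => (hc c).2.1) cp2,
    key _ _ _ (h3.mul_right h2) k3 q3 (fun c => (hc c).2.2.1) (c1 cp1),
    key _ _ _ (h4.mul_right h2) k3 q1 (fun c => (hc c).2.2.1) cp1]
  abel

theorem oneVarDiff_restr_homotopy (hF : FermionPair e i t δ)
    (hR : RadialCalculus z zb D Db J₀ J₁ J₂ ev) (hJ : Commute ev J₁)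
    (hc : ∀ c, Commute (cw c) e ∧ Commute (cw c) i ∧ Commute (cw c) t ∧ Commute (cw c) δ) :
    oneVarDiff cw z Db e δ * (cw ev * (1 - e * i) * oneVarHomotopy cw zb D J₀ J₁ e i t δ)
      = cw (z * ev * D) * ((1 - e * i) * (1 - t * δ)) := by
  have cP : ∀ c, Commute (cw c) (1 - e * i) := fun c =>
    (Commute.one_right _).sub_right ((hc c).1.mul_right (hc c).2.1)
  obtain ⟨p1, p2, -⟩ := hF.p_word
  obtain ⟨-, -, x3, -⟩ := hF.d_word
  have l : ∀ c' w, (cw ev * (1 - e * i)) * (cw c' * w) = cw (ev * c') * ((1 - e * i) * w) :=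
    fun c' w => by rw [mul_mul_mul_of_commute (cP c').symm, map_mul]
  have h1 : cw ev * (1 - e * i) * oneVarHomotopy cw zb D J₀ J₁ e i t δ
      = cw (ev * D) * (t * (1 - e * i)) := by
    unfold oneVarHomotopy
    simp only [mul_add, l, p1, p2, mul_zero, add_zero]
    rw [← mul_assoc ev zb, ← mul_assoc ev zb, hR.ev_zb, ← mul_assoc ev J₀, hR.ev_J₀]
    simp
  rw [h1]
  unfold oneVarDiff
  rw [add_mul, mul_mul_mul_of_commute (hc _).1.symm, mul_mul_mul_of_commute (hc _).2.2.2.symm,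
    ← map_mul, ← map_mul, ← mul_assoc Db, hR.Db_ev, zero_mul, map_zero, zero_mul, zero_add, x3,
    mul_assoc]

theorem restr_mul_oneVarDiff (hF : FermionPair e i t δ)
    (hR : RadialCalculus z zb D Db J₀ J₁ J₂ ev)
    (hc : ∀ c, Commute (cw c) e ∧ Commute (cw c) i ∧ Commute (cw c) t ∧ Commute (cw c) δ) :
    cw ev * (1 - e * i) * oneVarDiff cw z Db e δ = 0 := by
  have cP : ∀ c, Commute (cw c) (1 - e * i) := fun c =>
    (Commute.one_right _).sub_right ((hc c).1.mul_right (hc c).2.1)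
  unfold oneVarDiff
  rw [mul_add, mul_mul_mul_of_commute (cP _).symm, mul_mul_mul_of_commute (cP _).symm,
    hF.p_word.2.2.1, ← map_mul, ← map_mul, hR.ev_z]
  simp

end OneVariable

/-! ### The complex of a component -/

/-- Fields on `X_s` with smooth coefficients. -/
abbrev SFld (n : ℕ) {d : ℕ} (s : Finset (Fin d)) : Type := Finset (Gen n d) → Sm s

instance (s : Finset (Fin d)) : Ring (Module.End ℂ (SFld n s)) := Module.End.instRing

/-- Vectors `m v` which are dual to the rays `ray v`, `v ∈ s`. -/
structure IsDualFrame (ray m : Fin d → Fin n → ℤ) (s : Finset (Fin d)) : Prop where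
  pair : ∀ v ∈ s, ∀ i ∈ s, ∑ k, ray i k * m v k = if i = v then 1 else 0
  complete : ∀ k l, ∑ v ∈ s, m v k * ray v l = if k = l then 1 else 0

namespace Component

variable (ray m : Fin d → Fin n → ℤ) (s : Finset (Fin d))

/-- `d\bar z_i ∧`. -/
abbrev eOp (n : ℕ) {d : ℕ} (s : Finset (Fin d)) (i : Fin d) : Module.End ℂ (SFld n s) :=
  creation (Sm s) (Sum.inlₗ i : Gen n d)

/-- Contraction with `∂/∂\bar z_i`. -/
abbrev iOp (n : ℕ) {d : ℕ} (s : Finset (Fin d)) (i : Fin d) : Module.End ℂ (SFld n s) :=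
  annihilation (Sm s) (Sum.inlₗ i : Gen n d)

/-- The coefficientwise action of operators on functions. -/
abbrev cw (n : ℕ) {d : ℕ} (s : Finset (Fin d)) : Module.End ℂ (Sm s) →+* Module.End ℂ (SFld n s) :=
  coeffwise (Gen n d)

/-- The odd derivative along `z_v ∂/∂z_v`. -/
def deltaOp (v : Fin d) : Module.End ℂ (SFld n s) :=
  ∑ k, (ray v k : ℂ) • annihilation (Sm s) (Sum.inrₗ k : Gen n d)

/-- Multiplication by `z_v ∂/∂z_v`. -/
def thetaOp (v : Fin d) : Module.End ℂ (SFld n s) :=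
  ∑ k, (m v k : ℂ) • creation (Sm s) (Sum.inrₗ k : Gen n d)

/-- The summand of the differential which belongs to `z_v`. -/
def diffAt (v : Fin d) : Module.End ℂ (SFld n s) :=
  oneVarDiff (cw n s) (Sm.mulOp (Sm.coord s v)) (Sm.dzbarOp s v) (eOp n s v) (deltaOp ray s v)

/-- The differential `\bar∂ + {f, -}`. -/
def diff : Module.End ℂ (SFld n s) := ∑ v ∈ s, diffAt ray s v

/-- The homotopy in the variable `z_v`. -/
def homotopyAt (v : Fin d) : Module.End ℂ (SFld n s) :=
  oneVarHomotopy (cw n s) (Sm.mulOp (Sm.conjCoord s v)) (Sm.dzOp s v) (Sm.avg v 0) (Sm.avg v 1)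
    (eOp n s v) (iOp n s v) (thetaOp m s v) (deltaOp ray s v)

/-- Pullback to `z_v = 0`. -/
def pullbackAt (n : ℕ) {d : ℕ} (s : Finset (Fin d)) (v : Fin d) : Module.End ℂ (SFld n s) :=
  cw n s (Sm.restr v) * (1 - eOp n s v * iOp n s v)

/-- The fields on `X_s` whose pullbacks to the hyperplanes `z_k = 0`, `k ∈ τ`, vanish. -/
def relative (n : ℕ) {d : ℕ} (s τ : Finset (Fin d)) : Submodule ℂ (SFld n s) where
  carrier := {α | (∀ i ∉ s, iOp n s i α = 0) ∧ ∀ k ∈ τ, pullbackAt n s k α = 0}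
  zero_mem' := ⟨fun _ _ => map_zero _, fun _ _ => map_zero _⟩
  add_mem' ha hb := ⟨fun i hi => by rw [map_add, ha.1 i hi, hb.1 i hi, add_zero],
    fun i hi => by rw [map_add, ha.2 i hi, hb.2 i hi, add_zero]⟩
  smul_mem' c _ ha := ⟨fun i hi => by rw [map_smul, ha.1 i hi, smul_zero],
    fun i hi => by rw [map_smul, ha.2 i hi, smul_zero]⟩

variable {ray m s}

theorem inl_ne_inl {i j : Fin d} (h : i ≠ j) : (Sum.inlₗ i : Gen n d) ≠ Sum.inlₗ j :=
  fun h' => h (Sum.inl_injective (toLex.injective h'))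

theorem inr_ne_inl {i : Fin d} {k : Fin n} : (Sum.inrₗ k : Gen n d) ≠ Sum.inlₗ i :=
  fun h' => Sum.inr_ne_inl (toLex.injective h')

theorem inl_ne_inr {i : Fin d} {k : Fin n} : (Sum.inlₗ i : Gen n d) ≠ Sum.inrₗ k :=
  fun h' => Sum.inl_ne_inr (toLex.injective h')

theorem sum_smul_anticomm {A : Type} [Ring A] [Algebra ℂ A] {ι : Type} (S : Finset ι) (c : ι → ℂ)
    {x : ι → A} {y : A} (h : ∀ i ∈ S, x i * y = -(y * x i)) :
    (∑ i ∈ S, c i • x i) * y = -(y * ∑ i ∈ S, c i • x i) := by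
  rw [Finset.sum_mul, Finset.mul_sum, ← Finset.sum_neg_distrib]
  refine Finset.sum_congr rfl fun i hi => ?_
  rw [smul_mul_assoc, h i hi, mul_smul_comm, smul_neg]

theorem anticomm_symm {A : Type} [Ring A] {x y : A} (h : x * y = -(y * x)) : y * x = -(x * y) := by
  rw [h, neg_neg]

theorem eq_zero_of_eq_neg {A : Type} [AddCommGroup A] [Module ℂ A] {x : A} (h : x = -x) : x = 0 := by
  have h2 : (2 : ℂ) • x = 0 := by
    rw [two_smul]
    nth_rewrite 2 [h]
    exact add_neg_cancel x
  exact (smul_eq_zero_iff_right two_ne_zero).mp h2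

theorem delta_anticomm_delta (v w : Fin d) :
    deltaOp ray s v * deltaOp ray s w = -(deltaOp ray s w * deltaOp ray s v) :=
  sum_smul_anticomm _ _ fun _ _ => anticomm_symm <| sum_smul_anticomm _ _ fun _ _ =>
    annihilation_anticomm _ _

theorem theta_anticomm_theta (v w : Fin d) :
    thetaOp m s v * thetaOp m s w = -(thetaOp m s w * thetaOp m s v) :=
  sum_smul_anticomm _ _ fun _ _ => anticomm_symm <| sum_smul_anticomm _ _ fun _ _ =>
    creation_anticomm _ _

theorem delta_anticomm_e (v w : Fin d) :
    deltaOp ray s v * eOp n s w = -(eOp n s w * deltaOp ray s v) :=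
  sum_smul_anticomm _ _ fun _ _ => annihilation_mul_creation_of_ne inr_ne_inl

theorem delta_anticomm_i (v w : Fin d) :
    deltaOp ray s v * iOp n s w = -(iOp n s w * deltaOp ray s v) :=
  sum_smul_anticomm _ _ fun _ _ => annihilation_anticomm _ _

theorem theta_anticomm_e (v w : Fin d) :
    thetaOp m s v * eOp n s w = -(eOp n s w * thetaOp m s v) :=
  sum_smul_anticomm _ _ fun _ _ => creation_anticomm _ _

theorem theta_anticomm_i (v w : Fin d) :
    thetaOp m s v * iOp n s w = -(iOp n s w * thetaOp m s v) :=
  sum_smul_anticomm _ _ fun _ _ => anticomm_symm <|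
    annihilation_mul_creation_of_ne inl_ne_inr

theorem delta_mul_theta (v w : Fin d) :
    deltaOp ray s v * thetaOp m s w
      = ((∑ k, ray v k * m w k : ℤ) : ℂ) • 1 - thetaOp m s w * deltaOp ray s v := by
  have h : ∀ k l : Fin n, annihilation (Sm s) (Sum.inrₗ k : Gen n d) * creation (Sm s) (Sum.inrₗ l)
      = (if k = l then 1 else 0) - creation (Sm s) (Sum.inrₗ l) * annihilation (Sm s) (Sum.inrₗ k) := by
    intro k l
    by_cases hkl : k = l
    · subst hkl; simp [annihilation_mul_creation]
    · rw [annihilation_mul_creation_of_ne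
        (fun h' => hkl (Sum.inr_injective (toLex.injective h')))]
      simp [hkl]
  simp only [deltaOp, thetaOp, Finset.sum_mul, Finset.mul_sum, smul_mul_assoc, mul_smul_comm, h,
    smul_sub, Finset.sum_sub_distrib]
  congr 1
  · simp only [smul_ite, smul_zero, Finset.sum_ite_eq', Finset.mem_univ, if_true, smul_smul]
    rw [← Finset.sum_smul]
    congr 1
    push_cast
    exact Finset.sum_congr rfl fun k _ => mul_comm _ _
  · simp only [Finset.smul_sum]
    rw [Finset.sum_comm]
    exact Finset.sum_congr rfl fun k _ => Finset.sum_congr rfl fun l _ => smul_comm _ _ _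

theorem cw_commute (c : Module.End ℂ (Sm s)) (v : Fin d) :
    Commute (cw n s c) (eOp n s v) ∧ Commute (cw n s c) (iOp n s v) ∧
      Commute (cw n s c) (thetaOp m s v) ∧ Commute (cw n s c) (deltaOp ray s v) :=
  ⟨coeffwise_creation c _, coeffwise_annihilation c _,
    Commute.sum_right _ _ _ fun k _ => (coeffwise_creation c _).smul_right _,
    Commute.sum_right _ _ _ fun k _ => (coeffwise_annihilation c _).smul_right _⟩

variable (hm : IsDualFrame ray m s)

theorem fermionPair (hm : IsDualFrame ray m s) {v : Fin d} (hv : v ∈ s) :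
    FermionPair (eOp n s v) (iOp n s v) (thetaOp m s v) (deltaOp ray s v) where
  ee := creation_mul_self _
  ii := annihilation_mul_self _
  tt := eq_zero_of_eq_neg (theta_anticomm_theta v v)
  dd := eq_zero_of_eq_neg (delta_anticomm_delta v v)
  ie := annihilation_mul_creation _
  dt := by rw [delta_mul_theta, hm.pair v hv v hv]; simp
  te := theta_anticomm_e v v
  ti := theta_anticomm_i v v
  de := delta_anticomm_e v v
  di := delta_anticomm_i v v

theorem radialCalculus {v : Fin d} (hv : v ∈ s) :
    RadialCalculus (Sm.mulOp (Sm.coord s v)) (Sm.mulOp (Sm.conjCoord s v)) (Sm.dzOp s v)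
      (Sm.dzbarOp s v) (Sm.avg v 0) (Sm.avg v 1) (Sm.avg v 2) (Sm.restr v) where
  D_z := by rw [Sm.dzOp_mul_mulOp, Sm.dzOp_coord, if_pos ⟨hv, rfl⟩, Sm.mulOp_one]
  Db_zb := by rw [Sm.dzbarOp_mul_mulOp, Sm.dzbarOp_conjCoord, if_pos ⟨hv, rfl⟩, Sm.mulOp_one]
  D_Db := (Sm.dzbarOp_dzOp_comm v v).symm
  Db_J₀ := Sm.dzbarOp_avg v 0
  Db_J₁ := Sm.dzbarOp_avg v 1
  J₀_z := Sm.avg_coord v 0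
  J₁_z := Sm.avg_coord v 1
  z_zb := Sm.mulOp_comm _ _
  euler₀ := Sm.euler_avg_zero v
  euler₁ := by rw [Sm.euler_avg_succ v 0]; simp
  euler₂ := by
    rw [Sm.euler_avg_succ v 1, ← two_smul ℂ (Sm.avg (s := s) v 1)]
    congr 2; norm_num
  ev_zb := Sm.restr_conjCoord v
  ev_z := Sm.restr_coord v
  ev_J₀ := Sm.restr_avg v
  Db_ev := Sm.dzbarOp_restr v

theorem homotopyAt_diffAt (hm : IsDualFrame ray m s) {v : Fin d} (hv : v ∈ s) :
    diffAt ray s v * homotopyAt ray m s v + homotopyAt ray m s v * diffAt ray s v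
      = 1 - cw n s (Sm.restr v) * ((1 - eOp n s v * iOp n s v)
        * (1 - thetaOp m s v * deltaOp ray s v)) :=
  oneVarHomotopy_anticomm (fermionPair hm hv) (radialCalculus hv) fun c => cw_commute c v

theorem mulOp_commute_of_dz {a b : Sm s} {i : Fin d} (h : Sm.dzbarOp s i a = b) (hb : b = 0) :
    Commute (Sm.dzbarOp s i) (Sm.mulOp a) := by
  show _ * _ = _ * _
  rw [Sm.dzbarOp_mul_mulOp, h, hb, Sm.mulOp_zero, add_zero]

theorem diffAt_anticomm_homotopyAt (hm : IsDualFrame ray m s) {v w : Fin d} (hv : v ∈ s)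
    (hw : w ∈ s) (hvw : w ≠ v) :
    diffAt ray s w * homotopyAt ray m s v = -(homotopyAt ray m s v * diffAt ray s w) := by
  have h0 : ∑ k, ray w k * m v k = 0 := by rw [hm.pair v hv w hw, if_neg hvw]
  have hdt : deltaOp ray s w * thetaOp m s v = -(thetaOp m s v * deltaOp ray s w) := by
    rw [delta_mul_theta, h0]; simp
  have h1 := anticomm_oneVarHomotopy (cw := cw n s) (c := Sm.dzbarOp s w) (y := eOp n s w)
    (zb := Sm.mulOp (Sm.conjCoord s v)) (D := Sm.dzOp s v) (J₀ := Sm.avg v 0) (J₁ := Sm.avg v 1)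
    (e := eOp n s v) (i := iOp n s v) (t := thetaOp m s v) (δ := deltaOp ray s v)
    (fun c => cw_commute c v) (fun c => coeffwise_creation c _)
    (mulOp_commute_of_dz (Sm.dzbarOp_conjCoord w v) (by simp [hvw.symm]))
    (Sm.dzbarOp_dzOp_comm w v) (Sm.dzbarOp_avg_of_ne hvw 0) (Sm.dzbarOp_avg_of_ne hvw 1)
    (creation_anticomm _ _)
    (anticomm_symm (annihilation_mul_creation_of_ne (inl_ne_inl hvw.symm)))
    (anticomm_symm (theta_anticomm_e v w)) (anticomm_symm (delta_anticomm_e v w))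
  have hz : Commute (Sm.mulOp (Sm.coord s w)) (Sm.dzOp s v) := by
    symm
    show _ * _ = _ * _
    rw [Sm.dzOp_mul_mulOp, Sm.dzOp_coord, if_neg (fun h => hvw h.2), Sm.mulOp_zero, add_zero]
  have h2 := anticomm_oneVarHomotopy (cw := cw n s) (c := Sm.mulOp (Sm.coord s w))
    (y := deltaOp ray s w)
    (zb := Sm.mulOp (Sm.conjCoord s v)) (D := Sm.dzOp s v) (J₀ := Sm.avg v 0) (J₁ := Sm.avg v 1)
    (e := eOp n s v) (i := iOp n s v) (t := thetaOp m s v) (δ := deltaOp ray s v)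
    (fun c => cw_commute c v) (fun c => (cw_commute (m := m) c w).2.2.2)
    (Sm.mulOp_comm _ _) hz (Sm.avg_coord_of_ne hvw 0).symm (Sm.avg_coord_of_ne hvw 1).symm
    (delta_anticomm_e w v) (delta_anticomm_i w v) hdt (delta_anticomm_delta w v)
  unfold diffAt oneVarDiff homotopyAt
  rw [add_mul, h1, h2, mul_add, neg_add]

theorem diff_homotopyAt (hm : IsDualFrame ray m s) {v : Fin d} (hv : v ∈ s) :
    diff ray s * homotopyAt ray m s v + homotopyAt ray m s v * diff ray s
      = 1 - cw n s (Sm.restr v) * ((1 - eOp n s v * iOp n s v)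
        * (1 - thetaOp m s v * deltaOp ray s v)) := by
  unfold diff
  rw [← homotopyAt_diffAt hm hv, ← Finset.add_sum_erase s _ hv, add_mul, mul_add]
  have : (∑ w ∈ s.erase v, diffAt ray s w) * homotopyAt ray m s v
      = -(homotopyAt ray m s v * ∑ w ∈ s.erase v, diffAt ray s w) := by
    rw [Finset.sum_mul, Finset.mul_sum, ← Finset.sum_neg_distrib]
    exact Finset.sum_congr rfl fun w hw => diffAt_anticomm_homotopyAt hm hv
      (Finset.mem_of_mem_erase hw) (Finset.ne_of_mem_erase hw)
  rw [this]
  abel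

theorem pullbackAt_comm_diffAt (m : Fin d → Fin n → ℤ) {v w : Fin d} (hvw : w ≠ v) :
    Commute (pullbackAt n s v) (diffAt ray s w) := by
  have q1 : Commute (1 - eOp n s v * iOp n s v) (eOp n s w) := by
    refine (Commute.one_left _).sub_left ?_
    show _ * _ = _ * _
    rw [mul_assoc, annihilation_mul_creation_of_ne (inl_ne_inl hvw.symm), mul_neg, ← mul_assoc,
      creation_anticomm, neg_mul, neg_neg, mul_assoc]
  have q2 : Commute (1 - eOp n s v * iOp n s v) (deltaOp ray s w) := by
    refine (Commute.one_left _).sub_left ?_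
    show _ * _ = _ * _
    rw [mul_assoc, anticomm_symm (delta_anticomm_i w v), mul_neg, ← mul_assoc,
      anticomm_symm (delta_anticomm_e w v), neg_mul, neg_neg, mul_assoc]
  have hc : ∀ c : Module.End ℂ (Sm s), Commute (cw n s c) (1 - eOp n s v * iOp n s v) := fun c =>
    (Commute.one_right _).sub_right
      ((coeffwise_creation c _).mul_right (coeffwise_annihilation c _))
  have k1 : Commute (cw n s (Sm.restr v)) (cw n s (Sm.dzbarOp s w)) :=
    ((Sm.dzbarOp_restr_of_ne hvw).symm).map (cw n s)
  have k2 : Commute (cw n s (Sm.restr v)) (cw n s (Sm.mulOp (Sm.coord s w))) :=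
    (Sm.restr_coord_of_ne hvw).map (cw n s)
  unfold pullbackAt diffAt oneVarDiff
  refine Commute.add_right (Commute.mul_left ?_ ?_) (Commute.mul_left ?_ ?_)
  · exact k1.mul_right (coeffwise_creation _ _)
  · exact (hc _).symm.mul_right q1
  · exact k2.mul_right (cw_commute (m := m) _ w).2.2.2
  · exact (hc _).symm.mul_right q2

theorem pullbackAt_diff (hm : IsDualFrame ray m s) {v : Fin d} (hv : v ∈ s) :
    pullbackAt n s v * diff ray s = (diff ray s - diffAt ray s v) * pullbackAt n s v := by
  have h0 : pullbackAt n s v * diffAt ray s v = 0 :=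
    restr_mul_oneVarDiff (fermionPair hm hv) (radialCalculus hv) fun c => cw_commute c v
  unfold diff
  rw [← Finset.add_sum_erase s _ hv, mul_add, h0, zero_add, add_sub_cancel_left,
    Finset.mul_sum, Finset.sum_mul]
  exact Finset.sum_congr rfl fun w hw => pullbackAt_comm_diffAt m (Finset.ne_of_mem_erase hw)

/-- The projector onto the cohomology in the variable `z_v`. -/
def projectorAt (ray m : Fin d → Fin n → ℤ) (s : Finset (Fin d)) (τ : Finset (Fin d)) (v : Fin d) :
    Module.End ℂ (SFld n s) :=
  cw n s (if v ∈ τ then Sm.mulOp (Sm.coord s v) * Sm.restr v * Sm.dzOp s v else Sm.restr v)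
    * ((1 - eOp n s v * iOp n s v) * (1 - thetaOp m s v * deltaOp ray s v))

theorem anticomm_of_commute {C A : Type} [Ring C] [Ring A] (cw : C →+* A) {c c' : C} {y y' : A}
    (hc : Commute c c') (hy : y * y' = -(y' * y)) (h1 : Commute (cw c') y)
    (h2 : Commute (cw c) y') : (cw c * y) * (cw c' * y') = -((cw c' * y') * (cw c * y)) := by
  rw [mul_mul_mul_of_commute h1.symm, mul_mul_mul_of_commute h2.symm, ← map_mul, ← map_mul, hc.eq,
    hy, mul_neg]

theorem diffAt_anticomm (m : Fin d → Fin n → ℤ) (v w : Fin d) :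
    diffAt ray s v * diffAt ray s w = -(diffAt ray s w * diffAt ray s v) := by
  have ce : ∀ (c : Module.End ℂ (Sm s)) (v : Fin d), Commute (cw n s c) (eOp n s v) :=
    fun c v => coeffwise_creation c _
  have cd : ∀ (c : Module.End ℂ (Sm s)) (v : Fin d), Commute (cw n s c) (deltaOp ray s v) :=
    fun c v => (cw_commute (m := m) c v).2.2.2
  have hz : ∀ v w : Fin d, Commute (Sm.dzbarOp s v) (Sm.mulOp (Sm.coord s w)) := fun v w =>
    mulOp_commute_of_dz (Sm.dzbarOp_coord v w) rfl
  unfold diffAt oneVarDiff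
  rw [add_mul, mul_add, mul_add, add_mul, mul_add, mul_add,
    anticomm_of_commute (cw n s) (Sm.dzbarOp_comm v w) (creation_anticomm _ _) (ce _ _) (ce _ _),
    anticomm_of_commute (cw n s) (hz v w) (anticomm_symm (delta_anticomm_e w v)) (ce _ _)
      (cd _ _),
    anticomm_of_commute (cw n s) (hz w v).symm (delta_anticomm_e v w) (cd _ _) (ce _ _),
    anticomm_of_commute (cw n s) (Sm.mulOp_comm _ _) (delta_anticomm_delta v w) (cd _ _) (cd _ _)]
  abel

theorem diff_mul_diff (m : Fin d → Fin n → ℤ) : diff ray s * diff ray s = 0 := by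
  refine eq_zero_of_eq_neg ?_
  unfold diff
  rw [Finset.sum_mul_sum]
  conv_rhs => rw [Finset.sum_comm]
  simp only [← Finset.sum_neg_distrib]
  exact Finset.sum_congr rfl fun v _ => Finset.sum_congr rfl fun w _ => diffAt_anticomm m v w

theorem i_anticomm_diffAt {v k : Fin d} (h : k ≠ v) :
    iOp n s k * diffAt ray s v = -(diffAt ray s v * iOp n s k) := by
  unfold diffAt oneVarDiff
  have h1 := anticomm_of_commute (cw n s) (c := 1) (c' := Sm.dzbarOp s v) (Commute.one_left _)
    (annihilation_mul_creation_of_ne (R := Sm s) (inl_ne_inl (n := n) h))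
    (coeffwise_annihilation _ _) (coeffwise_creation _ _)
  have h2 := anticomm_of_commute (cw n s) (c := 1) (c' := Sm.mulOp (Sm.coord s v))
    (Commute.one_left _) (anticomm_symm (delta_anticomm_i (ray := ray) (s := s) v k))
    (coeffwise_annihilation _ _) (cw_commute (m := ray) _ v).2.2.2
  rw [map_one, one_mul] at h1 h2
  rw [mul_add, h1, h2, add_mul, neg_add]

theorem i_anticomm_homotopyAt {v k : Fin d} (h : k ≠ v) :
    iOp n s k * homotopyAt ray m s v = -(homotopyAt ray m s v * iOp n s k) := by
  have h1 := anticomm_oneVarHomotopy (cw := cw n s) (c := 1) (y := iOp n s k)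
    (zb := Sm.mulOp (Sm.conjCoord s v)) (D := Sm.dzOp s v) (J₀ := Sm.avg v 0) (J₁ := Sm.avg v 1)
    (e := eOp n s v) (i := iOp n s v) (t := thetaOp m s v) (δ := deltaOp ray s v)
    (fun c => cw_commute c v) (fun c => coeffwise_annihilation c _)
    (Commute.one_left _) (Commute.one_left _) (Commute.one_left _) (Commute.one_left _)
    (annihilation_mul_creation_of_ne (inl_ne_inl h)) (annihilation_anticomm _ _)
    (anticomm_symm (theta_anticomm_i v k)) (anticomm_symm (delta_anticomm_i v k))
  rwa [map_one, one_mul] at h1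

theorem commute_oneVarHomotopy {C A : Type} [Ring C] [Ring A] {cw : C →+* A} {zb D J₀ J₁ : C}
    {e i t δ x : A} (h1 : Commute x (cw zb)) (h2 : Commute x (cw D)) (h3 : Commute x (cw J₀))
    (h4 : Commute x (cw J₁)) (k1 : Commute x e) (k2 : Commute x i) (k3 : Commute x t)
    (k4 : Commute x δ) : Commute x (oneVarHomotopy cw zb D J₀ J₁ e i t δ) := by
  have p := k1.mul_right k2
  have p' := k3.mul_right k4
  have one := Commute.one_right x
  unfold oneVarHomotopy
  simp only [map_mul]
  exact ((((h1.mul_right h3).mul_right (k2.mul_right (one.sub_right p'))).add_right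
    ((h1.mul_right h4).mul_right (k2.mul_right p'))).add_right
    ((h3.mul_right h2).mul_right (k3.mul_right (one.sub_right p)))).add_right
    ((h4.mul_right h2).mul_right (k3.mul_right p))

theorem commute_mul_of_anticomm {A : Type} [Ring A] {x y z : A} (h : x * z = -(z * x))
    (h' : y * z = -(z * y)) : Commute (x * y) z := by
  show _ * _ = _ * _
  rw [mul_assoc, h', mul_neg, ← mul_assoc, h, neg_mul, neg_neg, mul_assoc]

theorem pullbackAt_comm_homotopyAt {v k : Fin d} (h : k ≠ v) :
    Commute (pullbackAt n s k) (homotopyAt ray m s v) := by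
  have cf : ∀ c : Module.End ℂ (Sm s), Commute (Sm.restr k) c →
      Commute (pullbackAt n s k) (cw n s c) := fun c hc =>
    (hc.map (cw n s)).mul_left <| (Commute.one_left _).sub_left
      ((coeffwise_creation c _).mul_right (coeffwise_annihilation c _)).symm
  have odd : ∀ y : Module.End ℂ (SFld n s), (∀ c, Commute (cw n s c) y) →
      (eOp n s k * y = -(y * eOp n s k)) → (iOp n s k * y = -(y * iOp n s k)) →
      Commute (pullbackAt n s k) y := fun y hy h1 h2 =>
    (hy _).mul_left ((Commute.one_left _).sub_left (commute_mul_of_anticomm h1 h2))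
  refine commute_oneVarHomotopy (cf _ (Sm.restr_conjCoord_of_ne h.symm))
    (cf _ (Sm.dzOp_restr_of_ne h.symm).symm) (cf _ (Sm.restr_avg_of_ne _ _ _))
    (cf _ (Sm.restr_avg_of_ne _ _ _)) (odd _ (fun c => (cw_commute (ray := ray) (m := m) c v).1) ?_ ?_)
    (odd _ (fun c => (cw_commute (ray := ray) (m := m) c v).2.1) ?_ ?_)
    (odd _ (fun c => (cw_commute (ray := ray) (m := m) c v).2.2.1) ?_ ?_)
    (odd _ (fun c => (cw_commute (ray := ray) (m := m) c v).2.2.2) ?_ ?_)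
  · exact creation_anticomm _ _
  · exact annihilation_mul_creation_of_ne (inl_ne_inl h)
  · exact anticomm_symm (annihilation_mul_creation_of_ne (inl_ne_inl h.symm))
  · exact annihilation_anticomm _ _
  · exact anticomm_symm (theta_anticomm_e v k)
  · exact anticomm_symm (theta_anticomm_i v k)
  · exact anticomm_symm (delta_anticomm_e v k)
  · exact anticomm_symm (delta_anticomm_i v k)

variable {τ : Finset (Fin d)}

theorem diff_mem_relative (hm : IsDualFrame ray m s) (hτ : τ ⊆ s) {α : SFld n s}
    (hα : α ∈ relative n s τ) : diff ray s α ∈ relative n s τ := by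
  refine ⟨fun i hi => ?_, fun k hk => ?_⟩
  · have h : iOp n s i * diff ray s = -(diff ray s * iOp n s i) := by
      unfold diff
      rw [Finset.mul_sum, Finset.sum_mul, ← Finset.sum_neg_distrib]
      exact Finset.sum_congr rfl fun v hv => i_anticomm_diffAt fun h => hi (h ▸ hv)
    have := LinearMap.congr_fun h α
    simpa [hα.1 i hi] using this
  · have := LinearMap.congr_fun (pullbackAt_diff hm (hτ hk)) α
    simpa [hα.2 k hk] using this

theorem cw_comm_one_sub (c : Module.End ℂ (Sm s)) (v : Fin d) :
    Commute (cw n s c) (1 - eOp n s v * iOp n s v) :=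
  (Commute.one_right _).sub_right ((coeffwise_creation _ _).mul_right (coeffwise_annihilation _ _))

theorem pullbackAt_idem (hm : IsDualFrame ray m s) {v : Fin d} (hv : v ∈ s) :
    pullbackAt n s v * pullbackAt n s v = pullbackAt n s v := by
  unfold pullbackAt
  rw [mul_mul_mul_of_commute (cw_comm_one_sub _ v).symm, (fermionPair hm hv).p_word.2.2.2.1,
    ← map_mul, Sm.restr_restr]

theorem number_comm {k v : Fin d} (hkv : k ≠ v) :
    Commute (eOp n s k * iOp n s k) (eOp n s v * iOp n s v) :=
  (commute_mul_of_anticomm (creation_anticomm _ _)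
    (annihilation_mul_creation_of_ne (inl_ne_inl hkv))).mul_right
  (commute_mul_of_anticomm
    (anticomm_symm (annihilation_mul_creation_of_ne (inl_ne_inl (Ne.symm hkv))))
    (annihilation_anticomm _ _))

theorem one_sub_comm_one_sub {A : Type} [Ring A] {x y : A} (h : Commute x y) :
    Commute (1 - x) (1 - y) :=
  (Commute.one_left _).sub_left ((Commute.one_right _).sub_right h)

theorem pullbackAt_comm {k v : Fin d} (hkv : k ≠ v) :
    Commute (pullbackAt n s k) (pullbackAt n s v) :=
  Commute.mul_left (((Sm.restr_comm k v).map (cw n s)).mul_right (cw_comm_one_sub _ _))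
    ((cw_comm_one_sub _ _).symm.mul_right (one_sub_comm_one_sub (number_comm hkv)))

theorem i_comm_pullbackAt {i v : Fin d} (hiv : i ≠ v) :
    Commute (iOp n s i) (pullbackAt n s v) :=
  ((coeffwise_annihilation (Sm.restr v) _).symm).mul_right
    ((Commute.one_right _).sub_right (Commute.symm (commute_mul_of_anticomm
      (anticomm_symm (annihilation_mul_creation_of_ne (inl_ne_inl hiv)))
      (annihilation_anticomm _ _))))

theorem restr_projector_eq (hm : IsDualFrame ray m s) {v : Fin d} (hv : v ∈ s) :
    cw n s (Sm.restr v) * ((1 - eOp n s v * iOp n s v) * (1 - thetaOp m s v * deltaOp ray s v))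
      = (1 - thetaOp m s v * deltaOp ray s v) * pullbackAt n s v := by
  have hc : Commute (cw n s (Sm.restr v)) (1 - thetaOp m s v * deltaOp ray s v) :=
    (Commute.one_right _).sub_right ((cw_commute (ray := ray) (m := m) _ v).2.2.1.mul_right
      (cw_commute (ray := ray) (m := m) _ v).2.2.2)
  rw [← (fermionPair hm hv).p_word.2.2.2.2.2.2.2.2, ← mul_assoc, hc.eq, mul_assoc]
  rfl

theorem i_homotopyAt_eq_zero {v : Fin d} (hv : v ∈ s) {α : SFld n s}
    (hα : α ∈ relative n s τ) : ∀ i ∉ s, iOp n s i (homotopyAt ray m s v α) = 0 := by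
  intro i hi
  have := LinearMap.congr_fun
    (i_anticomm_homotopyAt (ray := ray) (m := m) (s := s) (fun h => hi (h ▸ hv) : i ≠ v)) α
  rw [Module.End.mul_apply] at this
  rw [this, LinearMap.neg_apply, Module.End.mul_apply, hα.1 i hi, map_zero, neg_zero]

theorem pullbackAt_homotopyAt_eq_zero {v : Fin d} {α : SFld n s}
    (hα : α ∈ relative n s τ) : ∀ k ∈ τ, k ≠ v →
      pullbackAt n s k (homotopyAt ray m s v α) = 0 := by
  intro k hk hkv
  have := LinearMap.congr_fun
    (pullbackAt_comm_homotopyAt (ray := ray) (m := m) (s := s) hkv).eq α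
  rw [Module.End.mul_apply] at this
  rw [this, Module.End.mul_apply, hα.2 k hk, map_zero]

theorem relativeHomotopy_mem (hm : IsDualFrame ray m s) {v : Fin d} (hv : v ∈ s) {α : SFld n s}
    (hα : α ∈ relative n s τ) :
    homotopyAt ray m s v α - pullbackAt n s v (homotopyAt ray m s v α) ∈ relative n s τ := by
  refine ⟨fun i his => ?_, fun k hkτ => ?_⟩
  · have h0 := i_homotopyAt_eq_zero (ray := ray) (m := m) hv hα i his
    have := LinearMap.congr_fun (i_comm_pullbackAt (n := n) (s := s)
      (fun h => his (h ▸ hv) : i ≠ v)).eq (homotopyAt ray m s v α)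
    rw [Module.End.mul_apply, Module.End.mul_apply, h0, map_zero] at this
    rw [map_sub, this, h0, sub_zero]
  · by_cases hkv : k = v
    · subst hkv
      have := LinearMap.congr_fun (pullbackAt_idem hm hv) (homotopyAt ray m s k α)
      rw [Module.End.mul_apply] at this
      rw [map_sub, this, sub_self]
    · have h0 := pullbackAt_homotopyAt_eq_zero (ray := ray) (m := m) hα k hkτ hkv
      have := LinearMap.congr_fun (pullbackAt_comm (n := n) (s := s) hkv).eq
        (homotopyAt ray m s v α)
      rw [Module.End.mul_apply, Module.End.mul_apply, h0, map_zero] at this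
      rw [map_sub, this, h0, sub_zero]

theorem relativeHomotopy_diff (hm : IsDualFrame ray m s) {v : Fin d} (hv : v ∈ s) (hvτ : v ∈ τ)
    {α : SFld n s} (hα : α ∈ relative n s τ) :
    diff ray s (homotopyAt ray m s v α - pullbackAt n s v (homotopyAt ray m s v α))
      + (homotopyAt ray m s v (diff ray s α)
        - pullbackAt n s v (homotopyAt ray m s v (diff ray s α)))
      = α - projectorAt ray m s τ v α := by
  have e0 : pullbackAt n s v α = 0 := hα.2 v hvτ
  have e1 := LinearMap.congr_fun (diff_homotopyAt hm hv) α
  have e2 := LinearMap.congr_fun (pullbackAt_diff hm hv) (homotopyAt ray m s v α)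
  have e3 : diffAt ray s v (pullbackAt n s v (homotopyAt ray m s v α))
      = projectorAt ray m s τ v α := by
    unfold projectorAt
    rw [if_pos hvτ]
    exact LinearMap.congr_fun (oneVarDiff_restr_homotopy (cw := cw n s) (fermionPair hm hv)
      (radialCalculus hv) (Sm.restr_avg_of_ne v v 1) fun c => cw_commute c v) α
  rw [restr_projector_eq hm hv] at e1
  simp only [LinearMap.add_apply, LinearMap.sub_apply, Module.End.mul_apply,
    Module.End.one_apply, e0, map_zero, sub_zero] at e1
  have e5 := congrArg (pullbackAt n s v) e1
  rw [e0, map_add] at e5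
  simp only [Module.End.mul_apply, LinearMap.sub_apply] at e2
  rw [e3] at e2
  rw [map_sub]
  have e6 : diff ray s (pullbackAt n s v (homotopyAt ray m s v α))
      = pullbackAt n s v (diff ray s (homotopyAt ray m s v α)) + projectorAt ray m s τ v α := by
    rw [e2]; abel
  rw [e6, eq_neg_of_add_eq_zero_left e5]
  refine Eq.trans ?_ (congrArg (· - projectorAt ray m s τ v α) e1)
  abel

/-- In each variable, the complex of relative fields is homotopy equivalent to the image of the
projector. -/
theorem exists_homotopy_at (hm : IsDualFrame ray m s) {v : Fin d} (hv : v ∈ s) :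
    ∃ h : Module.End ℂ (SFld n s), (∀ α ∈ relative n s τ, h α ∈ relative n s τ) ∧
      ∀ α ∈ relative n s τ,
        diff ray s (h α) + h (diff ray s α) = α - projectorAt ray m s τ v α := by
  by_cases hvτ : v ∈ τ
  · exact ⟨homotopyAt ray m s v - pullbackAt n s v * homotopyAt ray m s v,
      fun α hα => relativeHomotopy_mem hm hv hα, fun α hα => relativeHomotopy_diff hm hv hvτ hα⟩
  · refine ⟨homotopyAt ray m s v, fun α hα => ⟨i_homotopyAt_eq_zero hv hα, fun k hkτ =>
      pullbackAt_homotopyAt_eq_zero hα k hkτ fun h => hvτ (h ▸ hkτ)⟩, fun α hα => ?_⟩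
    unfold projectorAt
    rw [if_neg hvτ]
    exact LinearMap.congr_fun (diff_homotopyAt hm hv) α

end Component

namespace Component

variable {ray m : Fin d → Fin n → ℤ} {s τ : Finset (Fin d)}

/-- The action of the projector on functions. -/
def fnProjector (s τ : Finset (Fin d)) (v : Fin d) : Module.End ℂ (Sm s) :=
  if v ∈ τ then Sm.mulOp (Sm.coord s v) * Sm.restr v * Sm.dzOp s v else Sm.restr v

theorem commute_mul_mul {R : Type*} [Ring R] {a b c a' b' c' : R} (h1 : Commute a a')
    (h2 : Commute b a') (h3 : Commute c a') (h4 : Commute a b') (h5 : Commute b b')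
    (h6 : Commute c b') (h7 : Commute a c') (h8 : Commute b c') (h9 : Commute c c') :
    Commute (a * b * c) (a' * b' * c') :=
  (((h1.mul_left h2).mul_left h3).mul_right ((h4.mul_left h5).mul_left h6)).mul_right
    ((h7.mul_left h8).mul_left h9)

theorem fnProjector_comm {v w : Fin d} (h : v ≠ w) :
    Commute (fnProjector s τ v) (fnProjector s τ w) := by
  have c1 : ∀ {v w : Fin d}, v ≠ w →
      Commute (Sm.mulOp (Sm.coord s v)) (Sm.dzOp s w) := fun {v w} h => by
    symm
    show _ * _ = _ * _
    rw [Sm.dzOp_mul_mulOp, Sm.dzOp_coord, if_neg (fun h' => h h'.2), Sm.mulOp_zero, add_zero]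
  have c2 : ∀ {v w : Fin d}, v ≠ w →
      Commute (Sm.mulOp (Sm.coord s v) * Sm.restr v * Sm.dzOp s v) (Sm.restr w) := fun {v w} h =>
    ((Sm.restr_coord_of_ne h).symm.mul_left (Sm.restr_comm v w)).mul_left (Sm.dzOp_restr_of_ne h)
  unfold fnProjector
  split_ifs
  · exact commute_mul_mul (Sm.mulOp_comm _ _) (Sm.restr_coord_of_ne h.symm) (c1 h.symm).symm
      (Sm.restr_coord_of_ne h).symm (Sm.restr_comm v w) (Sm.dzOp_restr_of_ne h)
      (c1 h) (Sm.dzOp_restr_of_ne h.symm).symm (Sm.dzOp_comm v w)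
  · exact c2 h
  · exact (c2 h.symm).symm
  · exact Sm.restr_comm v w

theorem fnProjector_idem {v : Fin d} (hv : v ∈ s) :
    fnProjector s τ v * fnProjector s τ v = fnProjector s τ v := by
  unfold fnProjector
  split_ifs
  · have h1 : Sm.dzOp s v * (Sm.mulOp (Sm.coord s v) * Sm.restr v * Sm.dzOp s v)
        = Sm.restr v * Sm.dzOp s v := by
      rw [← mul_assoc, ← mul_assoc, Sm.dzOp_mul_mulOp, Sm.dzOp_coord, if_pos ⟨hv, rfl⟩,
        Sm.mulOp_one, add_mul, mul_assoc _ (Sm.dzOp s v), Sm.dzOp_restr, mul_zero, zero_add, one_mul]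
    rw [mul_assoc _ (Sm.dzOp s v), h1, mul_assoc, ← mul_assoc (Sm.restr v), Sm.restr_restr,
      ← mul_assoc]
  · exact Sm.restr_restr v

theorem dzbar_fnProjector (v : Fin d) : Sm.dzbarOp s v * fnProjector s τ v = 0 := by
  unfold fnProjector
  split_ifs
  · rw [← mul_assoc, ← mul_assoc, Sm.dzbarOp_mul_mulOp, Sm.dzbarOp_coord, Sm.mulOp_zero, add_zero,
      mul_assoc (Sm.mulOp _), Sm.dzbarOp_restr, mul_zero, zero_mul]
  · exact Sm.dzbarOp_restr v

theorem projectorAt_eq (v : Fin d) : projectorAt ray m s τ v = cw n s (fnProjector s τ v)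
    * ((1 - eOp n s v * iOp n s v) * (1 - thetaOp m s v * deltaOp ray s v)) := rfl

/-- The fields fixed by the projector in the variable `z_v`. -/
structure IsReducedAt (ray : Fin d → Fin n → ℤ) (s τ : Finset (Fin d)) (v : Fin d)
    (α : SFld n s) : Prop where
  i_eq : iOp n s v α = 0
  delta_eq : deltaOp ray s v α = 0
  fn_eq : cw n s (fnProjector s τ v) α = α

theorem IsReducedAt.projectorAt_eq {v : Fin d} {α : SFld n s} (h : IsReducedAt ray s τ v α) :
    projectorAt ray m s τ v α = α := by
  show cw n s (fnProjector s τ v) _ = α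
  have h1 : (1 - thetaOp m s v * deltaOp ray s v) α = α := by
    show α - thetaOp m s v (deltaOp ray s v α) = α
    rw [h.delta_eq, map_zero, sub_zero]
  have h2 : (1 - eOp n s v * iOp n s v) α = α := by
    show α - eOp n s v (iOp n s v α) = α
    rw [h.i_eq, map_zero, sub_zero]
  rw [Module.End.mul_apply, h1, h2, h.fn_eq]

theorem isReducedAt_projectorAt (hm : IsDualFrame ray m s) {v : Fin d} (hv : v ∈ s)
    (α : SFld n s) : IsReducedAt ray s τ v (projectorAt ray m s τ v α) := by
  have hc := cw_commute (ray := ray) (m := m) (n := n) (s := s) (fnProjector s τ v) v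
  obtain ⟨-, -, -, -, -, -, p7, p8, -⟩ := (fermionPair hm hv).p_word
  refine ⟨?_, ?_, ?_⟩
  · have : iOp n s v * projectorAt ray m s τ v = 0 := by
      rw [projectorAt_eq, ← mul_assoc, ← hc.2.1.eq, mul_assoc, p7, mul_zero]
    exact LinearMap.congr_fun this α
  · have : deltaOp ray s v * projectorAt ray m s τ v = 0 := by
      rw [projectorAt_eq, ← mul_assoc, ← hc.2.2.2.eq, mul_assoc, p8, mul_zero]
    exact LinearMap.congr_fun this α
  · have : cw n s (fnProjector s τ v) * projectorAt ray m s τ v = projectorAt ray m s τ v := by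
      rw [projectorAt_eq, ← mul_assoc, ← map_mul, fnProjector_idem hv]
    exact LinearMap.congr_fun this α

theorem IsReducedAt.projectorAt (hm : IsDualFrame ray m s) {v w : Fin d} (hv : v ∈ s) (hw : w ∈ s)
    (hvw : w ≠ v) {α : SFld n s} (h : IsReducedAt ray s τ w α) :
    IsReducedAt ray s τ w (projectorAt ray m s τ v α) := by
  have h0 : ∑ k, ray w k * m v k = 0 := by rw [hm.pair v hv w hw, if_neg hvw]
  have hdt : deltaOp ray s w * thetaOp m s v = -(thetaOp m s v * deltaOp ray s w) := by
    rw [delta_mul_theta, h0]; simp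
  have odd : ∀ y : Module.End ℂ (SFld n s), (∀ c, Commute (cw n s c) y) →
      (eOp n s v * y = -(y * eOp n s v)) → (iOp n s v * y = -(y * iOp n s v)) →
      (thetaOp m s v * y = -(y * thetaOp m s v)) →
      (deltaOp ray s v * y = -(y * deltaOp ray s v)) →
      Commute (Component.projectorAt ray m s τ v) y := fun y hy h1 h2 h3 h4 =>
    (hy _).mul_left (((Commute.one_left _).sub_left (commute_mul_of_anticomm h1 h2)).mul_left
      ((Commute.one_left _).sub_left (commute_mul_of_anticomm h3 h4)))
  have hi : Commute (Component.projectorAt ray m s τ v) (iOp n s w) :=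
    odd _ (fun c => coeffwise_annihilation c _)
      (anticomm_symm (annihilation_mul_creation_of_ne (inl_ne_inl hvw)))
      (annihilation_anticomm _ _) (theta_anticomm_i v w) (delta_anticomm_i v w)
  have hd : Commute (Component.projectorAt ray m s τ v) (deltaOp ray s w) :=
    odd _ (fun c => (cw_commute (m := m) c w).2.2.2)
      (anticomm_symm (delta_anticomm_e w v)) (anticomm_symm (delta_anticomm_i w v))
      (anticomm_symm hdt) (delta_anticomm_delta v w)
  have hf : Commute (cw n s (fnProjector s τ w)) (Component.projectorAt ray m s τ v) :=
    ((fnProjector_comm hvw).map (cw n s)).mul_right ((cw_comm_one_sub _ _).mul_right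
      ((Commute.one_right _).sub_right ((cw_commute (ray := ray) (m := m) _ v).2.2.1.mul_right
      (cw_commute (ray := ray) (m := m) _ v).2.2.2)))
  refine ⟨?_, ?_, ?_⟩
  · have := LinearMap.congr_fun hi.eq α
    rw [Module.End.mul_apply, Module.End.mul_apply, h.i_eq, map_zero] at this
    exact this.symm
  · have := LinearMap.congr_fun hd.eq α
    rw [Module.End.mul_apply, Module.End.mul_apply, h.delta_eq, map_zero] at this
    exact this.symm
  · have := LinearMap.congr_fun hf.eq α
    rwa [Module.End.mul_apply, Module.End.mul_apply, h.fn_eq] at this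

theorem exists_projector (hm : IsDualFrame ray m s) (hτ : τ ⊆ s) (T : Finset (Fin d)) (hT : T ⊆ s) :
    ∃ r h : Module.End ℂ (SFld n s), (∀ α ∈ relative n s τ, h α ∈ relative n s τ) ∧
      (∀ α ∈ relative n s τ, diff ray s (h α) + h (diff ray s α) = α - r α) ∧
      (∀ α, ∀ v ∈ T, IsReducedAt ray s τ v (r α)) ∧
      ∀ α, (∀ v ∈ T, IsReducedAt ray s τ v α) → r α = α := by
  induction T using Finset.induction_on with
  | empty => exact ⟨1, 0, by simp, by simp, by simp, by simp⟩
  | insert v T hvT ih =>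
    obtain ⟨r, h, h1, h2, h3, h4⟩ := ih ((Finset.subset_insert _ _).trans hT)
    have hv : v ∈ s := hT (Finset.mem_insert_self _ _)
    obtain ⟨h', k1, k2⟩ := exists_homotopy_at (τ := τ) hm hv
    have hr : ∀ α ∈ relative n s τ, r α = α - (diff ray s (h α) + h (diff ray s α)) :=
      fun α hα => by rw [h2 α hα]; abel
    have hrm : ∀ α ∈ relative n s τ, r α ∈ relative n s τ := fun α hα => by
      rw [hr α hα]
      exact sub_mem hα (add_mem (diff_mem_relative hm hτ (h1 α hα))
        (h1 _ (diff_mem_relative hm hτ hα)))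
    have hDD : ∀ α, diff ray s (diff ray s α) = 0 := fun α =>
      LinearMap.congr_fun (diff_mul_diff (ray := ray) (s := s) m) α
    have hrD : ∀ α ∈ relative n s τ, r (diff ray s α) = diff ray s (r α) := fun α hα => by
      rw [hr α hα, hr _ (diff_mem_relative hm hτ hα)]
      simp [hDD]
    refine ⟨projectorAt ray m s τ v * r, h + h' * r, fun α hα => ?_, fun α hα => ?_,
      fun α w hw => ?_, fun α hα => ?_⟩
    · exact add_mem (h1 α hα) (k1 _ (hrm α hα))
    · have e1 := h2 α hα
      have e2 := k2 _ (hrm α hα)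
      show diff ray s (h α + h' (r α)) + (h (diff ray s α) + h' (r (diff ray s α)))
        = α - projectorAt ray m s τ v (r α)
      rw [hrD α hα, map_add]
      refine Eq.trans ?_ ((congrArg₂ (· + ·) e1 e2).trans ?_) <;> abel
    · rcases Finset.mem_insert.mp hw with rfl | hwT
      · exact isReducedAt_projectorAt hm hv _
      · exact (h3 α w hwT).projectorAt hm hv (hT hw) fun h => hvT (h ▸ hwT)
    · rw [Module.End.mul_apply, h4 α fun w hw => hα w (Finset.mem_insert_of_mem hw)]
      exact (hα v (Finset.mem_insert_self _ _)).projectorAt_eq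

/-- The monomial `∏_{i ∈ τ} z_i` as a field. -/
def monoFld (n : ℕ) {d : ℕ} (s τ : Finset (Fin d)) : SFld n s := fun A =>
  if A = ∅ then ∏ i ∈ τ, Sm.coord s i else 0

theorem annihilation_eq_zero_iff {ι : Type} [LinearOrder ι] [DecidableEq ι] {R : Type} [CommRing R]
    [Algebra ℂ R] {i : ι} {α : Finset ι → R} (h : annihilation R i α = 0) {A : Finset ι}
    (hA : i ∈ A) : α A = 0 := by
  have := congrFun h (A.erase i)
  simp only [annihilation_apply, genDer, Finset.notMem_erase, if_false, Finset.insert_erase hA,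
    Pi.zero_apply] at this
  exact (smul_eq_zero_iff_right (leftSign_ne_zero _ _)).mp this

theorem annihilation_monoFld (x : Gen n d) : annihilation (Sm s) x (monoFld n s τ) = 0 := by
  funext A
  simp only [annihilation_apply, genDer, monoFld]
  split_ifs <;> simp_all

theorem coe_prod (T : Finset (Fin d)) (a : Fin d → Sm s) (z : s → ℂ) :
    (∏ i ∈ T, a i).val z = ∏ i ∈ T, (a i).val z := by
  induction T using Finset.induction_on with
  | empty => simp
  | insert v T h ih => simp [Finset.prod_insert h, ih]

theorem isReducedAt_monoFld {v : Fin d} (hv : v ∈ s) : IsReducedAt ray s τ v (monoFld n s τ) := by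
  refine ⟨annihilation_monoFld _, ?_, ?_⟩
  · simp [deltaOp, annihilation_monoFld]
  · funext A
    rw [coeffwise_apply]
    simp only [monoFld]
    by_cases hA : A = ∅
    swap; · simp [hA]
    have hne : ∀ T : Finset (Fin d), v ∉ T →
        Sm.restr v (∏ i ∈ T, Sm.coord s i) = ∏ i ∈ T, Sm.coord s i := by
      intro T hT
      refine Sm.ext fun z => ?_
      rw [Sm.restr_apply, coe_prod, coe_prod]
      refine Finset.prod_congr rfl fun i hi => ?_
      show incl s _ i = incl s z i
      rw [Sm.incl_scale, if_neg (fun h : i = v => hT (h ▸ hi))]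
    rw [if_pos hA]
    unfold fnProjector
    split_ifs with hvτ
    · have hd : ∀ T : Finset (Fin d), v ∉ T → Sm.dzOp s v (∏ i ∈ T, Sm.coord s i) = 0 := by
        intro T hT
        rw [← hne T hT]
        exact LinearMap.congr_fun (Sm.dzOp_restr v) _
      rw [← Finset.mul_prod_erase τ _ hvτ, Module.End.mul_apply, Sm.dzOp_mul,
        hd _ (Finset.notMem_erase _ _), Sm.dzOp_coord, if_pos ⟨hv, rfl⟩, mul_zero, zero_add,
        one_mul, Module.End.mul_apply, hne _ (Finset.notMem_erase _ _)]
      rfl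
    · exact hne τ hvτ

theorem fn_of_fnProjector_eq (hτ : τ ⊆ s) {a : Sm s} (ha : ∀ v ∈ s, fnProjector s τ v a = a) :
    a = a.val (fun _ => 1) • ∏ i ∈ τ, Sm.coord s i := by
  let one (T : Finset (Fin d)) (z : s → ℂ) : s → ℂ := fun j => if (j : Fin d) ∈ T then 1 else z j
  have key : ∀ T ⊆ s, ∀ z, a.val z = (∏ i ∈ T ∩ τ, incl s z i) * a.val (one T z) := by
    intro T
    induction T using Finset.induction_on with
    | empty => intro _ z; simp [one]
    | insert v T hvT ih =>
      intro hT z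
      have hv : v ∈ s := hT (Finset.mem_insert_self _ _)
      rw [ih ((Finset.subset_insert _ _).trans hT) z]
      have hsc : Sm.scale v 0 (one T z) = Sm.scale v 0 (one (insert v T) z) := by
        funext j
        by_cases hj : (j : Fin d) = v <;> simp [Sm.scale, one, hj]
      have e := ha v hv
      by_cases hvτ : v ∈ τ
      · have h1 : ∀ y, a.val y = incl s y v * (Sm.dzOp s v a).val (Sm.scale v 0 y) := by
          intro y
          conv_lhs => rw [← e]
          simp only [fnProjector, if_pos hvτ]
          rfl
        have i1 : incl s (one T z) v = incl s z v := by simp [incl, hv, one, hvT]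
        have i2 : incl s (one (insert v T) z) v = 1 := by simp [incl, hv, one]
        rw [h1 (one T z), h1 (one (insert v T) z), hsc, i1, i2,
          Finset.insert_inter_of_mem hvτ, Finset.prod_insert (by simp [hvT])]
        ring
      · have h1 : ∀ y, a.val y = a.val (Sm.scale v 0 y) := by
          intro y
          conv_lhs => rw [← e]
          simp only [fnProjector, if_neg hvτ]
          rfl
        rw [h1 (one T z), h1 (one (insert v T) z), hsc, Finset.insert_inter_of_notMem hvτ]
  refine Sm.ext fun z => ?_
  rw [key s subset_rfl z, Finset.inter_eq_right.mpr hτ, Sm.coe_smul, coe_prod, mul_comm]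
  congr 2
  funext j
  simp [one]

theorem eq_monoFld_of_isReduced (hm : IsDualFrame ray m s) (hτ : τ ⊆ s) {α : SFld n s}
    (hα : α ∈ relative n s τ) (h : ∀ v ∈ s, IsReducedAt ray s τ v α) :
    ∃ c : ℂ, α = c • monoFld n s τ := by
  have hr : ∀ k : Fin n, annihilation (Sm s) (Sum.inrₗ k : Gen n d) α = 0 := by
    intro k
    have e : ∑ v ∈ s, (m v k : ℂ) • deltaOp ray s v α
        = annihilation (Sm s) (Sum.inrₗ k : Gen n d) α := by
      simp only [deltaOp, LinearMap.sum_apply, LinearMap.smul_apply, Finset.smul_sum, smul_smul]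
      rw [Finset.sum_comm]
      simp only [← Finset.sum_smul]
      have : ∀ l, ∑ v ∈ s, (m v k : ℂ) * (ray v l : ℂ) = if k = l then 1 else 0 := fun l => by
        exact_mod_cast congrArg (Int.cast : ℤ → ℂ) (hm.complete k l)
      simp [this]
    rw [← e]
    exact Finset.sum_eq_zero fun v hv => by rw [(h v hv).delta_eq, smul_zero]
  refine ⟨(α ∅).val fun _ => 1, funext fun A => ?_⟩
  simp only [Pi.smul_apply, monoFld]
  split_ifs with hA
  · subst hA
    exact fn_of_fnProjector_eq hτ fun v hv => congrFun (h v hv).fn_eq ∅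
  · rw [smul_zero]
    obtain ⟨x, hx⟩ := Finset.nonempty_iff_ne_empty.mpr hA
    have hx0 : annihilation (Sm s) x α = 0 := by
      rcases x with i | k
      · by_cases hi : i ∈ s
        · exact (h i hi).i_eq
        · exact hα.1 i hi
      · exact hr k
    exact annihilation_eq_zero_iff hx0 hx

theorem diff_eq_zero_of_isReduced {α : SFld n s} (h : ∀ v ∈ s, IsReducedAt ray s τ v α) :
    diff ray s α = 0 := by
  simp only [diff, LinearMap.sum_apply]
  refine Finset.sum_eq_zero fun v hv => ?_
  have h1 : cw n s (Sm.dzbarOp s v) α = 0 := by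
    rw [← (h v hv).fn_eq, ← Module.End.mul_apply, ← map_mul, dzbar_fnProjector, map_zero]
    rfl
  have h2 : (cw n s (Sm.dzbarOp s v) * eOp n s v) α = 0 := by
    rw [(coeffwise_creation _ _ : Commute (cw n s (Sm.dzbarOp s v)) (eOp n s v)).eq,
      Module.End.mul_apply, h1, map_zero]
  show (cw n s (Sm.dzbarOp s v) * eOp n s v) α + cw n s _ (deltaOp ray s v α) = 0
  rw [h2, (h v hv).delta_eq, map_zero, add_zero]

/-- A closed relative field is cohomologous to a multiple of the monomial. -/
theorem exists_primitive (hm : IsDualFrame ray m s) (hτ : τ ⊆ s) {α : SFld n s}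
    (hα : α ∈ relative n s τ) (hd : diff ray s α = 0) :
    ∃ c : ℂ, ∃ β ∈ relative n s τ, α = c • monoFld n s τ + diff ray s β := by
  obtain ⟨r, h, h1, h2, h3, -⟩ := exists_projector hm hτ s subset_rfl
  have e := h2 α hα
  rw [hd, map_zero, add_zero] at e
  have hr : r α = α - diff ray s (h α) := by rw [e]; abel
  have hrm : r α ∈ relative n s τ := hr ▸ sub_mem hα (diff_mem_relative hm hτ (h1 α hα))
  obtain ⟨c, hc⟩ := eq_monoFld_of_isReduced hm hτ hrm (h3 α)
  exact ⟨c, h α, h1 α hα, by rw [← hc, hr]; abel⟩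

/-- The monomial is not exact. -/
theorem eq_zero_of_monoFld_exact (hm : IsDualFrame ray m s) (hτ : τ ⊆ s) {β : SFld n s}
    (hβ : β ∈ relative n s τ) {c : ℂ} (h : c • monoFld n s τ = diff ray s β) : c = 0 := by
  obtain ⟨r, h', h1, h2, h3, h4⟩ := exists_projector hm hτ s subset_rfl
  have hDD : ∀ α, diff ray s (diff ray s α) = 0 := fun α =>
    LinearMap.congr_fun (diff_mul_diff (ray := ray) (s := s) m) α
  have hr : ∀ α ∈ relative n s τ, r α = α - (diff ray s (h' α) + h' (diff ray s α)) :=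
    fun α hα => by rw [h2 α hα]; abel
  have e1 : r (diff ray s β) = diff ray s (r β) := by
    rw [hr β hβ, hr _ (diff_mem_relative hm hτ hβ)]
    simp [hDD]
  rw [diff_eq_zero_of_isReduced (h3 β), ← h, map_smul,
    h4 _ fun v hv => isReducedAt_monoFld hv] at e1
  have e2 := congrArg (fun a : Sm s => a.val fun _ => 1) (congrFun e1 ∅)
  simp only [Pi.smul_apply, monoFld, if_true, Pi.zero_apply, Sm.coe_smul, coe_prod,
    Sm.coe_zero] at e2
  rwa [Finset.prod_eq_one, mul_one] at e2
  intro i hi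
  simp [Sm.coord, incl, hτ hi]

end Component

/-! ### Combinatorics of complete smooth fans -/

/-- A ray generator as a real vector. -/
def realRay (ray : Fin d → Fin n → ℤ) (i : Fin d) : Fin n → ℝ := fun k => (ray i k : ℝ)

/-- The real linear form given by an integral covector. -/
def covector (w : Fin n → ℤ) : (Fin n → ℝ) →ₗ[ℝ] ℝ := ∑ k, (w k : ℝ) • LinearMap.proj k

theorem covector_apply (w : Fin n → ℤ) (x : Fin n → ℝ) : covector w x = ∑ k, (w k : ℝ) * x k := by
  simp [covector]

theorem covector_realRay (ray : Fin d → Fin n → ℤ) (w : Fin n → ℤ) (i : Fin d) :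
    covector w (realRay ray i) = ((∑ k, ray i k * w k : ℤ) : ℝ) := by
  rw [covector_apply]
  push_cast
  exact Finset.sum_congr rfl fun k _ => mul_comm _ _

theorem mem_rayCone {ray : Fin d → Fin n → ℤ} {s : Finset (Fin d)} {x : Fin n → ℝ} :
    x ∈ rayCone ray s ↔ ∃ a : Fin d → ℝ, (∀ i, 0 ≤ a i) ∧ x = ∑ i ∈ s, a i • realRay ray i := by
  unfold rayCone
  rw [PointedCone.hull, Submodule.mem_span_image_finset_iff_exists_fun']
  constructor
  · rintro ⟨c, rfl⟩
    exact ⟨fun i => (c i : ℝ), fun i => (c i).2, rfl⟩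
  · rintro ⟨a, ha, rfl⟩
    exact ⟨fun i => ⟨a i, ha i⟩, rfl⟩

/-- The covectors `m v` are dual to the ray generators `ray v`, `v ∈ c`. -/
def IsDual (ray m : Fin d → Fin n → ℤ) (c : Finset (Fin d)) : Prop :=
  ∀ v ∈ c, ∀ i ∈ c, ∑ k, ray i k * m v k = if i = v then 1 else 0

section Dual

variable {ray m : Fin d → Fin n → ℤ} {c : Finset (Fin d)}

theorem IsDual.covector_sum (h : IsDual ray m c) {v : Fin d} (hv : v ∈ c) (a : Fin d → ℝ)
    {t : Finset (Fin d)} (ht : t ⊆ c) :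
    covector (m v) (∑ i ∈ t, a i • realRay ray i) = if v ∈ t then a v else 0 := by
  rw [map_sum]
  have : ∀ i ∈ t, covector (m v) (a i • realRay ray i) = if i = v then a i else 0 := by
    intro i hi
    rw [map_smul, covector_realRay, h v hv i (ht hi)]
    split_ifs <;> simp
  rw [Finset.sum_congr rfl this, Finset.sum_ite_eq']

theorem IsDual.of_mem (h : IsDual ray m c) {x : Fin n → ℝ} (hx : x ∈ rayCone ray c) :
    (∀ v ∈ c, 0 ≤ covector (m v) x) ∧ x = ∑ v ∈ c, covector (m v) x • realRay ray v := by
  obtain ⟨a, ha, rfl⟩ := mem_rayCone.mp hx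
  have e : ∀ v ∈ c, covector (m v) (∑ i ∈ c, a i • realRay ray i) = a v := fun v hv => by
    rw [h.covector_sum hv a subset_rfl, if_pos hv]
  refine ⟨fun v hv => by rw [e v hv]; exact ha v, ?_⟩
  exact Finset.sum_congr rfl fun v hv => by rw [e v hv]

theorem mem_rayCone_of_covector {x : Fin n → ℝ} (h : ∀ v ∈ c, 0 ≤ covector (m v) x)
    (hx : x = ∑ v ∈ c, covector (m v) x • realRay ray v) : x ∈ rayCone ray c := by
  refine mem_rayCone.mpr ⟨fun v => if v ∈ c then covector (m v) x else 0, fun v => ?_, ?_⟩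
  · dsimp only
    split_ifs with hv
    · exact h v hv
    · exact le_rfl
  · conv_lhs => rw [hx]
    exact Finset.sum_congr rfl fun v hv => by simp only [if_pos hv]

theorem IsDualFrame.isDual (h : IsDualFrame ray m c) : IsDual ray m c := h.pair

theorem IsDualFrame.sum_covector (h : IsDualFrame ray m c) (x : Fin n → ℝ) :
    x = ∑ v ∈ c, covector (m v) x • realRay ray v := by
  funext l
  simp only [Finset.sum_apply, Pi.smul_apply, smul_eq_mul, covector_apply, realRay, Finset.sum_mul]
  rw [Finset.sum_comm]
  have : ∀ k, ∑ v ∈ c, (m v k : ℝ) * x k * (ray v l : ℝ) = if k = l then x k else 0 := by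
    intro k
    have e : ((∑ v ∈ c, m v k * ray v l : ℤ) : ℝ) = if k = l then 1 else 0 := by
      rw [h.complete]; split_ifs <;> simp
    push_cast at e
    rw [← one_mul (x k), ← zero_mul (x k), ← ite_mul, ← e, Finset.sum_mul]
    exact Finset.sum_congr rfl fun v _ => by ring
  simp [this]

theorem IsDualFrame.mem_rayCone_iff (h : IsDualFrame ray m c) {x : Fin n → ℝ} :
    x ∈ rayCone ray c ↔ ∀ v ∈ c, 0 ≤ covector (m v) x :=
  ⟨fun hx => (h.isDual.of_mem hx).1, fun hx => mem_rayCone_of_covector hx (h.sum_covector x)⟩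

end Dual

namespace SmoothCompleteFan

variable (F : SmoothCompleteFan n d)

theorem card_le {c : Finset (Fin d)} (hc : c ∈ F.cones) : c.card ≤ n := by
  obtain ⟨hinj, b, hb⟩ := F.smooth c hc
  rcases isEmpty_or_nonempty (Fin n) with hn | hn
  · rw [Finset.eq_empty_of_forall_notMem fun i hi => hn.elim (hb i hi).choose]
    simp
  choose! e he using hb
  have : Set.InjOn e c := fun i hi j hj hij => hinj hi hj (by rw [← he i hi, ← he j hj, hij])
  simpa using Finset.card_le_card_of_injOn e (fun i _ => Finset.mem_univ _) this

theorem exists_isDual {c : Finset (Fin d)} (hc : c ∈ F.cones) :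
    ∃ m, IsDual F.ray m c ∧ (c.card = n → IsDualFrame F.ray m c) := by
  obtain ⟨hinj, b, hb⟩ := F.smooth c hc
  rcases isEmpty_or_nonempty (Fin n) with hn | hn
  · have hc0 : c = ∅ := Finset.eq_empty_of_forall_notMem fun i hi => hn.elim (hb i hi).choose
    subst hc0
    exact ⟨0, fun v hv => absurd hv (Finset.notMem_empty _), fun _ =>
      ⟨fun v hv => absurd hv (Finset.notMem_empty _), fun k => hn.elim k⟩⟩
  choose! e he using hb
  have hei : Set.InjOn e c := fun i hi j hj hij => hinj hi hj (by rw [← he i hi, ← he j hj, hij])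
  have hlin : ∀ (l : (Fin n → ℤ) →ₗ[ℤ] ℤ) (x : Fin n → ℤ),
      ∑ k, x k * l (Pi.single k 1) = l x := by
    intro l x
    conv_rhs => rw [← (Pi.basisFun ℤ (Fin n)).sum_repr x, map_sum]
    refine Finset.sum_congr rfl fun k _ => ?_
    rw [map_smul, Pi.basisFun_apply, Pi.basisFun_repr, smul_eq_mul]
  let m : Fin d → Fin n → ℤ := fun v k => b.coord (e v) (Pi.single k 1)
  have hm : IsDual F.ray m c := by
    intro v hv i hi
    rw [hlin, ← he i hi, Module.Basis.coord_apply, Module.Basis.repr_self, Finsupp.single_apply]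
    exact if_congr (hei.eq_iff hi hv) rfl rfl
  refine ⟨m, hm, fun hcard => ⟨hm, fun k l => ?_⟩⟩
  have himg : c.image e = Finset.univ := by
    refine Finset.eq_univ_of_card _ ?_
    rw [Finset.card_image_of_injOn hei, hcard, Fintype.card_fin]
  have h1 := congrFun (b.sum_repr (Pi.single k 1)) l
  rw [← himg, Finset.sum_image hei, Finset.sum_apply] at h1
  simp only [Pi.smul_apply, smul_eq_mul] at h1
  rw [Finset.sum_congr rfl fun v hv => by rw [← he v hv]]
  refine h1.trans ?_
  rw [Pi.single_apply]
  exact if_congr eq_comm rfl rfl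

/-- The covectors dual to the generators of an `n`-dimensional cone. -/
def dualVec (s : F.MaxCone) : Fin d → Fin n → ℤ :=
  (F.exists_isDual (Finset.mem_filter.mp s.2).1).choose

theorem isDualFrame (s : F.MaxCone) : IsDualFrame F.ray (F.dualVec s) s.1 :=
  (F.exists_isDual (Finset.mem_filter.mp s.2).1).choose_spec.2 (Finset.mem_filter.mp s.2).2

theorem MaxCone.mem_cones {F : SmoothCompleteFan n d} (s : F.MaxCone) : s.1 ∈ F.cones :=
  (Finset.mem_filter.mp s.2).1

theorem MaxCone.card_eq {F : SmoothCompleteFan n d} (s : F.MaxCone) : s.1.card = n :=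
  (Finset.mem_filter.mp s.2).2

variable {F}

/-- Every facet of an `n`-dimensional cone lies in another `n`-dimensional cone. -/
theorem exists_neighbour (s : F.MaxCone) {i : Fin d} (hi : i ∈ s.1) :
    ∃ s' : F.MaxCone, ∃ b ∈ s'.1, i ∉ s'.1 ∧ s'.1.erase b = s.1.erase i := by
  classical
  set t := s.1.erase i
  have hs := F.isDualFrame s
  set p : Fin n → ℝ := ∑ j ∈ t, (1 : ℝ) • realRay F.ray j with hp
  let x : ℕ → Fin n → ℝ := fun N => (N : ℝ) • p - realRay F.ray i
  have hts : t ⊆ s.1 := Finset.erase_subset _ _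
  have hxi : ∀ N, covector (F.dualVec s i) (x N) = -1 := by
    intro N
    simp only [x, map_sub, map_smul]
    rw [hs.isDual.covector_sum hi _ hts, if_neg (Finset.notMem_erase _ _), covector_realRay,
      hs.pair i hi i hi]
    simp
  have hxs : ∀ N, x N ∉ rayCone F.ray s.1 := fun N h => by
    have := (hs.mem_rayCone_iff.mp h) i hi
    rw [hxi] at this
    norm_num at this
  choose c hc hxc using fun N => F.complete (x N)
  let cc : ℕ → F.cones := fun N => ⟨c N, hc N⟩
  obtain ⟨⟨c₀, hc₀⟩, hinf⟩ := Finite.exists_infinite_fiber cc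
  have hinf' : (cc ⁻¹' {⟨c₀, hc₀⟩}).Infinite := Set.infinite_coe_iff.mp hinf
  have hmem : ∀ N ∈ cc ⁻¹' {⟨c₀, hc₀⟩}, x N ∈ rayCone F.ray c₀ := by
    intro N hN
    have : c N = c₀ := congrArg Subtype.val hN
    exact this ▸ hxc N
  obtain ⟨m, hm, -⟩ := F.exists_isDual hc₀
  obtain ⟨N, hN⟩ := hinf'.nonempty
  obtain ⟨N', hN', hlt⟩ := hinf'.exists_gt N
  have hp2 : p = ∑ v ∈ c₀, covector (m v) p • realRay F.ray v := by
    have hsub : x N' - x N = ((N' : ℝ) - N) • p := by simp only [x]; module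
    have hne : ((N' : ℝ) - N) ≠ 0 := sub_ne_zero.mpr (by exact_mod_cast hlt.ne')
    have e : ((N' : ℝ) - N) • p = ((N' : ℝ) - N) • ∑ v ∈ c₀, covector (m v) p • realRay F.ray v := by
      rw [Finset.smul_sum (s := c₀), ← hsub]
      conv_lhs => rw [(hm.of_mem (hmem N' hN')).2, (hm.of_mem (hmem N hN)).2,
        ← Finset.sum_sub_distrib]
      refine Finset.sum_congr rfl fun v _ => ?_
      rw [← sub_smul, ← map_sub, hsub, map_smul, smul_smul, smul_eq_mul]
    exact smul_right_injective _ hne e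
  have hp3 : ∀ v ∈ c₀, 0 ≤ covector (m v) p := by
    intro v hv
    by_contra hneg
    push Not at hneg
    obtain ⟨K, hK⟩ := exists_nat_gt (covector (m v) (realRay F.ray i) / covector (m v) p)
    obtain ⟨N₁, hN₁, hlt₁⟩ := hinf'.exists_gt K
    have h0 := (hm.of_mem (hmem N₁ hN₁)).1 v hv
    simp only [x, map_sub, map_smul, smul_eq_mul] at h0
    rw [div_lt_iff_of_neg hneg] at hK
    have : (N₁ : ℝ) * covector (m v) p ≤ K * covector (m v) p :=
      mul_le_mul_of_nonpos_right (by exact_mod_cast hlt₁.le) hneg.le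
    linarith
  have hpc : p ∈ rayCone F.ray c₀ := mem_rayCone_of_covector hp3 hp2
  have hps : p ∈ rayCone F.ray s.1 := mem_rayCone.mpr
    ⟨fun j => if j ∈ t then 1 else 0, fun j => by dsimp only; split_ifs <;> norm_num, by
      rw [hp, ← Finset.sum_subset hts]
      · exact Finset.sum_congr rfl fun j hj => by simp only [if_pos hj]
      · intro j _ hj
        simp only [if_neg hj, zero_smul]⟩
  have hpi : p ∈ rayCone F.ray (c₀ ∩ s.1) := by
    rw [← F.inter_eq c₀ hc₀ s.1 s.mem_cones]
    exact ⟨hpc, hps⟩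
  have htc : t ⊆ c₀ := by
    intro j hj
    obtain ⟨a, -, ha⟩ := mem_rayCone.mp hpi
    have h1 := hs.isDual.covector_sum (hts hj) a (t := c₀ ∩ s.1) Finset.inter_subset_right
    have h2 := hs.isDual.covector_sum (hts hj) (fun _ => 1) hts
    rw [← ha] at h1
    rw [← hp, h1, if_pos hj] at h2
    by_contra hjc
    rw [if_neg (fun h => hjc (Finset.mem_inter.mp h).1)] at h2
    norm_num at h2
  have hic : i ∉ c₀ := by
    intro hic
    have hsc : s.1 ⊆ c₀ := fun j hj => by
      by_cases h : j = i
      · exact h ▸ hic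
      · exact htc (Finset.mem_erase.mpr ⟨h, hj⟩)
    have : s.1 = c₀ := Finset.eq_of_subset_of_card_le hsc ((F.card_le hc₀).trans_eq s.card_eq.symm)
    exact hxs N (by rw [this]; exact hmem N hN)
  have hct : ∃ b ∈ c₀, b ∉ t := by
    by_contra hcon
    push Not at hcon
    have : c₀ = t := Finset.Subset.antisymm hcon htc
    obtain ⟨a, ha, hxa⟩ := mem_rayCone.mp (hmem N hN)
    rw [this] at hxa
    have h1 := hs.isDual.covector_sum hi a hts
    rw [← hxa, hxi, if_neg (Finset.notMem_erase _ _)] at h1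
    norm_num at h1
  obtain ⟨b, hb, hbt⟩ := hct
  have htcard : t.card + 1 = n := by
    rw [← s.card_eq]
    exact Finset.card_erase_add_one hi
  have hcb : insert b t = c₀ := by
    refine Finset.eq_of_subset_of_card_le (Finset.insert_subset hb htc) ?_
    rw [Finset.card_insert_of_notMem hbt, htcard]
    exact F.card_le hc₀
  refine ⟨⟨c₀, Finset.mem_filter.mpr ⟨hc₀, ?_⟩⟩, b, hb, hic, ?_⟩
  · rw [← hcb, Finset.card_insert_of_notMem hbt, htcard]
  · show c₀.erase b = t
    rw [← hcb, Finset.erase_insert hbt]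

/-- `⟨ρ_b, m_i⟩` for the covector `m_i` dual to `ρ_i` in the cone `s`. -/
def dualCoord (s : F.MaxCone) (i b : Fin d) : ℤ := ∑ k, F.ray b k * F.dualVec s i k

theorem covector_dualVec (s : F.MaxCone) (i b : Fin d) :
    covector (F.dualVec s i) (realRay F.ray b) = (dualCoord s i b : ℝ) := covector_realRay _ _ _

/-- Two `n`-dimensional cones with a common facet lie on opposite sides of it. -/
theorem dualCoord_neg {s s' : F.MaxCone} {i b : Fin d} (hi : i ∈ s.1) (hb : b ∈ s'.1)
    (his : i ∉ s'.1) (h : s'.1.erase b = s.1.erase i) : dualCoord s i b < 0 := by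
  by_contra hneg
  push Not at hneg
  have hs := F.isDualFrame s
  have hs' := F.isDualFrame s'
  set t := s.1.erase i with ht
  have hts : t ⊆ s.1 := Finset.erase_subset _ _
  have hts' : t ⊆ s'.1 := h ▸ Finset.erase_subset _ _
  have hbt : b ∉ t := h ▸ Finset.notMem_erase _ _
  set K : ℝ := ∑ j ∈ s.1, |(dualCoord s j b : ℝ)| with hK
  have hKj : ∀ j ∈ s.1, |(dualCoord s j b : ℝ)| ≤ K := fun j hj =>
    Finset.single_le_sum (f := fun j => |(dualCoord s j b : ℝ)|) (fun _ _ => abs_nonneg _) hj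
  have hK0 : 0 ≤ K := Finset.sum_nonneg fun _ _ => abs_nonneg _
  set y : Fin n → ℝ := realRay F.ray b + ∑ j ∈ t, K • realRay F.ray j with hy
  have hys : y ∈ rayCone F.ray s.1 := by
    rw [hs.mem_rayCone_iff]
    intro v hv
    rw [hy, map_add, covector_dualVec, hs.isDual.covector_sum hv (fun _ => K) hts]
    by_cases hvi : v = i
    · rw [hvi, if_neg (Finset.notMem_erase _ _), add_zero]
      exact_mod_cast hneg
    · rw [if_pos (Finset.mem_erase.mpr ⟨hvi, hv⟩)]
      have := neg_abs_le (dualCoord s v b : ℝ)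
      linarith [hKj v hv]
  have hyb : covector (F.dualVec s' b) y = 1 := by
    rw [hy, map_add, hs'.isDual.covector_sum hb (fun _ => K) hts', if_neg hbt, covector_dualVec,
      dualCoord, hs'.pair b hb b hb]
    simp
  have hys' : y ∈ rayCone F.ray s'.1 := by
    refine mem_rayCone.mpr ⟨fun j => if j = b then 1 else K, fun j => ?_, ?_⟩
    · dsimp only
      split_ifs
      · norm_num
      · exact hK0
    · rw [← Finset.add_sum_erase _ _ hb, h, hy]
      simp only [if_true, one_smul]
      congr 1
      exact Finset.sum_congr rfl fun j hj => by
        simp only [if_neg (fun e : j = b => hbt (e ▸ hj))]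
  have hyi : y ∈ rayCone F.ray (s.1 ∩ s'.1) := by
    rw [← F.inter_eq s.1 s.mem_cones s'.1 s'.mem_cones]
    exact ⟨hys, hys'⟩
  obtain ⟨a, -, ha⟩ := mem_rayCone.mp hyi
  have hbi : b ∉ s.1 ∩ s'.1 := fun hbm => by
    have h1 := (Finset.mem_inter.mp hbm).1
    refine hbt (Finset.mem_erase.mpr ⟨fun e => his (e ▸ hb), h1⟩)
  have := hs'.isDual.covector_sum hb a (t := s.1 ∩ s'.1) Finset.inter_subset_right
  rw [← ha, hyb, if_neg hbi] at this
  norm_num at this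

/-- Coordinates with respect to the generators of an `n`-dimensional cone. -/
theorem ray_eq_sum (s : F.MaxCone) (b : Fin d) (l : Fin n) :
    F.ray b l = ∑ v ∈ s.1, dualCoord s v b * F.ray v l := by
  simp only [dualCoord, Finset.sum_mul]
  rw [Finset.sum_comm]
  have : ∀ k, ∑ v ∈ s.1, F.ray b k * F.dualVec s v k * F.ray v l
      = if k = l then F.ray b k else 0 := by
    intro k
    simp only [mul_assoc]
    rw [← Finset.mul_sum, (F.isDualFrame s).complete]
    split_ifs <;> simp
  simp [this]

theorem dualCoord_mul {s s' : F.MaxCone} {i b : Fin d} (hi : i ∈ s.1) (hb : b ∈ s'.1)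
    (h : s'.1.erase b = s.1.erase i) (x : Fin d) :
    dualCoord s' b i * dualCoord s i x = dualCoord s' b x := by
  have hs' := F.isDualFrame s'
  have e : dualCoord s' b x = ∑ v ∈ s.1, dualCoord s v x * dualCoord s' b v := by
    rw [dualCoord]
    rw [Finset.sum_congr rfl fun k _ => by rw [ray_eq_sum s x k]]
    simp only [Finset.sum_mul, mul_assoc]
    rw [Finset.sum_comm]
    refine Finset.sum_congr rfl fun v _ => ?_
    rw [dualCoord, dualCoord, Finset.mul_sum]
  rw [e, Finset.sum_eq_single_of_mem i hi, mul_comm]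
  intro v hv hvi
  have hvt : v ∈ s'.1.erase b := h ▸ Finset.mem_erase.mpr ⟨hvi, hv⟩
  have : dualCoord s' b v = 0 := by
    rw [dualCoord, hs'.pair b hb v (Finset.mem_of_mem_erase hvt),
      if_neg (Finset.ne_of_mem_erase hvt)]
  rw [this, mul_zero]

theorem notMem_of_erase_eq {s s' : F.MaxCone} {i b : Fin d} (hi : i ∈ s.1)
    (his : i ∉ s'.1) (hb : b ∈ s'.1) (h : s'.1.erase b = s.1.erase i) : b ∉ s.1 := fun hbs => by
  have hbi : b ≠ i := fun e => his (e ▸ hb)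
  exact Finset.notMem_erase b s'.1 (h ▸ Finset.mem_erase.mpr ⟨hbi, hbs⟩)

theorem dualCoord_eq_neg_one {s s' : F.MaxCone} {i b : Fin d} (hi : i ∈ s.1) (hb : b ∈ s'.1)
    (his : i ∉ s'.1) (h : s'.1.erase b = s.1.erase i) : dualCoord s i b = -1 := by
  have h1 := dualCoord_neg hi hb his h
  have h2 := dualCoord_mul hi hb h b
  have h3 : dualCoord s' b b = 1 := by
    rw [dualCoord, (F.isDualFrame s').pair b hb b hb, if_pos rfl]
  rw [h3] at h2
  rcases Int.mul_eq_one_iff_eq_one_or_neg_one.mp h2 with h4 | h4 <;> omega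

/-- The second `n`-dimensional cone containing a given facet is unique. -/
theorem neighbour_unique {s s₁ s₂ : F.MaxCone} {i b₁ b₂ : Fin d} (hi : i ∈ s.1)
    (hb₁ : b₁ ∈ s₁.1) (h₁ : i ∉ s₁.1) (e₁ : s₁.1.erase b₁ = s.1.erase i)
    (hb₂ : b₂ ∈ s₂.1) (h₂ : i ∉ s₂.1) (e₂ : s₂.1.erase b₂ = s.1.erase i) :
    s₁ = s₂ ∧ b₁ = b₂ := by
  by_cases hb : b₁ = b₂
  · refine ⟨Subtype.ext ?_, hb⟩
    rw [← Finset.insert_erase hb₁, ← Finset.insert_erase hb₂, e₁, e₂, hb]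
  exfalso
  have hn1 := notMem_of_erase_eq hi h₁ hb₁ e₁
  have hib : b₁ ∉ s₂.1 := fun hm =>
    Finset.notMem_erase b₁ s₁.1 (e₁.trans e₂.symm ▸ Finset.mem_erase.mpr ⟨hb, hm⟩)
  have p1 := dualCoord_eq_neg_one hi hb₁ h₁ e₁
  have p2 := dualCoord_eq_neg_one hi hb₂ h₂ e₂
  have p3 := dualCoord_eq_neg_one hb₁ hb₂ hib (e₂.trans e₁.symm)
  have q1 := dualCoord_mul hi hb₁ e₁ b₁
  have q2 := dualCoord_mul hi hb₁ e₁ b₂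
  have h3 : dualCoord s₁ b₁ b₁ = 1 := by
    rw [dualCoord, (F.isDualFrame s₁).pair b₁ hb₁ b₁ hb₁, if_pos rfl]
  rw [p1, h3] at q1
  rw [p2, p3] at q2
  omega

theorem mem_topIdx_inl {s : Finset (Fin d)} {i : Fin d} :
    (Sum.inlₗ i : Gen n d) ∈ topIdx (n := n) s ↔ i ∈ s := by
  constructor
  · intro h
    obtain ⟨x, hx, e⟩ := Finset.mem_map.mp h
    have : x = Sum.inl i := toLex.injective e
    subst this
    simpa using hx
  · intro h
    exact Finset.mem_map.mpr ⟨Sum.inl i, by simpa using h, rfl⟩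

theorem mem_topIdx_inr {s : Finset (Fin d)} (k : Fin n) :
    (Sum.inrₗ k : Gen n d) ∈ topIdx (n := n) s :=
  Finset.mem_map.mpr ⟨Sum.inr k, by simp, rfl⟩

theorem gen_cases {p : Gen n d → Prop} (h1 : ∀ i, p (Sum.inlₗ i)) (h2 : ∀ k, p (Sum.inrₗ k))
    (x : Gen n d) : p x := by
  rcases h : ofLex x with i | k
  · have : x = Sum.inlₗ i := ofLex.injective h
    exact this ▸ h1 i
  · have : x = Sum.inrₗ k := ofLex.injective h
    exact this ▸ h2 k

theorem leftSign_topIdx (s : Finset (Fin d)) (i : Fin d) :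
    leftSign (Sum.inlₗ i : Gen n d) (topIdx s) = (-1) ^ (s.filter fun j => j < i).card := by
  unfold leftSign
  congr 1
  refine (Finset.card_bij (fun j _ => (Sum.inlₗ j : Gen n d)) ?_ ?_ ?_).symm
  · intro j hj
    obtain ⟨h1, h2⟩ := Finset.mem_filter.mp hj
    exact Finset.mem_filter.mpr ⟨mem_topIdx_inl.mpr h1, Sum.Lex.inl_lt_inl_iff.mpr h2⟩
  · intro j _ j' _ h
    exact Sum.inl_injective (toLex.injective h)
  · intro x
    refine gen_cases (p := fun x => x ∈ (topIdx (n := n) s).filter (fun a => a < Sum.inlₗ i) →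
      ∃ a, ∃ _ : a ∈ s.filter fun j => j < i, (Sum.inlₗ a : Gen n d) = x) (fun j => ?_)
      (fun k => ?_) x
    · intro hj
      obtain ⟨h1, h2⟩ := Finset.mem_filter.mp hj
      exact ⟨j, Finset.mem_filter.mpr ⟨mem_topIdx_inl.mp h1, Sum.Lex.inl_lt_inl_iff.mp h2⟩, rfl⟩
    · intro hk
      exact absurd (Finset.mem_filter.mp hk).2 Sum.Lex.not_inr_lt_inl

theorem card_filter_lt_orderEmbOfFin {m : ℕ} {s : Finset (Fin d)} (h : s.card = m) (p : Fin m) :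
    (s.filter fun j => j < s.orderEmbOfFin h p).card = p := by
  have : (s.filter fun j => j < s.orderEmbOfFin h p)
      = (Finset.univ.filter fun q : Fin m => q < p).map (s.orderEmbOfFin h).toEmbedding := by
    ext j
    simp only [Finset.mem_filter, Finset.mem_map, Finset.mem_univ, true_and]
    constructor
    · rintro ⟨hj, hlt⟩
      have : j ∈ Set.range (s.orderEmbOfFin h) := by
        rw [Finset.range_orderEmbOfFin]; exact hj
      obtain ⟨q, rfl⟩ := this
      exact ⟨q, (OrderEmbedding.lt_iff_lt _).mp hlt, rfl⟩
    · rintro ⟨q, hq, rfl⟩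
      exact ⟨Finset.orderEmbOfFin_mem _ _ _, (OrderEmbedding.lt_iff_lt _).mpr hq⟩
  rw [this, Finset.card_map]
  have : (Finset.univ.filter fun q : Fin m => q < p) = Finset.Iio p := by ext; simp
  rw [this, Fin.card_Iio]

/-- The rows of the ordered determinant of a set of rays, expanded along the row of one ray. -/
theorem neg_one_pow_mul_det_updateRow {m : ℕ} (ray : Fin d → Fin (m + 1) → ℤ) {s : Finset (Fin d)}
    (h : s.card = m + 1) (p : Fin (m + 1)) {t : Finset (Fin d)}
    (ht : s.erase (s.orderEmbOfFin h p) = t) (htc : t.card = m) (x : Fin (m + 1) → ℤ) :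
    (-1) ^ (p : ℕ) * ((Matrix.of fun a k => ray (s.orderEmbOfFin h a) k).updateRow p x).det
      = ∑ j : Fin (m + 1), (-1) ^ (j : ℕ) * x j *
        (Matrix.of fun a k => ray (t.orderEmbOfFin htc a) (j.succAbove k)).det := by
  have he : ⇑(t.orderEmbOfFin htc) = fun a => s.orderEmbOfFin h (p.succAbove a) := by
    refine (Finset.orderEmbOfFin_unique htc (fun a => ?_) ?_).symm
    · rw [← ht]
      refine Finset.mem_erase.mpr ⟨fun e => ?_, Finset.orderEmbOfFin_mem _ _ _⟩
      exact Fin.succAbove_ne p a ((s.orderEmbOfFin h).injective e)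
    · exact (s.orderEmbOfFin h).strictMono.comp (Fin.strictMono_succAbove p)
  rw [Matrix.det_succ_row _ p, Finset.mul_sum]
  refine Finset.sum_congr rfl fun j _ => ?_
  rw [Matrix.updateRow_self, pow_add]
  have hm : ((Matrix.of fun a k => ray (s.orderEmbOfFin h a) k).updateRow p x).submatrix
      p.succAbove j.succAbove
      = Matrix.of fun a k => ray (t.orderEmbOfFin htc a) (j.succAbove k) := by
    ext a k
    rw [Matrix.submatrix_apply, Matrix.updateRow_ne (Fin.succAbove_ne p a), he]
    rfl
  rw [hm]
  have : ((-1 : ℤ) ^ (p : ℕ)) * (-1) ^ (p : ℕ) = 1 := by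
    rw [← mul_pow]; simp
  linear_combination ((-1 : ℤ) ^ (j : ℕ) * x j *
    (Matrix.of fun a k => ray (t.orderEmbOfFin htc a) (j.succAbove k)).det) * this

/-- The orientations induced on a facet by the two adjacent cones are opposite. -/
theorem leftSign_mul_coneDet {s s' : F.MaxCone} {i b : Fin d} (hi : i ∈ s.1) (hb : b ∈ s'.1)
    (his : i ∉ s'.1) (h : s'.1.erase b = s.1.erase i) :
    leftSign (Sum.inlₗ i : Gen n d) (topIdx s.1) * (F.coneDet s : ℂ)
      = -(leftSign (Sum.inlₗ b : Gen n d) (topIdx s'.1) * (F.coneDet s' : ℂ)) := by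
  obtain ⟨m, rfl⟩ : ∃ m, n = m + 1 := by
    refine Nat.exists_eq_succ_of_ne_zero fun h0 => ?_
    have := s.card_eq.trans h0
    rw [Finset.card_eq_zero] at this
    exact Finset.notMem_empty i (this ▸ hi)
  obtain ⟨p, hp⟩ : i ∈ Set.range (s.1.orderEmbOfFin s.card_eq) := by
    rw [Finset.range_orderEmbOfFin]; exact hi
  obtain ⟨q, hq⟩ : b ∈ Set.range (s'.1.orderEmbOfFin s'.card_eq) := by
    rw [Finset.range_orderEmbOfFin]; exact hb
  have htc : (s.1.erase i).card = m := by rw [Finset.card_erase_of_mem hi, s.card_eq]; rfl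
  have e1 := neg_one_pow_mul_det_updateRow F.ray s.card_eq p (by rw [hp]) htc (F.ray b)
  have e2 := neg_one_pow_mul_det_updateRow F.ray s'.card_eq q (by rw [hq]; exact h) htc (F.ray b)
  have u1 : ((Matrix.of fun a k => F.ray (s.1.orderEmbOfFin s.card_eq a) k).updateRow p
      (F.ray b)).det = - F.coneDet s := by
    have hr : F.ray b = ∑ a, dualCoord s (s.1.orderEmbOfFin s.card_eq a) b •
        (Matrix.of fun a k => F.ray (s.1.orderEmbOfFin s.card_eq a) k) a := by
      funext l
      rw [ray_eq_sum s b l, Finset.sum_apply]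
      conv_lhs => rw [← Finset.image_orderEmbOfFin_univ s.1 s.card_eq,
        Finset.sum_image fun x _ y _ hxy => (s.1.orderEmbOfFin s.card_eq).injective hxy]
      rfl
    conv_lhs => rw [hr]
    rw [Matrix.det_updateRow_sum, hp, dualCoord_eq_neg_one hi hb his h, neg_one_smul]
    rfl
  have u2 : ((Matrix.of fun a k => F.ray (s'.1.orderEmbOfFin s'.card_eq a) k).updateRow q
      (F.ray b)).det = F.coneDet s' := by
    rw [← hq]
    exact congrArg Matrix.det (Matrix.updateRow_eq_self _ q)
  rw [u1] at e1
  rw [u2] at e2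
  have e3 := e1.trans e2.symm
  have c1 := card_filter_lt_orderEmbOfFin s.card_eq p
  have c2 := card_filter_lt_orderEmbOfFin s'.card_eq q
  rw [hp] at c1
  rw [hq] at c2
  rw [leftSign_topIdx, leftSign_topIdx, c1, c2]
  have e4 := congrArg (Int.cast : ℤ → ℂ) e3
  push_cast at e4
  linear_combination -e4

end SmoothCompleteFan

theorem Sm.coe_sum {ι : Type*} {s : Finset (Fin d)} (T : Finset ι) (a : ι → Sm s) (z : s → ℂ) :
    (∑ i ∈ T, a i).val z = ∑ i ∈ T, (a i).val z := by
  classical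
  induction T using Finset.induction_on with
  | empty => simp
  | insert i T hi ih => rw [Finset.sum_insert hi, Finset.sum_insert hi, ← ih]; rfl

namespace Component

variable {ray m : Fin d → Fin n → ℤ} {s : Finset (Fin d)}

/-- The Euler vector field `z_v ∂/∂z_v`. -/
def eulerAt (s : Finset (Fin d)) (v : Fin d) : Module.End ℂ (Sm s) :=
  Sm.mulOp (Sm.coord s v) * Sm.dzOp s v

/-- The operator `∂`. -/
def delOp (ray : Fin d → Fin n → ℤ) (s : Finset (Fin d)) : Module.End ℂ (SFld n s) :=
  ∑ v ∈ s, cw n s (eulerAt s v) * deltaOp ray s v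

theorem dz_commute_coord {v w : Fin d} (h : v ≠ w) :
    Commute (Sm.mulOp (Sm.coord s v)) (Sm.dzOp s w) := by
  symm
  show _ * _ = _ * _
  rw [Sm.dzOp_mul_mulOp, Sm.dzOp_coord, if_neg (fun h' => h h'.2), Sm.mulOp_zero, add_zero]

theorem commute_mul_mul_two {R : Type*} [Ring R] {a b a' b' : R} (h1 : Commute a a')
    (h2 : Commute a b') (h3 : Commute b a') (h4 : Commute b b') : Commute (a * b) (a' * b') :=
  (h1.mul_left h3).mul_right (h2.mul_left h4)

theorem eulerAt_comm (v w : Fin d) : Commute (eulerAt s v) (eulerAt s w) := by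
  by_cases h : v = w
  · subst h; exact Commute.refl _
  · exact commute_mul_mul_two (Sm.mulOp_comm _ _) (dz_commute_coord h)
      (dz_commute_coord (Ne.symm h)).symm (Sm.dzOp_comm v w)

theorem eulerAt_coord_comm {v w : Fin d} (h : v ≠ w) :
    Commute (eulerAt s v) (Sm.mulOp (Sm.coord s w)) :=
  (Sm.mulOp_comm _ _).mul_left (dz_commute_coord (Ne.symm h)).symm

theorem dzbar_eulerAt_comm (v w : Fin d) : Commute (Sm.dzbarOp s v) (eulerAt s w) :=
  (mulOp_commute_of_dz (Sm.dzbarOp_coord v w) rfl).mul_right (Sm.dzbarOp_dzOp_comm v w)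

theorem cw_commute_delta (c : Module.End ℂ (Sm s)) (v : Fin d) :
    Commute (cw n s c) (deltaOp ray s v) := (cw_commute (m := ray) c v).2.2.2

theorem delOp_mul_delOp : delOp ray s * delOp ray s = 0 := by
  refine eq_zero_of_eq_neg ?_
  unfold delOp
  rw [Finset.sum_mul_sum]
  conv_rhs => rw [Finset.sum_comm]
  simp only [← Finset.sum_neg_distrib]
  exact Finset.sum_congr rfl fun v _ => Finset.sum_congr rfl fun w _ =>
    anticomm_of_commute (cw n s) (eulerAt_comm v w) (delta_anticomm_delta v w)
      (cw_commute_delta _ _) (cw_commute_delta _ _)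

theorem mul_delta_anticomm_euler (v w : Fin d) :
    (cw n s (Sm.mulOp (Sm.coord s v)) * deltaOp ray s v) * (cw n s (eulerAt s w) * deltaOp ray s w)
      = -((cw n s (eulerAt s w) * deltaOp ray s w)
        * (cw n s (Sm.mulOp (Sm.coord s v)) * deltaOp ray s v)) := by
  by_cases h : v = w
  · subst h
    have hd : deltaOp ray s v * deltaOp ray s v = 0 :=
      eq_zero_of_eq_neg (delta_anticomm_delta v v)
    rw [mul_mul_mul_of_commute (cw_commute_delta _ _).symm,
      mul_mul_mul_of_commute (cw_commute_delta _ _).symm, hd]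
    simp
  · exact anticomm_of_commute (cw n s) (eulerAt_coord_comm (Ne.symm h)).symm
      (delta_anticomm_delta v w) (cw_commute_delta _ _) (cw_commute_delta _ _)

theorem diff_anticomm_delOp : diff ray s * delOp ray s = -(delOp ray s * diff ray s) := by
  unfold diff delOp
  rw [Finset.sum_mul_sum, Finset.sum_mul_sum]
  conv_rhs => rw [Finset.sum_comm]
  simp only [← Finset.sum_neg_distrib]
  refine Finset.sum_congr rfl fun v _ => Finset.sum_congr rfl fun w _ => ?_
  unfold diffAt oneVarDiff
  rw [add_mul, mul_add, mul_delta_anticomm_euler,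
    anticomm_of_commute (cw n s) (dzbar_eulerAt_comm v w) (anticomm_symm (delta_anticomm_e w v))
      (coeffwise_creation _ _) (cw_commute_delta _ _), neg_add]

end Component

open Component

namespace SmoothCompleteFan

variable {F : SmoothCompleteFan n d}

/-- The coefficients of a log polyvector field on the component `X_s`. -/
def emb (s : F.MaxCone) : F.PV →ₗ[ℂ] SFld n s.1 where
  toFun α := fun A => Sm.mk (α.1 s A) (α.2.1 s A)
  map_add' _ _ := rfl
  map_smul' _ _ := rfl

theorem emb_val (s : F.MaxCone) (α : F.PV) (A : Finset (Gen n d)) :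
    (emb s α A).val = α.1 s A := rfl

theorem PV_ext {α β : F.PV} (h : ∀ s, emb s α = emb s β) : α = β :=
  Subtype.ext <| funext fun s => funext fun A => congrArg Sm.val (congrFun (h s) A)

/-- The differential `\bar∂ + {f, -}`. -/
def baseDiff (F : SmoothCompleteFan n d) : F.PV →ₗ[ℂ] F.PV := F.dbarPV + F.bracketPV

theorem emb_dbarPV (s : F.MaxCone) (α : F.PV) :
    emb s (F.dbarPV α) = (∑ v ∈ s.1, cw n s.1 (Sm.dzbarOp s.1 v) * eOp n s.1 v) (emb s α) := by
  funext A
  refine Sm.ext fun z => ?_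
  have h1 : (∑ v ∈ s.1, cw n s.1 (Sm.dzbarOp s.1 v) * eOp n s.1 v)
      = ∑ v, eOp n s.1 v * cw n s.1 (Sm.dzbarOp s.1 v) := by
    rw [← Finset.sum_subset (Finset.subset_univ s.1)]
    · exact Finset.sum_congr rfl fun v _ => coeffwise_creation _ _
    · intro v _ hv
      rw [Sm.dzbarOp_eq_zero hv, map_zero, mul_zero]
  rw [h1, LinearMap.sum_apply, Finset.sum_apply]
  show (∑ i : Fin d, genMul (Sum.inlₗ i) fun B => dzbar s.1 i (α.1 s B)) A z = _
  rw [Finset.sum_apply, Finset.sum_apply, Sm.coe_sum]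
  refine Finset.sum_congr rfl fun i _ => ?_
  rw [Module.End.mul_apply]
  show _ = (genMul (Sum.inlₗ i) (cw n s.1 (Sm.dzbarOp s.1 i) (emb s α)) A).val z
  simp only [genMul]
  split_ifs
  · rfl
  · rfl

theorem genDer_val (s : F.MaxCone) (α : F.PV) (x : Gen n d) (A : Finset (Gen n d)) :
    (annihilation (Sm s.1) x (emb s α) A).val = genDer x (α.1 s) A := by
  rw [annihilation_apply]
  simp only [genDer]
  split_ifs
  · rfl
  · rfl

theorem emb_bracketPV (s : F.MaxCone) (α : F.PV) :
    emb s (F.bracketPV α)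
      = (∑ v ∈ s.1, cw n s.1 (Sm.mulOp (Sm.coord s.1 v)) * deltaOp F.ray s.1 v) (emb s α) := by
  funext A
  refine Sm.ext fun z => ?_
  have h1 : (∑ v ∈ s.1, cw n s.1 (Sm.mulOp (Sm.coord s.1 v)) * deltaOp F.ray s.1 v)
      = ∑ v, cw n s.1 (Sm.mulOp (Sm.coord s.1 v)) * deltaOp F.ray s.1 v := by
    rw [← Finset.sum_subset (Finset.subset_univ s.1)]
    intro v _ hv
    rw [Sm.coord_eq_zero hv, Sm.mulOp_zero, map_zero, zero_mul]
  rw [h1, LinearMap.sum_apply, Finset.sum_apply, Sm.coe_sum]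
  show (∑ k : Fin n, fun B => F.g s.1 k * genDer (Sum.inrₗ k) (α.1 s) B) A z = _
  rw [Finset.sum_apply, Finset.sum_apply]
  simp only [Pi.mul_apply, g, Finset.sum_mul]
  rw [Finset.sum_comm]
  refine Finset.sum_congr rfl fun i _ => ?_
  rw [Module.End.mul_apply, coeffwise_apply]
  show _ = incl s.1 z i * (deltaOp F.ray s.1 i (emb s α) A).val z
  unfold deltaOp
  rw [LinearMap.sum_apply, Finset.sum_apply, Sm.coe_sum, Finset.mul_sum]
  refine Finset.sum_congr rfl fun k _ => ?_
  rw [LinearMap.smul_apply, Pi.smul_apply, Sm.coe_smul, genDer_val]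
  ring

theorem emb_delPV (s : F.MaxCone) (α : F.PV) :
    emb s (F.delPV α) = delOp F.ray s.1 (emb s α) := by
  funext A
  refine Sm.ext fun z => ?_
  have h1 : delOp F.ray s.1 = ∑ v, cw n s.1 (eulerAt s.1 v) * deltaOp F.ray s.1 v := by
    unfold delOp
    rw [← Finset.sum_subset (Finset.subset_univ s.1)]
    intro v _ hv
    rw [eulerAt, Sm.coord_eq_zero hv, Sm.mulOp_zero, zero_mul, map_zero, zero_mul]
  rw [h1, LinearMap.sum_apply, Finset.sum_apply, Sm.coe_sum]
  show (∑ k : Fin n, fun B => F.theta s.1 k (genDer (Sum.inrₗ k) (α.1 s) B)) A z = _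
  rw [Finset.sum_apply, Finset.sum_apply]
  simp only [theta]
  rw [Finset.sum_comm]
  refine Finset.sum_congr rfl fun i _ => ?_
  rw [Module.End.mul_apply, coeffwise_apply]
  unfold deltaOp
  rw [LinearMap.sum_apply, Finset.sum_apply, map_sum, Sm.coe_sum]
  refine Finset.sum_congr rfl fun k _ => ?_
  rw [LinearMap.smul_apply, Pi.smul_apply, map_smul, Sm.coe_smul, mul_assoc]
  congr 1
  show _ = incl s.1 z i * dz s.1 i (annihilation (Sm s.1) (Sum.inrₗ k) (emb s α) A).val z
  rw [genDer_val]

theorem emb_baseDiff (s : F.MaxCone) (α : F.PV) :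
    emb s (F.baseDiff α) = diff F.ray s.1 (emb s α) := by
  rw [baseDiff, LinearMap.add_apply, map_add, emb_dbarPV, emb_bracketPV, ← LinearMap.add_apply,
    ← Finset.sum_add_distrib]
  rfl

theorem baseDiff_baseDiff (α : F.PV) : F.baseDiff (F.baseDiff α) = 0 :=
  PV_ext fun s => by
    rw [emb_baseDiff, emb_baseDiff, map_zero]
    exact LinearMap.congr_fun (diff_mul_diff F.ray) _

theorem delPV_delPV (α : F.PV) : F.delPV (F.delPV α) = 0 :=
  PV_ext fun s => by
    rw [emb_delPV, emb_delPV, map_zero]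
    exact LinearMap.congr_fun delOp_mul_delOp _

theorem baseDiff_delPV (α : F.PV) : F.baseDiff (F.delPV α) = -F.delPV (F.baseDiff α) :=
  PV_ext fun s => by
    rw [emb_baseDiff, emb_delPV, map_neg, emb_delPV, emb_baseDiff]
    exact LinearMap.congr_fun diff_anticomm_delOp _

/-- The monomial `P(τ)` in `PV_log(X)`. -/
def monomialPV (F : SmoothCompleteFan n d) (τ : Finset (Fin d)) : F.PV :=
  ⟨F.monomialField τ, F.monomialField_mem τ⟩

theorem emb_monomialPV (s : F.MaxCone) (τ : Finset (Fin d)) :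
    emb s (F.monomialPV τ) = monoFld n s.1 τ := by
  funext A
  refine Sm.ext fun z => ?_
  show (if A = ∅ then ∏ i ∈ τ, incl s.1 z i else 0) = _
  simp only [monoFld]
  split_ifs
  · rw [coe_prod]; rfl
  · rfl

theorem monomialPV_closed (τ : Finset (Fin d)) :
    F.baseDiff (F.monomialPV τ) = 0 ∧ F.delPV (F.monomialPV τ) = 0 := by
  have h : ∀ s : F.MaxCone, ∀ v, deltaOp F.ray s.1 v (monoFld n s.1 τ) = 0 := fun s v => by
    simp [deltaOp, annihilation_monoFld]
  constructor
  · refine PV_ext fun s => ?_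
    rw [emb_baseDiff, emb_monomialPV, map_zero]
    exact diff_eq_zero_of_isReduced fun v hv => isReducedAt_monoFld hv
  · refine PV_ext fun s => ?_
    rw [emb_delPV, emb_monomialPV, map_zero, delOp, LinearMap.sum_apply]
    refine Finset.sum_eq_zero fun v _ => ?_
    rw [Module.End.mul_apply, h, map_zero]

end SmoothCompleteFan

open Component

theorem eq_zero_of_not_leftIn {s : Finset (Fin d)} {a : SFld n s}
    (ha : ∀ i ∉ s, iOp n s i a = 0) {A : Finset (Gen n d)} (hA : ¬ LeftIn A s) : a A = 0 := by
  simp only [LeftIn, not_forall] at hA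
  obtain ⟨i, hi, his⟩ := hA
  exact annihilation_eq_zero_iff (ha i his) hi

theorem pullbackAt_apply {s : Finset (Fin d)} (k : Fin d) (a : SFld n s) (A : Finset (Gen n d)) :
    pullbackAt n s k a A = if (Sum.inlₗ k : Gen n d) ∈ A then 0 else Sm.restr k (a A) := by
  unfold pullbackAt
  rw [Module.End.mul_apply, coeffwise_apply, LinearMap.sub_apply, Module.End.one_apply,
    Module.End.mul_apply, Pi.sub_apply]
  show Sm.restr k (a A - genMul (Sum.inlₗ k) (genDer (Sum.inlₗ k) a) A) = _
  by_cases h : (Sum.inlₗ k : Gen n d) ∈ A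
  · rw [if_pos h]
    simp only [genMul, genDer, if_pos h, Finset.notMem_erase, if_false, Finset.insert_erase h]
    rw [smul_smul, leftSign_erase h, if_neg (lt_irrefl _), leftSign_mul_self, one_smul, sub_self, map_zero]
  · rw [if_neg h]
    simp [genMul, h]

namespace SmoothCompleteFan

variable {F : SmoothCompleteFan n d}

theorem proj_incl {s : Finset (Fin d)} (z : s → ℂ) : proj s (incl s z) = z := by
  funext i
  simp [proj, incl, i.2]

/-- The linear map `X_t → X_s` which sets the coordinates outside of `s` to zero. -/
def transfer (t s : Finset (Fin d)) : (t → ℂ) →L[ℝ] (s → ℂ) :=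
  LinearMap.toContinuousLinearMap
    { toFun := fun z => proj s (incl t z)
      map_add' := fun z w => funext fun i => Sm.incl_add z w i
      map_smul' := fun c z => funext fun i => Sm.incl_smul c z i }

theorem transfer_apply (t s : Finset (Fin d)) (z : t → ℂ) : transfer t s z = proj s (incl t z) :=
  rfl

open Classical in
/-- The extension of a field on `X_s` by pullback along the projections `X_t → X_s ∩ X_t`. -/
def extend (s : F.MaxCone) (a : SFld n s.1) : F.PV where
  val := fun t A w => if LeftIn A s.1 ∧ LeftIn A t.1 then (a A).val (transfer t.1 s.1 w) else 0
  property := by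
    refine ⟨fun t A => ?_, fun t A hA => ?_, fun t t' A ht ht' w hw => ?_⟩
    · by_cases h : LeftIn A s.1 ∧ LeftIn A t.1
      · simp only [if_pos h]
        exact (a A).contDiff.comp (transfer t.1 s.1).contDiff
      · simp only [if_neg h]
        exact contDiff_const
    · funext w
      exact if_neg fun h => hA h.2
    · simp only [ht, ht', and_true, transfer_apply]
      rw [incl_proj (fun i hi => hw i fun h => hi (Finset.mem_inter.mp h).1),
        incl_proj (fun i hi => hw i fun h => hi (Finset.mem_inter.mp h).2)]

theorem emb_extend (s : F.MaxCone) {a : SFld n s.1} (ha : ∀ i ∉ s.1, iOp n s.1 i a = 0) :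
    emb s (extend s a) = a := by
  classical
  funext A
  refine Sm.ext fun z => ?_
  show (if LeftIn A s.1 ∧ LeftIn A s.1 then (a A).val (transfer s.1 s.1 z) else 0) = _
  rw [transfer_apply, proj_incl]
  by_cases h : LeftIn A s.1
  · rw [if_pos ⟨h, h⟩]
  · rw [if_neg fun h' => h h'.1, eq_zero_of_not_leftIn ha h]
    rfl

theorem emb_extend_eq_zero (s t : F.MaxCone) {τ : Finset (Fin d)} {a : SFld n s.1}
    (ha : a ∈ relative n s.1 τ) {k : Fin d} (hk : k ∈ τ) (hkt : k ∉ t.1) :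
    emb t (extend s a) = 0 := by
  classical
  funext A
  refine Sm.ext fun z => ?_
  show (if LeftIn A s.1 ∧ LeftIn A t.1 then (a A).val (transfer t.1 s.1 z) else 0) = 0
  split_ifs with h
  · have h1 := congrFun (ha.2 k hk) A
    rw [pullbackAt_apply, if_neg (fun h' => hkt (h.2 k h'))] at h1
    have h2 := congrFun (congrArg Sm.val h1) (transfer t.1 s.1 z)
    rw [Sm.restr_apply] at h2
    have h3 : Sm.scale k 0 (transfer t.1 s.1 z) = transfer t.1 s.1 z := by
      funext i
      simp only [Sm.scale]
      split_ifs with hik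
      · rw [transfer_apply]
        simp [proj, incl, hik, hkt]
      · rfl
    rw [h3] at h2
    exact h2
  · rfl

theorem iOp_emb (s : F.MaxCone) (α : F.PV) {i : Fin d} (hi : i ∉ s.1) :
    iOp n s.1 i (emb s α) = 0 := by
  funext A
  refine Sm.ext fun z => ?_
  show (annihilation (Sm s.1) _ (emb s α) A).val z = 0
  rw [genDer_val]
  simp only [genDer]
  split_ifs
  · rfl
  · rw [α.2.2.1 s _ fun h => hi (h i (Finset.mem_insert_self _ _))]
    simp

/-- The fields which vanish on the first `i` components. -/
def VanishesBelow {μ : ℕ} (σ : Fin μ ≃ F.MaxCone) (i : ℕ) (α : F.PV) : Prop :=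
  ∀ j : Fin μ, (j : ℕ) < i → emb (σ j) α = 0

section Order

variable {μ : ℕ} {σ : Fin μ ≃ F.MaxCone}

theorem tau_subset (i : Fin μ) : F.tau σ i ⊆ (σ i).1 := Finset.filter_subset _ _

theorem mem_relative_of_vanishesBelow {i : Fin μ} {α : F.PV}
    (h : VanishesBelow σ i α) : emb (σ i) α ∈ relative n (σ i).1 (F.tau σ i) := by
  refine ⟨fun k hk => iOp_emb _ _ hk, fun k hk => ?_⟩
  have hki := tau_subset i hk
  obtain ⟨s', b, hb, hks, he⟩ := exists_neighbour (σ i) hki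
  obtain ⟨j, rfl⟩ := σ.surjective s'
  have hcap : (σ i).1 ∩ (σ j).1 = (σ i).1.erase k := by
    ext x
    simp only [Finset.mem_inter, Finset.mem_erase]
    constructor
    · rintro ⟨h1, h2⟩
      exact ⟨fun e => hks (e ▸ h2), h1⟩
    · rintro ⟨h1, h2⟩
      refine ⟨h2, ?_⟩
      have : x ∈ (σ j).1.erase b := he ▸ Finset.mem_erase.mpr ⟨h1, h2⟩
      exact Finset.mem_of_mem_erase this
  have hlt : (j : ℕ) < i := by
    by_contra hge
    have hne : i ≠ j := fun e => hks (e ▸ hki)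
    have hij : i < j := lt_of_le_of_ne (not_lt.mp hge) hne
    refine hks ((Finset.mem_filter.mp hk).2 j hij ?_)
    rw [hcap, Finset.card_erase_add_one hki, (σ i).card_eq]
  have hz := h j hlt
  funext A
  rw [pullbackAt_apply]
  split_ifs with hA
  · rfl
  refine Sm.ext fun z => ?_
  rw [Sm.restr_apply, emb_val]
  by_cases hL : LeftIn A (σ i).1
  swap
  · rw [α.2.2.1 _ A hL]; rfl
  have hL' : LeftIn A (σ j).1 := by
    intro x hx
    have hxk : x ≠ k := fun e => hA (e ▸ hx)
    have : x ∈ (σ i).1 ∩ (σ j).1 := hcap ▸ Finset.mem_erase.mpr ⟨hxk, hL x hx⟩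
    exact (Finset.mem_inter.mp this).2
  have hc := α.2.2.2 (σ i) (σ j) A hL hL' (incl (σ i).1 (Sm.scale k 0 z)) fun x hx => by
    rw [Sm.incl_scale]
    split_ifs with hxk
    · simp
    · rw [hcap, Finset.mem_erase] at hx
      have : x ∉ (σ i).1 := fun h' => hx ⟨hxk, h'⟩
      simp [incl, this]
  rw [proj_incl] at hc
  rw [hc]
  exact congrFun (congrArg Sm.val (congrFun hz A)) _

variable (hσ : F.IsGoodOrder σ)

theorem exists_mem_tau (hσ : F.IsGoodOrder σ) {i j : Fin μ} (h : (j : ℕ) < i) :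
    ∃ k ∈ F.tau σ i, k ∉ (σ j).1 := by
  by_contra hcon
  push Not at hcon
  exact absurd (hσ i j hcon) (not_le.mpr h)

theorem emb_monomialPV_eq_zero (hσ : F.IsGoodOrder σ) {i j : Fin μ} (h : (j : ℕ) < i) :
    emb (σ j) (F.monomialPV (F.tau σ i)) = 0 := by
  obtain ⟨k, hk, hkj⟩ := exists_mem_tau hσ h
  rw [emb_monomialPV]
  funext A
  simp only [monoFld]
  split_ifs
  · exact Finset.prod_eq_zero hk (Sm.coord_eq_zero hkj)
  · rfl

theorem VanishesBelow.succ {i : Fin μ} {α : F.PV} (h : VanishesBelow σ i α)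
    (hi : emb (σ i) α = 0) : VanishesBelow σ (i + 1) α := by
  intro j hj
  rcases Nat.lt_succ_iff_lt_or_eq.mp hj with hlt | heq
  · exact h j hlt
  · rw [Fin.ext heq]; exact hi

/-- A closed field which vanishes on the first `i` components can be made to vanish on the next
one by subtracting a multiple of `φ_i` and an exact field. -/
theorem exists_reduce (hσ : F.IsGoodOrder σ) {i : Fin μ} {α : F.PV} (h : VanishesBelow σ i α)
    (hd : emb (σ i) (F.baseDiff α) = 0) :
    ∃ (c : ℂ) (β : F.PV),
      VanishesBelow σ (i + 1) (α - c • F.monomialPV (F.tau σ i) - F.baseDiff β) := by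
  rw [emb_baseDiff] at hd
  obtain ⟨c, β, hβ, e⟩ := exists_primitive (F.isDualFrame (σ i)) (tau_subset i)
    (mem_relative_of_vanishesBelow h) hd
  refine ⟨c, extend (σ i) β, VanishesBelow.succ (fun j hj => ?_) ?_⟩
  · obtain ⟨k, hk, hkj⟩ := exists_mem_tau hσ hj
    rw [map_sub, map_sub, map_smul, h j hj, emb_monomialPV_eq_zero hσ hj, emb_baseDiff,
      emb_extend_eq_zero (σ i) (σ j) hβ hk hkj, map_zero, smul_zero, sub_zero, sub_zero]
  · rw [map_sub, map_sub, map_smul, emb_monomialPV, emb_baseDiff, emb_extend (σ i) hβ.1, e]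
    abel

theorem exists_decomposition (hσ : F.IsGoodOrder σ) (α : F.PV) (hα : F.baseDiff α = 0) :
    ∃ (c : Fin μ → ℂ) (β : F.PV),
      α = ∑ j, c j • F.monomialPV (F.tau σ j) + F.baseDiff β := by
  have key : ∀ (m i : ℕ), i + m = μ → ∀ α : F.PV, VanishesBelow σ i α → F.baseDiff α = 0 →
      ∃ (c : Fin μ → ℂ) (β : F.PV),
        α = ∑ j, c j • F.monomialPV (F.tau σ j) + F.baseDiff β := by
    intro m
    induction m with
    | zero =>
      intro i hi α hv _
      refine ⟨0, 0, ?_⟩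
      have : α = 0 := PV_ext fun s => by
        obtain ⟨j, rfl⟩ := σ.surjective s
        rw [hv j (by omega), map_zero]
      simp [this]
    | succ m ih =>
      intro i hi α hv hd
      have hlt : i < μ := by omega
      obtain ⟨c, β, hr⟩ := exists_reduce hσ (i := ⟨i, hlt⟩) hv (by rw [hd, map_zero])
      obtain ⟨c', β', e⟩ := ih (i + 1) (by omega) _ hr (by
        rw [map_sub, map_sub, map_smul, hd, (monomialPV_closed _).1, baseDiff_baseDiff]; simp)
      refine ⟨c' + Pi.single ⟨i, hlt⟩ c, β' + β, ?_⟩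
      simp only [Pi.add_apply, add_smul, Finset.sum_add_distrib, map_add, Pi.single_apply, ite_smul,
        zero_smul, Finset.sum_ite_eq', Finset.mem_univ, if_true]
      rw [sub_sub, sub_eq_iff_eq_add] at e
      rw [e]
      abel
  exact key μ 0 (by simp) α (fun j hj => absurd hj (by simp)) hα

theorem eq_zero_of_sum_eq (hσ : F.IsGoodOrder σ) (c : Fin μ → ℂ) (β : F.PV)
    (h : ∑ j, c j • F.monomialPV (F.tau σ j) = F.baseDiff β) : c = 0 := by
  have key : ∀ i : ℕ, i ≤ μ → (∀ j : Fin μ, (j : ℕ) < i → c j = 0) ∧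
      ∃ β' : F.PV, VanishesBelow σ i β' ∧
        ∑ j, c j • F.monomialPV (F.tau σ j) = F.baseDiff β' := by
    intro i
    induction i with
    | zero => exact fun _ => ⟨fun j hj => absurd hj (by simp),
        β, fun j hj => absurd hj (by simp), h⟩
    | succ i ih =>
      intro hi
      obtain ⟨h0, β', hv, e⟩ := ih (by omega)
      have hlt : i < μ := by omega
      have e1 : c ⟨i, hlt⟩ • monoFld n (σ ⟨i, hlt⟩).1 (F.tau σ ⟨i, hlt⟩)
          = diff F.ray (σ ⟨i, hlt⟩).1 (emb (σ ⟨i, hlt⟩) β') := by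
        rw [← emb_baseDiff, ← e, map_sum, Finset.sum_eq_single ⟨i, hlt⟩]
        · rw [map_smul, emb_monomialPV]
        · intro j _ hj
          rw [map_smul]
          rcases lt_trichotomy (j : ℕ) i with hji | hji | hji
          · rw [h0 j hji, zero_smul]
          · exact absurd (Fin.ext hji) hj
          · rw [emb_monomialPV_eq_zero hσ hji, smul_zero]
        · simp
      have hc := eq_zero_of_monoFld_exact (F.isDualFrame (σ ⟨i, hlt⟩)) (tau_subset _)
        (mem_relative_of_vanishesBelow (i := ⟨i, hlt⟩) hv) e1
      refine ⟨fun j hj => ?_, ?_⟩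
      · rcases Nat.lt_succ_iff_lt_or_eq.mp hj with hji | hji
        · exact h0 j hji
        · rw [show j = ⟨i, hlt⟩ from Fin.ext hji, hc]
      · obtain ⟨a, γ, hr⟩ := exists_reduce hσ (i := ⟨i, hlt⟩) hv (by
          rw [emb_baseDiff, ← e1, hc, zero_smul])
        refine ⟨_, hr, ?_⟩
        rw [e, map_sub, map_sub, map_smul, (monomialPV_closed _).1, baseDiff_baseDiff]
        simp
  exact funext fun j => (key μ le_rfl).1 j j.2

end Order

end SmoothCompleteFan

open Component

namespace SmoothCompleteFan

variable {F : SmoothCompleteFan n d}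

theorem coeff_Qf_zero (β : USeries F.PV) : (F.Qf β).coeff 0 = F.baseDiff (β.coeff 0) :=
  add_zero _

theorem coeff_Qf_succ (β : USeries F.PV) (k : ℕ) :
    (F.Qf β).coeff (k + 1) = F.baseDiff (β.coeff (k + 1)) + F.delPV (β.coeff k) := rfl

theorem coeff_sum {ι : Type*} (T : Finset ι) (a : ι → USeries F.PV) (k : ℕ) :
    (∑ i ∈ T, a i).coeff k = ∑ i ∈ T, (a i).coeff k := by
  classical
  induction T using Finset.induction_on with
  | empty => rfl
  | insert i T hi ih => rw [Finset.sum_insert hi, Finset.sum_insert hi, USeries.coeff_add, ih]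

theorem coeff_smul_monomial (c : ℂ⟦X⟧) (τ : Finset (Fin d)) (k : ℕ) :
    (c • F.monomial τ).coeff k = PowerSeries.coeff k c • F.monomialPV τ := by
  rw [USeries.coeff_smul, Finset.sum_eq_single (k, 0)]
  · rfl
  · rintro ⟨a, b⟩ hp hne
    have hb : b ≠ 0 := by
      rintro rfl
      exact hne (by simpa using hp)
    have : (F.monomial τ).coeff b = 0 := if_neg hb
    rw [this, smul_zero]
  · simp

theorem Qf_Qf (α : USeries F.PV) : F.Qf (F.Qf α) = 0 := by
  refine USeries.ext fun k => ?_
  rcases k with _ | _ | k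
  · rw [coeff_Qf_zero, coeff_Qf_zero, baseDiff_baseDiff]; rfl
  · rw [coeff_Qf_succ, coeff_Qf_succ, coeff_Qf_zero, map_add, baseDiff_baseDiff, baseDiff_delPV,
      zero_add, neg_add_cancel]; rfl
  · rw [coeff_Qf_succ, coeff_Qf_succ, coeff_Qf_succ, map_add, map_add, baseDiff_baseDiff,
      baseDiff_delPV, delPV_delPV, zero_add, add_zero, neg_add_cancel]; rfl

section Order

variable {μ : ℕ} {σ : Fin μ ≃ F.MaxCone}

/-- Every cocycle is cohomologous to a combination of the `φ_j`. -/
theorem exists_series_decomposition (hσ : F.IsGoodOrder σ) {α : USeries F.PV}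
    (hα : F.Qf α = 0) :
    ∃ (c : Fin μ → ℂ⟦X⟧) (β : USeries F.PV),
      α = ∑ j, c j • F.monomial (F.tau σ j) + F.Qf β := by
  have h0 : ∀ x : F.PV, ∃ (c : Fin μ → ℂ) (β : F.PV), F.baseDiff x = 0 →
      x = ∑ j, c j • F.monomialPV (F.tau σ j) + F.baseDiff β := by
    intro x
    by_cases hx : F.baseDiff x = 0
    · obtain ⟨c, β, e⟩ := exists_decomposition hσ x hx
      exact ⟨c, β, fun _ => e⟩
    · exact ⟨0, 0, fun h => absurd h hx⟩
  choose C B hCB using h0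
  let b : ℕ → F.PV := fun k => Nat.rec (B (α.coeff 0)) (fun k y => B (α.coeff (k + 1) - F.delPV y)) k
  let x : ℕ → F.PV := fun k => Nat.casesOn k (α.coeff 0) (fun k => α.coeff (k + 1) - F.delPV (b k))
  have hb : ∀ k, b k = B (x k) := fun k => by cases k <;> rfl
  have hd : ∀ k, F.baseDiff (x k) = 0 := by
    intro k
    induction k with
    | zero =>
      show F.baseDiff (α.coeff 0) = 0
      rw [← coeff_Qf_zero, hα]; rfl
    | succ k ih =>
      show F.baseDiff (α.coeff (k + 1) - F.delPV (b k)) = 0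
      have e1 : F.baseDiff (α.coeff (k + 1)) + F.delPV (α.coeff k) = 0 := by
        rw [← coeff_Qf_succ, hα]; rfl
      have e2 := hCB (x k) ih
      rw [← hb] at e2
      have e3 : F.delPV (x k) = F.delPV (F.baseDiff (b k)) := by
        conv_lhs => rw [e2]
        rw [map_add, map_sum, Finset.sum_eq_zero, zero_add]
        intro j _
        rw [map_smul, (monomialPV_closed _).2, smul_zero]
      have e4 : F.delPV (x k) = F.delPV (α.coeff k) := by
        cases k with
        | zero => rfl
        | succ k =>
          show F.delPV (α.coeff (k + 1) - F.delPV (b k)) = _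
          rw [map_sub, delPV_delPV, sub_zero]
      rw [map_sub, baseDiff_delPV, ← e3, e4, sub_neg_eq_add, e1]
  refine ⟨fun j => PowerSeries.mk fun k => C (x k) j, USeries.mk b, USeries.ext fun k => ?_⟩
  rw [USeries.coeff_add, coeff_sum]
  simp only [coeff_smul_monomial, PowerSeries.coeff_mk]
  have e := hCB (x k) (hd k)
  rw [← hb] at e
  cases k with
  | zero =>
    rw [coeff_Qf_zero]
    exact e
  | succ k =>
    rw [coeff_Qf_succ, ← add_assoc]
    exact sub_eq_iff_eq_add.mp e

theorem eq_zero_of_series_sum_eq (hσ : F.IsGoodOrder σ) (c : Fin μ → ℂ⟦X⟧) (β : USeries F.PV)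
    (h : ∑ j, c j • F.monomial (F.tau σ j) = F.Qf β) : c = 0 := by
  have e : ∀ k, ∑ j, PowerSeries.coeff k (c j) • F.monomialPV (F.tau σ j) = (F.Qf β).coeff k := by
    intro k
    rw [← h, coeff_sum]
    exact Finset.sum_congr rfl fun j _ => (coeff_smul_monomial _ _ _).symm
  have step : ∀ (a : Fin μ → ℂ) (x : F.PV), ∑ j, a j • F.monomialPV (F.tau σ j) = F.baseDiff x →
      a = 0 ∧ ∃ γ, F.delPV x = -F.baseDiff (F.delPV γ) := by
    intro a x hx
    have ha := eq_zero_of_sum_eq hσ a x hx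
    have hx0 : F.baseDiff x = 0 := by rw [← hx, ha]; simp
    obtain ⟨c', γ, e'⟩ := exists_decomposition hσ x hx0
    refine ⟨ha, γ, ?_⟩
    rw [e', map_add, map_sum, Finset.sum_eq_zero, zero_add, baseDiff_delPV, neg_neg]
    intro j _
    rw [map_smul, (monomialPV_closed _).2, smul_zero]
  have key : ∀ k, (fun j => PowerSeries.coeff k (c j)) = 0 ∧
      ∃ γ, F.delPV (β.coeff k) = -F.baseDiff (F.delPV γ) := by
    intro k
    induction k with
    | zero => exact step _ _ ((e 0).trans (coeff_Qf_zero β))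
    | succ k ih =>
      obtain ⟨-, γ, hγ⟩ := ih
      have e1 := e (k + 1)
      rw [coeff_Qf_succ, hγ, ← sub_eq_add_neg, ← map_sub] at e1
      obtain ⟨h1, γ', h2⟩ := step _ _ e1
      refine ⟨h1, γ', ?_⟩
      rw [← h2, map_sub, delPV_delPV, sub_zero]
  funext j
  ext k
  exact congrFun (key k).1 j

theorem cls_eq_iff {α β : F.Cocycle} :
    F.cls α = F.cls β ↔ ∃ γ, (α : USeries F.PV) - β = F.Qf γ := by
  unfold cls
  rw [Submodule.Quotient.eq]
  constructor
  · rintro ⟨γ, h⟩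
    exact ⟨γ, h.symm⟩
  · rintro ⟨γ, h⟩
    exact ⟨γ, h.symm⟩

theorem sum_smul_monomialClass (c : Fin μ → ℂ⟦X⟧) :
    ∑ j, c j • F.monomialClass (F.tau σ j)
      = F.cls (∑ j, c j • ⟨F.monomial (F.tau σ j), F.monomial_mem (F.tau σ j)⟩) := by
  unfold monomialClass cls
  rw [← Submodule.mkQ_apply, map_sum]
  rfl

theorem exists_basis (hσ : F.IsGoodOrder σ) :
    ∃ b : Module.Basis (Fin μ) (PowerSeries ℂ) F.Hf,
      ∀ i, b i = F.monomialClass (F.tau σ i) := by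
  have hli : LinearIndependent ℂ⟦X⟧ fun i => F.monomialClass (F.tau σ i) := by
    rw [Fintype.linearIndependent_iff]
    intro c hc
    rw [sum_smul_monomialClass] at hc
    have h0 : F.cls (∑ j, c j • ⟨F.monomial (F.tau σ j), F.monomial_mem (F.tau σ j)⟩)
      = F.cls 0 := hc
    obtain ⟨γ, hγ⟩ := cls_eq_iff.mp h0
    have := eq_zero_of_series_sum_eq hσ c γ (by
      rw [← hγ]
      simp)
    exact fun i => congrFun this i
  have hsp : ⊤ ≤ Submodule.span ℂ⟦X⟧ (Set.range fun i => F.monomialClass (F.tau σ i)) := by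
    rintro x -
    obtain ⟨α, rfl⟩ := Submodule.Quotient.mk_surjective _ x
    obtain ⟨c, β, e⟩ := exists_series_decomposition hσ (LinearMap.mem_ker.mp α.2)
    have hx : Submodule.Quotient.mk α = ∑ j, c j • F.monomialClass (F.tau σ j) := by
      rw [sum_smul_monomialClass]
      refine cls_eq_iff.mpr ⟨β, ?_⟩
      rw [e]
      simp
    rw [hx]
    exact Submodule.sum_mem _ fun j _ => Submodule.smul_mem _ _
      (Submodule.subset_span ⟨j, rfl⟩)
  exact ⟨Module.Basis.mk hli hsp, fun i => Module.Basis.mk_apply hli hsp i⟩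

end Order

end SmoothCompleteFan

open Component MeasureTheory

/-! ### Integrals with logarithmic poles along the coordinate hyperplanes -/

/-- An integrable bound for `1` and `1 / ζ` on a disc. -/
def poleBound (R : ℝ) : ℂ → ℝ := (Metric.ball 0 R).indicator fun ζ => 1 + ‖ζ‖⁻¹

theorem integrable_poleBound (R : ℝ) : Integrable (poleBound R) := by
  unfold poleBound
  rw [integrable_indicator_iff measurableSet_ball]
  refine Integrable.add ?_ ?_
  · exact integrableOn_const (Metric.isBounded_ball.measure_lt_top.ne)
  · refine integrableOn_ball_of_norm_le_rpow (C := 1) (α := 1) ?_ ?_ ?_ ?_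
    · rw [Complex.finrank_real_complex]; norm_num
    · rw [Complex.finrank_real_complex]; norm_num
    · refine Filter.Eventually.of_forall fun x => ?_
      rw [Real.rpow_neg_one, one_mul, norm_inv, norm_norm]
    · exact (measurable_norm.inv).aestronglyMeasurable

variable {s : Finset (Fin d)}

/-- An integrable bound for the products of the `1 / z_j`. -/
def poleDom (R : ℝ) (z : s → ℂ) : ℝ := ∏ j, poleBound R (z j)

theorem integrable_poleDom (R : ℝ) : Integrable (poleDom (s := s) R) :=
  Integrable.fintype_prod fun _ => integrable_poleBound R

/-- The product of the `1 / z_j`, `j ∈ T`. -/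
def poles (T : Finset s) (z : s → ℂ) : ℂ := ∏ j ∈ T, (z j)⁻¹

theorem measurable_poles (T : Finset s) : Measurable (poles T) :=
  Finset.measurable_prod _ fun j _ => (measurable_pi_apply j).inv

theorem norm_poles_le {R : ℝ} {z : s → ℂ} (hz : ‖z‖ < R) (T : Finset s) :
    ‖poles T z‖ ≤ poleDom R z := by
  unfold poles poleDom
  rw [norm_prod]
  have h1 : ∏ j ∈ T, ‖(z j)⁻¹‖ = ∏ j, if j ∈ T then ‖(z j)⁻¹‖ else 1 := by
    rw [Finset.prod_ite_mem, Finset.univ_inter]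
  rw [h1]
  refine Finset.prod_le_prod (fun j _ => ?_) fun j _ => ?_
  · split_ifs <;> positivity
  · have hj : z j ∈ Metric.ball (0 : ℂ) R := by
      rw [mem_ball_zero_iff]
      exact (norm_le_pi_norm z j).trans_lt hz
    rw [poleBound, Set.indicator_of_mem hj, norm_inv]
    have : 0 ≤ ‖z j‖⁻¹ := by positivity
    split_ifs <;> linarith

theorem poleDom_nonneg (R : ℝ) (z : s → ℂ) : 0 ≤ poleDom R z :=
  Finset.prod_nonneg fun j _ => Set.indicator_nonneg (fun _ _ => by positivity) _

theorem exists_poleDom_bound {a : (s → ℂ) → ℂ} (ha : Continuous a) (hc : HasCompactSupport a) :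
    ∃ K R : ℝ, ∀ z T, ‖a z‖ * ‖poles T z‖ ≤ K * poleDom R z := by
  obtain ⟨K, hK⟩ := hc.exists_bound_of_continuous ha
  obtain ⟨R, hR⟩ := hc.isCompact.isBounded.subset_ball 0
  refine ⟨K, R, fun z T => ?_⟩
  have hK0 : 0 ≤ K := (norm_nonneg _).trans (hK z)
  by_cases hz : a z = 0
  · rw [hz, norm_zero, zero_mul]
    exact mul_nonneg hK0 (poleDom_nonneg _ _)
  · have : ‖z‖ < R := mem_ball_zero_iff.mp (hR (subset_tsupport _ hz))
    exact mul_le_mul (hK z) (norm_poles_le this T) (norm_nonneg _) hK0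

theorem integrable_mul_poles {a : (s → ℂ) → ℂ} (ha : Continuous a) (hc : HasCompactSupport a)
    (T : Finset s) : Integrable fun z => a z * poles T z := by
  obtain ⟨K, R, h⟩ := exists_poleDom_bound ha hc
  refine ((integrable_poleDom R).const_mul K).mono'
    (ha.measurable.mul (measurable_poles T)).aestronglyMeasurable ?_
  exact Filter.Eventually.of_forall fun z => by rw [norm_mul]; exact h z T

theorem integral_fderiv_mul_poles {a : (s → ℂ) → ℂ} (ha : ContDiff ℝ ∞ a)
    (hc : HasCompactSupport a) {T : Finset s} {w : s → ℂ} (hw : ∀ j ∈ T, w j = 0) :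
    ∫ z, fderiv ℝ a z w * poles T z = 0 := by
  have hd : Continuous fun z => fderiv ℝ a z w := (contDiff_fderiv_apply ha w).continuous
  have hdc : HasCompactSupport fun z => fderiv ℝ a z w := hc.fderiv_apply ℝ w
  have key := integral_bilinear_hasLineDerivAt_right_eq_neg_left_of_integrable
    (μ := (volume : Measure (s → ℂ))) (f := fun _ => (1 : ℂ)) (f' := fun _ => 0)
    (g := fun z => a z * poles T z) (g' := fun z => fderiv ℝ a z w * poles T z) (v := w)
    (B := ContinuousLinearMap.mul ℝ ℂ) (by simp)
    (by simpa using integrable_mul_poles hd hdc T)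
    (by simpa using integrable_mul_poles ha.continuous hc T)
    (fun z _ => by
      rw [HasLineDerivAt]
      exact hasDerivAt_const _ _)
    (fun z _ => by
      have h1 : HasLineDerivAt ℝ a (fderiv ℝ a z w) z w :=
        (ha.differentiable (by simp) z).hasFDerivAt.hasLineDerivAt w
      rw [HasLineDerivAt] at h1 ⊢
      have h2 : ∀ t : ℝ, poles T (z + t • w) = poles T z := fun t =>
        Finset.prod_congr rfl fun j hj => by simp [hw j hj]
      simp only [h2]
      exact h1.mul_const _)
  simpa using key

theorem proj_single_apply_of_ne {i : Fin d} {j : s} (h : (j : Fin d) ≠ i) (c : ℂ) :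
    proj s (Pi.single i c) j = 0 := by
  simp [proj, h]

theorem hasCompactSupport_dzbar {a : Sm s} (hc : HasCompactSupport a.val) (i : Fin d) :
    HasCompactSupport (Sm.dzbarOp s i a).val := by
  have h1 := hc.fderiv_apply ℝ (proj s (Pi.single i 1))
  have h2 := hc.fderiv_apply ℝ (proj s (Pi.single i Complex.I))
  exact (h1.add (h2.mul_left (f := fun _ => Complex.I))).mul_left (f := fun _ => (1 / 2 : ℂ))

theorem integral_dz_mul_poles {a : Sm s} (hc : HasCompactSupport a.val) {T : Finset s}
    {i : Fin d} (hi : ∀ j ∈ T, (j : Fin d) ≠ i) :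
    ∫ z, (Sm.dzOp s i a).val z * poles T z = 0 := by
  have e : ∀ c : ℂ, ∫ z, fderiv ℝ a.val z (proj s (Pi.single i c)) * poles T z = 0 := fun c =>
    integral_fderiv_mul_poles a.contDiff hc fun j hj => proj_single_apply_of_ne (hi j hj) c
  have hI : ∀ c : ℂ, Integrable fun z => fderiv ℝ a.val z (proj s (Pi.single i c)) * poles T z :=
    fun c => integrable_mul_poles (contDiff_fderiv_apply a.contDiff _).continuous
      (hc.fderiv_apply ℝ _) T
  have h : ∀ z, (Sm.dzOp s i a).val z * poles T z
      = (1 / 2 : ℂ) * (fderiv ℝ a.val z (proj s (Pi.single i 1)) * poles T z)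
        - (Complex.I / 2) * (fderiv ℝ a.val z (proj s (Pi.single i Complex.I)) * poles T z) := by
    intro z
    rw [Sm.coe_dzOp]
    simp only [dz]
    ring
  simp only [h]
  rw [integral_sub ((hI 1).const_mul _) ((hI Complex.I).const_mul _), integral_const_mul,
    integral_const_mul, e, e]
  simp

theorem integral_dzbar_mul_poles {a : Sm s} (hc : HasCompactSupport a.val) {T : Finset s}
    {i : Fin d} (hi : ∀ j ∈ T, (j : Fin d) ≠ i) :
    ∫ z, (Sm.dzbarOp s i a).val z * poles T z = 0 := by
  have e : ∀ c : ℂ, ∫ z, fderiv ℝ a.val z (proj s (Pi.single i c)) * poles T z = 0 := fun c =>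
    integral_fderiv_mul_poles a.contDiff hc fun j hj => proj_single_apply_of_ne (hi j hj) c
  have hI : ∀ c : ℂ, Integrable fun z => fderiv ℝ a.val z (proj s (Pi.single i c)) * poles T z :=
    fun c => integrable_mul_poles (contDiff_fderiv_apply a.contDiff _).continuous
      (hc.fderiv_apply ℝ _) T
  have h : ∀ z, (Sm.dzbarOp s i a).val z * poles T z
      = (1 / 2 : ℂ) * (fderiv ℝ a.val z (proj s (Pi.single i 1)) * poles T z)
        + (Complex.I / 2) * (fderiv ℝ a.val z (proj s (Pi.single i Complex.I)) * poles T z) := by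
    intro z
    rw [Sm.coe_dzbarOp]
    simp only [dzbar]
    ring
  simp only [h]
  rw [integral_add ((hI 1).const_mul _) ((hI Complex.I).const_mul _), integral_const_mul,
    integral_const_mul, e, e]
  simp

theorem div_prod_eq (a : ℂ) (z : s → ℂ) : a / ∏ j, z j = a * poles Finset.univ z := by
  rw [poles, Finset.prod_inv_distrib, div_eq_mul_inv]

theorem poles_erase (z : s → ℂ) (i : s) :
    poles Finset.univ z = (z i)⁻¹ * poles (Finset.univ.erase i) z := by
  unfold poles
  rw [Finset.mul_prod_erase _ (fun j => (z j)⁻¹) (Finset.mem_univ i)]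

theorem ae_ne_zero (i : s) : ∀ᵐ z : s → ℂ, z i ≠ 0 :=
  Measure.ae_eval_ne (fun _ : s => (volume : Measure ℂ)) i 0

theorem incl_of_mem (z : s → ℂ) {i : Fin d} (hi : i ∈ s) : incl s z i = z ⟨i, hi⟩ := by
  simp [incl, hi]

theorem integral_euler_div {a : Sm s} (hc : HasCompactSupport a.val) (i : Fin d) :
    ∫ z, (eulerAt s i a).val z / ∏ j, z j = 0 := by
  by_cases hi : i ∈ s
  swap
  · have : eulerAt s i a = 0 := by
      rw [eulerAt, Sm.coord_eq_zero hi, Sm.mulOp_zero, zero_mul]; rfl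
    simp [this]
  rw [← integral_dz_mul_poles hc (T := Finset.univ.erase ⟨i, hi⟩) (i := i)
    (fun j hj e => Finset.ne_of_mem_erase hj (Subtype.ext e))]
  refine integral_congr_ae ?_
  filter_upwards [ae_ne_zero (⟨i, hi⟩ : s)] with z hz
  rw [div_prod_eq, poles_erase z ⟨i, hi⟩]
  show incl s z i * (Sm.dzOp s i a).val z * _ = _
  rw [incl_of_mem z hi]
  field_simp

/-! A regularization of `1 / z_i`. -/

/-- The function `1 / (|z_i|² + ε)`. -/
def regInv (s : Finset (Fin d)) (i : Fin d) (ε : ℝ) (hε : 0 < ε) : Sm s :=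
  Sm.mk (fun z => ((Complex.normSq (incl s z i) + ε : ℝ) : ℂ)⁻¹) (by
    have h1 : ContDiff ℝ ∞ fun z : s → ℂ => Complex.normSq (incl s z i) + ε := by
      simp only [Complex.normSq_apply]
      have hre := Complex.reCLM.contDiff.comp (contDiff_incl (s := s) i) (n := ∞)
      have him := Complex.imCLM.contDiff.comp (contDiff_incl (s := s) i) (n := ∞)
      exact ((hre.mul hre).add (him.mul him)).add contDiff_const
    refine ContDiff.inv (Complex.ofRealCLM.contDiff.comp h1) fun z => ?_
    show ((Complex.normSq (incl s z i) + ε : ℝ) : ℂ) ≠ 0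
    have : Complex.normSq (incl s z i) + ε ≠ 0 := by
      have := Complex.normSq_nonneg (incl s z i)
      positivity
    exact_mod_cast this)

theorem regInv_mul (i : Fin d) {ε : ℝ} (hε : 0 < ε) :
    regInv s i ε hε * (Sm.coord s i * Sm.conjCoord s i + algebraMap ℂ (Sm s) ε) = 1 := by
  refine Sm.ext fun z => ?_
  show ((Complex.normSq (incl s z i) + ε : ℝ) : ℂ)⁻¹ *
    (incl s z i * starRingEnd ℂ (incl s z i) + (ε : ℂ)) = 1
  rw [Complex.mul_conj, ← Complex.ofReal_add]
  refine inv_mul_cancel₀ ?_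
  have : Complex.normSq (incl s z i) + ε ≠ 0 := by
    have := Complex.normSq_nonneg (incl s z i)
    positivity
  exact_mod_cast this

theorem dzbar_algebraMap (i : Fin d) (c : ℂ) : Sm.dzbarOp s i (algebraMap ℂ (Sm s) c) = 0 := by
  have h1 : Sm.dzbarOp s i 1 = 0 := by
    have := Sm.dzbarOp_mul (s := s) i 1 1
    simp only [one_mul, mul_one] at this
    simpa using this
  rw [Algebra.algebraMap_eq_smul_one, map_smul, h1, smul_zero]

theorem dzbar_regularized {i : Fin d} (hi : i ∈ s) {ε : ℝ} (hε : 0 < ε) (b : Sm s) :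
    Sm.dzbarOp s i (b * (Sm.conjCoord s i * regInv s i ε hε))
      = Sm.dzbarOp s i b * (Sm.conjCoord s i * regInv s i ε hε)
        + algebraMap ℂ (Sm s) ε * (b * (regInv s i ε hε * regInv s i ε hε)) := by
  set r := regInv s i ε hε
  have h1 := regInv_mul (s := s) i hε
  have h2 := congrArg (Sm.dzbarOp s i) h1
  have h3 : Sm.dzbarOp s i 1 = 0 := by
    simpa using dzbar_algebraMap (s := s) i 1
  rw [Sm.dzbarOp_mul, map_add, Sm.dzbarOp_mul, Sm.dzbarOp_coord, Sm.dzbarOp_conjCoord,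
    if_pos ⟨hi, rfl⟩, dzbar_algebraMap, h3] at h2
  rw [Sm.dzbarOp_mul, Sm.dzbarOp_mul, Sm.dzbarOp_conjCoord, if_pos ⟨hi, rfl⟩]
  change r * (Sm.coord s i * Sm.conjCoord s i + algebraMap ℂ (Sm s) ε) = 1 at h1
  change r * (Sm.coord s i * 1 + 0 * Sm.conjCoord s i + 0)
    + Sm.dzbarOp s i r * (Sm.coord s i * Sm.conjCoord s i + algebraMap ℂ (Sm s) ε) = 0 at h2
  generalize Sm.dzbarOp s i r = r' at *
  generalize Sm.dzbarOp s i b = b' at *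
  generalize algebraMap ℂ (Sm s) ε = e at *
  generalize Sm.coord s i = x at *
  generalize Sm.conjCoord s i = y at *
  linear_combination (b * y * r) * h2 - (b * y * r' + b * r) * h1

theorem norm_le_of_vanish {b : Sm s} (hc : HasCompactSupport b.val) {i : s}
    (hv : ∀ z : s → ℂ, z i = 0 → b.val z = 0) : ∃ L : ℝ, 0 ≤ L ∧ ∀ z, ‖b.val z‖ ≤ L * ‖z i‖ := by
  obtain ⟨C, hC⟩ := ContDiff.lipschitzWith_of_hasCompactSupport hc b.contDiff (by simp)
  refine ⟨C, C.2, fun z => ?_⟩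
  have h1 := hC.dist_le_mul z (Function.update z i 0)
  rw [hv (Function.update z i 0) (Function.update_self _ _ _), dist_zero_right] at h1
  refine h1.trans (mul_le_mul_of_nonneg_left ?_ C.2)
  refine (dist_pi_le_iff (norm_nonneg _)).mpr fun j => ?_
  by_cases h : j = i
  · subst h; simp
  · simp [h]

theorem tendsto_regularized {ζ : ℂ} (hζ : ζ ≠ 0) (c β p : ℂ) {ε : ℕ → ℝ}
    (hε : Filter.Tendsto ε Filter.atTop (nhds 0)) :
    Filter.Tendsto (fun m => c * (starRingEnd ℂ ζ * ((Complex.normSq ζ + ε m : ℝ) : ℂ)⁻¹) * p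
      + ε m * (β * (((Complex.normSq ζ + ε m : ℝ) : ℂ)⁻¹ * ((Complex.normSq ζ + ε m : ℝ) : ℂ)⁻¹)) * p)
      Filter.atTop (nhds (c * (ζ⁻¹ * p))) := by
  have hns : ((Complex.normSq ζ : ℝ) : ℂ) ≠ 0 := by
    exact_mod_cast (Complex.normSq_pos.mpr hζ).ne'
  have hlr : Filter.Tendsto (fun m => ((Complex.normSq ζ + ε m : ℝ) : ℂ)⁻¹) Filter.atTop
      (nhds ((Complex.normSq ζ : ℝ) : ℂ)⁻¹) := by
    refine Filter.Tendsto.inv₀ ?_ hns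
    have := (hε.const_add (Complex.normSq ζ))
    rw [add_zero] at this
    exact (Complex.continuous_ofReal.tendsto _).comp this
  have hlε : Filter.Tendsto (fun m => (ε m : ℂ)) Filter.atTop (nhds 0) :=
    (Complex.continuous_ofReal.tendsto 0).comp hε
  have h3 := (((hlr.const_mul (starRingEnd ℂ ζ)).const_mul c).mul_const p).add
    ((hlε.mul ((hlr.mul hlr).const_mul β)).mul_const p)
  have e : starRingEnd ℂ ζ * ((Complex.normSq ζ : ℝ) : ℂ)⁻¹ = ζ⁻¹ := by
    rw [Complex.inv_def ζ, Complex.ofReal_inv]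
  rwa [e, zero_mul, zero_mul, add_zero, mul_assoc] at h3

theorem norm_regularized_le {ζ c β p : ℂ} (hζ : ζ ≠ 0) {ε L : ℝ} (hε : 0 < ε)
    (hβ : ‖β‖ ≤ L * ‖ζ‖) (hL : 0 ≤ L) :
    ‖c * (starRingEnd ℂ ζ * ((Complex.normSq ζ + ε : ℝ) : ℂ)⁻¹) * p‖ ≤ ‖c‖ * (‖ζ‖⁻¹ * ‖p‖) ∧
    ‖ε * (β * (((Complex.normSq ζ + ε : ℝ) : ℂ)⁻¹ * ((Complex.normSq ζ + ε : ℝ) : ℂ)⁻¹)) * p‖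
      ≤ L * (‖ζ‖⁻¹ * ‖p‖) := by
  have hx : 0 < ‖ζ‖ := norm_pos_iff.mpr hζ
  have hq : 0 < ‖ζ‖ ^ 2 + ε := by positivity
  have hrn : ‖((Complex.normSq ζ + ε : ℝ) : ℂ)⁻¹‖ = (‖ζ‖ ^ 2 + ε)⁻¹ := by
    rw [norm_inv, Complex.normSq_eq_norm_sq, Complex.norm_real, Real.norm_eq_abs, abs_of_pos hq]
  constructor
  · rw [norm_mul, norm_mul, norm_mul, RCLike.norm_conj, hrn, ← mul_assoc ‖c‖ ‖ζ‖⁻¹]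
    refine mul_le_mul_of_nonneg_right ?_ (norm_nonneg p)
    refine mul_le_mul_of_nonneg_left ?_ (norm_nonneg c)
    rw [← div_eq_mul_inv, div_le_iff₀ hq, inv_mul_eq_div, le_div_iff₀ hx]
    nlinarith
  · rw [norm_mul, norm_mul, norm_mul, norm_mul, hrn, Complex.norm_real, Real.norm_eq_abs,
      abs_of_pos hε, ← mul_assoc L]
    refine mul_le_mul_of_nonneg_right ?_ (norm_nonneg _)
    have h1 : ε * (‖β‖ * ((‖ζ‖ ^ 2 + ε)⁻¹ * (‖ζ‖ ^ 2 + ε)⁻¹))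
        ≤ ε * ((L * ‖ζ‖) * ((‖ζ‖ ^ 2 + ε)⁻¹ * (‖ζ‖ ^ 2 + ε)⁻¹)) := by
      gcongr
    refine h1.trans ?_
    have h2 : ε * ((L * ‖ζ‖) * ((‖ζ‖ ^ 2 + ε)⁻¹ * (‖ζ‖ ^ 2 + ε)⁻¹))
        = L * (ε * ‖ζ‖ / (‖ζ‖ ^ 2 + ε) ^ 2) := by
      field_simp
    rw [h2]
    refine mul_le_mul_of_nonneg_left ?_ hL
    rw [div_le_iff₀ (by positivity), inv_mul_eq_div, le_div_iff₀ hx]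
    nlinarith [sq_nonneg (‖ζ‖ ^ 2), mul_pos hε (pow_pos hx 2), sq_nonneg ε]

theorem coe_dzbar_regularized {i : Fin d} (hi : i ∈ s) {ε : ℝ} (hε : 0 < ε) (b : Sm s)
    (z : s → ℂ) (p : ℂ) :
    (Sm.dzbarOp s i (b * (Sm.conjCoord s i * regInv s i ε hε))).val z * p
      = (Sm.dzbarOp s i b).val z * (starRingEnd ℂ (z ⟨i, hi⟩) *
          ((Complex.normSq (z ⟨i, hi⟩) + ε : ℝ) : ℂ)⁻¹) * p
        + ε * (b.val z * (((Complex.normSq (z ⟨i, hi⟩) + ε : ℝ) : ℂ)⁻¹ *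
          ((Complex.normSq (z ⟨i, hi⟩) + ε : ℝ) : ℂ)⁻¹)) * p := by
  rw [dzbar_regularized hi hε b, ← incl_of_mem z hi, ← add_mul]
  rfl

theorem tendsto_integral_regularized {c β : (s → ℂ) → ℂ} (hc : Continuous c)
    (hcc : HasCompactSupport c) (hβ : Continuous β) (hβc : HasCompactSupport β) (i : s) {L : ℝ}
    (hL0 : 0 ≤ L) (hL : ∀ z, ‖β z‖ ≤ L * ‖z i‖) {ε : ℕ → ℝ} (hε : ∀ m, 0 < ε m)
    (hε0 : Filter.Tendsto ε Filter.atTop (nhds 0)) {G : ℕ → (s → ℂ) → ℂ}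
    (hGm : ∀ m, AEStronglyMeasurable (G m))
    (hG : ∀ m z, G m z = c z * (starRingEnd ℂ (z i) * ((Complex.normSq (z i) + ε m : ℝ) : ℂ)⁻¹)
        * poles (Finset.univ.erase i) z
      + ε m * (β z * (((Complex.normSq (z i) + ε m : ℝ) : ℂ)⁻¹ *
        ((Complex.normSq (z i) + ε m : ℝ) : ℂ)⁻¹)) * poles (Finset.univ.erase i) z) :
    Filter.Tendsto (fun m => ∫ z, G m z) Filter.atTop (nhds (∫ z, c z / ∏ j, z j)) := by
  obtain ⟨K, R, hKR⟩ := exists_poleDom_bound hc hcc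
  obtain ⟨R', hR'⟩ := hβc.isCompact.isBounded.subset_ball 0
  have hp : ∀ z : s → ℂ, ‖poles Finset.univ z‖ = ‖z i‖⁻¹ * ‖poles (Finset.univ.erase i) z‖ :=
    fun z => by rw [poles_erase z i, norm_mul, norm_inv]
  refine tendsto_integral_of_dominated_convergence
    (fun z => K * poleDom R z + L * poleDom R' z) hGm ?_ (fun m => ?_) ?_
  · exact ((integrable_poleDom R).const_mul K).add ((integrable_poleDom R').const_mul L)
  · filter_upwards [ae_ne_zero i] with z hz
    obtain ⟨h1, h2⟩ := norm_regularized_le (c := c z) (p := poles (Finset.univ.erase i) z) hz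
      (hε m) (hL z) hL0
    rw [hG]
    refine (norm_add_le _ _).trans (add_le_add (h1.trans ?_) ?_)
    · rw [← hp]
      exact hKR z _
    · by_cases hbz : β z = 0
      · rw [hbz]
        simp only [zero_mul, mul_zero, norm_zero]
        exact mul_nonneg hL0 (poleDom_nonneg _ _)
      · refine h2.trans ?_
        rw [← hp]
        exact mul_le_mul_of_nonneg_left (norm_poles_le
          (mem_ball_zero_iff.mp (hR' (subset_tsupport _ hbz))) _) hL0
  · filter_upwards [ae_ne_zero i] with z hz
    simp only [hG]
    rw [div_prod_eq, poles_erase z i]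
    exact tendsto_regularized hz _ _ _ hε0

theorem hasCompactSupport_mul {b : Sm s} (hc : HasCompactSupport b.val) (c : Sm s) :
    HasCompactSupport (b * c).val :=
  hc.mono fun z hz h => hz (by rw [Sm.coe_mul, h, zero_mul])

/-- `∫ \bar∂_i b / ∏ z_j = 0` if `b` vanishes on the hyperplane `z_i = 0`. -/
theorem integral_dzbar_div_of_vanish {b : Sm s} (hc : HasCompactSupport b.val) {i : Fin d}
    (hi : i ∈ s) (hv : ∀ z : s → ℂ, z ⟨i, hi⟩ = 0 → b.val z = 0) :
    ∫ z, (Sm.dzbarOp s i b).val z / ∏ j, z j = 0 := by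
  obtain ⟨L, hL0, hL⟩ := norm_le_of_vanish hc hv
  obtain ⟨ε, hε, hε0⟩ : ∃ ε : ℕ → ℝ, (∀ m, 0 < ε m) ∧ Filter.Tendsto ε Filter.atTop (nhds 0) :=
    ⟨fun m => 1 / ((m : ℝ) + 1), fun m => by positivity, tendsto_one_div_add_atTop_nhds_zero_nat⟩
  obtain ⟨X, hX⟩ : ∃ X : ℕ → Sm s, ∀ m,
      X m = Sm.dzbarOp s i (b * (Sm.conjCoord s i * regInv s i (ε m) (hε m))) := ⟨_, fun _ => rfl⟩
  have hlim := tendsto_integral_regularized (Sm.dzbarOp s i b).contDiff.continuous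
    (hasCompactSupport_dzbar hc i) b.contDiff.continuous hc ⟨i, hi⟩ hL0 hL hε hε0
    (G := fun m z => (X m).val z * poles (Finset.univ.erase ⟨i, hi⟩) z)
    (fun m => (Measurable.mul (X m).contDiff.continuous.measurable
        (measurable_poles _)).aestronglyMeasurable)
    (fun m z => by rw [hX]; exact coe_dzbar_regularized hi (hε m) b z _)
  have hG0 : ∀ m : ℕ, ∫ z, (X m).val z * poles (Finset.univ.erase ⟨i, hi⟩) z = 0 := fun m => by
    rw [hX]
    exact integral_dzbar_mul_poles (hasCompactSupport_mul hc _)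
      (fun j hj e => Finset.ne_of_mem_erase hj (Subtype.ext e))
  simp only [hG0] at hlim
  exact tendsto_nhds_unique hlim tendsto_const_nhds

open Component MeasureTheory

/-! ### The residue theorem -/

section Reindex

variable {s s' : Finset (Fin d)}

/-- Relabelling of the coordinates. -/
def relabel (e : s ≃ s') : (s → ℂ) →L[ℝ] (s' → ℂ) :=
  ContinuousLinearMap.pi fun j => ContinuousLinearMap.proj (e.symm j)

theorem relabel_apply (e : s ≃ s') (z : s → ℂ) (j : s') : relabel e z j = z (e.symm j) := rfl

/-- The pullback of a function under a relabelling of the coordinates. -/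
def Sm.relabel (e : s ≃ s') (a : Sm s') : Sm s :=
  Sm.mk (fun z => a.val (LogLG.relabel e z)) (a.contDiff.comp (LogLG.relabel e).contDiff)

theorem relabel_proj_single (e : s ≃ s') {i b : Fin d} (hi : i ∈ s) (hb : b ∈ s')
    (hib : e ⟨i, hi⟩ = ⟨b, hb⟩) (c : ℂ) :
    relabel e (proj s (Pi.single i c)) = proj s' (Pi.single b c) := by
  funext j
  rw [relabel_apply]
  simp only [proj, Pi.single_apply]
  refine if_congr ?_ rfl rfl
  constructor
  · intro h
    have : e.symm j = ⟨i, hi⟩ := Subtype.ext h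
    rw [Equiv.symm_apply_eq, hib] at this
    rw [this]
  · intro h
    have : j = ⟨b, hb⟩ := Subtype.ext h
    rw [this, ← hib, Equiv.symm_apply_apply]

theorem dzbar_relabel (e : s ≃ s') {i b : Fin d} (hi : i ∈ s) (hb : b ∈ s')
    (hib : e ⟨i, hi⟩ = ⟨b, hb⟩) (a : Sm s') (z : s → ℂ) :
    (Sm.dzbarOp s i (Sm.relabel e a)).val z = (Sm.dzbarOp s' b a).val (relabel e z) := by
  have h : ∀ v, fderiv ℝ (Sm.relabel e a).val z v
      = fderiv ℝ a.val (relabel e z) (relabel e v) := by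
    intro v
    have h1 := ((a.differentiable (relabel e z)).hasFDerivAt.comp z (relabel e).hasFDerivAt).fderiv
    exact congrArg (fun L : (s → ℂ) →L[ℝ] ℂ => L v) h1
  rw [Sm.coe_dzbarOp, Sm.coe_dzbarOp]
  simp only [dzbar, h, relabel_proj_single e hi hb hib]

theorem integral_relabel (e : s ≃ s') (f : (s' → ℂ) → ℂ) :
    ∫ z, f (relabel e z) = ∫ z, f z := by
  have hm := volume_measurePreserving_piCongrLeft (fun _ : s' => ℂ) e
  rw [← hm.integral_comp' f]
  refine integral_congr_ae (Filter.Eventually.of_forall fun z => congrArg f (funext fun j => ?_))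
  obtain ⟨i, rfl⟩ := e.surjective j
  rw [relabel_apply, Equiv.symm_apply_apply]
  exact (Equiv.piCongrLeft_apply_apply (fun _ : s' => ℂ) e z i).symm

theorem prod_relabel (e : s ≃ s') (z : s → ℂ) : ∏ j, relabel e z j = ∏ j, z j :=
  Equiv.prod_comp e.symm z

end Reindex

/-- The relabelling between two cones with a common facet. -/
def facetEquiv {s s' : Finset (Fin d)} {i b : Fin d} (hi : i ∈ s) (hb : b ∈ s')
    (his : i ∉ s') (hbs : b ∉ s) (h : s'.erase b = s.erase i) : s ≃ s' :=
  (Equiv.swap i b).subtypeEquiv fun a => by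
    by_cases hai : a = i
    · subst hai
      simp [hi, hb]
    by_cases hab : a = b
    · subst hab
      simp [hbs, his]
    · rw [Equiv.swap_apply_of_ne_of_ne hai hab]
      have := congrArg (a ∈ ·) h
      simpa [hai, hab] using this.symm

section Facet

variable {s s' : Finset (Fin d)} {i b : Fin d}

theorem integral_dzbar_eq (hi : i ∈ s) (hb : b ∈ s') (his : i ∉ s') (hbs : b ∉ s)
    (h : s'.erase b = s.erase i) {a : Sm s} {a' : Sm s'} (hc : HasCompactSupport a.val)
    (hc' : HasCompactSupport a'.val)
    (haa : ∀ w : Fin d → ℂ, (∀ j, j ∉ s ∩ s' → w j = 0) → a.val (proj s w) = a'.val (proj s' w)) :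
    ∫ z, (Sm.dzbarOp s i a).val z / ∏ j, z j = ∫ z, (Sm.dzbarOp s' b a').val z / ∏ j, z j := by
  let e := facetEquiv hi hb his hbs h
  have hib : e ⟨i, hi⟩ = ⟨b, hb⟩ := Subtype.ext (Equiv.swap_apply_left i b)
  have hrc : HasCompactSupport (Sm.relabel e a').val := by
    obtain ⟨R, hR⟩ := hc'.isCompact.isBounded.subset_closedBall 0
    refine HasCompactSupport.intro (isCompact_closedBall (0 : s → ℂ) R) fun z hz => ?_
    by_contra hne
    refine hz ?_
    have h1 : relabel e z ∈ Metric.closedBall (0 : s' → ℂ) R := hR (subset_tsupport _ hne)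
    rw [mem_closedBall_zero_iff] at h1 ⊢
    have hR0 : 0 ≤ R := (norm_nonneg _).trans h1
    refine (pi_norm_le_iff_of_nonneg hR0).mpr fun j => ?_
    have := (norm_le_pi_norm (relabel e z) (e j)).trans h1
    rwa [relabel_apply, Equiv.symm_apply_apply] at this
  have hdc : HasCompactSupport (a - Sm.relabel e a').val :=
    HasCompactSupport.sub (f := a.val) hc hrc
  have hv : ∀ z : s → ℂ, z ⟨i, hi⟩ = 0 → (a - Sm.relabel e a').val z = 0 := by
    intro z hz
    have hw : ∀ j, j ∉ s ∩ s' → incl s z j = 0 := by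
      intro j hj
      by_cases hjs : j ∈ s
      · by_cases hji : j = i
        · subst hji; rw [incl_of_mem z hi]; exact hz
        · refine absurd (Finset.mem_inter.mpr ⟨hjs, ?_⟩) hj
          have : j ∈ s'.erase b := h ▸ Finset.mem_erase.mpr ⟨hji, hjs⟩
          exact Finset.mem_of_mem_erase this
      · simp [incl, hjs]
    have h1 := haa (incl s z) hw
    rw [SmoothCompleteFan.proj_incl] at h1
    have h2 : proj s' (incl s z) = relabel e z := by
      funext j
      rw [relabel_apply]
      by_cases hj : j = ⟨b, hb⟩
      · rw [hj, ← hib, Equiv.symm_apply_apply, hz, hib]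
        exact hw b fun hm => hbs (Finset.mem_inter.mp hm).1
      · have hjb : (j : Fin d) ≠ b := fun e' => hj (Subtype.ext e')
        have hji : (j : Fin d) ≠ i := fun e' => his (e' ▸ j.2)
        have hjs : (j : Fin d) ∈ s := by
          have : (j : Fin d) ∈ s.erase i := h ▸ Finset.mem_erase.mpr ⟨hjb, j.2⟩
          exact Finset.mem_of_mem_erase this
        have hej : e.symm j = ⟨j, hjs⟩ := by
          rw [Equiv.symm_apply_eq]
          exact Subtype.ext (Equiv.swap_apply_of_ne_of_ne hji hjb).symm
        rw [hej]
        exact incl_of_mem z hjs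
    rw [h2] at h1
    exact sub_eq_zero.mpr h1
  have key := integral_dzbar_div_of_vanish hdc hi hv
  have hI : ∀ x : Sm s, HasCompactSupport x.val →
      Integrable fun z => (Sm.dzbarOp s i x).val z / ∏ j, z j := fun x hx => by
    simp only [div_prod_eq]
    exact integrable_mul_poles (Sm.dzbarOp s i x).contDiff.continuous
      (hasCompactSupport_dzbar hx i) _
  simp only [map_sub, Sm.coe_sub, sub_div] at key
  rw [integral_sub (hI a hc) (hI _ hrc), sub_eq_zero] at key
  rw [key, ← integral_relabel e]
  refine integral_congr_ae (Filter.Eventually.of_forall fun z => ?_)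
  dsimp only
  rw [dzbar_relabel e hi hb hib, prod_relabel]

end Facet

namespace SmoothCompleteFan

variable {F : SmoothCompleteFan n d}

/-- Compactly supported log polyvector fields. -/
def HasCompSupp (γ : F.PV) : Prop := ∀ s A, HasCompactSupport (γ.1 s A)

/-- The coefficient integral on one component. -/
def compInt (s : F.MaxCone) (a : Sm s.1) : ℂ := ∫ z, a.val z / ∏ j, z j

theorem compInt_add (s : F.MaxCone) {a b : Sm s.1} (ha : HasCompactSupport a.val)
    (hb : HasCompactSupport b.val) : compInt s (a + b) = compInt s a + compInt s b := by
  unfold compInt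
  simp only [Sm.coe_add, add_div]
  refine integral_add ?_ ?_ <;> simp only [div_prod_eq]
  · exact integrable_mul_poles a.contDiff.continuous ha _
  · exact integrable_mul_poles b.contDiff.continuous hb _

theorem compInt_smul (s : F.MaxCone) (c : ℂ) (a : Sm s.1) : compInt s (c • a) = c * compInt s a := by
  unfold compInt
  simp only [Sm.coe_smul, mul_div_assoc]
  exact integral_const_mul _ _

theorem compInt_zero (s : F.MaxCone) : compInt s 0 = 0 := by simp [compInt]

theorem compInt_sum (s : F.MaxCone) {ι : Type*} (T : Finset ι) (a : ι → Sm s.1)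
    (ha : ∀ i ∈ T, HasCompactSupport (a i).val) :
    compInt s (∑ i ∈ T, a i) = ∑ i ∈ T, compInt s (a i) := by
  unfold compInt
  simp only [Sm.coe_sum, Finset.sum_div]
  refine integral_finsetSum T fun i hi => ?_
  simp only [div_prod_eq]
  exact integrable_mul_poles (a i).contDiff.continuous (ha i hi) _

theorem trace_eq (γ : F.PV) : F.trace γ.1
    = (2 * Complex.I) ^ n * ∑ s : F.MaxCone, (F.coneDet s : ℂ) * compInt s (emb s γ (topIdx s.1)) :=
  rfl

theorem topIdx_erase {s s' : F.MaxCone} {i b : Fin d}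
    (h : s'.1.erase b = s.1.erase i) :
    (topIdx (n := n) s'.1).erase (Sum.inlₗ b) = (topIdx (n := n) s.1).erase (Sum.inlₗ i) := by
  have key : ∀ (s : Finset (Fin d)) (i : Fin d) (x : Gen n d),
      x ∈ (topIdx (n := n) s).erase (Sum.inlₗ i) ↔
        (∃ j ∈ s.erase i, x = Sum.inlₗ j) ∨ ∃ k, x = Sum.inrₗ k := by
    intro s i x
    refine gen_cases (p := fun x => x ∈ (topIdx (n := n) s).erase (Sum.inlₗ i) ↔
        (∃ j ∈ s.erase i, x = Sum.inlₗ j) ∨ ∃ k, x = Sum.inrₗ k) (fun j => ?_) (fun k => ?_) x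
    · rw [Finset.mem_erase, mem_topIdx_inl]
      constructor
      · rintro ⟨h1, h2⟩
        exact Or.inl ⟨j, Finset.mem_erase.mpr ⟨fun e => h1 (by rw [e]), h2⟩, rfl⟩
      · rintro (⟨j', hj', e⟩ | ⟨k, e⟩)
        · have : j = j' := Sum.inl_injective (toLex.injective e)
          subst this
          exact ⟨inl_ne_inl (Finset.ne_of_mem_erase hj'), Finset.mem_of_mem_erase hj'⟩
        · exact absurd e inl_ne_inr
    · rw [Finset.mem_erase]
      exact ⟨fun _ => Or.inr ⟨k, rfl⟩, fun _ => ⟨inr_ne_inl, mem_topIdx_inr k⟩⟩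
  ext x
  rw [key, key, h]

theorem leftIn_topIdx_erase {s : F.MaxCone} {i : Fin d} :
    LeftIn ((topIdx (n := n) s.1).erase (Sum.inlₗ i)) s.1 := fun _ hj =>
  mem_topIdx_inl.mp (Finset.mem_of_mem_erase hj)

/-- The contribution of a facet of a cone to `Tr \bar∂ γ`. -/
def facetInt (γ : F.PV) (p : F.MaxCone × Fin d) : ℂ :=
  leftSign (Sum.inlₗ p.2 : Gen n d) (topIdx p.1.1) * (F.coneDet p.1 : ℂ) *
    compInt p.1 (Sm.dzbarOp p.1.1 p.2 (emb p.1 γ ((topIdx p.1.1).erase (Sum.inlₗ p.2))))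

theorem trace_dbarPV (γ : F.PV) (hγ : HasCompSupp γ) : F.trace (F.dbarPV γ).1
    = (2 * Complex.I) ^ n * ∑ p ∈ Finset.univ.filter (fun p : F.MaxCone × Fin d => p.2 ∈ p.1.1),
      facetInt γ p := by
  rw [trace_eq]
  congr 1
  have h1 : ∑ p ∈ Finset.univ.filter (fun p : F.MaxCone × Fin d => p.2 ∈ p.1.1), facetInt γ p
      = ∑ s : F.MaxCone, ∑ i ∈ s.1, facetInt γ (s, i) := by
    rw [Finset.sum_sigma']
    refine Finset.sum_bij' (fun p _ => ⟨p.1, p.2⟩) (fun p _ => (p.1, p.2)) ?_ ?_ ?_ ?_ ?_ <;> simp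
  rw [h1]
  refine Finset.sum_congr rfl fun s _ => ?_
  have h2 : emb s (F.dbarPV γ) (topIdx s.1)
      = ∑ i ∈ s.1, leftSign (Sum.inlₗ i : Gen n d) (topIdx s.1) •
        Sm.dzbarOp s.1 i (emb s γ ((topIdx s.1).erase (Sum.inlₗ i))) := by
    rw [emb_dbarPV, LinearMap.sum_apply, Finset.sum_apply]
    refine Finset.sum_congr rfl fun i hi => ?_
    rw [Module.End.mul_apply, coeffwise_apply, creation_apply, genMul,
      if_pos (mem_topIdx_inl.mpr hi), map_smul]
  rw [h2, compInt_sum, Finset.mul_sum]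
  · refine Finset.sum_congr rfl fun i _ => ?_
    rw [compInt_smul, facetInt]
    ring
  · intro i _
    exact (hasCompactSupport_dzbar (a := emb s γ _) (hγ s _) i).mul_left (f := fun _ => leftSign _ _)

/-- `Tr \bar∂ γ = 0` for compactly supported `γ`. -/
theorem trace_dbarPV_eq_zero (γ : F.PV) (hγ : HasCompSupp γ) : F.trace (F.dbarPV γ).1 = 0 := by
  rw [trace_dbarPV γ hγ]
  have hex : ∀ p : F.MaxCone × Fin d, ∃ q : F.MaxCone × Fin d, p.2 ∈ p.1.1 →
      q.2 ∈ q.1.1 ∧ p.2 ∉ q.1.1 ∧ q.1.1.erase q.2 = p.1.1.erase p.2 := by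
    intro p
    by_cases hp : p.2 ∈ p.1.1
    · obtain ⟨s', b, h1, h2, h3⟩ := exists_neighbour p.1 hp
      exact ⟨(s', b), fun _ => ⟨h1, h2, h3⟩⟩
    · exact ⟨p, fun h => absurd h hp⟩
  choose ν hν using hex
  have hz : ∑ p ∈ Finset.univ.filter (fun p : F.MaxCone × Fin d => p.2 ∈ p.1.1),
      facetInt γ p = 0 := by
    refine Finset.sum_involution (fun p _ => ν p) ?_ ?_ ?_ ?_
    · intro p hp
      have hpm := (Finset.mem_filter.mp hp).2
      obtain ⟨h1, h2, h3⟩ := hν p hpm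
      have hbs := notMem_of_erase_eq hpm h2 h1 h3
      have e1 := leftSign_mul_coneDet hpm h1 h2 h3
      have e2 := integral_dzbar_eq hpm h1 h2 hbs h3 (hγ p.1 _) (hγ (ν p).1 _)
        (a := emb p.1 γ ((topIdx p.1.1).erase (Sum.inlₗ p.2)))
        (a' := emb (ν p).1 γ ((topIdx p.1.1).erase (Sum.inlₗ p.2)))
        (γ.2.2.2 p.1 (ν p).1 _ leftIn_topIdx_erase
          (by rw [← topIdx_erase h3]; exact leftIn_topIdx_erase))
      unfold facetInt
      rw [topIdx_erase h3, e1]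
      unfold compInt
      rw [e2]
      ring
    · intro p hp _ he
      have hpm := (Finset.mem_filter.mp hp).2
      obtain ⟨h1, h2, h3⟩ := hν p hpm
      rw [he] at h2
      exact h2 hpm
    · intro p hp
      have hpm := (Finset.mem_filter.mp hp).2
      exact Finset.mem_filter.mpr ⟨Finset.mem_univ _, (hν p hpm).1⟩
    · intro p hp
      have hpm := (Finset.mem_filter.mp hp).2
      obtain ⟨h1, h2, h3⟩ := hν p hpm
      obtain ⟨k1, k2, k3⟩ := hν (ν p) h1
      have hbs := notMem_of_erase_eq hpm h2 h1 h3
      obtain ⟨u1, u2⟩ := neighbour_unique h1 k1 k2 k3 hpm hbs h3.symm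
      exact Prod.ext u1 u2
  rw [hz, mul_zero]

end SmoothCompleteFan

open Component

/-! ### Further operators on one component -/

section Weight

variable {ι : Type} [LinearOrder ι] [DecidableEq ι] {R : Type} [CommRing R] [Algebra ℂ R]

/-- Multiplication of the coefficients by numbers. -/
def weightOp (R : Type) [CommRing R] [Algebra ℂ R] (w : Finset ι → ℂ) :
    Module.End ℂ (Finset ι → R) where
  toFun α := fun A => w A • α A
  map_add' α β := by funext A; simp
  map_smul' c α := by funext A; exact smul_comm _ _ _

theorem weightOp_apply (w : Finset ι → ℂ) (α : Finset ι → R) (A : Finset ι) :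
    weightOp R w α A = w A • α A := rfl

theorem coeffwise_weight (L : Module.End ℂ R) (w : Finset ι → ℂ) :
    Commute (coeffwise ι L) (weightOp R w) := by
  refine LinearMap.ext fun α => funext fun A => ?_
  simp only [Module.End.mul_apply, coeffwise_apply, weightOp_apply, map_smul]

theorem annihilation_weight {w w' : Finset ι → ℂ} {i : ι}
    (h : ∀ A, i ∉ A → w (insert i A) = w' A) :
    annihilation R i * weightOp R w = weightOp R w' * annihilation R i := by
  refine LinearMap.ext fun α => funext fun A => ?_
  simp only [Module.End.mul_apply, weightOp_apply, annihilation_apply, genDer]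
  split_ifs with hi
  · simp
  · rw [h A hi, smul_comm]

theorem creation_weight {w w' : Finset ι → ℂ} {i : ι}
    (h : ∀ A, i ∉ A → w' (insert i A) = w A) :
    creation R i * weightOp R w = weightOp R w' * creation R i := by
  refine LinearMap.ext fun α => funext fun A => ?_
  simp only [Module.End.mul_apply, weightOp_apply, creation_apply, genMul]
  split_ifs with hi
  · rw [← h (A.erase i) (Finset.notMem_erase _ _), Finset.insert_erase hi, smul_comm]
  · simp

theorem weightOp_add (w w' : Finset ι → ℂ) :
    weightOp R (w + w') = weightOp R w + weightOp R w' :=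
  LinearMap.ext fun α => funext fun A => add_smul _ _ _

theorem weightOp_neg (w : Finset ι → ℂ) : weightOp R (-w) = -weightOp R w :=
  LinearMap.ext fun α => funext fun A => neg_smul _ _

theorem weightOp_one : weightOp R (1 : Finset ι → ℂ) = 1 :=
  LinearMap.ext fun α => funext fun A => one_smul _ _

end Weight

/-- The number of the factors `θ̃_k` in a monomial. -/
def thetaCount (A : Finset (Gen n d)) : ℂ :=
  ((Finset.univ.filter fun k : Fin n => (Sum.inrₗ k : Gen n d) ∈ A).card : ℂ)

theorem thetaCount_insert_inl (A : Finset (Gen n d)) (i : Fin d) :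
    thetaCount (insert (Sum.inlₗ i) A) = thetaCount A := by
  unfold thetaCount
  congr 3
  ext k
  rw [Finset.mem_insert]
  exact ⟨fun h => h.resolve_left inr_ne_inl, Or.inr⟩

theorem thetaCount_insert_inr {A : Finset (Gen n d)} {k : Fin n} (h : Sum.inrₗ k ∉ A) :
    thetaCount (insert (Sum.inrₗ k) A) = thetaCount A + 1 := by
  unfold thetaCount
  have : (Finset.univ.filter fun l : Fin n => (Sum.inrₗ l : Gen n d) ∈ insert (Sum.inrₗ k) A)
      = insert k (Finset.univ.filter fun l : Fin n => (Sum.inrₗ l : Gen n d) ∈ A) := by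
    ext l
    simp only [Finset.mem_filter, Finset.mem_univ, true_and, Finset.mem_insert]
    constructor
    · rintro (e | e)
      · exact Or.inl (Sum.inr_injective (toLex.injective e))
      · exact Or.inr e
    · rintro (e | e)
      · exact Or.inl (by rw [e])
      · exact Or.inr e
  rw [this, Finset.card_insert_of_notMem (by simpa using h)]
  push_cast
  rfl

/-- The sign of a monomial. -/
def paritySign (A : Finset (Gen n d)) : ℂ := (-1) ^ A.card

theorem paritySign_insert {A : Finset (Gen n d)} {x : Gen n d} (h : x ∉ A) :
    paritySign (insert x A) = -paritySign A := by
  unfold paritySign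
  rw [Finset.card_insert_of_notMem h, pow_succ]
  ring

namespace Component

variable {ray m : Fin d → Fin n → ℤ} {s : Finset (Fin d)}

/-- The operator `\bar∂` on `X_s`. -/
def dbarOp (n : ℕ) {d : ℕ} (s : Finset (Fin d)) : Module.End ℂ (SFld n s) :=
  ∑ v ∈ s, cw n s (Sm.dzbarOp s v) * eOp n s v

/-- The contraction `∑_v c_v δ_v`, for operators `c_v` on functions. -/
def contractOp (ray : Fin d → Fin n → ℤ) (s : Finset (Fin d)) (c : Fin d → Module.End ℂ (Sm s)) :
    Module.End ℂ (SFld n s) :=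
  ∑ v ∈ s, cw n s (c v) * deltaOp ray s v

theorem delta_mul_creation (v : Fin d) (k : Fin n) :
    deltaOp ray s v * creation (Sm s) (Sum.inrₗ k)
      + creation (Sm s) (Sum.inrₗ k) * deltaOp ray s v = (ray v k : ℂ) • 1 := by
  unfold deltaOp
  rw [Finset.sum_mul, Finset.mul_sum, ← Finset.sum_add_distrib, Finset.sum_eq_single k]
  · rw [smul_mul_assoc, mul_smul_comm, ← smul_add, annihilation_mul_creation, sub_add_cancel]
  · intro l _ hl
    rw [smul_mul_assoc, mul_smul_comm, ← smul_add, annihilation_mul_creation_of_ne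
      (fun h' => hl (Sum.inr_injective (toLex.injective h'))), neg_add_cancel, smul_zero]
  · simp

theorem contractOp_creation (c : Fin d → Module.End ℂ (Sm s)) (k : Fin n) :
    contractOp ray s c * creation (Sm s) (Sum.inrₗ k)
      + creation (Sm s) (Sum.inrₗ k) * contractOp ray s c
      = ∑ v ∈ s, (ray v k : ℂ) • cw n s (c v) := by
  unfold contractOp
  rw [Finset.sum_mul, Finset.mul_sum, ← Finset.sum_add_distrib]
  refine Finset.sum_congr rfl fun v _ => ?_
  rw [mul_assoc, ← mul_assoc (creation (Sm s) _), ← (coeffwise_creation (c v) _).eq, mul_assoc,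
    ← mul_add, delta_mul_creation, mul_smul_comm, mul_one]

theorem dbarOp_creation (k : Fin n) :
    dbarOp n s * creation (Sm s) (Sum.inrₗ k) = -(creation (Sm s) (Sum.inrₗ k) * dbarOp n s) := by
  unfold dbarOp
  rw [Finset.sum_mul, Finset.mul_sum, ← Finset.sum_neg_distrib]
  refine Finset.sum_congr rfl fun v _ => ?_
  rw [mul_assoc, creation_anticomm, mul_neg, ← mul_assoc, ← mul_assoc,
    (coeffwise_creation (Sm.dzbarOp s v) _).eq]

theorem commute_dbarOp {c : Module.End ℂ (Sm s)} (h : ∀ v ∈ s, Commute c (Sm.dzbarOp s v)) :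
    Commute (cw n s c) (dbarOp n s) :=
  Commute.sum_right _ _ _ fun v hv => ((h v hv).map (cw n s)).mul_right (coeffwise_creation c _)

theorem cw_mul_contractOp (b : Module.End ℂ (Sm s)) (c : Fin d → Module.End ℂ (Sm s)) :
    cw n s b * contractOp ray s c = contractOp ray s fun v => b * c v := by
  unfold contractOp
  rw [Finset.mul_sum]
  exact Finset.sum_congr rfl fun v _ => by rw [map_mul, mul_assoc]

theorem contractOp_mul_cw (b : Module.End ℂ (Sm s)) (c : Fin d → Module.End ℂ (Sm s)) :
    contractOp ray s c * cw n s b = contractOp ray s fun v => c v * b := by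
  unfold contractOp
  rw [Finset.sum_mul]
  exact Finset.sum_congr rfl fun v _ => by
    rw [map_mul, mul_assoc, mul_assoc, (cw_commute_delta b v).eq]

theorem contractOp_sub (b c : Fin d → Module.End ℂ (Sm s)) :
    contractOp ray s b - contractOp ray s c = contractOp ray s fun v => b v - c v := by
  unfold contractOp
  rw [← Finset.sum_sub_distrib]
  exact Finset.sum_congr rfl fun v _ => by rw [map_sub, sub_mul]

theorem contractOp_congr {b c : Fin d → Module.End ℂ (Sm s)} (h : ∀ v ∈ s, b v = c v) :
    contractOp ray s b = contractOp ray s c :=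
  Finset.sum_congr rfl fun v hv => by rw [h v hv]

/-- The multiplication operators by the coordinates. -/
def coordOps (s : Finset (Fin d)) (v : Fin d) : Module.End ℂ (Sm s) := Sm.mulOp (Sm.coord s v)

theorem diff_eq : diff ray s = dbarOp n s + contractOp ray s (coordOps s) := by
  unfold diff dbarOp contractOp diffAt oneVarDiff
  rw [Finset.sum_add_distrib]
  rfl

theorem delOp_eq : delOp ray s = contractOp ray s (eulerAt s) := rfl

theorem euler_mul_coord {v : Fin d} (hv : v ∈ s) :
    eulerAt s v * coordOps s v = coordOps s v * eulerAt s v + coordOps s v := by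
  unfold eulerAt coordOps
  rw [mul_assoc, Sm.dzOp_mul_mulOp, Sm.dzOp_coord, if_pos ⟨hv, rfl⟩, Sm.mulOp_one, mul_add, mul_one]

theorem contractOp_single {i : Fin d} (hi : i ∈ s) (b : Module.End ℂ (Sm s)) :
    contractOp ray s (fun v => if v = i then b else 0) = cw n s b * deltaOp ray s i := by
  unfold contractOp
  rw [Finset.sum_eq_single_of_mem i hi]
  · simp only [if_true]
  · intro v _ hv
    simp only [if_neg hv, map_zero, zero_mul]

theorem delOp_coord (i : Fin d) :
    delOp ray s * cw n s (coordOps s i) - cw n s (coordOps s i) * delOp ray s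
      = cw n s (coordOps s i) * deltaOp ray s i := by
  by_cases hi : i ∈ s
  · rw [delOp_eq, contractOp_mul_cw, cw_mul_contractOp, contractOp_sub, ← contractOp_single hi]
    refine contractOp_congr fun v hv => ?_
    split_ifs with hvi
    · subst hvi
      rw [euler_mul_coord hv, add_sub_cancel_left]
    · rw [show eulerAt s v * coordOps s i = coordOps s i * eulerAt s v from
        (eulerAt_coord_comm hvi).eq, sub_self]
  · have : coordOps s i = 0 := by unfold coordOps; rw [Sm.coord_eq_zero hi, Sm.mulOp_zero]
    rw [this, map_zero, mul_zero, zero_mul, zero_mul, sub_self]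

theorem diff_coord (i : Fin d) : Commute (diff ray s) (cw n s (coordOps s i)) := by
  rw [diff_eq]
  refine Commute.add_left (commute_dbarOp fun v _ => ?_).symm ?_
  · exact (mulOp_commute_of_dz (Sm.dzbarOp_coord v i) rfl).symm
  · show _ * _ = _ * _
    rw [contractOp_mul_cw, cw_mul_contractOp]
    exact contractOp_congr fun v _ => (Sm.mulOp_comm _ _).eq

theorem diff_euler (i : Fin d) :
    diff ray s * cw n s (eulerAt s i) - cw n s (eulerAt s i) * diff ray s
      = -(cw n s (coordOps s i) * deltaOp ray s i) := by
  have h1 : dbarOp n s * cw n s (eulerAt s i) = cw n s (eulerAt s i) * dbarOp n s :=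
    (commute_dbarOp fun v _ => (dzbar_eulerAt_comm v i).symm).symm.eq
  rw [diff_eq, add_mul, mul_add, h1, add_sub_add_left_eq_sub]
  by_cases hi : i ∈ s
  · rw [contractOp_mul_cw, cw_mul_contractOp, contractOp_sub, ← contractOp_single hi]
    unfold contractOp
    rw [← Finset.sum_neg_distrib]
    refine Finset.sum_congr rfl fun v hv => ?_
    dsimp only
    split_ifs with hvi
    · subst hvi
      rw [euler_mul_coord hv, sub_add_cancel_left, map_neg, neg_mul]
    · rw [show coordOps s v * eulerAt s i = eulerAt s i * coordOps s v from
        (eulerAt_coord_comm (Ne.symm hvi)).symm.eq, sub_self, map_zero, zero_mul, neg_zero]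
  · have h0 : coordOps s i = 0 := by unfold coordOps; rw [Sm.coord_eq_zero hi, Sm.mulOp_zero]
    have h2 : eulerAt s i = 0 := by unfold eulerAt; rw [Sm.coord_eq_zero hi, Sm.mulOp_zero, zero_mul]
    rw [h0, h2, map_zero, mul_zero, zero_mul, zero_mul, sub_self, neg_zero]

theorem delOp_euler (i : Fin d) : Commute (delOp ray s) (cw n s (eulerAt s i)) := by
  show _ * _ = _ * _
  rw [delOp_eq, contractOp_mul_cw, cw_mul_contractOp]
  exact contractOp_congr fun v _ => (eulerAt_comm v i).eq

theorem dbarOp_weight {w w' : Finset (Gen n d) → ℂ}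
    (h : ∀ i A, Sum.inlₗ i ∉ A → w' (insert (Sum.inlₗ i) A) = w A) :
    dbarOp n s * weightOp (Sm s) w = weightOp (Sm s) w' * dbarOp n s := by
  unfold dbarOp
  rw [Finset.sum_mul, Finset.mul_sum]
  refine Finset.sum_congr rfl fun v _ => ?_
  rw [mul_assoc, creation_weight (h v), ← mul_assoc, (coeffwise_weight _ _).eq, mul_assoc]

theorem contractOp_weight {w w' : Finset (Gen n d) → ℂ} (c : Fin d → Module.End ℂ (Sm s))
    (h : ∀ k A, Sum.inrₗ k ∉ A → w (insert (Sum.inrₗ k) A) = w' A) :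
    contractOp ray s c * weightOp (Sm s) w = weightOp (Sm s) w' * contractOp ray s c := by
  have hd : ∀ v, deltaOp ray s v * weightOp (Sm s) w = weightOp (Sm s) w' * deltaOp ray s v := by
    intro v
    unfold deltaOp
    rw [Finset.sum_mul, Finset.mul_sum]
    refine Finset.sum_congr rfl fun k _ => ?_
    rw [smul_mul_assoc, mul_smul_comm, annihilation_weight (h k)]
  unfold contractOp
  rw [Finset.sum_mul, Finset.mul_sum]
  refine Finset.sum_congr rfl fun v _ => ?_
  rw [mul_assoc, hd, ← mul_assoc, (coeffwise_weight _ _).eq, mul_assoc]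

theorem contractOp_thetaCount (c : Fin d → Module.End ℂ (Sm s)) :
    contractOp ray s c * weightOp (Sm s) thetaCount
      = weightOp (Sm s) thetaCount * contractOp ray s c + contractOp ray s c := by
  rw [contractOp_weight (w' := thetaCount + 1) c fun k A h => thetaCount_insert_inr h,
    weightOp_add, weightOp_one, add_mul, one_mul]

theorem diff_thetaCount : diff ray s * weightOp (Sm s) thetaCount
    = weightOp (Sm s) thetaCount * diff ray s + contractOp ray s (coordOps s) := by
  rw [diff_eq, add_mul, mul_add, contractOp_thetaCount,
    dbarOp_weight (w' := thetaCount) fun i A _ => thetaCount_insert_inl A i, add_assoc]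

theorem diff_parity : diff ray s * weightOp (Sm s) paritySign
    = -(weightOp (Sm s) paritySign * diff ray s) := by
  rw [diff_eq, add_mul, mul_add,
    contractOp_weight (w' := -paritySign) _ fun k A h => paritySign_insert h,
    dbarOp_weight (w' := -paritySign) fun i A h => by
      rw [Pi.neg_apply, paritySign_insert h, neg_neg], weightOp_neg, neg_mul, neg_mul, neg_add]

theorem delOp_parity : delOp ray s * weightOp (Sm s) paritySign
    = -(weightOp (Sm s) paritySign * delOp ray s) := by
  rw [delOp_eq, contractOp_weight (w' := -paritySign) _ fun k A h => paritySign_insert h,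
    weightOp_neg, neg_mul]

theorem contractOp_coord_sum :
    contractOp ray s (coordOps s) = ∑ i, cw n s (coordOps s i) * deltaOp ray s i := by
  unfold contractOp
  refine Finset.sum_subset (Finset.subset_univ s) fun v _ hv => ?_
  unfold coordOps
  rw [Sm.coord_eq_zero hv, Sm.mulOp_zero, map_zero, zero_mul]

end Component

open Component

namespace SmoothCompleteFan

variable {F : SmoothCompleteFan n d}

/-! ### Operators on `PV_log(X)` -/

/-- A function on `ℂᵈ` is smooth on the components of `X`. -/
def SmoothOn (F : SmoothCompleteFan n d) (h : (Fin d → ℂ) → ℂ) : Prop :=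
  ∀ s : F.MaxCone, ContDiff ℝ ∞ fun z => h (incl s.1 z)

/-- Multiplication by a function. -/
def mulPV (h : (Fin d → ℂ) → ℂ) (hh : F.SmoothOn h) : Module.End ℂ F.PV where
  toFun α := ⟨fun s A z => h (incl s.1 z) * α.1 s A z, by
    refine ⟨fun s A => (hh s).mul (α.2.1 s A), fun s A hA => ?_, fun s t A hs ht w hw => ?_⟩
    · funext z
      beta_reduce
      rw [α.2.2.1 s A hA]
      simp
    · beta_reduce
      rw [α.2.2.2 s t A hs ht w hw,
        incl_proj (fun i hi => hw i fun h => hi (Finset.mem_inter.mp h).1),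
        incl_proj (fun i hi => hw i fun h => hi (Finset.mem_inter.mp h).2)]⟩
  map_add' α β := Subtype.ext <| funext fun s => funext fun A => funext fun z => mul_add _ _ _
  map_smul' c α := Subtype.ext <| funext fun s => funext fun A => funext fun z =>
    mul_left_comm _ _ _

theorem leftIn_erase_inr {s : Finset (Fin d)} {A : Finset (Gen n d)} {k : Fin n} :
    LeftIn (A.erase (Sum.inrₗ k)) s ↔ LeftIn A s :=
  ⟨fun h i hi => h i (Finset.mem_erase.mpr ⟨inl_ne_inr, hi⟩),
    fun h i hi => h i (Finset.mem_of_mem_erase hi)⟩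

/-- Multiplication by `θ̃_k`. -/
def thetaPV (F : SmoothCompleteFan n d) (k : Fin n) : Module.End ℂ F.PV where
  toFun α := ⟨fun s => genMul (Sum.inrₗ k) (α.1 s), by
    refine ⟨fun s A => contDiff_genMul (α.2.1 s) _ _, fun s A hA => ?_, fun s t A hs ht w hw => ?_⟩
    · unfold genMul
      beta_reduce
      rw [α.2.2.1 s _ (fun h => hA (leftIn_erase_inr.mp h)), smul_zero, ite_self]
    · unfold genMul
      beta_reduce
      split_ifs
      · simp only [Pi.smul_apply]
        rw [α.2.2.2 s t _ (leftIn_erase_inr.mpr hs) (leftIn_erase_inr.mpr ht) w hw]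
      · rfl⟩
  map_add' α β := Subtype.ext <| funext fun s => genMul_add _ _ _
  map_smul' c α := Subtype.ext <| funext fun s => genMul_smul _ _ _

/-- The Euler vector field `z_i ∂/∂z_i`, acting on the coefficients. -/
def eulerPV (F : SmoothCompleteFan n d) (i : Fin d) : Module.End ℂ F.PV where
  toFun α := ⟨fun s A z => incl s.1 z i * dz s.1 i (α.1 s A) z, by
    refine ⟨fun s A => (contDiff_incl i).mul (contDiff_dz (α.2.1 s A) i), fun s A hA => ?_,
      fun s t A hs ht w hw => ?_⟩
    · funext z
      beta_reduce
      rw [α.2.2.1 s A hA, dz_zero]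
      simp
    · beta_reduce
      rw [incl_proj (fun i hi => hw i fun h => hi (Finset.mem_inter.mp h).1),
        incl_proj (fun i hi => hw i fun h => hi (Finset.mem_inter.mp h).2)]
      by_cases hi : i ∈ s.1 ∩ t.1
      · rw [dz_compat (α.2.1 s A) (α.2.1 t A) (α.2.2.2 s t A hs ht) hw hi]
      · rw [hw i hi, zero_mul, zero_mul]⟩
  map_add' α β := Subtype.ext <| funext fun s => funext fun A => funext fun z => by
    show incl s.1 z i * dz s.1 i (α.1 s A + β.1 s A) z
      = incl s.1 z i * dz s.1 i (α.1 s A) z + incl s.1 z i * dz s.1 i (β.1 s A) z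
    rw [dz_add (α.2.1 s A) (β.2.1 s A), Pi.add_apply, mul_add]
  map_smul' c α := Subtype.ext <| funext fun s => funext fun A => funext fun z => by
    show incl s.1 z i * dz s.1 i (c • α.1 s A) z = c * (incl s.1 z i * dz s.1 i (α.1 s A) z)
    rw [dz_smul (α.2.1 s A), Pi.smul_apply, smul_eq_mul, mul_left_comm]

/-- Multiplication of the coefficients by numbers. -/
def weightPV (F : SmoothCompleteFan n d) (w : Finset (Gen n d) → ℂ) : Module.End ℂ F.PV where
  toFun α := ⟨fun s A => w A • α.1 s A, by
    refine ⟨fun s A => contDiff_const.smul (α.2.1 s A), fun s A hA => ?_,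
      fun s t A hs ht w hw => ?_⟩
    · beta_reduce
      rw [α.2.2.1 s A hA, smul_zero]
    · beta_reduce
      rw [Pi.smul_apply, Pi.smul_apply, α.2.2.2 s t A hs ht w hw]⟩
  map_add' α β := Subtype.ext <| funext fun s => funext fun A => smul_add _ _ _
  map_smul' c α := Subtype.ext <| funext fun s => funext fun A =>
    smul_comm (w A) c (α.1 s A)

/-- `L` acts on the component `X_s` by the operator `A s`. -/
def Rep (L : Module.End ℂ F.PV) (A : ∀ s : F.MaxCone, Module.End ℂ (SFld n s.1)) : Prop :=
  ∀ s α, emb s (L α) = A s (emb s α)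

section Rep

variable {L L' : Module.End ℂ F.PV} {A A' : ∀ s : F.MaxCone, Module.End ℂ (SFld n s.1)}

theorem Rep.mul (h : Rep L A) (h' : Rep L' A') : Rep (L * L') fun s => A s * A' s := fun s α => by
  rw [Module.End.mul_apply, h, h', Module.End.mul_apply]

theorem Rep.add (h : Rep L A) (h' : Rep L' A') : Rep (L + L') fun s => A s + A' s := fun s α => by
  rw [LinearMap.add_apply, map_add, h, h', LinearMap.add_apply]

theorem Rep.neg (h : Rep L A) : Rep (-L) fun s => -A s := fun s α => by
  rw [LinearMap.neg_apply, map_neg, h, LinearMap.neg_apply]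

theorem Rep.smul (h : Rep L A) (c : ℂ) : Rep (c • L) fun s => c • A s := fun s α => by
  rw [LinearMap.smul_apply, map_smul, h, LinearMap.smul_apply]

theorem Rep.sum {ι : Type*} (T : Finset ι) {L : ι → Module.End ℂ F.PV}
    {A : ι → ∀ s : F.MaxCone, Module.End ℂ (SFld n s.1)} (h : ∀ i, Rep (L i) (A i)) :
    Rep (∑ i ∈ T, L i) fun s => ∑ i ∈ T, A i s := fun s α => by
  rw [LinearMap.sum_apply, map_sum, LinearMap.sum_apply]
  exact Finset.sum_congr rfl fun i _ => h i s α

theorem Rep.eq (h : Rep L A) (h' : Rep L' A') (e : ∀ s, A s = A' s) : L = L' :=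
  LinearMap.ext fun α => PV_ext fun s => by rw [h, h', e]

theorem rep_baseDiff : Rep F.baseDiff fun s => diff F.ray s.1 := emb_baseDiff

theorem rep_dbarPV : Rep F.dbarPV fun s => dbarOp n s.1 := emb_dbarPV

theorem rep_bracketPV : Rep F.bracketPV fun s => contractOp F.ray s.1 (coordOps s.1) :=
  emb_bracketPV

theorem rep_delPV : Rep F.delPV fun s => delOp F.ray s.1 := emb_delPV

theorem rep_mulPV (h : (Fin d → ℂ) → ℂ) (hh : F.SmoothOn h) :
    Rep (mulPV h hh) fun s => cw n s.1 (Sm.mulOp (Sm.mk _ (hh s))) := fun _ _ => rfl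

theorem rep_thetaPV (k : Fin n) : Rep (F.thetaPV k) fun s => creation (Sm s.1) (Sum.inrₗ k) := by
  intro s α
  funext A
  rw [creation_apply]
  refine Sm.ext fun z => ?_
  show genMul (Sum.inrₗ k) (α.1 s) A z = _
  simp only [genMul]
  split_ifs
  · rfl
  · rfl

theorem rep_eulerPV (i : Fin d) : Rep (F.eulerPV i) fun s => cw n s.1 (eulerAt s.1 i) :=
  fun _ _ => rfl

theorem rep_weightPV (w : Finset (Gen n d) → ℂ) :
    Rep (F.weightPV w) fun s => weightOp (Sm s.1) w := fun _ _ => funext fun _ => Sm.ext fun _ => rfl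

end Rep

theorem smoothOn_coord (i : Fin d) : F.SmoothOn fun w => w i := fun _ => contDiff_incl i

/-- Multiplication by the coordinate `z_i`. -/
def coordPV (F : SmoothCompleteFan n d) (i : Fin d) : Module.End ℂ F.PV :=
  mulPV (fun w => w i) (smoothOn_coord i)

theorem rep_coordPV (i : Fin d) : Rep (F.coordPV i) fun s => cw n s.1 (coordOps s.1 i) :=
  fun _ _ => rfl

theorem sum_cw_eq {s : Finset (Fin d)} {c : Fin d → Module.End ℂ (Sm s)}
    (hc : ∀ v ∉ s, c v = 0) (ray : Fin d → Fin n → ℤ) (k : Fin n) :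
    ∑ v ∈ s, (ray v k : ℂ) • cw n s (c v) = ∑ v, (ray v k : ℂ) • cw n s (c v) :=
  Finset.sum_subset (Finset.subset_univ s) fun v _ hv => by rw [hc v hv, map_zero, smul_zero]

theorem coordOps_eq_zero {s : Finset (Fin d)} {v : Fin d} (hv : v ∉ s) : coordOps s v = 0 := by
  unfold coordOps
  rw [Sm.coord_eq_zero hv, Sm.mulOp_zero]

theorem eulerAt_eq_zero {s : Finset (Fin d)} {v : Fin d} (hv : v ∉ s) : eulerAt s v = 0 := by
  unfold eulerAt
  rw [Sm.coord_eq_zero hv, Sm.mulOp_zero, zero_mul]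

theorem bracketPV_theta (k : Fin n) : F.bracketPV * F.thetaPV k + F.thetaPV k * F.bracketPV
    = ∑ i, (F.ray i k : ℂ) • F.coordPV i :=
  ((rep_bracketPV.mul (rep_thetaPV k)).add ((rep_thetaPV k).mul rep_bracketPV)).eq
    (Rep.sum _ fun i => (rep_coordPV i).smul _) fun s => by
      rw [contractOp_creation, sum_cw_eq fun v hv => coordOps_eq_zero hv]

theorem dbarPV_theta (k : Fin n) : F.dbarPV * F.thetaPV k = -(F.thetaPV k * F.dbarPV) :=
  (rep_dbarPV.mul (rep_thetaPV k)).eq ((rep_thetaPV k).mul rep_dbarPV).neg fun s =>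
    dbarOp_creation k

theorem baseDiff_theta (k : Fin n) : F.baseDiff * F.thetaPV k + F.thetaPV k * F.baseDiff
    = ∑ i, (F.ray i k : ℂ) • F.coordPV i := by
  rw [← bracketPV_theta, baseDiff, add_mul, mul_add, dbarPV_theta]
  abel

theorem delPV_theta (k : Fin n) : F.delPV * F.thetaPV k + F.thetaPV k * F.delPV
    = ∑ i, (F.ray i k : ℂ) • F.eulerPV i :=
  ((rep_delPV.mul (rep_thetaPV k)).add ((rep_thetaPV k).mul rep_delPV)).eq
    (Rep.sum _ fun i => (rep_eulerPV i).smul _) fun s => by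
      rw [delOp_eq, contractOp_creation, sum_cw_eq fun v hv => eulerAt_eq_zero hv]

theorem baseDiff_coord (i : Fin d) : F.baseDiff * F.coordPV i = F.coordPV i * F.baseDiff :=
  (rep_baseDiff.mul (rep_coordPV i)).eq ((rep_coordPV i).mul rep_baseDiff) fun s => diff_coord i

theorem delPV_euler (i : Fin d) : F.delPV * F.eulerPV i = F.eulerPV i * F.delPV :=
  (rep_delPV.mul (rep_eulerPV i)).eq ((rep_eulerPV i).mul rep_delPV) fun s => delOp_euler i

theorem baseDiff_euler_add (i : Fin d) :
    F.baseDiff * F.eulerPV i + F.delPV * F.coordPV i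
      = F.eulerPV i * F.baseDiff + F.coordPV i * F.delPV :=
  ((rep_baseDiff.mul (rep_eulerPV i)).add (rep_delPV.mul (rep_coordPV i))).eq
    (((rep_eulerPV i).mul rep_baseDiff).add ((rep_coordPV i).mul rep_delPV)) fun s => by
      have h1 := diff_euler (ray := F.ray) (s := s.1) i
      have h2 := delOp_coord (ray := F.ray) (s := s.1) i
      rw [sub_eq_iff_eq_add] at h1 h2
      rw [h1, h2]
      abel

/-- The total Euler field with the `θ̃_k` in degree one. -/
def degPV (F : SmoothCompleteFan n d) : Module.End ℂ F.PV :=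
  ∑ i, F.eulerPV i + F.weightPV thetaCount

theorem rep_degPV : Rep F.degPV fun s =>
    ∑ i, cw n s.1 (eulerAt s.1 i) + weightOp (Sm s.1) thetaCount :=
  (Rep.sum _ fun i => rep_eulerPV i).add (rep_weightPV _)

theorem baseDiff_deg : F.baseDiff * F.degPV = F.degPV * F.baseDiff :=
  (rep_baseDiff.mul rep_degPV).eq (rep_degPV.mul rep_baseDiff) fun s => by
    have h1 : ∀ i, diff F.ray s.1 * cw n s.1 (eulerAt s.1 i)
        = cw n s.1 (eulerAt s.1 i) * diff F.ray s.1
          - cw n s.1 (coordOps s.1 i) * deltaOp F.ray s.1 i := fun i => by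
      rw [sub_eq_add_neg, ← diff_euler]
      abel
    rw [mul_add, add_mul, diff_thetaCount, Finset.mul_sum, Finset.sum_mul]
    simp only [h1]
    rw [Finset.sum_sub_distrib, ← contractOp_coord_sum]
    abel

theorem delPV_deg : F.delPV * F.degPV = F.degPV * F.delPV + F.delPV :=
  (rep_delPV.mul rep_degPV).eq ((rep_degPV.mul rep_delPV).add rep_delPV) fun s => by
    rw [mul_add, add_mul, delOp_eq, contractOp_thetaCount, Finset.mul_sum, Finset.sum_mul,
      ← delOp_eq, Finset.sum_congr rfl fun i _ => (delOp_euler (ray := F.ray) (s := s.1) i).eq,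
      add_assoc]

theorem baseDiff_parity :
    F.baseDiff * F.weightPV paritySign = -(F.weightPV paritySign * F.baseDiff) :=
  (rep_baseDiff.mul (rep_weightPV _)).eq ((rep_weightPV _).mul rep_baseDiff).neg fun s =>
    diff_parity

theorem delPV_parity :
    F.delPV * F.weightPV paritySign = -(F.weightPV paritySign * F.delPV) :=
  (rep_delPV.mul (rep_weightPV _)).eq ((rep_weightPV _).mul rep_delPV).neg fun s =>
    delOp_parity

theorem bracketPV_mul (h : (Fin d → ℂ) → ℂ) (hh : F.SmoothOn h) :
    F.bracketPV * mulPV h hh = mulPV h hh * F.bracketPV :=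
  (rep_bracketPV.mul (rep_mulPV h hh)).eq ((rep_mulPV h hh).mul rep_bracketPV) fun s => by
    rw [contractOp_mul_cw, cw_mul_contractOp]
    exact contractOp_congr fun v _ => (Sm.mulOp_comm _ _).eq

theorem coord_coord (i j : Fin d) : F.coordPV i * F.coordPV j = F.coordPV j * F.coordPV i :=
  ((rep_coordPV i).mul (rep_coordPV j)).eq ((rep_coordPV j).mul (rep_coordPV i)) fun s => by
    rw [← map_mul, ← map_mul]
    exact congrArg _ (Sm.mulOp_comm _ _).eq

theorem euler_euler (i j : Fin d) : F.eulerPV i * F.eulerPV j = F.eulerPV j * F.eulerPV i :=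
  ((rep_eulerPV i).mul (rep_eulerPV j)).eq ((rep_eulerPV j).mul (rep_eulerPV i)) fun s => by
    rw [← map_mul, ← map_mul, (eulerAt_comm i j).eq]

theorem euler_coord {i j : Fin d} (h : i ≠ j) :
    F.eulerPV i * F.coordPV j = F.coordPV j * F.eulerPV i :=
  ((rep_eulerPV i).mul (rep_coordPV j)).eq ((rep_coordPV j).mul (rep_eulerPV i)) fun s => by
    rw [← map_mul, ← map_mul]
    exact congrArg _ (eulerAt_coord_comm h).eq

end SmoothCompleteFan

/-! ### Operators on `M[[u]]` -/

namespace USeries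

variable {M : Type} [AddCommGroup M]

theorem coeff_sub (α β : USeries M) (k : ℕ) : (α - β).coeff k = α.coeff k - β.coeff k := rfl

theorem coeff_finset_sum {ι : Type*} (S : Finset ι) (α : ι → USeries M) (k : ℕ) :
    (∑ i ∈ S, α i).coeff k = ∑ i ∈ S, (α i).coeff k :=
  map_sum (⟨⟨fun α => α.coeff k, rfl⟩, fun _ _ => rfl⟩ : USeries M →+ M) _ _

theorem coeff_sum_apply {ι : Type*} (S : Finset ι) (B : ι → AddMonoid.End (USeries M))
    (α : USeries M) (k : ℕ) :
    ((∑ i ∈ S, B i : AddMonoid.End (USeries M)) α).coeff k = ∑ i ∈ S, (B i α).coeff k :=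
  map_sum (⟨⟨fun B => (B α).coeff k, rfl⟩, fun _ _ => rfl⟩ : AddMonoid.End (USeries M) →+ M) _ _

/-- Multiplication by `u`. -/
def shift : AddMonoid.End (USeries M) where
  toFun α := mk fun k => Nat.casesOn k 0 α.coeff
  map_zero' := ext fun k => by cases k <;> rfl
  map_add' α β := ext fun k => by
    cases k with
    | zero => exact (add_zero 0).symm
    | succ k => rfl

theorem coeff_shift_zero (α : USeries M) : (shift α).coeff 0 = 0 := rfl

theorem coeff_shift_succ (α : USeries M) (k : ℕ) : (shift α).coeff (k + 1) = α.coeff k := rfl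

/-- The derivation `u d/du`. -/
def uDeriv : AddMonoid.End (USeries M) where
  toFun α := mk fun k => k • α.coeff k
  map_zero' := ext fun k => smul_zero _
  map_add' α β := ext fun k => smul_add _ _ _

theorem coeff_uDeriv (α : USeries M) (k : ℕ) : (uDeriv α).coeff k = k • α.coeff k := rfl

variable [Module ℂ M]

/-- The coefficientwise action of an operator. -/
def lift : Module.End ℂ M →+* AddMonoid.End (USeries M) where
  toFun D :=
    { toFun := fun α => mk fun k => D (α.coeff k)
      map_zero' := ext fun _ => map_zero D
      map_add' := fun _ _ => ext fun _ => map_add D _ _ }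
  map_one' := rfl
  map_mul' _ _ := rfl
  map_zero' := rfl
  map_add' _ _ := rfl

theorem coeff_lift (D : Module.End ℂ M) (α : USeries M) (k : ℕ) :
    (lift D α).coeff k = D (α.coeff k) := rfl

theorem lift_shift (D : Module.End ℂ M) : lift D * shift = shift * lift D := by
  refine AddMonoidHom.ext fun α => ext fun k => ?_
  cases k with
  | zero => exact map_zero D
  | succ k => rfl

theorem lift_uDeriv (D : Module.End ℂ M) : lift D * uDeriv = uDeriv * lift D :=
  AddMonoidHom.ext fun α => ext fun k => map_nsmul D k _

theorem uDeriv_shift : (uDeriv * shift : AddMonoid.End (USeries M)) = shift * (uDeriv + 1) := by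
  refine AddMonoidHom.ext fun α => ext fun k => ?_
  cases k with
  | zero => exact smul_zero (0 : ℕ)
  | succ k => exact succ_nsmul _ _

theorem linearOp_eq (D₀ D₁ : Module.End ℂ M) (α : USeries M) :
    linearOp D₀ D₁ α = (lift D₀ + shift * lift D₁ : AddMonoid.End (USeries M)) α := by
  refine ext fun k => ?_
  cases k <;> rfl

section Neumann

/-- Operators for which the coefficients of the image up to order `k` depend only on those of the
argument. -/
def Causal (B : AddMonoid.End (USeries M)) : Prop :=
  ∀ k α, (∀ j ≤ k, α.coeff j = 0) → ∀ j ≤ k, (B α).coeff j = 0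

theorem causal_add_shift (b₀ b₁ : Module.End ℂ M) : Causal (lift b₀ + shift * lift b₁) := by
  intro k α h j hj
  show b₀ (α.coeff j) + (shift (lift b₁ α)).coeff j = 0
  rw [h j hj, map_zero, zero_add]
  cases j with
  | zero => rfl
  | succ j =>
    rw [coeff_shift_succ, coeff_lift, h j (by omega), map_zero]

/-- The sum `∑ (-B)^m`, truncated in such a way that the powers `m ≥ N + k` do not contribute to
the coefficient of `u^k`. -/
def neumann (N : ℕ) (B : AddMonoid.End (USeries M)) : AddMonoid.End (USeries M) where
  toFun α := mk fun k => ∑ m ∈ Finset.range (N + k), (-1 : ℂ) ^ m • ((B ^ m) α).coeff k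
  map_zero' := ext fun k => by
    simp only [coeff_mk, map_zero, coeff_zero, smul_zero, Finset.sum_const_zero]
  map_add' α β := ext fun k => by
    simp only [coeff_mk, coeff_add, map_add, smul_add, Finset.sum_add_distrib]

theorem coeff_neumann (N : ℕ) (B : AddMonoid.End (USeries M)) (α : USeries M) (k : ℕ) :
    (neumann N B α).coeff k
      = ∑ m ∈ Finset.range (N + k), (-1 : ℂ) ^ m • ((B ^ m) α).coeff k := rfl

theorem coeff_neg_pow (B : AddMonoid.End (USeries M)) (m : ℕ) (α : USeries M) (k : ℕ) :
    (((-B) ^ m) α).coeff k = (-1 : ℂ) ^ m • ((B ^ m) α).coeff k := by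
  rcases Nat.even_or_odd m with h | h
  · rw [h.neg_pow, h.neg_one_pow, one_smul]
  · rw [h.neg_pow, h.neg_one_pow, neg_smul, one_smul]
    rfl

variable {N : ℕ} {B : AddMonoid.End (USeries M)}

theorem coeff_neumann_of_le (hN : ∀ m k, N + k ≤ m → ∀ α, ((B ^ m) α).coeff k = 0)
    (α : USeries M) {k K : ℕ} (hk : N + k ≤ K) :
    (neumann N B α).coeff k
      = ((∑ m ∈ Finset.range K, (-B) ^ m : AddMonoid.End (USeries M)) α).coeff k := by
  have h : ((∑ m ∈ Finset.range K, (-B) ^ m : AddMonoid.End (USeries M)) α).coeff k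
      = ∑ m ∈ Finset.range K, (-1 : ℂ) ^ m • ((B ^ m) α).coeff k := by
    rw [coeff_sum_apply]
    exact Finset.sum_congr rfl fun m _ => coeff_neg_pow B m α k
  rw [h, coeff_neumann]
  refine Finset.sum_subset (Finset.range_mono hk) fun m _ hm => ?_
  rw [hN m k (by simpa using hm), smul_zero]

theorem neumann_mul (hN : ∀ m k, N + k ≤ m → ∀ α, ((B ^ m) α).coeff k = 0) :
    neumann N B * (1 + B) = 1 := by
  refine AddMonoidHom.ext fun α => ext fun k => ?_
  show (neumann N B ((1 + B : AddMonoid.End (USeries M)) α)).coeff k = α.coeff k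
  rw [coeff_neumann_of_le hN _ le_rfl]
  have h := geom_sum_mul_neg (-B) (N + k)
  rw [sub_neg_eq_add] at h
  show (((∑ m ∈ Finset.range (N + k), (-B) ^ m) * (1 + B) : AddMonoid.End (USeries M)) α).coeff k
    = α.coeff k
  rw [h]
  show α.coeff k - (((-B) ^ (N + k)) α).coeff k = α.coeff k
  rw [coeff_neg_pow, hN _ _ le_rfl, smul_zero, sub_zero]

theorem mul_neumann (hB : Causal B) (hN : ∀ m k, N + k ≤ m → ∀ α, ((B ^ m) α).coeff k = 0) :
    (1 + B) * neumann N B = 1 := by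
  refine AddMonoidHom.ext fun α => ext fun k => ?_
  set S : AddMonoid.End (USeries M) := ∑ m ∈ Finset.range (N + k), (-B) ^ m with hS
  have h := mul_neg_geom_sum (-B) (N + k)
  rw [sub_neg_eq_add, ← hS] at h
  have h1 : ∀ j ≤ k, (neumann N B α - S α).coeff j = 0 := fun j hj => by
    rw [coeff_sub, coeff_neumann_of_le hN α (K := N + k) (by omega), sub_self]
  have h2 : ((1 + B : AddMonoid.End (USeries M)) (neumann N B α - S α)).coeff k = 0 := by
    show (neumann N B α - S α).coeff k + (B (neumann N B α - S α)).coeff k = 0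
    rw [h1 k le_rfl, hB k _ h1 k le_rfl, zero_add]
  rw [map_sub, coeff_sub, sub_eq_zero] at h2
  refine h2.trans ?_
  show (((1 + B) * S : AddMonoid.End (USeries M)) α).coeff k = α.coeff k
  rw [h]
  show α.coeff k - (((-B) ^ (N + k)) α).coeff k = α.coeff k
  rw [coeff_neg_pow, hN _ _ le_rfl, smul_zero, sub_zero]

end Neumann

end USeries

/-- The homotopy formula for the perturbed contracting homotopy. -/
theorem perturbed_homotopy {R : Type*} [Ring R] {D V B I κ : R} (hD : D * D = 0)
    (hV : D * V + V * D = 1 - κ + B) (h1 : I * (1 + B) = 1) (h2 : (1 + B) * I = 1) :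
    D * (V * I) + V * I * D = 1 - κ * I + V * I * ((D * κ - κ * D) * I) := by
  have e1 : 1 + B = D * V + V * D + κ := by rw [hV]; abel
  have e2 : D * (1 + B) - (1 + B) * D = D * κ - κ * D := by
    rw [e1]
    have : D * (D * V + V * D + κ) - (D * V + V * D + κ) * D
        = (D * D) * V - V * (D * D) + (D * κ - κ * D) := by noncomm_ring
    rw [this, hD, zero_mul, mul_zero, sub_zero, zero_add]
  have e3 : I * D - D * I = I * ((D * κ - κ * D) * I) := by
    rw [← e2]
    have : I * ((D * (1 + B) - (1 + B) * D) * I)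
        = I * D * ((1 + B) * I) - (I * (1 + B)) * (D * I) := by noncomm_ring
    rw [this, h1, h2, mul_one, one_mul]
  have e4 : D * (V * I) + V * I * D = (D * V + V * D) * I + V * (I * D - D * I) := by noncomm_ring
  have e5 : (1 - κ + B) * I = (1 + B) * I - κ * I := by noncomm_ring
  rw [e4, e3, hV, e5, h2, mul_assoc]

/-- The operator `1 - [D, (1 - ρ) W]` for an approximate homotopy `W`. -/
theorem cutoff_homotopy {R : Type*} [Ring R] {D V I κ ρ : R}
    (hW : D * (V * I) + V * I * D = 1 - κ * I + V * I * ((D * κ - κ * D) * I))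
    (h1 : (1 - ρ) * κ = 0) (h2 : (1 - ρ) * (V * I * ((D * κ - κ * D) * I)) = 0) :
    1 - (D * ((1 - ρ) * (V * I)) + (1 - ρ) * (V * I) * D) = ρ + (D * ρ - ρ * D) * (V * I) := by
  have e : D * ((1 - ρ) * (V * I)) + (1 - ρ) * (V * I) * D
      = (1 - ρ) * (D * (V * I) + V * I * D) - (D * ρ - ρ * D) * (V * I) := by noncomm_ring
  have e2 : (1 - ρ) * (1 - κ * I + V * I * ((D * κ - κ * D) * I))
      = (1 - ρ) - ((1 - ρ) * κ) * I + (1 - ρ) * (V * I * ((D * κ - κ * D) * I)) := by noncomm_ring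
  rw [e, hW, e2, h1, h2, zero_mul]
  abel

open Filter Topology

/-! ### Locality -/

section Agree

variable {s : Finset (Fin d)} {O : Set (Fin d → ℂ)}

theorem continuous_incl (s : Finset (Fin d)) : Continuous (incl s) :=
  (contDiff_pi.mpr fun i => contDiff_incl i).continuous (𝕜 := ℝ) (n := ∞)

theorem dz_congr {a b : (s → ℂ) → ℂ} {z : s → ℂ} (h : a =ᶠ[𝓝 z] b) (i : Fin d) :
    dz s i a z = dz s i b z := by
  simp only [dz, h.fderiv_eq]

theorem dzbar_congr {a b : (s → ℂ) → ℂ} {z : s → ℂ} (h : a =ᶠ[𝓝 z] b) (i : Fin d) :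
    dzbar s i a z = dzbar s i b z := by
  simp only [dzbar, h.fderiv_eq]

/-- Two functions on `X_s` coincide on `X_s ∩ O`. -/
def FunAgree (O : Set (Fin d → ℂ)) (a b : (s → ℂ) → ℂ) : Prop :=
  ∀ z, incl s z ∈ O → a z = b z

/-- Two fields on `X_s` coincide on `X_s ∩ O`. -/
def AgreeOn (O : Set (Fin d → ℂ)) (x y : Fld n s) : Prop := ∀ A, FunAgree O (x A) (y A)

theorem FunAgree.eventuallyEq {a b : (s → ℂ) → ℂ} (h : FunAgree O a b) (hO : IsOpen O) {z : s → ℂ}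
    (hz : incl s z ∈ O) : a =ᶠ[𝓝 z] b := by
  filter_upwards [(hO.preimage (continuous_incl s)).mem_nhds hz] with z' hz'
  exact h z' hz'

theorem FunAgree.smul {a b : (s → ℂ) → ℂ} (h : FunAgree O a b) (c : ℂ) :
    FunAgree O (c • a) (c • b) := fun z hz => by
  rw [Pi.smul_apply, Pi.smul_apply, h z hz]

theorem AgreeOn.add {x y x' y' : Fld n s} (h : AgreeOn O x y) (h' : AgreeOn O x' y') :
    AgreeOn O (x + x') (y + y') := fun A z hz => by
  show x A z + x' A z = y A z + y' A z
  rw [h A z hz, h' A z hz]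

theorem AgreeOn.sum {ι : Type*} (S : Finset ι) {x y : ι → Fld n s}
    (h : ∀ i, AgreeOn O (x i) (y i)) : AgreeOn O (∑ i ∈ S, x i) (∑ i ∈ S, y i) := fun A z hz => by
  simp only [Finset.sum_apply]
  exact Finset.sum_congr rfl fun i _ => h i A z hz

theorem AgreeOn.smul {x y : Fld n s} (h : AgreeOn O x y) (c : ℂ) :
    AgreeOn O (c • x) (c • y) := fun A => (h A).smul c

theorem AgreeOn.trans {x y w : Fld n s} (h : AgreeOn O x y) (h' : AgreeOn O y w) :
    AgreeOn O x w := fun A z hz => (h A z hz).trans (h' A z hz)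

theorem AgreeOn.genMul {x y : Fld n s} (h : AgreeOn O x y) (g : Gen n d) :
    AgreeOn O (genMul g x) (genMul g y) := fun A => by
  unfold LogLG.genMul
  split_ifs
  · exact (h _).smul _
  · exact fun _ _ => rfl

theorem AgreeOn.genDer {x y : Fld n s} (h : AgreeOn O x y) (g : Gen n d) :
    AgreeOn O (genDer g x) (genDer g y) := fun A => by
  unfold LogLG.genDer
  split_ifs
  · exact fun _ _ => rfl
  · exact (h _).smul _

variable (F : SmoothCompleteFan n d)

theorem AgreeOn.dbar {x y : Fld n s} (h : AgreeOn O x y) (hO : IsOpen O) :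
    AgreeOn O (SmoothCompleteFan.dbar s x) (SmoothCompleteFan.dbar s y) := by
  unfold SmoothCompleteFan.dbar
  exact AgreeOn.sum _ fun i => AgreeOn.genMul
    (fun A z hz => dzbar_congr ((h A).eventuallyEq hO hz) i) _

theorem AgreeOn.bracketF {x y : Fld n s} (h : AgreeOn O x y) :
    AgreeOn O (F.bracketF s x) (F.bracketF s y) := by
  unfold SmoothCompleteFan.bracketF
  exact AgreeOn.sum _ fun k A z hz => congrArg (F.g s k z * ·) (h.genDer (Sum.inrₗ k) A z hz)

theorem AgreeOn.del {x y : Fld n s} (h : AgreeOn O x y) (hO : IsOpen O) :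
    AgreeOn O (F.del s x) (F.del s y) := by
  unfold SmoothCompleteFan.del
  refine AgreeOn.sum _ fun k A z hz => ?_
  simp only [SmoothCompleteFan.theta]
  exact Finset.sum_congr rfl fun i _ => by
    rw [dz_congr ((h.genDer (Sum.inrₗ k) A).eventuallyEq hO hz) i]

theorem AgreeOn.mulV {x y : Fld n s} (h : AgreeOn O x y) :
    AgreeOn O (F.mulV s x) (F.mulV s y) := by
  unfold SmoothCompleteFan.mulV
  refine AgreeOn.sum _ fun k A z hz => ?_
  beta_reduce
  rw [h.genMul (Sum.inrₗ k) A z hz]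

end Agree

namespace SmoothCompleteFan

variable {F : SmoothCompleteFan n d}

/-- `α` vanishes on `X ∩ O`. -/
def VanOn (O : Set (Fin d → ℂ)) (α : F.PV) : Prop := ∀ s, AgreeOn O (α.1 s) 0

/-- The local operators on `PV_log(X)`. -/
def localOps (F : SmoothCompleteFan n d) : Subring (Module.End ℂ F.PV) where
  carrier := {L | ∀ O, IsOpen O → ∀ α, VanOn O α → VanOn O (L α)}
  mul_mem' h h' O hO α hα := h O hO _ (h' O hO α hα)
  one_mem' _ _ _ hα := hα
  add_mem' h h' O hO α hα s A z hz := by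
    show ((_ : F.PV).1 s A z) + ((_ : F.PV).1 s A z) = 0
    rw [h O hO α hα s A z hz, h' O hO α hα s A z hz]
    exact add_zero _
  zero_mem' _ _ _ _ _ _ _ _ := rfl
  neg_mem' h O hO α hα s A z hz := by
    show -((_ : F.PV).1 s A z) = 0
    rw [h O hO α hα s A z hz]
    exact neg_zero

theorem dbarPV_mem_localOps : F.dbarPV ∈ F.localOps := fun O hO α hα s => by
  have h := (hα s).dbar hO
  rwa [show dbar s.1 (0 : Fld n s.1) = 0 from congrFun (congrArg Subtype.val (map_zero F.dbarPV)) s]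
    at h

theorem bracketPV_mem_localOps : F.bracketPV ∈ F.localOps := fun O hO α hα s => by
  have h := (hα s).bracketF F
  rwa [show F.bracketF s.1 (0 : Fld n s.1) = 0 from
    congrFun (congrArg Subtype.val (map_zero F.bracketPV)) s] at h

theorem delPV_mem_localOps : F.delPV ∈ F.localOps := fun O hO α hα s => by
  have h := (hα s).del F hO
  rwa [show F.del s.1 (0 : Fld n s.1) = 0 from
    congrFun (congrArg Subtype.val (map_zero F.delPV)) s] at h

theorem baseDiff_mem_localOps : F.baseDiff ∈ F.localOps :=
  add_mem dbarPV_mem_localOps bracketPV_mem_localOps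

theorem thetaPV_mem_localOps (k : Fin n) : F.thetaPV k ∈ F.localOps := fun O hO α hα s => by
  have h := (hα s).genMul (Sum.inrₗ k)
  rwa [show genMul (Sum.inrₗ k) (0 : Fld n s.1) = 0 from
    congrFun (congrArg Subtype.val (map_zero (F.thetaPV k))) s] at h

theorem mulPV_mem_localOps (h : (Fin d → ℂ) → ℂ) (hh : F.SmoothOn h) : mulPV h hh ∈ F.localOps :=
  fun O _ α hα s A z hz => by
    show h (incl s.1 z) * α.1 s A z = 0
    rw [hα s A z hz]
    exact mul_zero _

theorem eulerPV_mem_localOps (i : Fin d) : F.eulerPV i ∈ F.localOps := fun O hO α hα s A z hz => by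
  show incl s.1 z i * dz s.1 i (α.1 s A) z = 0
  rw [dz_congr ((hα s A).eventuallyEq hO hz)]
  show incl s.1 z i * dz s.1 i 0 z = 0
  rw [dz_zero, Pi.zero_apply, mul_zero]

theorem weightPV_mem_localOps (w : Finset (Gen n d) → ℂ) : F.weightPV w ∈ F.localOps :=
  fun O _ α hα s A z hz => by
    show w A * α.1 s A z = 0
    rw [hα s A z hz]
    exact mul_zero _

theorem smul_mem_localOps {L : Module.End ℂ F.PV} (hL : L ∈ F.localOps) (c : ℂ) :
    c • L ∈ F.localOps := fun O hO α hα s A z hz => by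
  show c * (L α).1 s A z = 0
  rw [hL O hO α hα s A z hz]
  exact mul_zero _

/-- All the coefficients vanish on `X ∩ O`. -/
def SVanOn (O : Set (Fin d → ℂ)) (α : USeries F.PV) : Prop := ∀ k, VanOn O (α.coeff k)

theorem SVanOn.add {O : Set (Fin d → ℂ)} {α β : USeries F.PV} (h : SVanOn O α) (h' : SVanOn O β) :
    SVanOn O (α + β) := fun k s A z hz => by
  show (α.coeff k).1 s A z + (β.coeff k).1 s A z = 0
  rw [h k s A z hz, h' k s A z hz]
  exact add_zero _

theorem SVanOn.neg {O : Set (Fin d → ℂ)} {α : USeries F.PV} (h : SVanOn O α) :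
    SVanOn O (-α) := fun k s A z hz => by
  show -(α.coeff k).1 s A z = 0
  rw [h k s A z hz]
  exact neg_zero

/-- The local operators on `PV_log(X)[[u]]`. -/
def localSOps (F : SmoothCompleteFan n d) : Subring (AddMonoid.End (USeries F.PV)) where
  carrier := {L | ∀ O, IsOpen O → ∀ α, SVanOn O α → SVanOn O (L α)}
  mul_mem' h h' O hO α hα := h O hO _ (h' O hO α hα)
  one_mem' _ _ _ hα := hα
  add_mem' h h' O hO α hα := (h O hO α hα).add (h' O hO α hα)
  zero_mem' _ _ _ _ _ _ _ _ _ := rfl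
  neg_mem' h O hO α hα := (h O hO α hα).neg

theorem lift_mem_localSOps {L : Module.End ℂ F.PV} (hL : L ∈ F.localOps) :
    USeries.lift L ∈ F.localSOps := fun O hO _ hα k => hL O hO _ (hα k)

theorem shift_mem_localSOps : USeries.shift ∈ F.localSOps := fun O _ α hα k => by
  cases k with
  | zero => exact fun _ _ _ _ => rfl
  | succ k => exact hα k

theorem uDeriv_mem_localSOps : USeries.uDeriv ∈ F.localSOps := fun O _ α hα k s A z hz => by
  show k • (α.coeff k).1 s A z = 0
  rw [hα k s A z hz]
  exact smul_zero k

theorem neumann_mem_localSOps {B : AddMonoid.End (USeries F.PV)} (hB : B ∈ F.localSOps) (N : ℕ) :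
    USeries.neumann N B ∈ F.localSOps := fun O hO α hα k => by
  rw [USeries.coeff_neumann]
  refine Finset.sum_induction _ (VanOn O) (fun x y hx hy s A z hz => ?_) (fun _ _ _ _ => rfl)
    fun m _ s A z hz => ?_
  · show x.1 s A z + y.1 s A z = 0
    rw [hx s A z hz, hy s A z hz]
    exact add_zero _
  · show (-1 : ℂ) ^ m * (((B ^ m) α).coeff k).1 s A z = 0
    rw [(pow_mem hB m) O hO α hα k s A z hz]
    exact mul_zero _

/-! ### The degree filtration -/

/-- `α` has no components of degree less than `m`. -/
def DegGE (m : ℕ) (α : F.PV) : Prop := ∀ s A, A.card < m → α.1 s A = 0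

theorem DegGE.mono {m m' : ℕ} {α : F.PV} (h : DegGE m α) (hm : m' ≤ m) : DegGE m' α :=
  fun s A hA => h s A (by omega)

theorem DegGE.add {m : ℕ} {α β : F.PV} (h : DegGE m α) (h' : DegGE m β) : DegGE m (α + β) :=
  fun s A hA => by
    show α.1 s A + β.1 s A = 0
    rw [h s A hA, h' s A hA, add_zero]

theorem degGE_zero (m : ℕ) : DegGE m (0 : F.PV) := fun _ _ _ => rfl

theorem genMul_eq_zero {s : Finset (Fin d)} {x : Fld n s} {m : ℕ} (h : ∀ A, A.card < m → x A = 0)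
    (g : Gen n d) {A : Finset (Gen n d)} (hA : A.card < m + 1) : genMul g x A = 0 := by
  unfold genMul
  split_ifs with hg
  · rw [h _ (by rw [Finset.card_erase_of_mem hg]; have := Finset.card_pos.mpr ⟨g, hg⟩; omega),
      smul_zero]
  · rfl

theorem DegGE.dbarPV {m : ℕ} {α : F.PV} (h : DegGE m α) : DegGE (m + 1) (F.dbarPV α) :=
  fun s A hA => by
    show dbar s.1 (α.1 s) A = 0
    simp only [dbar, Finset.sum_apply]
    refine Finset.sum_eq_zero fun i _ => genMul_eq_zero (fun B hB => ?_) _ hA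
    rw [h s B hB, dzbar_zero]

theorem DegGE.thetaPV {m : ℕ} {α : F.PV} (h : DegGE m α) (k : Fin n) :
    DegGE (m + 1) (F.thetaPV k α) := fun s _ hA => genMul_eq_zero (h s) _ hA

theorem DegGE.mulPV {m : ℕ} {α : F.PV} (hα : DegGE m α) (h : (Fin d → ℂ) → ℂ)
    (hh : F.SmoothOn h) : DegGE m (mulPV h hh α) := fun s A hA => by
  funext z
  show h (incl s.1 z) * α.1 s A z = 0
  rw [hα s A hA]
  exact mul_zero _

theorem DegGE.delPV {m : ℕ} {α : F.PV} (h : DegGE m α) : DegGE (m - 1) (F.delPV α) :=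
  fun s A hA => by
    show F.del s.1 (α.1 s) A = 0
    simp only [del, Finset.sum_apply]
    refine Finset.sum_eq_zero fun k _ => ?_
    rw [show genDer (Sum.inrₗ k) (α.1 s) A = 0 from ?_, theta_zero]
    unfold genDer
    split_ifs with hk
    · rfl
    · rw [h _ _ (by rw [Finset.card_insert_of_notMem hk]; omega), smul_zero]

theorem DegGE.eq_zero {m : ℕ} {α : F.PV} (h : DegGE m α) (hm : 2 * n < m) : α = 0 := by
  refine Subtype.ext (funext fun s => funext fun A => ?_)
  by_cases hA : LeftIn A s.1
  · refine h s A (lt_of_le_of_lt ?_ hm)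
    have hsub : A ⊆ topIdx s.1 := fun g => by
      refine gen_cases (p := fun g => g ∈ A → g ∈ topIdx s.1) (fun i hi => ?_) (fun k _ => ?_) g
      · exact mem_topIdx_inl.mpr (hA i hi)
      · exact mem_topIdx_inr k
    refine (Finset.card_le_card hsub).trans ?_
    rw [topIdx, Finset.card_map, Finset.card_disjSum, s.card_eq, Finset.card_univ, Fintype.card_fin]
    omega
  · exact α.2.2.1 s A hA

end SmoothCompleteFan

open Filter Topology

/-- A cut-off function `ρ`, together with a second one, `κ`, which is supported where `ρ = 1`:
`κ` vanishes on the open set `outer`, `ρ = 1` on the open set `inner`, and these sets cover. -/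
structure CutoffPair (d : ℕ) where
  ρ : (Fin d → ℂ) → ℝ
  κ : (Fin d → ℂ) → ℝ
  outer : Set (Fin d → ℂ)
  inner : Set (Fin d → ℂ)
  radius : ℝ
  contDiff_ρ : ContDiff ℝ ∞ ρ
  contDiff_κ : ContDiff ℝ ∞ κ
  isOpen_outer : IsOpen outer
  isOpen_inner : IsOpen inner
  κ_near : ∀ᶠ w in 𝓝 0, κ w = 1
  κ_outer : ∀ w ∈ outer, κ w = 0
  ρ_inner : ∀ w ∈ inner, ρ w = 1
  ρ_far : ∀ w, radius < ‖w‖ → ρ w = 0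
  cover : ∀ w, w ∈ outer ∨ w ∈ inner

theorem IsCutoff.exists_pair {ρ : (Fin d → ℂ) → ℝ} (h : IsCutoff ρ) :
    ∃ P : CutoffPair d, P.ρ = ρ := by
  obtain ⟨⟨r, hr, hρ⟩, hc, h1⟩ := h
  obtain ⟨ε, hε, hball⟩ := Metric.eventually_nhds_iff_ball.mp h1
  obtain ⟨R, hR⟩ := hc.isCompact.isBounded.subset_closedBall 0
  let b : ContDiffBump (0 : Fin d → ℂ) := ⟨ε / 4, ε / 2, by linarith, by linarith⟩
  refine ⟨⟨ρ, b, {w | ε / 2 < ‖w‖}, Metric.ball 0 ε, R, ?_, b.contDiff,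
    isOpen_lt continuous_const continuous_norm, Metric.isOpen_ball, b.eventuallyEq_one,
    fun w hw => ?_, hball, fun w hw => ?_, fun w => ?_⟩, rfl⟩
  · have : ρ = fun z => r fun i => ‖z i‖ ^ 2 := funext hρ
    rw [this]
    exact hr.comp (contDiff_pi.mpr fun i => (contDiff_apply ℝ ℂ i).norm_sq ℝ)
  · refine b.zero_of_le_dist ?_
    rw [dist_zero_right]
    exact le_of_lt hw
  · by_contra hne
    have := hR (subset_tsupport _ hne)
    rw [Metric.mem_closedBall, dist_zero_right] at this
    linarith
  · by_cases hw : ε / 2 < ‖w‖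
    · exact Or.inl hw
    · refine Or.inr ?_
      rw [Metric.mem_ball, dist_zero_right]
      linarith

namespace SmoothCompleteFan

variable {F : SmoothCompleteFan n d}

/-! ### The homotopy -/

/-- The function `g_k` on `ℂᵈ`. -/
def gFun (F : SmoothCompleteFan n d) (k : Fin n) (w : Fin d → ℂ) : ℂ := ∑ i, (F.ray i k : ℂ) * w i

/-- `∑_k g_k \bar g_k`. -/
def gSq (F : SmoothCompleteFan n d) (w : Fin d → ℂ) : ℂ :=
  ∑ k, F.gFun k w * starRingEnd ℂ (F.gFun k w)

theorem gSq_ne_zero (s : F.MaxCone) {z : s.1 → ℂ} (hz : z ≠ 0) : F.gSq (incl s.1 z) ≠ 0 := by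
  intro h
  have h0 : ∀ k, F.gFun k (incl s.1 z) = 0 := by
    have h1 : ∑ k, Complex.normSq (F.gFun k (incl s.1 z)) = 0 := by
      have : ((∑ k, Complex.normSq (F.gFun k (incl s.1 z)) : ℝ) : ℂ) = 0 := by
        rw [Complex.ofReal_sum, ← h]
        exact Finset.sum_congr rfl fun k _ => (Complex.mul_conj _).symm
      exact_mod_cast this
    intro k
    exact Complex.normSq_eq_zero.mp
      ((Finset.sum_eq_zero_iff_of_nonneg fun k _ => Complex.normSq_nonneg _).mp h1 k
        (Finset.mem_univ k))
  refine hz (funext fun v => ?_)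
  have h1 : ∑ k, F.gFun k (incl s.1 z) * (F.dualVec s v k : ℂ) = z v := by
    have e : ∀ i ∈ s.1, ∑ k, (F.ray i k : ℂ) * (F.dualVec s v k : ℂ) = if i = v then 1 else 0 :=
      fun i hi => by exact_mod_cast (F.isDualFrame s).pair v v.2 i hi
    calc ∑ k, F.gFun k (incl s.1 z) * (F.dualVec s v k : ℂ)
        = ∑ i, incl s.1 z i * ∑ k, (F.ray i k : ℂ) * (F.dualVec s v k : ℂ) := by
          simp only [gFun, Finset.sum_mul, Finset.mul_sum]
          rw [Finset.sum_comm]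
          exact Finset.sum_congr rfl fun i _ => Finset.sum_congr rfl fun k _ => by ring
      _ = ∑ i : Fin d, if i = (v : Fin d) then z v else 0 := by
          refine Finset.sum_congr rfl fun i _ => ?_
          by_cases hi : i ∈ s.1
          · rw [e i hi]
            split_ifs with hiv
            · subst hiv
              rw [incl_of_mem z v.2, mul_one]
            · exact mul_zero _
          · rw [if_neg fun hiv => hi (by rw [hiv]; exact v.2)]
            simp [incl, hi]
      _ = z v := by simp
  rw [← h1]
  exact Finset.sum_eq_zero fun k _ => by rw [h0, zero_mul]

theorem contDiff_incl_pi (s : Finset (Fin d)) : ContDiff ℝ ∞ (incl s) :=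
  contDiff_pi.mpr fun i => contDiff_incl i

theorem smoothOn_ofReal {ρ : (Fin d → ℂ) → ℝ} (h : ContDiff ℝ ∞ ρ) :
    F.SmoothOn fun w => (ρ w : ℂ) := fun s =>
  Complex.ofRealCLM.contDiff.comp (h.comp (contDiff_incl_pi s.1))

theorem contDiff_gFun (k : Fin n) : ContDiff ℝ ∞ (F.gFun k) :=
  ContDiff.sum fun i _ => contDiff_const.mul (contDiff_apply ℝ ℂ i)

theorem contDiff_conj_gFun (k : Fin n) : ContDiff ℝ ∞ fun w => starRingEnd ℂ (F.gFun k w) :=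
  Complex.conjCLE.contDiff.comp (contDiff_gFun k)

theorem contDiff_gSq : ContDiff ℝ ∞ F.gSq :=
  ContDiff.sum fun k _ => (contDiff_gFun k).mul (contDiff_conj_gFun k)

variable (F) in
/-- The coefficients of `V_f`, cut off near the origin. -/
def vFun (P : CutoffPair d) (k : Fin n) (w : Fin d → ℂ) : ℂ :=
  (1 - (P.κ w : ℂ)) * (starRingEnd ℂ (F.gFun k w) / F.gSq w)

theorem smoothOn_vFun (P : CutoffPair d) (k : Fin n) : F.SmoothOn (F.vFun P k) := by
  intro s
  rw [contDiff_iff_contDiffAt]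
  intro z
  by_cases hz : z = 0
  · have h0 : incl s.1 z = 0 := by
      rw [hz]
      funext i
      simp [incl]
    have h1 : ∀ᶠ z' in 𝓝 z, P.κ (incl s.1 z') = 1 :=
      (continuous_incl s.1).continuousAt.eventually (h0 ▸ P.κ_near)
    refine (contDiffAt_const (c := (0 : ℂ))).congr_of_eventuallyEq ?_
    filter_upwards [h1] with z' hz'
    simp [vFun, hz']
  · have hi : ContDiffAt ℝ ∞ (incl s.1) z := (contDiff_incl_pi s.1).contDiffAt
    have hq : ContDiffAt ℝ ∞ (fun z' => (F.gSq (incl s.1 z'))⁻¹) z :=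
      (contDiff_gSq.contDiffAt.comp z hi).inv (gSq_ne_zero s hz)
    simp only [vFun, div_eq_mul_inv]
    refine ContDiffAt.mul ?_ (ContDiffAt.mul ?_ hq)
    · exact (contDiff_const.sub (smoothOn_ofReal P.contDiff_κ s)).contDiffAt
    · exact (contDiff_conj_gFun k).contDiffAt.comp z hi

variable (F) in
/-- Multiplication by `ρ`. -/
def cutPV (P : CutoffPair d) : Module.End ℂ F.PV := mulPV _ (smoothOn_ofReal P.contDiff_ρ)

variable (F) in
/-- Multiplication by `κ`. -/
def corePV (P : CutoffPair d) : Module.End ℂ F.PV := mulPV _ (smoothOn_ofReal P.contDiff_κ)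

variable (F) in
/-- Multiplication by `V_f`, cut off near the origin. -/
def vecPV (P : CutoffPair d) : Module.End ℂ F.PV :=
  ∑ k, mulPV (F.vFun P k) (smoothOn_vFun P k) * F.thetaPV k

theorem bracketPV_vecPV (P : CutoffPair d) :
    F.bracketPV * F.vecPV P + F.vecPV P * F.bracketPV = 1 - F.corePV P := by
  have h : F.bracketPV * F.vecPV P + F.vecPV P * F.bracketPV
      = ∑ k, mulPV (F.vFun P k) (smoothOn_vFun P k) * ∑ i, (F.ray i k : ℂ) • F.coordPV i := by
    rw [vecPV, Finset.mul_sum, Finset.sum_mul, ← Finset.sum_add_distrib]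
    refine Finset.sum_congr rfl fun k _ => ?_
    rw [← bracketPV_theta, mul_add, ← mul_assoc, bracketPV_mul, mul_assoc, mul_assoc]
  rw [h]
  refine LinearMap.ext fun α => Subtype.ext (funext fun s => funext fun A => funext fun z => ?_)
  have e : ((∑ k, mulPV (F.vFun P k) (smoothOn_vFun P k) * ∑ i, (F.ray i k : ℂ) • F.coordPV i :
      Module.End ℂ F.PV) α).1 s A z
      = ∑ k, F.vFun P k (incl s.1 z) * (F.gFun k (incl s.1 z) * α.1 s A z) := by
    simp only [LinearMap.sum_apply, AddSubmonoidClass.coe_finset_sum, Finset.sum_apply]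
    refine Finset.sum_congr rfl fun k _ => ?_
    show F.vFun P k (incl s.1 z) * ((∑ i, (F.ray i k : ℂ) • F.coordPV i :
      Module.End ℂ F.PV) α).1 s A z = _
    simp only [LinearMap.sum_apply, AddSubmonoidClass.coe_finset_sum, Finset.sum_apply, gFun,
      Finset.sum_mul]
    congr 1
    refine Finset.sum_congr rfl fun i _ => ?_
    show (F.ray i k : ℂ) * (incl s.1 z i * α.1 s A z) = _
    rw [mul_assoc]
  refine e.trans ?_
  show _ = α.1 s A z - (P.κ (incl s.1 z) : ℂ) * α.1 s A z
  have e2 : ∑ k, F.vFun P k (incl s.1 z) * F.gFun k (incl s.1 z) = 1 - (P.κ (incl s.1 z) : ℂ) := by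
    have e3 : ∑ k, F.vFun P k (incl s.1 z) * F.gFun k (incl s.1 z)
        = (1 - (P.κ (incl s.1 z) : ℂ)) * (F.gSq (incl s.1 z) / F.gSq (incl s.1 z)) := by
      rw [gSq, Finset.sum_div, Finset.mul_sum, ← gSq]
      refine Finset.sum_congr rfl fun k _ => ?_
      rw [vFun]
      ring
    rw [e3]
    by_cases hz : z = 0
    · have h0 : incl s.1 z = 0 := by
        rw [hz]
        funext i
        simp [incl]
      rw [h0, P.κ_near.self_of_nhds]
      simp
    · rw [div_self (gSq_ne_zero s hz), mul_one]
  simp only [← mul_assoc, ← Finset.sum_mul]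
  rw [e2]
  ring

theorem anticomm_perturbed {R : Type*} [Ring R] {b c e u v : R} (h : v * u = u * v) :
    (b + c + u * e) * v + v * (b + c + u * e)
      = c * v + v * c + (b * v + v * b + u * (e * v + v * e)) := by
  rw [mul_add v, ← mul_assoc v u e, h]
  noncomm_ring

variable (F) in
/-- `Q_f` as an additive operator. -/
def diffS : AddMonoid.End (USeries F.PV) :=
  USeries.lift F.baseDiff + USeries.shift * USeries.lift F.delPV

theorem diffS_apply (α : USeries F.PV) : F.diffS α = F.Qf α := (USeries.linearOp_eq _ _ α).symm

theorem diffS_sq : F.diffS * F.diffS = 0 := AddMonoidHom.ext fun α => by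
  show F.diffS (F.diffS α) = 0
  rw [diffS_apply, diffS_apply, Qf_Qf]

theorem diffS_mem_localSOps : F.diffS ∈ F.localSOps :=
  add_mem (lift_mem_localSOps baseDiff_mem_localOps)
    (mul_mem shift_mem_localSOps (lift_mem_localSOps delPV_mem_localOps))

variable (F) in
/-- The commutator `[\bar∂ + u ∂, V]` for the cut-off `V_f`. -/
def commS (P : CutoffPair d) : AddMonoid.End (USeries F.PV) :=
  USeries.lift (F.dbarPV * F.vecPV P + F.vecPV P * F.dbarPV)
    + USeries.shift * USeries.lift (F.delPV * F.vecPV P + F.vecPV P * F.delPV)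

theorem diffS_vec (P : CutoffPair d) :
    F.diffS * USeries.lift (F.vecPV P) + USeries.lift (F.vecPV P) * F.diffS
      = 1 - USeries.lift (F.corePV P) + F.commS P := by
  have h : USeries.lift F.bracketPV * USeries.lift (F.vecPV P)
      + USeries.lift (F.vecPV P) * USeries.lift F.bracketPV = 1 - USeries.lift (F.corePV P) :=
    congrArg (USeries.lift (M := F.PV)) (bracketPV_vecPV (F := F) P)
  have e1 : USeries.lift F.baseDiff = USeries.lift F.dbarPV + USeries.lift F.bracketPV := rfl
  have e2 : USeries.lift (F.dbarPV * F.vecPV P + F.vecPV P * F.dbarPV)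
      = USeries.lift F.dbarPV * USeries.lift (F.vecPV P)
        + USeries.lift (F.vecPV P) * USeries.lift F.dbarPV := rfl
  have e3 : USeries.lift (F.delPV * F.vecPV P + F.vecPV P * F.delPV)
      = USeries.lift F.delPV * USeries.lift (F.vecPV P)
        + USeries.lift (F.vecPV P) * USeries.lift F.delPV := rfl
  rw [← h, commS, diffS, e1, e2, e3]
  exact anticomm_perturbed (USeries.lift_shift _)

theorem vecPV_mem_localOps (P : CutoffPair d) : F.vecPV P ∈ F.localOps :=
  sum_mem fun k _ => mul_mem (mulPV_mem_localOps _ _) (thetaPV_mem_localOps k)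

theorem commS_mem_localSOps (P : CutoffPair d) : F.commS P ∈ F.localSOps :=
  add_mem (lift_mem_localSOps (add_mem (mul_mem dbarPV_mem_localOps (vecPV_mem_localOps P))
      (mul_mem (vecPV_mem_localOps P) dbarPV_mem_localOps)))
    (mul_mem shift_mem_localSOps (lift_mem_localSOps
      (add_mem (mul_mem delPV_mem_localOps (vecPV_mem_localOps P))
        (mul_mem (vecPV_mem_localOps P) delPV_mem_localOps))))

theorem DegGE.vecPV {m : ℕ} {α : F.PV} (h : DegGE m α) (P : CutoffPair d) :
    DegGE (m + 1) (F.vecPV P α) := by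
  have e : F.vecPV P α = ∑ k, SmoothCompleteFan.mulPV (F.vFun P k) (smoothOn_vFun P k)
      (F.thetaPV k α) := by
    rw [SmoothCompleteFan.vecPV, LinearMap.sum_apply]
    rfl
  rw [e]
  exact Finset.sum_induction _ (DegGE (m + 1)) (fun _ _ hx hy => hx.add hy) (degGE_zero _)
    fun k _ => (h.thetaPV k).mulPV _ _

theorem degGE_commS_pow (P : CutoffPair d) (m : ℕ) (α : USeries F.PV) (k : ℕ) :
    DegGE (2 * m - 2 * k) (((F.commS P ^ m) α).coeff k) := by
  induction m generalizing k with
  | zero => exact fun s A hA => absurd hA (by omega)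
  | succ m ih =>
    rw [pow_succ']
    set β := (F.commS P ^ m) α with hβ
    show DegGE _ ((F.commS P β).coeff k)
    have h0 : DegGE (2 * m - 2 * k + 2) ((F.dbarPV * F.vecPV P + F.vecPV P * F.dbarPV) (β.coeff k)) :=
      ((ih k).vecPV P).dbarPV.add ((ih k).dbarPV.vecPV P)
    cases k with
    | zero =>
      show DegGE _ ((F.dbarPV * F.vecPV P + F.vecPV P * F.dbarPV) (β.coeff 0) + 0)
      rw [add_zero]
      exact h0.mono (by omega)
    | succ k =>
      show DegGE _ ((F.dbarPV * F.vecPV P + F.vecPV P * F.dbarPV) (β.coeff (k + 1))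
        + (F.delPV * F.vecPV P + F.vecPV P * F.delPV) (β.coeff k))
      have h1 : DegGE (2 * m - 2 * k) ((F.delPV * F.vecPV P + F.vecPV P * F.delPV) (β.coeff k)) :=
        ((ih k).vecPV P).delPV.add (((ih k).delPV.vecPV P).mono (by omega))
      exact (h0.mono (by omega)).add (h1.mono (by omega))

theorem commS_pow_eq_zero (P : CutoffPair d) (m k : ℕ) (h : n + 1 + k ≤ m) (α : USeries F.PV) :
    ((F.commS P ^ m) α).coeff k = 0 :=
  (degGE_commS_pow P m α k).eq_zero (by omega)

variable (F) in
/-- `(1 + [\bar∂ + u ∂, V])⁻¹` for the cut-off `V_f`. -/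
def invS (P : CutoffPair d) : AddMonoid.End (USeries F.PV) := USeries.neumann (n + 1) (F.commS P)

theorem invS_mul (P : CutoffPair d) : F.invS P * (1 + F.commS P) = 1 :=
  USeries.neumann_mul (commS_pow_eq_zero P)

theorem mul_invS (P : CutoffPair d) : (1 + F.commS P) * F.invS P = 1 :=
  USeries.mul_neumann (USeries.causal_add_shift _ _) (commS_pow_eq_zero P)

variable (F) in
/-- `V (1 + [\bar∂ + u ∂, V])⁻¹` for the cut-off `V_f`. -/
def propS (P : CutoffPair d) : AddMonoid.End (USeries F.PV) :=
  USeries.lift (F.vecPV P) * F.invS P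

variable (F) in
/-- The homotopy between the identity and the operator `T_ρ^u`. -/
def homS (P : CutoffPair d) : AddMonoid.End (USeries F.PV) :=
  (1 - USeries.lift (F.cutPV P)) * F.propS P

variable (F) in
/-- The operator `T_ρ^u`. -/
def cutS (P : CutoffPair d) : AddMonoid.End (USeries F.PV) :=
  1 - (F.diffS * F.homS P + F.homS P * F.diffS)

theorem cut_mul_eq_zero (P : CutoffPair d) {α : USeries F.PV} (h : SVanOn P.outer α) :
    (1 - USeries.lift (F.cutPV P) : AddMonoid.End (USeries F.PV)) α = 0 := by
  refine USeries.ext fun k => Subtype.ext (funext fun s => funext fun A => funext fun z => ?_)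
  show (α.coeff k).1 s A z - (P.ρ (incl s.1 z) : ℂ) * (α.coeff k).1 s A z = 0
  rcases P.cover (incl s.1 z) with hz | hz
  · rw [h k s A z hz, Pi.zero_apply, Pi.zero_apply, mul_zero, sub_zero]
  · rw [P.ρ_inner _ hz, Complex.ofReal_one, one_mul, sub_self]

theorem sVanOn_core (P : CutoffPair d) (α : USeries F.PV) :
    SVanOn P.outer (USeries.lift (F.corePV P) α) := fun k s A z hz => by
  show (P.κ (incl s.1 z) : ℂ) * (α.coeff k).1 s A z = 0
  rw [P.κ_outer _ hz, Complex.ofReal_zero, zero_mul]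

theorem invS_mem_localSOps (P : CutoffPair d) : F.invS P ∈ F.localSOps :=
  neumann_mem_localSOps (commS_mem_localSOps P) _

theorem propS_mem_localSOps (P : CutoffPair d) : F.propS P ∈ F.localSOps :=
  mul_mem (lift_mem_localSOps (vecPV_mem_localOps P)) (invS_mem_localSOps P)

theorem cutPV_mem_localOps (P : CutoffPair d) : F.cutPV P ∈ F.localOps := mulPV_mem_localOps _ _

theorem homS_mem_localSOps (P : CutoffPair d) : F.homS P ∈ F.localSOps :=
  mul_mem (sub_mem (one_mem _) (lift_mem_localSOps (cutPV_mem_localOps P))) (propS_mem_localSOps P)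

theorem cutS_eq (P : CutoffPair d) : F.cutS P = USeries.lift (F.cutPV P)
    + (F.diffS * USeries.lift (F.cutPV P) - USeries.lift (F.cutPV P) * F.diffS) * F.propS P := by
  refine cutoff_homotopy (perturbed_homotopy diffS_sq (diffS_vec P) (invS_mul P) (mul_invS P))
    (AddMonoidHom.ext fun α => cut_mul_eq_zero P (sVanOn_core P α))
    (AddMonoidHom.ext fun α => cut_mul_eq_zero P ?_)
  refine propS_mem_localSOps P _ P.isOpen_outer _ ?_
  set β := F.invS P α
  have h2 := (sVanOn_core P (F.diffS β)).neg
  have h1 := diffS_mem_localSOps _ P.isOpen_outer _ (sVanOn_core P β)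
  have := h1.add h2
  rw [← sub_eq_add_neg] at this
  exact this

end SmoothCompleteFan

open Filter Topology

namespace SmoothCompleteFan

variable {F : SmoothCompleteFan n d}

/-! ### Comparison with the operators on the components -/

section Compare

variable {s : Finset (Fin d)} {O : Set (Fin d → ℂ)}

/-- Two series of fields on `X_s` coincide on `X_s ∩ O`. -/
def SAgreeOn (O : Set (Fin d → ℂ)) (x y : ℕ → Fld n s) : Prop := ∀ k, AgreeOn O (x k) (y k)

theorem SAgreeOn.trans {x y w : ℕ → Fld n s} (h : SAgreeOn O x y) (h' : SAgreeOn O y w) :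
    SAgreeOn O x w := fun k => (h k).trans (h' k)

theorem SAgreeOn.add {x y x' y' : ℕ → Fld n s} (h : SAgreeOn O x y) (h' : SAgreeOn O x' y') :
    SAgreeOn O (x + x') (y + y') := fun k => (h k).add (h' k)

theorem SAgreeOn.opQ {x y : ℕ → Fld n s} (h : SAgreeOn O x y) (hO : IsOpen O) :
    SAgreeOn O (F.opQ s x) (F.opQ s y) := fun k => by
  refine ((h k).dbar hO).add ?_
  cases k with
  | zero => exact fun _ _ _ => rfl
  | succ k => exact (h k).del F hO

theorem SAgreeOn.opV {x y : ℕ → Fld n s} (h : SAgreeOn O x y) :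
    SAgreeOn O (F.opV s x) (F.opV s y) := fun k => (h k).mulV F

theorem SAgreeOn.commQV {x y : ℕ → Fld n s} (h : SAgreeOn O x y) (hO : IsOpen O) :
    SAgreeOn O (F.commQV s x) (F.commQV s y) := (h.opV.opQ hO).add (h.opQ hO).opV

theorem sAgreeOn_mulFun (P : CutoffPair d) (x : ℕ → Fld n s) :
    SAgreeOn P.inner (mulFun s P.ρ x) x := fun k A z hz => by
  show (P.ρ (incl s z) : ℂ) * x k A z = x k A z
  rw [P.ρ_inner _ hz, Complex.ofReal_one, one_mul]

theorem commQFun_inner (P : CutoffPair d) (x : ℕ → Fld n s) :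
    SAgreeOn P.inner (F.commQFun s P.ρ x) 0 := fun k A z hz => by
  show F.opQ s (mulFun s P.ρ x) k A z - mulFun s P.ρ (F.opQ s x) k A z = 0
  rw [(sAgreeOn_mulFun P x).opQ P.isOpen_inner k A z hz, sAgreeOn_mulFun P _ k A z hz, sub_self]

theorem commQFun_congr (P : CutoffPair d) {x y : ℕ → Fld n s} (h : SAgreeOn P.outer x y) :
    F.commQFun s P.ρ x = F.commQFun s P.ρ y := by
  refine funext fun k => funext fun A => funext fun z => ?_
  rcases P.cover (incl s z) with hz | hz
  · have h1 : SAgreeOn P.outer (mulFun s P.ρ x) (mulFun s P.ρ y) := fun k A z hz => by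
      show (P.ρ (incl s z) : ℂ) * x k A z = (P.ρ (incl s z) : ℂ) * y k A z
      rw [h k A z hz]
    show F.opQ s (mulFun s P.ρ x) k A z - (P.ρ (incl s z) : ℂ) * F.opQ s x k A z
      = F.opQ s (mulFun s P.ρ y) k A z - (P.ρ (incl s z) : ℂ) * F.opQ s y k A z
    rw [h1.opQ P.isOpen_outer k A z hz, h.opQ P.isOpen_outer k A z hz]
  · exact (commQFun_inner P x k A z hz).trans (commQFun_inner P y k A z hz).symm

end Compare

/-- The series of fields on a component given by an element of `PV_log(X)[[u]]`. -/
def onComp (s : F.MaxCone) (α : USeries F.PV) : ℕ → Fld n s.1 := fun l => (α.coeff l).1 s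

variable (F) in
/-- `\bar∂ + u ∂`. -/
def freeS : AddMonoid.End (USeries F.PV) :=
  USeries.lift F.dbarPV + USeries.shift * USeries.lift F.delPV

theorem opQ_onComp (s : F.MaxCone) (α : USeries F.PV) :
    F.opQ s.1 (onComp s α) = onComp s (F.freeS α) := by
  funext k
  cases k <;> rfl

theorem anticomm_shift {R : Type*} [Ring R] {b e u v : R} (h : v * u = u * v) :
    (b + u * e) * v + v * (b + u * e) = b * v + v * b + u * (e * v + v * e) := by
  rw [mul_add v, ← mul_assoc v u e, h]
  noncomm_ring

theorem commS_eq (P : CutoffPair d) :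
    F.freeS * USeries.lift (F.vecPV P) + USeries.lift (F.vecPV P) * F.freeS = F.commS P := by
  have e2 : USeries.lift (F.dbarPV * F.vecPV P + F.vecPV P * F.dbarPV)
      = USeries.lift F.dbarPV * USeries.lift (F.vecPV P)
        + USeries.lift (F.vecPV P) * USeries.lift F.dbarPV := rfl
  have e3 : USeries.lift (F.delPV * F.vecPV P + F.vecPV P * F.delPV)
      = USeries.lift F.delPV * USeries.lift (F.vecPV P)
        + USeries.lift (F.vecPV P) * USeries.lift F.delPV := rfl
  rw [commS, freeS, e2, e3]
  exact anticomm_shift (USeries.lift_shift _)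

theorem opV_onComp (P : CutoffPair d) (s : F.MaxCone) (α : USeries F.PV) :
    SAgreeOn P.outer (F.opV s.1 (onComp s α)) (onComp s (USeries.lift (F.vecPV P) α)) :=
  fun k A z hz => by
    have e : (F.vecPV P (α.coeff k)).1 s A z
        = ∑ l, F.vFun P l (incl s.1 z) * genMul (Sum.inrₗ l) ((α.coeff k).1 s) A z := by
      rw [vecPV]
      simp only [LinearMap.sum_apply, AddSubmonoidClass.coe_finset_sum, Finset.sum_apply]
      rfl
    show F.mulV s.1 ((α.coeff k).1 s) A z = (F.vecPV P (α.coeff k)).1 s A z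
    rw [e, mulV]
    simp only [Finset.sum_apply]
    refine Finset.sum_congr rfl fun l _ => ?_
    rw [vFun, P.κ_outer _ hz, Complex.ofReal_zero, sub_zero, one_mul]
    rfl

theorem commQV_onComp (P : CutoffPair d) (s : F.MaxCone) (α : USeries F.PV) :
    SAgreeOn P.outer (F.commQV s.1 (onComp s α)) (onComp s (F.commS P α)) := by
  have h1 := (opV_onComp P s α).opQ (F := F) P.isOpen_outer
  rw [opQ_onComp] at h1
  have h2 := opV_onComp P s (F.freeS α)
  rw [← opQ_onComp] at h2
  have h3 := h1.add h2
  rw [← commS_eq]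
  exact h3

theorem commQV_iterate_onComp (P : CutoffPair d) (s : F.MaxCone) (α : USeries F.PV) (m : ℕ) :
    SAgreeOn P.outer ((F.commQV s.1)^[m] (onComp s α)) (onComp s ((F.commS P ^ m) α)) := by
  induction m with
  | zero => exact fun _ _ _ _ => rfl
  | succ m ih =>
    rw [Function.iterate_succ_apply', pow_succ']
    exact (ih.commQV P.isOpen_outer).trans (commQV_onComp P s _)

theorem invQV_onComp (P : CutoffPair d) (s : F.MaxCone) (α : USeries F.PV) :
    SAgreeOn P.outer (F.invQV s.1 (onComp s α)) (onComp s (F.invS P α)) := fun k => by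
  have e : onComp s (F.invS P α) k
      = ∑ m ∈ Finset.range (n + k + 1), (-1 : ℂ) ^ m • onComp s ((F.commS P ^ m) α) k := by
    show ((F.invS P α).coeff k).1 s = _
    rw [invS, USeries.coeff_neumann, show n + 1 + k = n + k + 1 by omega]
    simp only [AddSubmonoidClass.coe_finset_sum, Finset.sum_apply]
    rfl
  rw [e]
  exact AgreeOn.sum _ fun m => (commQV_iterate_onComp P s α m k).smul _

theorem commutator_cut (P : CutoffPair d) :
    F.diffS * USeries.lift (F.cutPV P) - USeries.lift (F.cutPV P) * F.diffS
      = F.freeS * USeries.lift (F.cutPV P) - USeries.lift (F.cutPV P) * F.freeS := by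
  have h : USeries.lift F.bracketPV * USeries.lift (F.cutPV P)
      = USeries.lift (F.cutPV P) * USeries.lift F.bracketPV :=
    congrArg (USeries.lift (M := F.PV)) (bracketPV_mul _ (smoothOn_ofReal P.contDiff_ρ))
  have e : F.diffS = F.freeS + USeries.lift F.bracketPV := by
    have e1 : USeries.lift F.baseDiff = USeries.lift F.dbarPV + USeries.lift F.bracketPV := rfl
    rw [diffS, freeS, e1, add_right_comm]
  rw [e, add_mul, mul_add, h, add_sub_add_right_eq_sub]

theorem opT_onComp (P : CutoffPair d) (s : F.MaxCone) (α : USeries F.PV) :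
    F.opT s.1 P.ρ (onComp s α) = onComp s (F.cutS P α) := by
  have h1 : SAgreeOn P.outer (F.opV s.1 (F.invQV s.1 (onComp s α))) (onComp s (F.propS P α)) :=
    (invQV_onComp P s α).opV.trans (opV_onComp P s _)
  rw [opT, commQFun_congr P h1, cutS_eq, commutator_cut]
  have h2 : F.commQFun s.1 P.ρ (onComp s (F.propS P α))
      = onComp s (F.freeS (USeries.lift (F.cutPV P) (F.propS P α)))
        - onComp s (USeries.lift (F.cutPV P) (F.freeS (F.propS P α))) := by
    rw [← opQ_onComp]
    show _ = _ - mulFun s.1 P.ρ (onComp s (F.freeS (F.propS P α)))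
    rw [← opQ_onComp]
    rfl
  rw [h2]
  rfl

/-! ### Compact support -/

/-- Elements of `PV_log(X)[[u]]` with compact support. -/
def CompSupp (α : USeries F.PV) : Prop := ∃ R : ℝ, SVanOn {w | R < ‖w‖} α

theorem isOpen_far (R : ℝ) : IsOpen {w : Fin d → ℂ | R < ‖w‖} :=
  isOpen_lt continuous_const continuous_norm

theorem CompSupp.map {α : USeries F.PV} (h : CompSupp α) {L : AddMonoid.End (USeries F.PV)}
    (hL : L ∈ F.localSOps) : CompSupp (L α) := by
  obtain ⟨R, hR⟩ := h
  exact ⟨R, hL _ (isOpen_far R) _ hR⟩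

theorem SVanOn.mono {O O' : Set (Fin d → ℂ)} {α : USeries F.PV} (h : SVanOn O α) (hO : O' ⊆ O) :
    SVanOn O' α := fun k s A z hz => h k s A z (hO hz)

theorem CompSupp.add {α β : USeries F.PV} (h : CompSupp α) (h' : CompSupp β) :
    CompSupp (α + β) := by
  obtain ⟨R, hR⟩ := h
  obtain ⟨R', hR'⟩ := h'
  have h1 : {w : Fin d → ℂ | max R R' < ‖w‖} ⊆ {w | R < ‖w‖} :=
    fun w (hw : max R R' < ‖w‖) => lt_of_le_of_lt (le_max_left R R') hw
  have h2 : {w : Fin d → ℂ | max R R' < ‖w‖} ⊆ {w | R' < ‖w‖} :=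
    fun w (hw : max R R' < ‖w‖) => lt_of_le_of_lt (le_max_right R R') hw
  exact ⟨max R R', (hR.mono h1).add (hR'.mono h2)⟩

theorem CompSupp.neg {α : USeries F.PV} (h : CompSupp α) : CompSupp (-α) := by
  obtain ⟨R, hR⟩ := h
  exact ⟨R, hR.neg⟩

theorem CompSupp.sub {α β : USeries F.PV} (h : CompSupp α) (h' : CompSupp β) :
    CompSupp (α - β) := sub_eq_add_neg α β ▸ h.add h'.neg

theorem compSupp_zero : CompSupp (0 : USeries F.PV) := ⟨0, fun _ _ _ _ _ => rfl⟩

theorem CompSupp.sum {ι : Type*} (S : Finset ι) {α : ι → USeries F.PV} (h : ∀ i ∈ S, CompSupp (α i)) :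
    CompSupp (∑ i ∈ S, α i) :=
  Finset.sum_induction _ CompSupp (fun _ _ hx hy => hx.add hy) compSupp_zero h

theorem sVanOn_cut (P : CutoffPair d) (α : USeries F.PV) :
    SVanOn {w | P.radius < ‖w‖} (USeries.lift (F.cutPV P) α) := fun k s A z hz => by
  show (P.ρ (incl s.1 z) : ℂ) * (α.coeff k).1 s A z = 0
  rw [P.ρ_far _ hz, Complex.ofReal_zero, zero_mul]

theorem compSupp_cutS (P : CutoffPair d) (α : USeries F.PV) : CompSupp (F.cutS P α) := by
  have h1 : CompSupp (USeries.lift (F.cutPV P) α) := ⟨_, sVanOn_cut P α⟩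
  have h2 : CompSupp (USeries.lift (F.cutPV P) (F.propS P α)) := ⟨_, sVanOn_cut P _⟩
  have h3 : CompSupp (USeries.lift (F.cutPV P) (F.diffS (F.propS P α))) := ⟨_, sVanOn_cut P _⟩
  rw [cutS_eq]
  exact h1.add ((h2.map diffS_mem_localSOps).sub h3)

theorem norm_le_norm_incl (s : Finset (Fin d)) (z : s → ℂ) : ‖z‖ ≤ ‖incl s z‖ := by
  refine (pi_norm_le_iff_of_nonneg (norm_nonneg _)).mpr fun i => ?_
  have := norm_le_pi_norm (incl s z) i
  rwa [incl_of_mem z i.2] at this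

theorem CompSupp.coeff {α : USeries F.PV} (h : CompSupp α) (k : ℕ) : HasCompSupp (α.coeff k) := by
  obtain ⟨R, hR⟩ := h
  intro s A
  refine HasCompactSupport.intro (isCompact_closedBall (0 : s.1 → ℂ) R) fun z hz => ?_
  refine hR k s A z ?_
  rw [Metric.mem_closedBall, dist_zero_right, not_le] at hz
  exact lt_of_lt_of_le hz (norm_le_norm_incl s.1 z)

end SmoothCompleteFan

/-! ### Derivations of the exterior algebra -/

section Derivation

variable {ι : Type} [LinearOrder ι] [DecidableEq ι] {R : Type} [CommRing R] [Algebra ℂ R]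

theorem coeffwise_wedge {L : Module.End ℂ R} (hL : ∀ a b, L (a * b) = a * L b + L a * b)
    (α β : Finset ι → R) : coeffwise ι L (wedge α β)
      = wedge (coeffwise ι L α) β + wedge α (coeffwise ι L β) := by
  funext A
  rw [Pi.add_apply, coeffwise_apply]
  simp only [wedge, coeffwise_apply]
  rw [map_sum, ← Finset.sum_add_distrib]
  refine Finset.sum_congr rfl fun B _ => ?_
  rw [map_smul, hL, smul_add, add_comm]

theorem wedge_mul_left {L : Module.End ℂ R} {c : R} (hL : ∀ a, L a = c * a) (α β : Finset ι → R) :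
    wedge (coeffwise ι L α) β = coeffwise ι L (wedge α β) := by
  funext A
  rw [coeffwise_apply]
  simp only [wedge, coeffwise_apply, hL]
  rw [Finset.mul_sum]
  refine Finset.sum_congr rfl fun B _ => ?_
  rw [mul_smul_comm, mul_assoc]

theorem wedge_mul_right {L : Module.End ℂ R} {c : R} (hL : ∀ a, L a = c * a) (α β : Finset ι → R) :
    wedge α (coeffwise ι L β) = coeffwise ι L (wedge α β) := by
  funext A
  rw [coeffwise_apply]
  simp only [wedge, coeffwise_apply, hL]
  rw [Finset.mul_sum]
  refine Finset.sum_congr rfl fun B _ => ?_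
  rw [mul_smul_comm, mul_left_comm]

theorem wedge_weight {w : Finset ι → ℂ} (hw : ∀ A B, B ⊆ A → w B + w (A \ B) = w A)
    (α β : Finset ι → R) :
    wedge (weightOp R w α) β + wedge α (weightOp R w β) = weightOp R w (wedge α β) := by
  funext A
  rw [Pi.add_apply, weightOp_apply]
  simp only [wedge, weightOp_apply]
  rw [Finset.smul_sum, ← Finset.sum_add_distrib]
  refine Finset.sum_congr rfl fun B hB => ?_
  rw [← hw A B (Finset.mem_powerset.mp hB), add_smul, smul_mul_assoc, mul_smul_comm,
    smul_comm (w B), smul_comm (w (A \ B))]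

/-- Odd derivations. -/
def IsOddDer (L : Module.End ℂ (Finset ι → R)) : Prop :=
  ∀ α β, L (wedge α β) = wedge (L α) β + wedge (parity α) (L β)

theorem IsOddDer.add {L L' : Module.End ℂ (Finset ι → R)} (h : IsOddDer L) (h' : IsOddDer L') :
    IsOddDer (L + L') := fun α β => by
  rw [LinearMap.add_apply, LinearMap.add_apply, LinearMap.add_apply, h, h', wedge_add_left,
    wedge_add_right]
  abel

theorem wedge_zero_left (β : Finset ι → R) : wedge 0 β = 0 := by
  simpa using wedge_smul_left 0 0 β

theorem wedge_zero_right (α : Finset ι → R) : wedge α 0 = 0 := by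
  simpa using wedge_smul_right 0 α 0

theorem isOddDer_zero : IsOddDer (0 : Module.End ℂ (Finset ι → R)) := fun α β => by
  simp only [LinearMap.zero_apply, wedge_zero_left, wedge_zero_right, add_zero]

theorem IsOddDer.sum {κ : Type*} (S : Finset κ) {L : κ → Module.End ℂ (Finset ι → R)}
    (h : ∀ i, IsOddDer (L i)) : IsOddDer (∑ i ∈ S, L i) :=
  Finset.sum_induction _ IsOddDer (fun _ _ hx hy => hx.add hy) isOddDer_zero fun i _ => h i

theorem IsOddDer.smul {L : Module.End ℂ (Finset ι → R)} (h : IsOddDer L) (c : ℂ) :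
    IsOddDer (c • L) := fun α β => by
  rw [LinearMap.smul_apply, LinearMap.smul_apply, LinearMap.smul_apply, h, smul_add,
    wedge_smul_left, wedge_smul_right]

theorem isOddDer_annihilation (i : ι) : IsOddDer (annihilation R i) := genDer_wedge i

theorem IsOddDer.coeffwise_mul {L : Module.End ℂ (Finset ι → R)} (h : IsOddDer L)
    {C : Module.End ℂ R} {c : R} (hC : ∀ a, C a = c * a) : IsOddDer (coeffwise ι C * L) :=
  fun α β => by
    rw [Module.End.mul_apply, Module.End.mul_apply, Module.End.mul_apply, h, map_add,
      wedge_mul_left hC, wedge_mul_right hC]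

theorem isOddDer_coeffwise_creation {L : Module.End ℂ R}
    (hL : ∀ a b, L (a * b) = a * L b + L a * b) (i : ι) :
    IsOddDer (coeffwise ι L * creation R i) := by
  rw [(coeffwise_creation L i).eq]
  intro α β
  rw [Module.End.mul_apply, Module.End.mul_apply, Module.End.mul_apply, coeffwise_wedge hL, map_add,
    creation_apply, creation_apply, creation_apply, creation_apply, genMul_wedge_left,
    genMul_wedge_right]

end Derivation

namespace Component

variable {ray : Fin d → Fin n → ℤ} {s : Finset (Fin d)}

theorem isOddDer_delta (v : Fin d) : IsOddDer (deltaOp ray s v) := by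
  unfold deltaOp
  exact IsOddDer.sum _ fun k => (isOddDer_annihilation _).smul _

theorem isOddDer_dbarOp : IsOddDer (dbarOp n s) :=
  IsOddDer.sum _ fun v => isOddDer_coeffwise_creation (Sm.dzbarOp_mul v) _

theorem isOddDer_contractOp : IsOddDer (contractOp ray s (coordOps s)) :=
  IsOddDer.sum _ fun v => (isOddDer_delta v).coeffwise_mul (c := Sm.coord s v) fun _ => rfl

theorem isOddDer_diff : IsOddDer (diff ray s) := by
  rw [diff_eq]
  exact isOddDer_dbarOp.add isOddDer_contractOp

theorem eulerAt_mul (v : Fin d) (a b : Sm s) :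
    eulerAt s v (a * b) = a * eulerAt s v b + eulerAt s v a * b := by
  show Sm.coord s v * Sm.dzOp s v (a * b)
    = a * (Sm.coord s v * Sm.dzOp s v b) + Sm.coord s v * Sm.dzOp s v a * b
  rw [Sm.dzOp_mul]
  ring

end Component

theorem thetaCount_add (A B : Finset (Gen n d)) (h : B ⊆ A) :
    thetaCount B + thetaCount (A \ B) = thetaCount A := by
  unfold thetaCount
  rw [← Nat.cast_add, ← Finset.card_union_of_disjoint]
  · congr 2
    ext k
    simp only [Finset.mem_union, Finset.mem_filter, Finset.mem_univ, true_and, Finset.mem_sdiff]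
    constructor
    · rintro (h1 | h1)
      · exact h h1
      · exact h1.1
    · intro h1
      by_cases h2 : Sum.inrₗ k ∈ B
      · exact Or.inl h2
      · exact Or.inr ⟨h1, h2⟩
  · rw [Finset.disjoint_left]
    intro k h1 h2
    exact (Finset.mem_sdiff.mp (Finset.mem_filter.mp h2).2).2 (Finset.mem_filter.mp h1).2

theorem LeftIn.subset {A B : Finset (Gen n d)} {s : Finset (Fin d)} (h : LeftIn A s) (hB : B ⊆ A) :
    LeftIn B s := fun i hi => h i (hB hi)

namespace SmoothCompleteFan

variable {F : SmoothCompleteFan n d}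

open Component

/-! ### The product and the trace -/

/-- The product on `PV_log(X)`. -/
def wedgePV (x y : F.PV) : F.PV :=
  ⟨fun s => wedge (x.1 s) (y.1 s), by
    refine ⟨fun s A => ?_, fun s A hA => ?_, fun s t A hs ht w hw => ?_⟩
    · have e : wedge (x.1 s) (y.1 s) A
          = fun z => ∑ B ∈ A.powerset, wedgeSign B (A \ B) • (x.1 s B z * y.1 s (A \ B) z) := by
        funext z
        simp only [wedge, Finset.sum_apply, Pi.smul_apply, Pi.mul_apply]
      beta_reduce
      rw [e]
      exact ContDiff.sum fun B _ => ((x.2.1 s B).mul (y.2.1 s _)).const_smul _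
    · refine Finset.sum_eq_zero fun B hB => ?_
      have hBA := Finset.mem_powerset.mp hB
      by_cases h1 : LeftIn B s.1
      · rw [y.2.2.1 s (A \ B) fun h2 => hA fun i hi => ?_, mul_zero, smul_zero]
        by_cases hiB : Sum.inlₗ i ∈ B
        · exact h1 i hiB
        · exact h2 i (Finset.mem_sdiff.mpr ⟨hi, hiB⟩)
      · rw [x.2.2.1 s B h1, zero_mul, smul_zero]
    · simp only [wedge, Finset.sum_apply, Pi.smul_apply, Pi.mul_apply]
      refine Finset.sum_congr rfl fun B hB => ?_
      have hBA := Finset.mem_powerset.mp hB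
      rw [x.2.2.2 s t B (hs.subset hBA) (ht.subset hBA) w hw,
        y.2.2.2 s t _ (hs.subset Finset.sdiff_subset) (ht.subset Finset.sdiff_subset) w hw]⟩

theorem emb_wedgePV (s : F.MaxCone) (x y : F.PV) :
    emb s (wedgePV x y) = wedge (emb s x) (emb s y) := by
  funext A
  refine Sm.ext fun z => ?_
  show wedge (x.1 s) (y.1 s) A z = _
  simp only [wedge, Finset.sum_apply, Pi.smul_apply, Pi.mul_apply, Sm.coe_sum, Sm.coe_smul,
    Sm.coe_mul]
  rfl

theorem wedgePV_add_left (x x' y : F.PV) : wedgePV (x + x') y = wedgePV x y + wedgePV x' y :=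
  PV_ext fun s => by
    rw [map_add, emb_wedgePV, emb_wedgePV, emb_wedgePV, map_add, wedge_add_left]

theorem wedgePV_add_right (x y y' : F.PV) : wedgePV x (y + y') = wedgePV x y + wedgePV x y' :=
  PV_ext fun s => by
    rw [map_add, emb_wedgePV, emb_wedgePV, emb_wedgePV, map_add, wedge_add_right]

theorem wedgePV_smul_left (c : ℂ) (x y : F.PV) : wedgePV (c • x) y = c • wedgePV x y :=
  PV_ext fun s => by
    rw [map_smul, emb_wedgePV, emb_wedgePV, map_smul, wedge_smul_left]

theorem wedgePV_smul_right (c : ℂ) (x y : F.PV) : wedgePV x (c • y) = c • wedgePV x y :=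
  PV_ext fun s => by
    rw [map_smul, emb_wedgePV, emb_wedgePV, map_smul, wedge_smul_right]

/-- Compactly supported elements of `PV_log(X)`. -/
def Bdd (x : F.PV) : Prop := ∃ R : ℝ, VanOn {w | R < ‖w‖} x

theorem CompSupp.bdd {α : USeries F.PV} (h : CompSupp α) (k : ℕ) : Bdd (α.coeff k) :=
  h.imp fun _ hR => hR k

theorem Bdd.hasCompSupp {x : F.PV} (h : Bdd x) : HasCompSupp x := by
  obtain ⟨R, hR⟩ := h
  exact CompSupp.coeff (α := USeries.mk fun _ => x) ⟨R, fun _ => hR⟩ 0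

theorem Bdd.emb {x : F.PV} (h : Bdd x) (s : F.MaxCone) (A : Finset (Gen n d)) :
    HasCompactSupport (emb s x A).val := h.hasCompSupp s A

theorem Bdd.map {x : F.PV} (h : Bdd x) {L : Module.End ℂ F.PV} (hL : L ∈ F.localOps) :
    Bdd (L x) := h.imp fun R hR => hL _ (isOpen_far R) _ hR

theorem Bdd.wedge {x : F.PV} (h : Bdd x) (y : F.PV) : Bdd (wedgePV x y) :=
  h.imp fun R hR s A z hz => by
    show LogLG.wedge (x.1 s) (y.1 s) A z = 0
    simp only [LogLG.wedge, Finset.sum_apply, Pi.smul_apply, Pi.mul_apply]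
    refine Finset.sum_eq_zero fun B _ => ?_
    rw [hR s B z hz, Pi.zero_apply, Pi.zero_apply, zero_mul, smul_zero]

/-- The trace of an element of `PV_log(X)`. -/
def tr (x : F.PV) : ℂ := F.trace x.1

theorem tr_eq (x : F.PV) : tr x
    = (2 * Complex.I) ^ n * ∑ s : F.MaxCone, (F.coneDet s : ℂ) * compInt s (emb s x (topIdx s.1)) :=
  rfl

theorem tr_add {x y : F.PV} (hx : Bdd x) (hy : Bdd y) : tr (x + y) = tr x + tr y := by
  rw [tr_eq, tr_eq, tr_eq, ← mul_add, ← Finset.sum_add_distrib]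
  congr 1
  refine Finset.sum_congr rfl fun s _ => ?_
  rw [map_add, Pi.add_apply, compInt_add s (hx.emb s _) (hy.emb s _), mul_add]

theorem tr_smul (c : ℂ) (x : F.PV) : tr (c • x) = c * tr x := by
  rw [tr_eq, tr_eq, mul_left_comm c, Finset.mul_sum _ _ c]
  congr 1
  refine Finset.sum_congr rfl fun s _ => ?_
  rw [map_smul, Pi.smul_apply, compInt_smul, mul_left_comm]

theorem tr_eq_zero {x : F.PV} (h : ∀ s, compInt s (emb s x (topIdx s.1)) = 0) : tr x = 0 := by
  rw [tr_eq, Finset.sum_eq_zero fun s _ => by rw [h s, mul_zero], mul_zero]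

theorem delta_topIdx {s : Finset (Fin d)} (v : Fin d) (γ : SFld n s) :
    deltaOp F.ray s v γ (topIdx s) = 0 := by
  unfold deltaOp
  rw [LinearMap.sum_apply, Finset.sum_apply]
  refine Finset.sum_eq_zero fun k _ => ?_
  rw [LinearMap.smul_apply, Pi.smul_apply, annihilation_apply, genDer, if_pos (mem_topIdx_inr k),
    smul_zero]

theorem tr_bracketPV (x : F.PV) : tr (F.bracketPV x) = 0 := tr_eq_zero fun s => by
  rw [rep_bracketPV s x]
  beta_reduce
  rw [contractOp, LinearMap.sum_apply, Finset.sum_apply,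
    Finset.sum_eq_zero fun v _ => ?_, compInt_zero]
  rw [Module.End.mul_apply, coeffwise_apply, delta_topIdx, map_zero]

theorem tr_baseDiff {x : F.PV} (hx : Bdd x) : tr (F.baseDiff x) = 0 := by
  have h := tr_add (hx.map dbarPV_mem_localOps) (hx.map bracketPV_mem_localOps)
  rw [tr_bracketPV, add_zero] at h
  exact h.trans (trace_dbarPV_eq_zero x hx.hasCompSupp)

theorem tr_eulerPV {x : F.PV} (hx : Bdd x) (i : Fin d) : tr (F.eulerPV i x) = 0 :=
  tr_eq_zero fun s => by
    rw [rep_eulerPV i s x, coeffwise_apply]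
    exact integral_euler_div (hx.emb s _) i

variable (F) in
/-- The parity operator. -/
abbrev parityPV : Module.End ℂ F.PV := F.weightPV paritySign

theorem emb_parityPV (s : F.MaxCone) (x : F.PV) : emb s (F.parityPV x) = parity (emb s x) :=
  rep_weightPV _ s x

theorem baseDiff_wedge (x y : F.PV) : F.baseDiff (wedgePV x y)
    = wedgePV (F.baseDiff x) y + wedgePV (F.parityPV x) (F.baseDiff y) :=
  PV_ext fun s => by
    rw [rep_baseDiff s, map_add, emb_wedgePV, emb_wedgePV, emb_wedgePV, isOddDer_diff,
      rep_baseDiff s, rep_baseDiff s, emb_parityPV]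

theorem eulerPV_wedge (i : Fin d) (x y : F.PV) : F.eulerPV i (wedgePV x y)
    = wedgePV (F.eulerPV i x) y + wedgePV x (F.eulerPV i y) :=
  PV_ext fun s => by
    rw [rep_eulerPV i s, map_add, emb_wedgePV, emb_wedgePV, emb_wedgePV, rep_eulerPV i s,
      rep_eulerPV i s]
    exact coeffwise_wedge (eulerAt_mul i) _ _

theorem coordPV_wedge (i : Fin d) (x y : F.PV) :
    wedgePV (F.coordPV i x) y = wedgePV x (F.coordPV i y) :=
  PV_ext fun s => by
    rw [emb_wedgePV, emb_wedgePV, rep_coordPV i s, rep_coordPV i s]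
    exact (wedge_mul_left (c := Sm.coord s.1 i) (fun _ => rfl) _ _).trans
      (wedge_mul_right (c := Sm.coord s.1 i) (fun _ => rfl) _ _).symm

theorem tr_wedge_baseDiff {x : F.PV} (hx : Bdd x) (y : F.PV) :
    tr (wedgePV (F.baseDiff x) y) = -1 * tr (wedgePV (F.parityPV x) (F.baseDiff y)) := by
  have h := tr_baseDiff (hx.wedge y)
  rw [baseDiff_wedge, tr_add ((hx.map baseDiff_mem_localOps).wedge _)
    ((hx.map (weightPV_mem_localOps _)).wedge _)] at h
  linear_combination h

theorem tr_wedge_euler {x : F.PV} (hx : Bdd x) (y : F.PV) (i : Fin d) :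
    tr (wedgePV (F.eulerPV i x) y) = -1 * tr (wedgePV x (F.eulerPV i y)) := by
  have h := tr_eulerPV (hx.wedge y) i
  rw [eulerPV_wedge, tr_add ((hx.map (eulerPV_mem_localOps i)).wedge _) (hx.wedge _)] at h
  linear_combination h

end SmoothCompleteFan

namespace SmoothCompleteFan

variable {F : SmoothCompleteFan n d}

open Component USeries

/-- The contraction `∂/∂θ̃_k`. -/
def contrPV (F : SmoothCompleteFan n d) (k : Fin n) : Module.End ℂ F.PV where
  toFun α := ⟨fun s => genDer (Sum.inrₗ k) (α.1 s), fun s A => contDiff_genDer (α.2.1 s) _ _,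
    fun s _ hA => genDer_inr_eq_zero (α.2.2.1 s) k hA, F.genDer_inr_compat α.2 k⟩
  map_add' α β := Subtype.ext <| funext fun s => genDer_add _ _ _
  map_smul' c α := Subtype.ext <| funext fun s => genDer_smul _ _ _

theorem rep_contrPV (k : Fin n) :
    Rep (F.contrPV k) fun s => annihilation (Sm s.1) (Sum.inrₗ k) := by
  intro s α
  funext A
  rw [annihilation_apply]
  refine Sm.ext fun z => ?_
  show genDer (Sum.inrₗ k) (α.1 s) A z = _
  simp only [genDer]
  split_ifs
  · rfl
  · rfl

theorem contrPV_mem_localOps (k : Fin n) : F.contrPV k ∈ F.localOps := fun O hO α hα s => by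
  have h := (hα s).genDer (Sum.inrₗ k)
  rwa [show genDer (Sum.inrₗ k) (0 : Fld n s.1) = 0 from
    congrFun (congrArg Subtype.val (map_zero (F.contrPV k))) s] at h

theorem contrPV_wedge (k : Fin n) (x y : F.PV) : F.contrPV k (wedgePV x y)
    = wedgePV (F.contrPV k x) y + wedgePV (F.parityPV x) (F.contrPV k y) :=
  PV_ext fun s => by
    rw [rep_contrPV k s, map_add, emb_wedgePV, emb_wedgePV, emb_wedgePV, rep_contrPV k s,
      rep_contrPV k s, emb_parityPV]
    exact isOddDer_annihilation _ _ _

theorem tr_contrPV (k : Fin n) (x : F.PV) : tr (F.contrPV k x) = 0 := tr_eq_zero fun s => by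
  rw [rep_contrPV k s x]
  beta_reduce
  rw [annihilation_apply, genDer, if_pos (mem_topIdx_inr k), compInt_zero]

theorem euler_contr (i : Fin d) (k : Fin n) :
    F.eulerPV i * F.contrPV k = F.contrPV k * F.eulerPV i :=
  ((rep_eulerPV i).mul (rep_contrPV k)).eq ((rep_contrPV k).mul (rep_eulerPV i)) fun s =>
    (coeffwise_annihilation _ _).eq

theorem delPV_eq_sum : F.delPV = ∑ k, ∑ i, (F.ray i k : ℂ) • (F.eulerPV i * F.contrPV k) := by
  refine LinearMap.ext fun x => Subtype.ext (funext fun s => funext fun A => funext fun z => ?_)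
  show F.del s.1 (x.1 s) A z = _
  simp only [del, Finset.sum_apply, theta, LinearMap.sum_apply, AddSubmonoidClass.coe_finset_sum]
  refine Finset.sum_congr rfl fun k _ => Finset.sum_congr rfl fun i _ => ?_
  rw [mul_assoc]
  rfl

theorem Bdd.add {x y : F.PV} (hx : Bdd x) (hy : Bdd y) : Bdd (x + y) := by
  have := CompSupp.bdd (CompSupp.add (α := USeries.mk fun _ => x) (β := USeries.mk fun _ => y)
    (hx.imp fun _ h _ => h) (hy.imp fun _ h _ => h)) 0
  exact this

theorem Bdd.smul {x : F.PV} (hx : Bdd x) (c : ℂ) : Bdd (c • x) := hx.imp fun R hR s A z hz => by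
  show c * x.1 s A z = 0
  rw [hR s A z hz]
  exact mul_zero _

theorem bdd_zero : Bdd (0 : F.PV) := ⟨0, fun _ _ _ _ => rfl⟩

theorem tr_zero : tr (0 : F.PV) = 0 := by
  have := tr_smul (F := F) 0 0
  rwa [zero_smul, zero_mul] at this

theorem Bdd.sum {ι : Type*} (S : Finset ι) {x : ι → F.PV} (h : ∀ i, Bdd (x i)) :
    Bdd (∑ i ∈ S, x i) :=
  Finset.sum_induction _ Bdd (fun _ _ hx hy => hx.add hy) bdd_zero fun i _ => h i

theorem tr_sum {ι : Type*} (S : Finset ι) {x : ι → F.PV} (h : ∀ i, Bdd (x i)) :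
    tr (∑ i ∈ S, x i) = ∑ i ∈ S, tr (x i) := by
  classical
  induction S using Finset.induction_on with
  | empty => simp [tr_zero]
  | insert a S ha ih =>
    rw [Finset.sum_insert ha, Finset.sum_insert ha, tr_add (h a) (Bdd.sum S h), ih]

theorem tr_wedge_euler_contr {x : F.PV} (hx : Bdd x) (y : F.PV) (i : Fin d) (k : Fin n) :
    tr (wedgePV (F.eulerPV i (F.contrPV k x)) y)
      = tr (wedgePV (F.parityPV x) (F.eulerPV i (F.contrPV k y))) := by
  have h := tr_contrPV k (wedgePV x (F.eulerPV i y))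
  rw [contrPV_wedge, tr_add ((hx.map (contrPV_mem_localOps k)).wedge _)
    ((hx.map (weightPV_mem_localOps _)).wedge _)] at h
  have e : F.eulerPV i (F.contrPV k y) = F.contrPV k (F.eulerPV i y) :=
    LinearMap.congr_fun (euler_contr i k) y
  rw [tr_wedge_euler (hx.map (contrPV_mem_localOps k)), e]
  linear_combination -h

theorem delPV_apply_eq_sum (x : F.PV) :
    F.delPV x = ∑ p : Fin n × Fin d, (F.ray p.2 p.1 : ℂ) • F.eulerPV p.2 (F.contrPV p.1 x) := by
  rw [delPV_eq_sum, Fintype.sum_prod_type]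
  simp only [LinearMap.sum_apply]
  rfl

theorem wedgePV_sum_left {ι : Type*} (S : Finset ι) (x : ι → F.PV) (y : F.PV) :
    wedgePV (∑ i ∈ S, x i) y = ∑ i ∈ S, wedgePV (x i) y :=
  map_sum (AddMonoidHom.mk' (fun x => wedgePV x y) fun a b => wedgePV_add_left a b y) _ _

theorem wedgePV_sum_right {ι : Type*} (S : Finset ι) (x : F.PV) (y : ι → F.PV) :
    wedgePV x (∑ i ∈ S, y i) = ∑ i ∈ S, wedgePV x (y i) :=
  map_sum (AddMonoidHom.mk' (fun y => wedgePV x y) fun a b => wedgePV_add_right x a b) _ _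

theorem tr_wedge_delPV {x : F.PV} (hx : Bdd x) (y : F.PV) :
    tr (wedgePV (F.delPV x) y) = tr (wedgePV (F.parityPV x) (F.delPV y)) := by
  have hl : ∀ p : Fin n × Fin d, Bdd (wedgePV (F.eulerPV p.2 (F.contrPV p.1 x)) y) := fun p =>
    ((hx.map (contrPV_mem_localOps p.1)).map (eulerPV_mem_localOps p.2)).wedge _
  have hr : Bdd (F.parityPV x) := hx.map (weightPV_mem_localOps _)
  have e1 : wedgePV (F.delPV x) y = ∑ p : Fin n × Fin d,
      (F.ray p.2 p.1 : ℂ) • wedgePV (F.eulerPV p.2 (F.contrPV p.1 x)) y := by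
    rw [delPV_apply_eq_sum, wedgePV_sum_left]
    exact Finset.sum_congr rfl fun p _ => wedgePV_smul_left _ _ _
  have e2 : wedgePV (F.parityPV x) (F.delPV y) = ∑ p : Fin n × Fin d,
      (F.ray p.2 p.1 : ℂ) • wedgePV (F.parityPV x) (F.eulerPV p.2 (F.contrPV p.1 y)) := by
    rw [delPV_apply_eq_sum, wedgePV_sum_right]
    exact Finset.sum_congr rfl fun p _ => wedgePV_smul_right _ _ _
  rw [e1, e2, tr_sum _ fun p => (hl p).smul _, tr_sum _ fun p => (hr.wedge _).smul _]
  refine Finset.sum_congr rfl fun p _ => ?_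
  rw [tr_smul, tr_smul, tr_wedge_euler_contr hx]

theorem thetaCount_topIdx (s : Finset (Fin d)) : thetaCount (topIdx (n := n) s) = n := by
  unfold thetaCount
  rw [Finset.filter_true_of_mem fun k _ => mem_topIdx_inr k, Finset.card_univ, Fintype.card_fin]

theorem tr_weight (x : F.PV) : tr (F.weightPV thetaCount x) = n * tr x := by
  rw [← tr_smul, tr_eq, tr_eq]
  congr 1
  refine Finset.sum_congr rfl fun s _ => ?_
  rw [rep_weightPV _ s x]
  beta_reduce
  rw [weightOp_apply, thetaCount_topIdx, map_smul, Pi.smul_apply]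

theorem weight_wedge (x y : F.PV) : wedgePV (F.weightPV thetaCount x) y
    + wedgePV x (F.weightPV thetaCount y) = F.weightPV thetaCount (wedgePV x y) :=
  PV_ext fun s => by
    rw [map_add, emb_wedgePV, emb_wedgePV, rep_weightPV _ s, rep_weightPV _ s, rep_weightPV _ s,
      emb_wedgePV]
    exact wedge_weight thetaCount_add _ _

theorem degPV_wedge (x y : F.PV) : wedgePV (F.degPV x) y + wedgePV x (F.degPV y)
    = F.degPV (wedgePV x y) := by
  have e : ∀ z : F.PV, F.degPV z = ∑ i, F.eulerPV i z + F.weightPV thetaCount z := fun z => by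
    rw [degPV, LinearMap.add_apply, LinearMap.sum_apply]
  rw [e, e, e, wedgePV_add_left, wedgePV_add_right, ← weight_wedge, wedgePV_sum_left,
    wedgePV_sum_right]
  simp only [eulerPV_wedge, Finset.sum_add_distrib]
  abel

theorem tr_degPV {x : F.PV} (hx : Bdd x) : tr (F.degPV x) = n * tr x := by
  have e : F.degPV x = ∑ i, F.eulerPV i x + F.weightPV thetaCount x := by
    rw [degPV, LinearMap.add_apply, LinearMap.sum_apply]
  rw [e, tr_add (Bdd.sum _ fun i => hx.map (eulerPV_mem_localOps i))
    (hx.map (weightPV_mem_localOps _)), tr_sum _ fun i => hx.map (eulerPV_mem_localOps i), tr_weight,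
    Finset.sum_eq_zero fun i _ => tr_eulerPV hx i, zero_add]

theorem degPV_mem_localOps : F.degPV ∈ F.localOps :=
  add_mem (sum_mem fun i _ => eulerPV_mem_localOps i) (weightPV_mem_localOps _)

theorem tr_wedge_degPV {x : F.PV} (hx : Bdd x) (y : F.PV) :
    tr (wedgePV (F.degPV x) y) + tr (wedgePV x (F.degPV y)) = n * tr (wedgePV x y) := by
  rw [← tr_degPV (hx.wedge y), ← degPV_wedge,
    tr_add ((hx.map degPV_mem_localOps).wedge _) (hx.wedge _)]

/-! ### The pairing of compactly supported elements -/

/-- The coefficient of `u^k` in `Tr (α(u) ∧ β(-u))`. -/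
def pair (k : ℕ) (α β : USeries F.PV) : ℂ :=
  ∑ p ∈ Finset.HasAntidiagonal.antidiagonal k,
    (-1) ^ p.2 * tr (wedgePV (α.coeff p.1) (β.coeff p.2))

theorem pair_add_left (k : ℕ) {α α' : USeries F.PV} (h : CompSupp α) (h' : CompSupp α')
    (β : USeries F.PV) : pair k (α + α') β = pair k α β + pair k α' β := by
  simp only [pair, ← Finset.sum_add_distrib]
  refine Finset.sum_congr rfl fun p _ => ?_
  rw [coeff_add, wedgePV_add_left, tr_add ((h.bdd _).wedge _) ((h'.bdd _).wedge _), mul_add]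

theorem pair_add_right (k : ℕ) {α : USeries F.PV} (h : CompSupp α) (β β' : USeries F.PV) :
    pair k α (β + β') = pair k α β + pair k α β' := by
  simp only [pair, ← Finset.sum_add_distrib]
  refine Finset.sum_congr rfl fun p _ => ?_
  rw [coeff_add, wedgePV_add_right, tr_add ((h.bdd _).wedge _) ((h.bdd _).wedge _), mul_add]

theorem wedgePV_zero_left (y : F.PV) : wedgePV 0 y = 0 := by
  simpa using wedgePV_smul_left 0 0 y

theorem wedgePV_zero_right (x : F.PV) : wedgePV x 0 = 0 := by
  simpa using wedgePV_smul_right 0 x 0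

theorem pair_zero_left (k : ℕ) (β : USeries F.PV) : pair k 0 β = 0 :=
  Finset.sum_eq_zero fun p _ => by rw [coeff_zero, wedgePV_zero_left, tr_zero, mul_zero]

theorem pair_zero_right (k : ℕ) (α : USeries F.PV) : pair k α 0 = 0 :=
  Finset.sum_eq_zero fun p _ => by rw [coeff_zero, wedgePV_zero_right, tr_zero, mul_zero]

theorem pair_shift (k : ℕ) (α β : USeries F.PV) : pair k (shift α) β = -pair k α (shift β) := by
  cases k with
  | zero =>
    simp only [pair, Finset.Nat.antidiagonal_zero, Finset.sum_singleton, coeff_shift_zero,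
      wedgePV_zero_left, wedgePV_zero_right, tr_zero, mul_zero, neg_zero]
  | succ k =>
    rw [pair, pair]
    have h1 := Finset.Nat.sum_antidiagonal_succ (n := k) (f := fun p : ℕ × ℕ =>
      (-1 : ℂ) ^ p.2 * tr (wedgePV ((shift α).coeff p.1) (β.coeff p.2)))
    have h2 := Finset.Nat.sum_antidiagonal_succ' (n := k) (f := fun p : ℕ × ℕ =>
      (-1 : ℂ) ^ p.2 * tr (wedgePV (α.coeff p.1) ((shift β).coeff p.2)))
    rw [h1, h2]
    simp only [coeff_shift_zero, coeff_shift_succ, wedgePV_zero_left, wedgePV_zero_right, tr_zero,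
      mul_zero, zero_add, pow_succ, ← Finset.sum_neg_distrib]
    exact Finset.sum_congr rfl fun p _ => by ring

theorem pair_lift (k : ℕ) {A A' L : Module.End ℂ F.PV} {c : ℂ}
    (hA : ∀ x, Bdd x → ∀ y, tr (wedgePV (A x) y) = c * tr (wedgePV (L x) (A' y)))
    {α : USeries F.PV} (hα : CompSupp α) (β : USeries F.PV) :
    pair k (lift A α) β = c * pair k (lift L α) (lift A' β) := by
  rw [pair, pair, Finset.mul_sum]
  refine Finset.sum_congr rfl fun p _ => ?_
  rw [coeff_lift, coeff_lift, coeff_lift, hA _ (hα.bdd _), mul_left_comm]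

theorem lift_shift_apply (D : Module.End ℂ F.PV) (α : USeries F.PV) :
    lift D (shift α) = shift (lift D α) :=
  DFunLike.congr_fun (lift_shift D) α

theorem pair_adjoint (k : ℕ) {A A' B B' L : Module.End ℂ F.PV} {c : ℂ}
    (hA : ∀ x, Bdd x → ∀ y, tr (wedgePV (A x) y) = c * tr (wedgePV (L x) (A' y)))
    (hB : ∀ x, Bdd x → ∀ y, tr (wedgePV (B x) y) = -c * tr (wedgePV (L x) (B' y)))
    (lA : A ∈ F.localOps) (lB : B ∈ F.localOps) (lL : L ∈ F.localOps)
    {α : USeries F.PV} (hα : CompSupp α) (β : USeries F.PV) :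
    pair k ((lift A + shift * lift B : AddMonoid.End (USeries F.PV)) α) β
      = c * pair k (lift L α) ((lift A' + shift * lift B' : AddMonoid.End (USeries F.PV)) β) := by
  show pair k (lift A α + shift (lift B α)) β
    = c * pair k (lift L α) (lift A' β + shift (lift B' β))
  rw [pair_add_left k (hα.map (lift_mem_localSOps lA))
      ((hα.map (lift_mem_localSOps lB)).map shift_mem_localSOps),
    pair_add_right k (hα.map (lift_mem_localSOps lL)), pair_lift k hA hα, pair_shift,
    pair_lift k hB hα, lift_shift_apply B']
  ring

end SmoothCompleteFan

section RingLemmas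

variable {R : Type*} [Ring R]

theorem commute_affine {b e z E u : R} (hb : b * u = u * b) (he : e * u = u * e)
    (hz : z * u = u * z) (hE : E * u = u * E) (h0 : b * z = z * b)
    (h1 : b * E + e * z = E * b + z * e) (h2 : e * E = E * e) :
    (b + u * e) * (z + u * E) = (z + u * E) * (b + u * e) := by
  have e1 : (b + u * e) * (z + u * E) = b * z + (b * u) * E + u * (e * z) + u * ((e * u) * E) := by
    noncomm_ring
  have e2 : (z + u * E) * (b + u * e) = z * b + (z * u) * e + u * (E * b) + u * ((E * u) * e) := by
    noncomm_ring
  rw [e1, e2, hb, he, hz, hE, h0, mul_assoc u b, mul_assoc u e, mul_assoc u z, mul_assoc u E, h2,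
    add_assoc (z * b), ← mul_add u, h1]
  noncomm_ring

theorem commute_euler {b e D N u : R} (hD : D * u = u * D)
    (hbN : b * N = N * b) (heN : e * N = N * e) (hN : N * u = u * (N + 1))
    (h0 : b * D = D * b) (h1 : e * D = D * e + e) :
    (b + u * e) * (D + N) = (D + N) * (b + u * e) := by
  have e1 : (b + u * e) * (D + N) = b * D + b * N + u * (e * D) + u * (e * N) := by noncomm_ring
  have e2 : (D + N) * (b + u * e) = D * b + N * b + (D * u) * e + (N * u) * e := by noncomm_ring
  rw [e1, e2, h0, hbN, h1, heN, hD, hN]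
  noncomm_ring

theorem anticomm_affine {b e p u : R} (hp : p * u = u * p) (hb : b * p = -(p * b))
    (he : e * p = -(p * e)) : (b + u * e) * p = -(p * (b + u * e)) := by
  rw [add_mul, mul_add, hb, mul_assoc, he, ← mul_assoc p, hp, mul_assoc, mul_neg, neg_add]

end RingLemmas

namespace SmoothCompleteFan

variable {F : SmoothCompleteFan n d}

open Component USeries

variable (F) in
/-- Multiplication by `z_i`, corrected so as to commute with `Q_f`. -/
def posS (i : Fin d) : AddMonoid.End (USeries F.PV) := lift (F.coordPV i) + shift * lift (F.eulerPV i)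

variable (F) in
/-- The grading operator. -/
def numS : AddMonoid.End (USeries F.PV) := lift F.degPV + uDeriv

theorem lift_congr {A B : Module.End ℂ F.PV} (h : A = B) : lift A = lift B := congrArg _ h

theorem diffS_posS (i : Fin d) : F.diffS * F.posS i = F.posS i * F.diffS :=
  commute_affine (lift_shift _) (lift_shift _) (lift_shift _) (lift_shift _)
    (lift_congr (baseDiff_coord i)) (lift_congr (baseDiff_euler_add i))
    (lift_congr (delPV_euler i))

theorem posS_comm (i j : Fin d) : F.posS i * F.posS j = F.posS j * F.posS i := by
  by_cases h : i = j
  · rw [h]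
  · refine commute_affine (lift_shift _) (lift_shift _) (lift_shift _) (lift_shift _)
      (lift_congr (coord_coord i j)) ?_ (lift_congr (euler_euler i j))
    have h1 : lift (F.coordPV i) * lift (F.eulerPV j) = lift (F.eulerPV j) * lift (F.coordPV i) :=
      lift_congr (euler_coord (Ne.symm h)).symm
    have h2 : lift (F.eulerPV i) * lift (F.coordPV j) = lift (F.coordPV j) * lift (F.eulerPV i) :=
      lift_congr (euler_coord h)
    rw [h1, h2]

theorem diffS_numS : F.diffS * F.numS = F.numS * F.diffS :=
  commute_euler (lift_shift _) (lift_uDeriv _) (lift_uDeriv _) uDeriv_shift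
    (lift_congr baseDiff_deg) (lift_congr delPV_deg)

theorem diffS_parity : F.diffS * lift F.parityPV = -(lift F.parityPV * F.diffS) :=
  anticomm_affine (lift_shift _) (lift_congr baseDiff_parity) (lift_congr delPV_parity)

theorem posS_mem_localSOps (i : Fin d) : F.posS i ∈ F.localSOps :=
  add_mem (lift_mem_localSOps (mulPV_mem_localOps _ _))
    (mul_mem shift_mem_localSOps (lift_mem_localSOps (eulerPV_mem_localOps i)))

theorem numS_mem_localSOps : F.numS ∈ F.localSOps :=
  add_mem (lift_mem_localSOps degPV_mem_localOps) uDeriv_mem_localSOps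

theorem pair_diffS (k : ℕ) {α : USeries F.PV} (hα : CompSupp α) (β : USeries F.PV) :
    pair k (F.diffS α) β = -1 * pair k (lift F.parityPV α) (F.diffS β) :=
  pair_adjoint k (fun x hx y => tr_wedge_baseDiff hx y)
    (fun x hx y => by rw [neg_neg, one_mul]; exact tr_wedge_delPV hx y) baseDiff_mem_localOps
    delPV_mem_localOps (weightPV_mem_localOps _) hα β

theorem lift_one_apply (α : USeries F.PV) : lift (1 : Module.End ℂ F.PV) α = α := rfl

theorem pair_posS (k : ℕ) (i : Fin d) {α : USeries F.PV} (hα : CompSupp α) (β : USeries F.PV) :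
    pair k (F.posS i α) β = pair k α (F.posS i β) := by
  have h := pair_adjoint k (A := F.coordPV i) (A' := F.coordPV i) (B := F.eulerPV i)
    (B' := F.eulerPV i) (L := 1) (c := 1)
    (fun x hx y => by rw [one_mul, Module.End.one_apply, coordPV_wedge])
    (fun x hx y => by rw [Module.End.one_apply]; exact tr_wedge_euler hx y i)
    (mulPV_mem_localOps _ _) (eulerPV_mem_localOps i) (one_mem _) hα β
  rw [one_mul, lift_one_apply] at h
  exact h

theorem pair_numS (k : ℕ) {α : USeries F.PV} (hα : CompSupp α) (β : USeries F.PV) :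
    pair k (F.numS α) β + pair k α (F.numS β) = ((n : ℂ) + k) * pair k α β := by
  have e1 : pair k (F.numS α) β = pair k (lift F.degPV α) β + pair k (uDeriv α) β :=
    pair_add_left k (hα.map (lift_mem_localSOps degPV_mem_localOps))
      (hα.map uDeriv_mem_localSOps) β
  have e2 : pair k α (F.numS β) = pair k α (lift F.degPV β) + pair k α (uDeriv β) :=
    pair_add_right k hα _ _
  rw [e1, e2]
  simp only [pair, ← Finset.sum_add_distrib, Finset.mul_sum]
  refine Finset.sum_congr rfl fun p hp => ?_
  have h1 := tr_wedge_degPV (hα.bdd p.1) (β.coeff p.2)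
  have hk : ((p.1 : ℂ) + p.2) = k := by exact_mod_cast Finset.HasAntidiagonal.mem_antidiagonal.mp hp
  have h2 : tr (wedgePV ((uDeriv α).coeff p.1) (β.coeff p.2))
      = p.1 * tr (wedgePV (α.coeff p.1) (β.coeff p.2)) := by
    rw [coeff_uDeriv, ← Nat.cast_smul_eq_nsmul ℂ, wedgePV_smul_left, tr_smul]
  have h3 : tr (wedgePV (α.coeff p.1) ((uDeriv β).coeff p.2))
      = p.2 * tr (wedgePV (α.coeff p.1) (β.coeff p.2)) := by
    rw [coeff_uDeriv, ← Nat.cast_smul_eq_nsmul ℂ, wedgePV_smul_right, tr_smul]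
  rw [coeff_lift, coeff_lift, h2, h3, ← hk]
  linear_combination (-1) ^ p.2 * h1

theorem pair_exact_left (k : ℕ) {γ β : USeries F.PV} (hγ : CompSupp γ) (hβ : F.diffS β = 0) :
    pair k (F.diffS γ) β = 0 := by
  rw [pair_diffS k hγ, hβ, pair_zero_right, mul_zero]

theorem parity_parity_apply (β : USeries F.PV) : lift F.parityPV (lift F.parityPV β) = β := by
  refine USeries.ext fun k => Subtype.ext (funext fun s => funext fun A => funext fun z => ?_)
  show paritySign A * (paritySign A * (β.coeff k).1 s A z) = (β.coeff k).1 s A z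
  rw [← mul_assoc, paritySign, ← mul_pow]
  simp

theorem pair_exact_right (k : ℕ) {γ β : USeries F.PV} (hβ : CompSupp β) (h : F.diffS β = 0) :
    pair k β (F.diffS γ) = 0 := by
  have h1 := pair_diffS k (hβ.map (lift_mem_localSOps (weightPV_mem_localOps paritySign))) γ
  have h2 : F.diffS (lift F.parityPV β) = 0 := by
    have := DFunLike.congr_fun (diffS_parity (F := F)) β
    refine this.trans ?_
    show -(lift F.parityPV (F.diffS β)) = 0
    rw [h, map_zero, neg_zero]
  rw [h2, pair_zero_left, parity_parity_apply] at h1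
  linear_combination h1

/-- Exact elements with compact support have primitives with compact support. -/
theorem exists_compSupp_primitive (P : CutoffPair d) {δ γ : USeries F.PV} (hδ : CompSupp δ)
    (h : δ = F.diffS γ) : ∃ γ', CompSupp γ' ∧ δ = F.diffS γ' := by
  refine ⟨F.cutS P γ + F.homS P δ, (compSupp_cutS P γ).add (hδ.map (homS_mem_localSOps P)), ?_⟩
  have h1 : F.cutS P γ = γ - (F.diffS (F.homS P γ) + F.homS P (F.diffS γ)) := rfl
  have h2 : ∀ x, F.diffS (F.diffS x) = 0 := DFunLike.congr_fun diffS_sq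
  rw [map_add, h1, map_sub, map_add, h2, ← h]
  abel

theorem diffS_cutS (P : CutoffPair d) {α : USeries F.PV} (h : F.diffS α = 0) :
    F.cutS P α = α - F.diffS (F.homS P α) := by
  have h1 : F.cutS P α = α - (F.diffS (F.homS P α) + F.homS P (F.diffS α)) := rfl
  rw [h1, h, map_zero, add_zero]

theorem pair_congr (P : CutoffPair d) (k : ℕ) {a a' b b' γ η : USeries F.PV} (ha : CompSupp a)
    (ha' : CompSupp a') (hb : CompSupp b) (hb' : CompSupp b') (da' : F.diffS a' = 0)
    (db : F.diffS b = 0) (hγ : a - a' = F.diffS γ) (hη : b - b' = F.diffS η) :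
    pair k a b = pair k a' b' := by
  obtain ⟨γ', cγ, eγ⟩ := exists_compSupp_primitive P (ha.sub ha') hγ
  obtain ⟨η', cη, eη⟩ := exists_compSupp_primitive P (hb.sub hb') hη
  have h1 : a = a' + F.diffS γ' := by rw [← eγ]; abel
  have h2 : b = b' + F.diffS η' := by rw [← eη]; abel
  rw [h1, pair_add_left k ha' (cγ.map diffS_mem_localSOps), pair_exact_left k cγ db, add_zero, h2,
    pair_add_right k ha', pair_exact_right k ha' da', add_zero]

end SmoothCompleteFan

namespace Component

variable {s : Finset (Fin d)}

theorem eulerAt_coord (i j : Fin d) :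
    eulerAt s i (Sm.coord s j) = if i = j then Sm.coord s j else 0 := by
  show Sm.coord s i * Sm.dzOp s i (Sm.coord s j) = _
  rw [Sm.dzOp_coord]
  by_cases hi : i ∈ s
  · by_cases hij : i = j
    · rw [if_pos ⟨hi, hij.symm⟩, if_pos hij, mul_one, hij]
    · rw [if_neg fun h => hij h.2.symm, if_neg hij, mul_zero]
  · rw [if_neg fun h => hi h.1, mul_zero]
    split_ifs with hij
    · rw [← hij, Sm.coord_eq_zero hi]
    · rfl

theorem eulerAt_one (i : Fin d) : eulerAt s i 1 = 0 := by
  have h := eulerAt_mul (s := s) i 1 1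
  rw [mul_one, one_mul, mul_one] at h
  exact left_eq_add.mp h

theorem eulerAt_prod (i : Fin d) (τ : Finset (Fin d)) :
    eulerAt s i (∏ j ∈ τ, Sm.coord s j) = if i ∈ τ then ∏ j ∈ τ, Sm.coord s j else 0 := by
  induction τ using Finset.induction_on with
  | empty => rw [Finset.prod_empty, eulerAt_one, if_neg (Finset.notMem_empty i)]
  | insert a τ ha ih =>
    rw [Finset.prod_insert ha, eulerAt_mul, ih, eulerAt_coord]
    by_cases hia : i = a
    · subst hia
      rw [if_neg ha, if_pos rfl, if_pos (Finset.mem_insert_self _ _), mul_zero, zero_add]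
    · rw [if_neg hia, zero_mul, add_zero]
      by_cases hi : i ∈ τ
      · rw [if_pos hi, if_pos (Finset.mem_insert_of_mem hi)]
      · rw [if_neg hi, if_neg fun h => (Finset.mem_insert.mp h).elim hia hi, mul_zero]

end Component

namespace SmoothCompleteFan

variable {F : SmoothCompleteFan n d}

open Component USeries

/-! ### Products of coordinates -/

theorem coordPV_monomialPV {i : Fin d} {τ : Finset (Fin d)} (h : i ∉ τ) :
    F.coordPV i (F.monomialPV τ) = F.monomialPV (insert i τ) := PV_ext fun s => by
  rw [rep_coordPV i s, emb_monomialPV, emb_monomialPV]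
  funext A
  show Sm.coord s.1 i * monoFld n s.1 τ A = _
  unfold monoFld
  split_ifs
  · rw [Finset.prod_insert h]
  · rw [mul_zero]

theorem eulerPV_monomialPV (i : Fin d) (τ : Finset (Fin d)) :
    F.eulerPV i (F.monomialPV τ) = if i ∈ τ then F.monomialPV τ else 0 := by
  refine PV_ext fun s => ?_
  have e : emb s (F.eulerPV i (F.monomialPV τ)) = if i ∈ τ then monoFld n s.1 τ else 0 := by
    rw [rep_eulerPV i s, emb_monomialPV]
    funext A
    show eulerAt s.1 i (monoFld n s.1 τ A) = _
    unfold monoFld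
    by_cases hA : A = ∅
    · rw [if_pos hA, eulerAt_prod]
      split_ifs
      · exact (if_pos hA).symm
      · rfl
    · rw [if_neg hA, map_zero]
      split_ifs
      · exact (if_neg hA).symm
      · rfl
  rw [e]
  split_ifs
  · rw [emb_monomialPV]
  · rw [map_zero]

theorem weightPV_monomialPV (τ : Finset (Fin d)) :
    F.weightPV thetaCount (F.monomialPV τ) = 0 := PV_ext fun s => by
  rw [rep_weightPV _ s, emb_monomialPV, map_zero]
  funext A
  show thetaCount A • monoFld n s.1 τ A = 0
  unfold monoFld
  by_cases hA : A = ∅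
  · have h0 : thetaCount (∅ : Finset (Gen n d)) = 0 := by
      unfold thetaCount
      simp
    rw [hA, h0, zero_smul]
  · rw [if_neg hA, smul_zero]

theorem degPV_monomialPV (τ : Finset (Fin d)) :
    F.degPV (F.monomialPV τ) = (τ.card : ℂ) • F.monomialPV τ := by
  rw [degPV, LinearMap.add_apply, LinearMap.sum_apply, weightPV_monomialPV, add_zero]
  simp only [eulerPV_monomialPV]
  rw [Finset.sum_ite_mem, Finset.univ_inter, Finset.sum_const, Nat.cast_smul_eq_nsmul]

theorem coeff_monomial_zero (τ : Finset (Fin d)) : (F.monomial τ).coeff 0 = F.monomialPV τ := rfl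

theorem coeff_monomial_succ (τ : Finset (Fin d)) (k : ℕ) : (F.monomial τ).coeff (k + 1) = 0 := rfl

theorem posS_monomial {i : Fin d} {τ : Finset (Fin d)} (h : i ∉ τ) :
    F.posS i (F.monomial τ) = F.monomial (insert i τ) := by
  refine USeries.ext fun k => ?_
  show F.coordPV i ((F.monomial τ).coeff k) + (shift (lift (F.eulerPV i) (F.monomial τ))).coeff k
    = (F.monomial (insert i τ)).coeff k
  rcases k with _ | k
  · rw [coeff_shift_zero, coeff_monomial_zero, coeff_monomial_zero, coordPV_monomialPV h, add_zero]
  · rw [coeff_shift_succ, coeff_monomial_succ, coeff_monomial_succ, map_zero, zero_add, coeff_lift]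
    rcases k with _ | k
    · rw [coeff_monomial_zero, eulerPV_monomialPV, if_neg h]
    · rw [coeff_monomial_succ, map_zero]

variable (F) in
/-- Multiplication by a number. -/
def scalS (c : ℂ) : AddMonoid.End (USeries F.PV) := lift (c • 1)

theorem coeff_scalS (c : ℂ) (α : USeries F.PV) (k : ℕ) : (F.scalS c α).coeff k = c • α.coeff k := rfl

theorem diffS_scalS (c : ℂ) (α : USeries F.PV) : F.diffS (F.scalS c α) = F.scalS c (F.diffS α) := by
  refine USeries.ext fun k => ?_
  rcases k with _ | k
  · show F.baseDiff (c • α.coeff 0) + 0 = c • (F.baseDiff (α.coeff 0) + 0)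
    rw [add_zero, add_zero, map_smul]
  · show F.baseDiff (c • α.coeff (k + 1)) + F.delPV (c • α.coeff k)
      = c • (F.baseDiff (α.coeff (k + 1)) + F.delPV (α.coeff k))
    rw [map_smul, map_smul, smul_add]

theorem scalS_mem_localSOps (c : ℂ) : F.scalS c ∈ F.localSOps :=
  lift_mem_localSOps (smul_mem_localOps F.localOps.one_mem c)

theorem pair_scalS_left (k : ℕ) (c : ℂ) (α β : USeries F.PV) :
    pair k (F.scalS c α) β = c * pair k α β := by
  rw [pair, pair, Finset.mul_sum]
  refine Finset.sum_congr rfl fun p _ => ?_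
  rw [coeff_scalS, wedgePV_smul_left, tr_smul, mul_left_comm]

theorem pair_scalS_right (k : ℕ) (c : ℂ) (α β : USeries F.PV) :
    pair k α (F.scalS c β) = c * pair k α β := by
  rw [pair, pair, Finset.mul_sum]
  refine Finset.sum_congr rfl fun p _ => ?_
  rw [coeff_scalS, wedgePV_smul_right, tr_smul, mul_left_comm]

theorem numS_monomial (τ : Finset (Fin d)) :
    F.numS (F.monomial τ) = F.scalS τ.card (F.monomial τ) := by
  refine USeries.ext fun k => ?_
  show F.degPV ((F.monomial τ).coeff k) + k • (F.monomial τ).coeff k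
    = (τ.card : ℂ) • (F.monomial τ).coeff k
  rcases k with _ | k
  · rw [coeff_monomial_zero, degPV_monomialPV, zero_smul, add_zero]
  · rw [coeff_monomial_succ, map_zero, smul_zero, smul_zero, add_zero]

variable (F) in
/-- The product of the operators `posS i` over a list. -/
def posListS (l : List (Fin d)) : AddMonoid.End (USeries F.PV) := (l.map F.posS).prod

theorem posListS_cons (i : Fin d) (l : List (Fin d)) (α : USeries F.PV) :
    F.posListS (i :: l) α = F.posS i (F.posListS l α) := by
  unfold posListS
  rw [List.map_cons, List.prod_cons]
  rfl

theorem posS_posListS (i : Fin d) (l : List (Fin d)) (α : USeries F.PV) :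
    F.posListS l (F.posS i α) = F.posS i (F.posListS l α) := by
  induction l with
  | nil => rfl
  | cons j l ih =>
    rw [posListS_cons, posListS_cons, ih]
    exact DFunLike.congr_fun (posS_comm j i) _

theorem diffS_posListS (l : List (Fin d)) (α : USeries F.PV) :
    F.diffS (F.posListS l α) = F.posListS l (F.diffS α) := by
  induction l with
  | nil => rfl
  | cons j l ih =>
    rw [posListS_cons, posListS_cons, ← ih]
    exact DFunLike.congr_fun (diffS_posS j) _

theorem CompSupp.posListS {α : USeries F.PV} (h : CompSupp α) (l : List (Fin d)) :
    CompSupp (F.posListS l α) := by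
  induction l with
  | nil => exact h
  | cons j l ih =>
    rw [posListS_cons]
    exact ih.map (posS_mem_localSOps j)

theorem pair_posListS (k : ℕ) (l : List (Fin d)) {α : USeries F.PV} (hα : CompSupp α)
    (β : USeries F.PV) : pair k (F.posListS l α) β = pair k α (F.posListS l β) := by
  induction l generalizing β with
  | nil => rfl
  | cons j l ih =>
    rw [posListS_cons, pair_posS k j (hα.posListS l), ih, posS_posListS, posListS_cons]

theorem posListS_monomial {l : List (Fin d)} (h : l.Nodup) :
    F.posListS l (F.monomial ∅) = F.monomial l.toFinset := by
  induction l with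
  | nil => rfl
  | cons j l ih =>
    rw [posListS_cons, ih (List.nodup_cons.mp h).2, posS_monomial, List.toFinset_cons]
    rw [List.mem_toFinset]
    exact (List.nodup_cons.mp h).1

theorem posS_eq_zero_on (i : Fin d) (s : F.MaxCone) (α : USeries F.PV)
    (h : i ∉ s.1 ∨ ∀ k A, (α.coeff k).1 s A = 0) (k : ℕ) (A : Finset (Gen n d)) :
    ((F.posS i α).coeff k).1 s A = 0 := by
  have h1 : ∀ k, (F.coordPV i (α.coeff k)).1 s A = 0 := fun k => funext fun z => by
    show incl s.1 z i * (α.coeff k).1 s A z = 0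
    rcases h with h | h
    · rw [show incl s.1 z i = 0 by simp [incl, h], zero_mul]
    · rw [h, Pi.zero_apply, mul_zero]
  have h2 : ∀ k, (F.eulerPV i (α.coeff k)).1 s A = 0 := fun k => funext fun z => by
    show incl s.1 z i * dz s.1 i ((α.coeff k).1 s A) z = 0
    rcases h with h | h
    · rw [show incl s.1 z i = 0 by simp [incl, h], zero_mul]
    · rw [h, dz_zero, Pi.zero_apply, mul_zero]
  rcases k with _ | k
  · show (F.coordPV i (α.coeff 0)).1 s A + 0 = 0
    rw [h1, add_zero]
  · show (F.coordPV i (α.coeff (k + 1))).1 s A + (F.eulerPV i (α.coeff k)).1 s A = 0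
    rw [h1, h2, add_zero]

theorem posListS_eq_zero {l : List (Fin d)} (h : ∀ s : F.MaxCone, ∃ i ∈ l, i ∉ s.1)
    (α : USeries F.PV) : F.posListS l α = 0 := by
  have key : ∀ (s : F.MaxCone) (l : List (Fin d)), (∃ i ∈ l, i ∉ s.1) →
      ∀ k A, ((F.posListS l α).coeff k).1 s A = 0 := by
    intro s l
    induction l with
    | nil =>
      rintro ⟨i, hi, -⟩
      exact absurd hi List.not_mem_nil
    | cons j l ih =>
      rintro ⟨i, hi, his⟩ k A
      rw [posListS_cons]
      refine posS_eq_zero_on j s _ ?_ k A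
      rcases List.mem_cons.mp hi with rfl | hi
      · exact Or.inl his
      · exact Or.inr (ih ⟨i, hi, his⟩)
  exact USeries.ext fun k => Subtype.ext (funext fun s => funext fun A => key s l (h s) k A)

end SmoothCompleteFan

/-- Anticommutators with a linear combination. -/
theorem anticomm_linear_comb {M : Type} [AddCommGroup M] [Module ℂ M] {b : Module.End ℂ M}
    {t : Fin n → Module.End ℂ M} {x : Fin d → Module.End ℂ M} {r : Fin d → Fin n → ℂ}
    (h : ∀ k, b * t k + t k * b = ∑ j, r j k • x j) (m : Fin n → ℂ) :
    b * (∑ k, m k • t k) + (∑ k, m k • t k) * b = ∑ j, (∑ k, r j k * m k) • x j := by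
  have e : b * (∑ k, m k • t k) + (∑ k, m k • t k) * b = ∑ k, m k • (b * t k + t k * b) := by
    rw [Finset.mul_sum, Finset.sum_mul, ← Finset.sum_add_distrib]
    exact Finset.sum_congr rfl fun k _ => by rw [mul_smul_comm, smul_mul_assoc, smul_add]
  rw [e]
  simp only [h, Finset.smul_sum, Finset.sum_smul, smul_smul]
  rw [Finset.sum_comm]
  exact Finset.sum_congr rfl fun j _ => Finset.sum_congr rfl fun k _ => by rw [mul_comm]

namespace SmoothCompleteFan

variable {F : SmoothCompleteFan n d}

open Component USeries

/-- The vector field dual to the ray `i` of `s`. -/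
def framePV (s : F.MaxCone) (i : Fin d) : Module.End ℂ F.PV :=
  ∑ k, (F.dualVec s i k : ℂ) • F.thetaPV k

theorem framePV_mem_localOps (s : F.MaxCone) (i : Fin d) : framePV s i ∈ F.localOps :=
  sum_mem fun k _ => smul_mem_localOps (thetaPV_mem_localOps k) _

theorem cast_dualCoord (s : F.MaxCone) (i j : Fin d) :
    ((dualCoord s i j : ℤ) : ℂ) = ∑ k, (F.ray j k : ℂ) * (F.dualVec s i k : ℂ) := by
  rw [dualCoord]
  push_cast
  rfl

theorem baseDiff_frame (s : F.MaxCone) (i : Fin d) :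
    F.baseDiff * framePV s i + framePV s i * F.baseDiff
      = ∑ j, ((dualCoord s i j : ℤ) : ℂ) • F.coordPV j := by
  simp only [cast_dualCoord]
  exact anticomm_linear_comb (r := fun j k => (F.ray j k : ℂ)) baseDiff_theta _

theorem delPV_frame (s : F.MaxCone) (i : Fin d) :
    F.delPV * framePV s i + framePV s i * F.delPV
      = ∑ j, ((dualCoord s i j : ℤ) : ℂ) • F.eulerPV j := by
  simp only [cast_dualCoord]
  exact anticomm_linear_comb (r := fun j k => (F.ray j k : ℂ)) delPV_theta _

theorem diffS_frame (s : F.MaxCone) (i : Fin d) (α : USeries F.PV) :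
    F.diffS (lift (framePV s i) α) + lift (framePV s i) (F.diffS α)
      = ∑ j, F.scalS (dualCoord s i j : ℤ) (F.posS j α) := by
  have h : F.diffS * lift (framePV s i) + lift (framePV s i) * F.diffS
      = lift (F.baseDiff * framePV s i + framePV s i * F.baseDiff)
        + shift * lift (F.delPV * framePV s i + framePV s i * F.delPV) := by
    have e2 : lift (F.baseDiff * framePV s i + framePV s i * F.baseDiff)
        = lift F.baseDiff * lift (framePV s i) + lift (framePV s i) * lift F.baseDiff := rfl
    have e3 : lift (F.delPV * framePV s i + framePV s i * F.delPV)
        = lift F.delPV * lift (framePV s i) + lift (framePV s i) * lift F.delPV := rfl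
    rw [e2, e3]
    exact anticomm_shift (lift_shift _)
  refine (DFunLike.congr_fun h α).trans ?_
  rw [baseDiff_frame, delPV_frame]
  refine USeries.ext fun k => ?_
  rw [coeff_finset_sum]
  rcases k with _ | k
  · show (∑ j, ((dualCoord s i j : ℤ) : ℂ) • F.coordPV j : Module.End ℂ F.PV) (α.coeff 0) + 0 = _
    rw [add_zero, LinearMap.sum_apply]
    refine Finset.sum_congr rfl fun j _ => ?_
    show ((dualCoord s i j : ℤ) : ℂ) • F.coordPV j (α.coeff 0)
      = ((dualCoord s i j : ℤ) : ℂ) • (F.coordPV j (α.coeff 0) + 0)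
    rw [add_zero]
  · show (∑ j, ((dualCoord s i j : ℤ) : ℂ) • F.coordPV j : Module.End ℂ F.PV) (α.coeff (k + 1))
      + (∑ j, ((dualCoord s i j : ℤ) : ℂ) • F.eulerPV j : Module.End ℂ F.PV) (α.coeff k) = _
    rw [LinearMap.sum_apply, LinearMap.sum_apply, ← Finset.sum_add_distrib]
    refine Finset.sum_congr rfl fun j _ => ?_
    show ((dualCoord s i j : ℤ) : ℂ) • F.coordPV j (α.coeff (k + 1))
        + ((dualCoord s i j : ℤ) : ℂ) • F.eulerPV j (α.coeff k)
      = ((dualCoord s i j : ℤ) : ℂ) • (F.coordPV j (α.coeff (k + 1)) + F.eulerPV j (α.coeff k))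
    rw [smul_add]

theorem scalS_one (α : USeries F.PV) : F.scalS 1 α = α :=
  USeries.ext fun k => one_smul ℂ (α.coeff k)

theorem scalS_zero (α : USeries F.PV) : F.scalS 0 α = 0 :=
  USeries.ext fun k => zero_smul ℂ (α.coeff k)

/-- The linear relations between the `z_i`, up to homotopy. -/
theorem posS_eq (s : F.MaxCone) {i : Fin d} (hi : i ∈ s.1) {α : USeries F.PV}
    (h : F.diffS α = 0) : F.posS i α = F.diffS (lift (framePV s i) α)
      - ∑ j ∈ s.1ᶜ, F.scalS (dualCoord s i j : ℤ) (F.posS j α) := by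
  have h1 := diffS_frame s i α
  rw [h, map_zero, add_zero] at h1
  rw [h1, ← Finset.sum_add_sum_compl s.1, add_sub_cancel_right, Finset.sum_eq_single_of_mem i hi]
  · rw [show dualCoord s i i = 1 by
      rw [dualCoord, (F.isDualFrame s).pair i hi i hi, if_pos rfl], Int.cast_one, scalS_one]
  · intro j hj hji
    rw [show dualCoord s i j = 0 by
      rw [dualCoord, (F.isDualFrame s).pair i hi j hj, if_neg hji], Int.cast_zero, scalS_zero]

/-- Products of more than `n` coordinates annihilate the cohomology with compact support. -/
theorem posListS_exact {x : USeries F.PV} (hx : CompSupp x) (dx : F.diffS x = 0)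
    (l' : List (Fin d)) : ∀ l : List (Fin d), l.Nodup → n < l.length + l'.length →
      ∃ γ, CompSupp γ ∧ F.posListS l (F.posListS l' x) = F.diffS γ := by
  induction l' with
  | nil =>
    intro l hl hn
    refine ⟨0, compSupp_zero, ?_⟩
    rw [map_zero, posListS_eq_zero]
    intro s
    by_contra! hcon
    have hsub : l.toFinset ⊆ s.1 := fun i hi => hcon i (List.mem_toFinset.mp hi)
    have := Finset.card_le_card hsub
    rw [List.toFinset_card_of_nodup hl, s.card_eq] at this
    simp only [List.length_nil] at hn
    omega
  | cons i l' ih =>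
    intro l hl hn
    have hlen : ∀ j, n < (j :: l).length + l'.length := fun j => by
      simp only [List.length_cons] at hn ⊢
      omega
    have step : ∀ j, j ∉ l →
        ∃ γ, CompSupp γ ∧ F.posS j (F.posListS l (F.posListS l' x)) = F.diffS γ := fun j hj => by
      obtain ⟨γ, hγ, e⟩ := ih (j :: l) (List.nodup_cons.mpr ⟨hj, hl⟩) (hlen j)
      exact ⟨γ, hγ, by rw [← e, posListS_cons]⟩
    rw [posListS_cons, posS_posListS]
    by_cases hi : i ∈ l
    · by_cases hs : ∃ s : F.MaxCone, ∀ j ∈ l, j ∈ s.1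
      · obtain ⟨s, hs⟩ := hs
        set y := F.posListS l (F.posListS l' x) with hy
        have cy : CompSupp y := (hx.posListS l').posListS l
        have dy : F.diffS y = 0 := by
          rw [hy, diffS_posListS, diffS_posListS, dx, map_zero, map_zero]
        have hex : ∀ j, ∃ γ, CompSupp γ ∧ (j ∉ l → F.posS j y = F.diffS γ) := fun j => by
          by_cases hj : j ∈ l
          · exact ⟨0, compSupp_zero, fun h => absurd hj h⟩
          · obtain ⟨γ, hγ, e⟩ := step j hj
            exact ⟨γ, hγ, fun _ => e⟩
        choose γ hγ eγ using hex
        refine ⟨lift (framePV s i) y - ∑ j ∈ s.1ᶜ, F.scalS (dualCoord s i j : ℤ) (γ j),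
          (cy.map (lift_mem_localSOps (framePV_mem_localOps s i))).sub
            (CompSupp.sum _ fun j _ => (hγ j).map (scalS_mem_localSOps _)), ?_⟩
        rw [posS_eq s (hs i hi) dy, map_sub, map_sum]
        congr 1
        refine Finset.sum_congr rfl fun j hj => ?_
        rw [diffS_scalS, eγ j fun h => Finset.mem_compl.mp hj (hs j h)]
      · push Not at hs
        refine ⟨0, compSupp_zero, ?_⟩
        rw [posListS_eq_zero hs, map_zero, map_zero]
    · exact step i hi

/-! ### Good bases -/

theorem diffS_monomial (τ : Finset (Fin d)) : F.diffS (F.monomial τ) = 0 := by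
  rw [diffS_apply]
  exact LinearMap.mem_ker.mp (F.monomial_mem τ)

theorem diffS_cut_eq_zero (P : CutoffPair d) {α : USeries F.PV} (h : F.diffS α = 0) :
    F.diffS (F.cutS P α) = 0 := by
  have h2 : ∀ x, F.diffS (F.diffS x) = 0 := DFunLike.congr_fun diffS_sq
  rw [diffS_cutS P h, map_sub, h, h2, sub_zero]

/-- The compatibility of the pairing with the grading. -/
theorem pair_grading (P : CutoffPair d) (k : ℕ) {A B : Finset (Fin d)} {a b γ η : USeries F.PV}
    (ha : CompSupp a) (hb : CompSupp b) (da : F.diffS a = 0) (db : F.diffS b = 0)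
    (eγ : a - F.monomial A = F.diffS γ) (eη : b - F.monomial B = F.diffS η) :
    ((n : ℂ) + k - A.card - B.card) * pair k a b = 0 := by
  have key : ∀ {C : Finset (Fin d)} {c ζ : USeries F.PV}, c - F.monomial C = F.diffS ζ →
      F.numS c - F.scalS C.card c = F.diffS (F.numS ζ - F.scalS C.card ζ) := by
    intro C c ζ h
    have e1 : F.diffS (F.numS ζ) = F.numS (F.diffS ζ) := DFunLike.congr_fun diffS_numS ζ
    rw [map_sub, e1, diffS_scalS, ← h, map_sub, map_sub, numS_monomial]
    abel
  have dn : F.diffS (F.numS b) = 0 := by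
    have e1 : F.diffS (F.numS b) = F.numS (F.diffS b) := DFunLike.congr_fun diffS_numS b
    rw [e1, db, map_zero]
  have h1 : pair k (F.numS a) b = A.card * pair k a b := by
    rw [← pair_scalS_left]
    refine pair_congr P k (ha.map numS_mem_localSOps) (ha.map (scalS_mem_localSOps _)) hb hb ?_ db
      (key eγ) (η := 0) (by rw [sub_self, map_zero])
    rw [diffS_scalS, da, map_zero]
  have h2 : pair k a (F.numS b) = B.card * pair k a b := by
    rw [← pair_scalS_right]
    exact pair_congr P k ha ha (hb.map numS_mem_localSOps) (hb.map (scalS_mem_localSOps _)) da dn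
      (γ := 0) (by rw [sub_self, map_zero]) (key eη)
  have h3 := pair_numS k ha b
  rw [h1, h2] at h3
  linear_combination -h3

theorem posListS_cut_sub (P : CutoffPair d) (A : Finset (Fin d)) :
    F.posListS A.toList (F.cutS P (F.monomial ∅)) - F.monomial A
      = F.diffS (-F.posListS A.toList (F.homS P (F.monomial ∅))) := by
  rw [diffS_cutS P (diffS_monomial ∅), map_sub, posListS_monomial A.nodup_toList,
    Finset.toList_toFinset, map_neg, diffS_posListS]
  abel

theorem pair_eq_zero (P : CutoffPair d) {k : ℕ} (hk : 0 < k) {A B : Finset (Fin d)}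
    {a b γ η : USeries F.PV} (ha : CompSupp a) (hb : CompSupp b) (da : F.diffS a = 0)
    (db : F.diffS b = 0) (eγ : a - F.monomial A = F.diffS γ)
    (eη : b - F.monomial B = F.diffS η) : pair k a b = 0 := by
  by_cases hAB : A.card + B.card ≤ n
  · refine (mul_eq_zero.mp (pair_grading P k ha hb da db eγ eη)).resolve_left fun h => ?_
    have h1 : ((n + k : ℕ) : ℂ) = ((A.card + B.card : ℕ) : ℂ) := by
      push_cast
      linear_combination h
    have := Nat.cast_injective h1
    omega
  · set x := F.cutS P (F.monomial ∅) with hx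
    have cx : CompSupp x := compSupp_cutS P _
    have dx : F.diffS x = 0 := diffS_cut_eq_zero P (diffS_monomial ∅)
    have hdl : ∀ l, F.diffS (F.posListS l x) = 0 := fun l => by rw [diffS_posListS, dx, map_zero]
    have e : ∀ {C : Finset (Fin d)} {c ζ : USeries F.PV}, c - F.monomial C = F.diffS ζ →
        c - F.posListS C.toList x
          = F.diffS (ζ - -F.posListS C.toList (F.homS P (F.monomial ∅))) := by
      intro C c ζ h
      rw [map_sub, ← h, ← posListS_cut_sub]
      abel
    rw [pair_congr P k ha (cx.posListS A.toList) hb (cx.posListS B.toList) (hdl _) db (e eγ) (e eη),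
      pair_posListS k _ cx]
    obtain ⟨ζ, -, hζ⟩ := posListS_exact cx dx B.toList A.toList A.nodup_toList (by
      rw [Finset.length_toList, Finset.length_toList]
      omega)
    rw [hζ, pair_exact_right k cx dx]

theorem coeff_Kf (P : CutoffPair d) (α β : USeries F.PV) (k : ℕ) :
    PowerSeries.coeff k (F.Kf P.ρ α β) = pair k (F.cutS P α) (F.cutS P β) := by
  rw [Kf, PowerSeries.coeff_mk]
  refine Finset.sum_congr rfl fun p _ => ?_
  congr 1
  have e : (fun s : F.MaxCone => wedge (F.opT s.1 P.ρ (fun l => (α.coeff l).1 s) p.1)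
      (F.opT s.1 P.ρ (fun l => (β.coeff l).1 s) p.2))
      = (wedgePV ((F.cutS P α).coeff p.1) ((F.cutS P β).coeff p.2)).1 := by
    funext s
    have h1 := congrFun (opT_onComp P s α) p.1
    have h2 := congrFun (opT_onComp P s β) p.2
    exact congrArg₂ wedge h1 h2
  exact congrArg F.trace e

theorem cutS_sub_monomial (P : CutoffPair d) {α : F.Cocycle} {τ : Finset (Fin d)}
    (h : F.cls α = F.monomialClass τ) :
    ∃ γ, F.cutS P α - F.monomial τ = F.diffS γ := by
  obtain ⟨γ, hγ⟩ := cls_eq_iff.mp h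
  have dα : F.diffS α = 0 := by
    rw [diffS_apply]
    exact LinearMap.mem_ker.mp α.2
  refine ⟨γ - F.homS P α, ?_⟩
  rw [diffS_cutS P dα, map_sub, diffS_apply γ, ← hγ]
  abel

/-- The higher residue pairing of two monomials does not depend on `u`. -/
theorem exists_Kf_eq (A B : Finset (Fin d)) :
    ∃ c : ℂ, ∀ ρ : (Fin d → ℂ) → ℝ, IsCutoff ρ → ∀ α β : F.Cocycle, F.cls α = F.monomialClass A →
      F.cls β = F.monomialClass B → F.Kf ρ α β = PowerSeries.C c := by
  by_cases hex : ∃ ρ₀ : (Fin d → ℂ) → ℝ, IsCutoff ρ₀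
  swap
  · exact ⟨0, fun ρ hρ => absurd ⟨ρ, hρ⟩ hex⟩
  obtain ⟨ρ₀, h₀⟩ := hex
  obtain ⟨P₀, -⟩ := h₀.exists_pair
  refine ⟨pair 0 (F.cutS P₀ (F.monomial A)) (F.cutS P₀ (F.monomial B)), fun ρ hρ α β hα hβ => ?_⟩
  obtain ⟨P, rfl⟩ := hρ.exists_pair
  have dc : ∀ γ : F.Cocycle, F.diffS (F.cutS P γ) = 0 := fun γ => diffS_cut_eq_zero P (by
    rw [diffS_apply]
    exact LinearMap.mem_ker.mp γ.2)
  obtain ⟨γ, eγ⟩ := cutS_sub_monomial P hα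
  obtain ⟨η, eη⟩ := cutS_sub_monomial P hβ
  refine PowerSeries.ext fun k => ?_
  rw [coeff_Kf, PowerSeries.coeff_C]
  split_ifs with hk
  · subst hk
    have e : ∀ {C : Finset (Fin d)} {c ζ : USeries F.PV}, c - F.monomial C = F.diffS ζ →
        c - F.cutS P₀ (F.monomial C) = F.diffS (ζ + F.homS P₀ (F.monomial C)) := by
      intro C c ζ h
      rw [map_add, ← h, diffS_cutS P₀ (diffS_monomial C)]
      abel
    exact pair_congr P 0 (compSupp_cutS P _) (compSupp_cutS P₀ _) (compSupp_cutS P _)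
      (compSupp_cutS P₀ _) (diffS_cut_eq_zero P₀ (diffS_monomial A)) (dc β) (e eγ) (e eη)
  · exact pair_eq_zero P (Nat.pos_of_ne_zero hk) (compSupp_cutS P _) (compSupp_cutS P _) (dc α)
      (dc β) eγ eη

end SmoothCompleteFan

end LogLG

end

theorem mainTheorem4 {n d μ : ℕ} (F : LogLG.SmoothCompleteFan n d) (hF : F.IsProjective)
    (σ : Fin μ ≃ F.MaxCone) (hσ : F.IsGoodOrder σ) :
    (∃ b : Module.Basis (Fin μ) (PowerSeries ℂ) F.Hf,
      ∀ i, b i = F.monomialClass (F.tau σ i)) ∧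
    ∀ i j, ∃ c : ℂ, ∀ (ρ : (Fin d → ℂ) → ℝ), LogLG.IsCutoff ρ →
      ∀ α β : F.Cocycle, F.cls α = F.monomialClass (F.tau σ i) →
        F.cls β = F.monomialClass (F.tau σ j) →
          F.Kf ρ α β = PowerSeries.C c := by
  exact ⟨LogLG.SmoothCompleteFan.exists_basis hσ, fun i j =>
    LogLG.SmoothCompleteFan.exists_Kf_eq (F.tau σ i) (F.tau σ j)⟩
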